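/- Let $m\in\{4,6\}$ and $F=F_1x_1^3+\dots+F_mx_m^3$ with nonzero integers $F_i$. Let $F^\vee\in\mathbb Z[c_1,\dots,c_m]$ be a fixed nonzero rational multiple of $\prod_{\varepsilon}\big(\varepsilon_1(c_1^3/F_1)^{1/2}+\dots+\varepsilon_m(c_m^3/F_m)^{1/2}\big)$, $\varepsilon\in\{1\}\times\{\pm1\}^{m-1}$ (the discriminant of the hyperplane sections $F(x)=c\cdot x=0$). All norms $\|\cdot\|$ are maximum norms. Write $n\mid a^\infty$ if $n$ divides a power of $a$, and $e(z)=e^{2\pi iz}$. *Exponential sums.* For $c\in\mathbb Z^m$, $n\ge1$ put $S_c(n)=\sum_{a\bmod n,\,(a,n)=1}\ \sum_{x\bmod n}e\big((aF(x)+c\cdot x)/n\big)$ and $\widetilde S_c(n)=n^{-(m+1)/2}S_c(n)$. Hypothesis (B3) for $(F,F^\vee)$: there is $\delta_1>0$ such that, uniformly over $Z>0$ and $0<N\le Z^3$, $$\sum_{\substack{c\in\mathbb Z^m,\ \|c\|\le Z\\ F^\vee(c)\ne0}}\Big(\sum_{\substack{n\in[N,2N]\\ n\mid F^\vee(c)^\infty}}\frac{|\widetilde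 S_c(n)|}{N^{1/2}}\Big)^2\ll_{F,F^\vee}Z^mN^{-\delta_1}.$$ *Integrals.* Let $\omega(x)=4c_0^{-1}\omega_0(4x-3)$, where $\omega_0(x)=e^{-1/(1-x^2)}$ for $|x|<1$, $\omega_0(x)=0$ otherwise, and $c_0=\int\omega_0$; let $h(x,y)=\sum_{j\ge1}\frac1{xj}\big(\omega(xj)-\omega(|y|/(xj))\big)$ for $x>0$. Let $w\in C_c^\infty(\mathbb R^m)$ be real-valued with support disjoint from the real zero locus of the Hessian determinant of $F$. For $X,n>0$ and $c\in\mathbb R^m$ put $$J_{c,X}(n)=\int_{\mathbb R^m}w(x)\,h\big(n/X^{3/2},F(x)\big)\,e\big(-Xc\cdot x/n\big)\,dx.$$ Call a Schwartz function $\nu:\mathbb R^m\to\mathbb R_{>0}$ *admissible* for $(F,F^\vee,w)$ if for every integer $j\ge0$, uniformly over $X,n>0$ and $c\in\mathbb R^m$, with $\tilde c=c/\|c\|$, $$\big|(n\,\partial_n)^jJ_{c,X}(n)\big|\ll_j\min\Big[1,\Big(\frac{X\|c\|}{n}\Big)^{1-m/2}\Big]\cdot\nu\Big(\frac{c}{X^{1/2}}\Big)^3\cdot\nu\Big(\frac{Xc\,|F^\vee(\tilde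 c)|}{n}\Big)$$ (at $c=0$ the minimum is $1$ and the last argument is $0$). *Dyadic pieces.* Let $D\in C_c^\infty(\mathbb R_{>0})$ be real-valued with $\int_0^\infty D(r)^2\,dr/r=1$. For $N_0,N_1>0$, $N=N_0N_1$, and $s=(s_0,s_1)\in\mathbb C^2$ put $$\heartsuit^{c,(0)}(s)=\sum_{n_0\ge1,\ n_0\mid F^\vee(c)^\infty}n_0^{-s_0}\widetilde S_c(n_0)D(n_0/N_0),$$ $$D^\vee_{c,X}(s)=\int_0^\infty\!\!\int_0^\infty(n_0n_1)^{(1-m)/2}J_{c,X}(n_0n_1)D\Big(\frac{n_0}{N_0}\Big)D\Big(\frac{n_1}{N_1}\Big)n_0^{s_0}n_1^{s_1}\,\frac{dn_0}{n_0}\frac{dn_1}{n_1}.$$ For $\mathcal S\subseteq\{c\in\mathbb Z^m:F^\vee(c)\ne0\}$ and $C>0$ let $\mathcal S_C=\{c\in\mathcal S:C\le\|c\|<2C\}$ and $\rho(\mathcal S_C)=X^{-m/2}\sum_{c\in\mathcal S_C}\nu(c/X^{1/2})$. **Lemma.** Assume (B3). For every $w$ as above there is an admissible $\nu$. Moreover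 there are $\theta,\eta,\delta_0>0$, depending only on $F$ and $F^\vee$, such that for all $w$ as above, all admissible $\nu$, all $D$ as above, all $\kappa>0$, all integers $k\ge0$ and all $0<\delta\le\delta_0$, the following holds, uniformly over all $\mathcal S$, all $X,N_0,C>0$, all $N_1\ge\kappa$, and all $s\in\mathbb C^2$ with $\operatorname{Re}s_0=\operatorname{Re}s_1=0$: $$\Big\|\frac{\heartsuit^{c,(0)}(s)}{N_0^{1/2}}\cdot N^{1/2}D^\vee_{c,X}(s)\,\nu\Big(\frac{c}{X^{1/2}}\Big)^{-2}\Big\|_{\ell^{2+\delta}(c\in\mathcal S_C)}\ll\frac{\mathcal E\cdot(X^{m/2})^{1/(2+\delta)}}{(1+\|s\|)^k(1+C/X^{1/2})^k},$$ $$\mathcal E=N_0^{-\theta}\Big(\frac{N}{X^{3/2}}\Big)^{\theta}\rho(\mathcal S_C)^{\theta}\Big(\frac{(XC)^{1-m/3-\eta}}{X^{m/4}}+X^{(6-3m)/4}\Big),$$ where the implied constant depends only on $F,F^\vee,w,\nu,D,\kappa,k,\delta$. -/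

import Mathlib

open scoped ContDiff

noncomputable section

namespace HybridBound

/-- The diagonal cubic form `F(x) = F₁ x₁³ + ⋯ + F_m x_m³` on `ℝ^m`. -/
def form {m : ℕ} (F : Fin m → ℤ) (x : Fin m → ℝ) : ℝ :=
  ∑ i, (F i : ℝ) * x i ^ 3

/-- The Hessian determinant of the diagonal cubic form `F`
(its Hessian matrix is diagonal, with entries `6 F_i x_i`). -/
def hessDet {m : ℕ} (F : Fin m → ℤ) (x : Fin m → ℝ) : ℝ :=
  (Matrix.diagonal fun i => 6 * (F i : ℝ) * x i).det

/-- The dual form (discriminant of the hyperplane sections `F(x) = c ⬝ x = 0`), as an integral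
polynomial that is fixed only up to a nonzero rational factor:
`P(c) = q ∏_ε (ε₁ (c₁³/F₁)^{1/2} + ⋯ + ε_m (c_m³/F_m)^{1/2})`, the product running over the signs
`ε ∈ {1} × {±1}^{m-1}`.  The square roots are made polynomial by `c_i = F_i t_i²`, for which
`(c_i³/F_i)^{1/2} = F_i t_i³`. -/
def IsDualForm {m : ℕ} (F : Fin m → ℤ) (P : MvPolynomial (Fin m) ℤ) : Prop :=
  ∃ q : ℚ, q ≠ 0 ∧
    MvPolynomial.aeval
        (fun i => (MvPolynomial.C (F i : ℚ) * MvPolynomial.X i ^ 2 : MvPolynomial (Fin m) ℚ)) P =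
      MvPolynomial.C q *
        ∏ ε : Fin m → ℤˣ with (∀ i : Fin m, (i : ℕ) = 0 → ε i = 1),
          ∑ i, MvPolynomial.C (((ε i : ℤ) * F i : ℤ) : ℚ) * MvPolynomial.X i ^ 3

/-- The value of an integral polynomial at an integral point. -/
def dualInt {m : ℕ} (P : MvPolynomial (Fin m) ℤ) (c : Fin m → ℤ) : ℤ :=
  MvPolynomial.eval c P

/-- The value of an integral polynomial at a real point. -/
def dualReal {m : ℕ} (P : MvPolynomial (Fin m) ℤ) (c : Fin m → ℝ) : ℝ :=
  MvPolynomial.aeval c P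

/-- An integral vector, seen as a real vector (with the maximum norm). -/
def toReal {m : ℕ} (c : Fin m → ℤ) : Fin m → ℝ := fun i => (c i : ℝ)

/-- The complete exponential sum
`S_c(n) = ∑_{a mod n, (a,n)=1} ∑_{x mod n} e((a F(x) + c ⬝ x) / n)`. -/
def expSum {m : ℕ} (F : Fin m → ℤ) (c : Fin m → ℤ) (n : ℕ) : ℂ :=
  ∑ a ∈ (Finset.range n).filter (fun a => Nat.Coprime a n),
    ∑ x : Fin m → Fin n,
      Complex.exp (2 * Real.pi * Complex.I *
        (((a : ℤ) * (∑ i, F i * ((x i : ℕ) : ℤ) ^ 3) + ∑ i, c i * ((x i : ℕ) : ℤ) : ℤ) : ℂ)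
          / (n : ℂ))

/-- The normalized sum `n^{-(m+1)/2} S_c(n)`. -/
def expSumNorm {m : ℕ} (F : Fin m → ℤ) (c : Fin m → ℤ) (n : ℕ) : ℂ :=
  (((n : ℝ) ^ (-((m : ℝ) + 1) / 2) : ℝ) : ℂ) * expSum F c n

/-- `n ∣ a^∞`: some power of `a` is divisible by `n`. -/
def DvdInfty (n : ℕ) (a : ℤ) : Prop := ∃ j : ℕ, (n : ℤ) ∣ a ^ j

open Classical in
/-- The hypothesis (B3): a power saving, in mean square over `c` with `P(c) ≠ 0`, for the
contribution of the moduli `n ∣ P(c)^∞`, uniformly over `Z > 0` and `N ≤ Z³`.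
(Only finitely many terms of the outer sum are nonzero.) -/
def B3 {m : ℕ} (F : Fin m → ℤ) (P : MvPolynomial (Fin m) ℤ) : Prop :=
  ∃ δ : ℝ, 0 < δ ∧ ∃ K : ℝ, ∀ Z N : ℝ, 0 < Z → 0 < N → N ≤ Z ^ 3 →
    (∑' c : {c : Fin m → ℤ // ‖toReal c‖ ≤ Z ∧ dualInt P c ≠ 0},
      (∑ n ∈ (Finset.Icc ⌈N⌉₊ ⌊2 * N⌋₊).filter (fun n => DvdInfty n (dualInt P c.1)),
        ‖expSumNorm F c.1 n‖ / N ^ (1 / 2 : ℝ)) ^ 2)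
      ≤ K * Z ^ m * N ^ (-δ)

/-- The standard bump function `exp(-1/(1-x²))` on `|x| < 1`. -/
def bump (x : ℝ) : ℝ := if |x| < 1 then Real.exp (-(1 - x ^ 2)⁻¹) else 0

/-- `ω(x) = 4 c₀⁻¹ bump(4x - 3)` with `c₀ = ∫ bump`; supported on `[1/2, 1]`, of integral `1`. -/
def omega (x : ℝ) : ℝ := 4 * (∫ y : ℝ, bump y)⁻¹ * bump (4 * x - 3)

/-- The weight of the delta method,
`h(x, y) = ∑_{j ≥ 1} (xj)⁻¹ (ω(xj) - ω(|y|/(xj)))` for `x > 0` (a finite sum). -/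
def hFun (x y : ℝ) : ℝ :=
  ∑' j : ℕ+, (x * (j : ℝ))⁻¹ * (omega (x * (j : ℝ)) - omega (|y| / (x * (j : ℝ))))

/-- The normalized integral `J_{c,X}(n) = X^{-m} ∫ w(x/X) h(n/Y, F(x)/Y²) e(-c ⬝ x/n) dx` with
`Y = X^{3/2}`, written in the variable `x/X`: it is the Fourier transform of
`x ↦ w(x) h(n/X^{3/2}, F(x))` at the frequency `Xc/n`. -/
def Jint {m : ℕ} (F : Fin m → ℤ) (w : (Fin m → ℝ) → ℝ) (X : ℝ) (c : Fin m → ℝ) (n : ℝ) : ℂ :=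
  ∫ x : Fin m → ℝ, ((w x * hFun (n / X ^ (3 / 2 : ℝ)) (form F x) : ℝ) : ℂ) *
    Complex.exp (-(2 * Real.pi * Complex.I * ((X / n * ∑ i, c i * x i : ℝ) : ℂ)))

/-- The weights `w` that are allowed: smooth, compactly supported, and with support disjoint from
the real zero locus of the Hessian determinant of `F`. -/
structure IsWeight {m : ℕ} (F : Fin m → ℤ) (w : (Fin m → ℝ) → ℝ) : Prop where
  smooth : ContDiff ℝ ∞ w
  compact : HasCompactSupport w
  disjoint : tsupport w ∩ {x | hessDet F x = 0} = ∅

/-- Admissible decay weights for the integrals `J_{c,X}(n)`: positive Schwartz functions `ν` such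
that, for every `j`, uniformly over all `X > 0`, `c ∈ ℝ^m`, `n > 0`,
`|(n ∂_n)^j J_{c,X}(n)| ≪_j min(1, (X‖c‖/n)^{1-m/2}) ν(c/X^{1/2})³ ν(Xc / (n |P(c/‖c‖)|⁻¹))`.
The minimum is written as `max(1, X‖c‖/n)^{1-m/2}`, which is the same as `1 - m/2 < 0`, and is
correct at `c = 0` as well, where it has to be `1`.
At `c = 0` the last argument of `ν` is `0`. -/
def IsAdmissible {m : ℕ} (F : Fin m → ℤ) (P : MvPolynomial (Fin m) ℤ) (w : (Fin m → ℝ) → ℝ)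
    (ν : SchwartzMap (Fin m → ℝ) ℝ) : Prop :=
  (∀ a, 0 < ν a) ∧
  ∀ j : ℕ, ∃ K : ℝ, ∀ (X : ℝ) (c : Fin m → ℝ) (n : ℝ), 0 < X → 0 < n →
    ‖iteratedDeriv j (fun t : ℝ => Jint F w X c (Real.exp t)) (Real.log n)‖ ≤
      K * (max 1 (X * ‖c‖ / n)) ^ (1 - (m : ℝ) / 2)
        * ν ((X ^ (1 / 2 : ℝ))⁻¹ • c) ^ 3
        * ν ((X / n * |dualReal P (‖c‖⁻¹ • c)|) • c)

/-- The smooth dyadic cutoffs: real `D ∈ C_c^∞(ℝ_{>0})` with `∫ D(r)² dr/r = 1`. -/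
structure IsCutoff (D : ℝ → ℝ) : Prop where
  smooth : ContDiff ℝ ∞ D
  compact : HasCompactSupport D
  support_pos : tsupport D ⊆ Set.Ioi 0
  normalized : ∫ r in Set.Ioi (0 : ℝ), D r ^ 2 * r⁻¹ = 1

/-- `D_{c,X,N}(n₀,n₁) = (n₀n₁)^{(1-m)/2} J_{c,X}(n₀n₁) D(n₀/N₀) D(n₁/N₁)`. -/
def dyadicWeight {m : ℕ} (F : Fin m → ℤ) (w : (Fin m → ℝ) → ℝ) (D : ℝ → ℝ) (X N₀ N₁ : ℝ)
    (c : Fin m → ℝ) (n₀ n₁ : ℝ) : ℂ :=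
  (((n₀ * n₁) ^ ((1 - (m : ℝ)) / 2) : ℝ) : ℂ) * Jint F w X c (n₀ * n₁) *
    ((D (n₀ / N₀) * D (n₁ / N₁) : ℝ) : ℂ)

/-- The Mellin transform
`D^∨_{c,X,N}(s) = ∫∫_{n₀,n₁>0} D_{c,X,N}(n₀,n₁) n₀^{s₀} n₁^{s₁} (dn₀/n₀) (dn₁/n₁)`. -/
def dyadicMellin {m : ℕ} (F : Fin m → ℤ) (w : (Fin m → ℝ) → ℝ) (D : ℝ → ℝ) (X N₀ N₁ : ℝ)
    (c : Fin m → ℝ) (s₀ s₁ : ℂ) : ℂ :=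
  ∫ p : ℝ × ℝ in Set.Ioi (0 : ℝ) ×ˢ Set.Ioi (0 : ℝ),
    dyadicWeight F w D X N₀ N₁ c p.1 p.2 * ((p.1 : ℂ) ^ s₀ * (p.2 : ℂ) ^ s₁)
      * (((p.1 * p.2)⁻¹ : ℝ) : ℂ)

open Classical in
/-- The bad-modulus sum
`♥^{(0)} = ∑_{n₀ ≥ 1, n₀ ∣ P(c)^∞} n₀^{-s₀} n₀^{-(m+1)/2} S_c(n₀) D(n₀/N₀)` (a finite sum). -/
def heartZero {m : ℕ} (F : Fin m → ℤ) (P : MvPolynomial (Fin m) ℤ) (D : ℝ → ℝ) (N₀ : ℝ)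
    (c : Fin m → ℤ) (s₀ : ℂ) : ℂ :=
  ∑' n : ℕ+, if DvdInfty n (dualInt P c) then
    ((n : ℕ) : ℂ) ^ (-s₀) * expSumNorm F c n * ((D ((n : ℕ) / N₀) : ℝ) : ℂ) else 0

/-- The dyadic piece `S_C = {c ∈ S : C ≤ ‖c‖ < 2C}` of a set of integral vectors. -/
def shell {m : ℕ} (S : Set (Fin m → ℤ)) (C : ℝ) : Set (Fin m → ℤ) :=
  {c | c ∈ S ∧ C ≤ ‖toReal c‖ ∧ ‖toReal c‖ < 2 * C}

/-- `ρ_X(S) = X^{-m/2} ∑_{c ∈ S} ν(c/X^{1/2})`. -/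
def rho {m : ℕ} (ν : SchwartzMap (Fin m → ℝ) ℝ) (X : ℝ) (S : Set (Fin m → ℤ)) : ℝ :=
  (∑' c : S, ν ((X ^ (1 / 2 : ℝ))⁻¹ • toReal c.1)) / X ^ ((m : ℝ) / 2)

/-- The quantity whose `ℓ^{2+δ}` norm over `c` is estimated:
`(♥^{(0)}(s) / N₀^{1/2}) · N^{1/2} D^∨_{c,X,N}(s) · ν(c/X^{1/2})^{-2}`, with `N = N₀N₁`. -/
def hybridTerm {m : ℕ} (F : Fin m → ℤ) (P : MvPolynomial (Fin m) ℤ) (w : (Fin m → ℝ) → ℝ)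
    (ν : SchwartzMap (Fin m → ℝ) ℝ) (D : ℝ → ℝ) (X N₀ N₁ : ℝ) (s₀ s₁ : ℂ)
    (c : Fin m → ℤ) : ℂ :=
  heartZero F P D N₀ c s₀ / ((N₀ ^ (1 / 2 : ℝ) : ℝ) : ℂ) *
    (((N₀ * N₁) ^ (1 / 2 : ℝ) : ℝ) : ℂ) * dyadicMellin F w D X N₀ N₁ (toReal c) s₀ s₁ *
    (((ν ((X ^ (1 / 2 : ℝ))⁻¹ • toReal c) ^ 2)⁻¹ : ℝ) : ℂ)

/-- The norm of `f` in `ℓ^q(S)` for real `q > 0` (used for finite `S`). -/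
def lqNorm {m : ℕ} (q : ℝ) (S : Set (Fin m → ℤ)) (f : (Fin m → ℤ) → ℂ) : ℝ :=
  (∑' c : S, ‖f c.1‖ ^ q) ^ (1 / q)

/-- The factor
`E = N₀^{-θ} (N/X^{3/2})^θ ρ(T)^θ ((XC)^{1-m/3-η} / X^{m/4} + X^{(6-3m)/4})`, `N = N₀N₁`. -/
def errFactor {m : ℕ} (ν : SchwartzMap (Fin m → ℝ) ℝ) (θ η X N₀ N₁ C : ℝ)
    (T : Set (Fin m → ℤ)) : ℝ :=
  N₀ ^ (-θ) * (N₀ * N₁ / X ^ (3 / 2 : ℝ)) ^ θ * rho ν X T ^ θ *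
    ((X * C) ^ (1 - (m : ℝ) / 3 - η) / X ^ ((m : ℝ) / 4) + X ^ ((6 - 3 * (m : ℝ)) / 4))

/-- Only finitely many integral vectors lie in a given ball. -/
theorem finite_ball {m : ℕ} (Z : ℝ) : {c : Fin m → ℤ | ‖toReal c‖ ≤ Z}.Finite := by
  refine (Set.finite_Icc (fun _ : Fin m => -⌈Z⌉) (fun _ : Fin m => ⌈Z⌉)).subset ?_
  intro c hc
  have h : ∀ i, |(c i : ℝ)| ≤ ⌈Z⌉ := fun i =>
    ((norm_le_pi_norm (toReal c) i).trans hc).trans (Int.le_ceil Z)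
  constructor <;> intro i <;> have := abs_le.1 (h i)
  · exact_mod_cast this.1
  · exact_mod_cast this.2

/-- The dyadic pieces are finite sets. -/
theorem finite_shell {m : ℕ} (S : Set (Fin m → ℤ)) (C : ℝ) : (shell S C).Finite :=
  (finite_ball (2 * C)).subset fun _ hc => hc.2.2.le

end HybridBound

end

open scoped ContDiff SchwartzMap FourierTransform RealInnerProductSpace
open MeasureTheory Set

/-! Two independent estimates, one for the integrals and one for the sums over c, meet in a
three-factor Hölder inequality.

Integrals. Write r = n/X^{3/2} and ξ = Xc/n. The weight h(r, y) is r⁻¹ times a difference of two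
Riemann sum errors, E_ψ(1/r) − E_φ(|y|/r), because the two main terms cancel (`hFun_eq`). By Poisson
summation b(z) = E_φ(|z|) is a Schwartz function. So J is a rapidly decreasing Fourier transform of
w, minus ∫ w(x) r⁻¹ b(F(x)/r) e(−ξ·x) dx. Fourier inversion of b rewrites the latter as ∫ b̂(rt)
I(t) dt with I(t) = ∫ w(x) e(tF(x) − ξ·x) dx. Since w avoids the coordinate hyperplanes (the zero
locus of the Hessian), the second derivative test in each coordinate gives I(t) ≪ |t|^{-m/2}, and
repeated integration by parts makes I(t) negligible unless |t| is comparable to λ = ‖ξ‖. This yields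
λ^{1-m/2}, and the decay of b̂(rt) yields decay in rλ = ‖c‖/X^{1/2}.

The decay in λ|F^∨(ξ/λ)| comes from the t-integration. With ξ_i = 3λ a_i p_i², t = λv⁻² and x = vy
the phase becomes λ v f_p(y), where f_p(y) = Σ a_i(y_i³ − 3p_i² y_i) has its critical points at y_i
= ±p_i for every v. The critical value f_p(p) is a combination of the v- and y-derivatives of the
phase, so each integration by parts gains a factor λ|f_p(p)| (`integral_statIntegrand_identity`). Up
to constants f_p(p) is one of the factors of F^∨(ξ/λ), and the other factors are bounded.
Derivatives n∂_n cost nothing: after x = eᵗu the character no longer depends on n, and n∂_n acts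
only on the amplitude and the kernel. A Schwartz function that dominates these countably many rates
of rapid decay is admissible.

Sums. The Mellin transform inherits the bounds for J. What is needed of them is max(N, XC)^{1-m/2},
a factor ν(c/X^{1/2})^θ, and one power of decay (1 + XC|F^∨(c̃)|/N)⁻¹. Hölder with 1/(2+δ) = 1/q + θ
+ τ separates three sums. The bad-modulus sums in ℓ^q, with q slightly larger than 2, are controlled
by (B3) interpolated with trivial bounds. The sum of ν gives ρ^θ. The last sum saves a small power
because F^∨ is small at few integral points: it is a product of finitely many factors, and smallness
of one of them confines one coordinate to a short interval.

(B3) requires its modulus range to be at most Z³. If N₀ ≪ C³ it is used with Z = 2C, and the outcome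
is the term X^{(6-3m)/4}. Otherwise Z is taken of order N₀^{1/3}; then essentially N₀^{m/6-η} meets
max(N, XC)^{1-m/2}, and N ≥ κN₀ converts this into the term with (XC)^{1-m/3-η}. -/

namespace HybridBound

/-! ### One-dimensional oscillatory integrals with cubic phase -/

/-- The additive character `e(x) = exp(2πix)`. -/
noncomputable def osc (x : ℝ) : ℂ := Complex.exp (2 * Real.pi * Complex.I * (x : ℂ))

@[simp] theorem norm_osc (x : ℝ) : ‖osc x‖ = 1 := by
  rw [osc, show 2 * Real.pi * Complex.I * (x : ℂ) = ((2 * Real.pi * x : ℝ) : ℂ) * Complex.I by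
    push_cast; ring]
  exact Complex.norm_exp_ofReal_mul_I _

theorem osc_add (x y : ℝ) : osc (x + y) = osc x * osc y := by
  rw [osc, osc, osc, ← Complex.exp_add]
  congr 1
  push_cast
  ring

@[simp] theorem osc_zero : osc 0 = 1 := by simp [osc]

theorem osc_sum {ι : Type*} (s : Finset ι) (f : ι → ℝ) :
    osc (∑ i ∈ s, f i) = ∏ i ∈ s, osc (f i) := by
  classical
  induction s using Finset.induction_on with
  | empty => simp
  | insert a s ha ih => rw [Finset.sum_insert ha, Finset.prod_insert ha, osc_add, ih]

theorem conj_osc (x : ℝ) : (starRingEnd ℂ) (osc x) = osc (-x) := by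
  rw [osc, osc, ← Complex.exp_conj]
  congr 1
  simp [Complex.conj_ofNat]

@[fun_prop] theorem contDiff_osc {n : WithTop ℕ∞} : ContDiff ℝ n osc := by
  unfold osc
  exact (contDiff_const.mul Complex.ofRealCLM.contDiff).cexp

@[fun_prop] theorem continuous_osc : Continuous osc := (contDiff_osc (n := 0)).continuous

theorem hasDerivAt_osc (x : ℝ) : HasDerivAt osc (2 * Real.pi * Complex.I * osc x) x := by
  have h : HasDerivAt (fun y : ℝ => 2 * Real.pi * Complex.I * (y : ℂ))
      (2 * Real.pi * Complex.I) x := by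
    simpa using (Complex.ofRealCLM.hasDerivAt (x := x)).const_mul (2 * Real.pi * Complex.I)
  have h2 := h.cexp
  exact h2.congr_deriv (mul_comm _ _)

/-- First derivative test. Integrating the derivative of e(ψ)/ψ' leaves boundary terms and ∫
e(ψ)ψ''/ψ'². As ψ'' ≥ 0, the latter is at most ∫ ψ''/ψ'², which telescopes to the boundary values of
−1/ψ'. Both contributions are at most 2/δ, and 4/(2π) ≤ 1. -/
theorem norm_intervalIntegral_osc_le_of_deriv {ψ ψ' ψ'' : ℝ → ℝ} {u v δ : ℝ} (huv : u ≤ v)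
    (hδ : 0 < δ) (h1 : ∀ y, HasDerivAt ψ (ψ' y) y) (h2 : ∀ y, HasDerivAt ψ' (ψ'' y) y)
    (hc : Continuous ψ'') (hpos : ∀ y ∈ Icc u v, 0 ≤ ψ'' y)
    (hlow : ∀ y ∈ Icc u v, δ ≤ |ψ' y|) :
    ‖∫ y in u..v, osc (ψ y)‖ ≤ 1 / δ := by
  have hne : ∀ y ∈ Icc u v, ψ' y ≠ 0 := fun y hy => by
    have := hlow y hy
    intro h0
    rw [h0, abs_zero] at this
    linarith
  have hcψ : Continuous ψ := continuous_iff_continuousAt.2 fun y => (h1 y).continuousAt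
  have hcψ' : Continuous ψ' := continuous_iff_continuousAt.2 fun y => (h2 y).continuousAt
  rw [← uIcc_of_le huv] at hne
  have hd : ∀ y ∈ uIcc u v, HasDerivAt (fun y => osc (ψ y) * ((ψ' y)⁻¹ : ℝ))
      (2 * Real.pi * Complex.I * osc (ψ y) - osc (ψ y) * ((ψ'' y / ψ' y ^ 2 : ℝ) : ℂ)) y := by
    intro y hy
    have e1 : HasDerivAt (fun y => osc (ψ y)) ((ψ' y : ℂ) * (2 * Real.pi * Complex.I * osc (ψ y))) y := by
      exact (hasDerivAt_osc (ψ y)).scomp y (h1 y)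
    have e2 := ((h2 y).inv (hne y hy)).ofReal_comp
    refine (e1.mul e2).congr_deriv ?_
    have : (ψ' y : ℂ) ≠ 0 := by exact_mod_cast hne y hy
    push_cast
    simp only [Pi.inv_apply, Complex.ofReal_inv]
    field_simp
    ring
  have hci2 : ContinuousOn (fun y => ψ'' y / ψ' y ^ 2) (uIcc u v) :=
    hc.continuousOn.div (hcψ'.continuousOn.pow 2) fun y hy => pow_ne_zero 2 (hne y hy)
  have hi1 : IntervalIntegrable (fun y => 2 * Real.pi * Complex.I * osc (ψ y)) volume u v :=
    (by fun_prop : Continuous fun y => 2 * Real.pi * Complex.I * osc (ψ y)).intervalIntegrable _ _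
  have hi2 : IntervalIntegrable (fun y => osc (ψ y) * ((ψ'' y / ψ' y ^ 2 : ℝ) : ℂ)) volume u v := by
    apply ContinuousOn.intervalIntegrable
    exact (by fun_prop : Continuous fun y => osc (ψ y)).continuousOn.mul
      (Complex.continuous_ofReal.comp_continuousOn hci2)
  have hi3 : IntervalIntegrable (fun y => ψ'' y / ψ' y ^ 2) volume u v :=
    hci2.intervalIntegrable
  have key := intervalIntegral.integral_eq_sub_of_hasDerivAt hd (hi1.sub hi2)
  rw [intervalIntegral.integral_sub hi1 hi2, intervalIntegral.integral_const_mul] at key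
  have hd' : ∀ y ∈ uIcc u v, HasDerivAt (fun y => -(ψ' y)⁻¹) (ψ'' y / ψ' y ^ 2) y := by
    intro y hy
    convert! ((h2 y).inv (hne y hy)).neg using 1
    ring
  have key2 := intervalIntegral.integral_eq_sub_of_hasDerivAt hd' hi3
  have hu : |(ψ' u)⁻¹| ≤ 1 / δ := by
    rw [abs_inv, inv_eq_one_div]
    exact one_div_le_one_div_of_le hδ (hlow u ⟨le_rfl, huv⟩)
  have hv : |(ψ' v)⁻¹| ≤ 1 / δ := by
    rw [abs_inv, inv_eq_one_div]
    exact one_div_le_one_div_of_le hδ (hlow v ⟨huv, le_rfl⟩)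
  have b2 : ‖∫ y in u..v, osc (ψ y) * ((ψ'' y / ψ' y ^ 2 : ℝ) : ℂ)‖ ≤ 2 / δ := by
    refine (intervalIntegral.norm_integral_le_of_norm_le huv (g := fun y => ψ'' y / ψ' y ^ 2)
      (ae_of_all _ fun y hy => ?_) hi3).trans ?_
    · rw [norm_mul, norm_osc, one_mul, Complex.norm_real, Real.norm_eq_abs, abs_of_nonneg]
      exact div_nonneg (hpos y (Ioc_subset_Icc_self hy)) (sq_nonneg _)
    · rw [key2]
      have := abs_le.1 hu
      have := abs_le.1 hv
      have : 2 / δ = 1 / δ + 1 / δ := by ring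
      linarith
  have b1 : ‖osc (ψ v) * ((ψ' v)⁻¹ : ℝ) - osc (ψ u) * ((ψ' u)⁻¹ : ℝ)‖ ≤ 2 / δ := by
    refine (norm_sub_le _ _).trans ?_
    rw [norm_mul, norm_mul, norm_osc, norm_osc, one_mul, one_mul, Complex.norm_real,
      Complex.norm_real, Real.norm_eq_abs, Real.norm_eq_abs]
    have : 2 / δ = 1 / δ + 1 / δ := by ring
    linarith
  have hpi : ‖(2 * Real.pi * Complex.I : ℂ)‖ = 2 * Real.pi := by
    simp [abs_of_pos Real.pi_pos]
  have : 2 * Real.pi * ‖∫ y in u..v, osc (ψ y)‖ ≤ 4 / δ := by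
    rw [← hpi, ← norm_mul, sub_eq_iff_eq_add.1 key]
    refine (norm_add_le _ _).trans ?_
    have : 4 / δ = 2 / δ + 2 / δ := by ring
    rw [this]
    exact add_le_add b1 b2
  have h4 : 4 / δ = 4 * (1 / δ) := by ring
  have := Real.pi_gt_three
  have h0 : 0 ≤ ‖∫ y in u..v, osc (ψ y)‖ := norm_nonneg _
  nlinarith

/-- The second derivative test for the phase `Ay³ + By` on an interval of the positive half-line. -/
theorem norm_intervalIntegral_osc_cubic_le_of_pos {A B α β : ℝ} (hA : 0 < A) (hα : 0 < α)
    (hαβ : α ≤ β) :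
    ‖∫ y in α..β, osc (A * y ^ 3 + B * y)‖ ≤ 4 / √(A * α) := by
  -- The width of the neighbourhood of the stationary point that is estimated trivially. Outside it
  -- the derivative is at least 6Aα·h = 6√(Aα), so both contributions have size h.
  set h : ℝ := 1 / √(A * α) with hh
  have hAα : 0 < A * α := mul_pos hA hα
  have hs : 0 < √(A * α) := Real.sqrt_pos.2 hAα
  have hh0 : 0 < h := by positivity
  have hs2 : √(A * α) * √(A * α) = A * α := Real.mul_self_sqrt hAα.le
  have hd1 : ∀ y : ℝ, HasDerivAt (fun y => A * y ^ 3 + B * y) (3 * A * y ^ 2 + B) y := fun y => by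
    convert! ((hasDerivAt_pow 3 y).const_mul A).add ((hasDerivAt_id y).const_mul B) using 1
    simp; ring
  have hd2 : ∀ y : ℝ, HasDerivAt (fun y => 3 * A * y ^ 2 + B) (6 * A * y) y := fun y => by
    convert! ((hasDerivAt_pow 2 y).const_mul (3 * A)).add_const B using 1
    simp; ring
  have hcont : Continuous fun y => osc (A * y ^ 3 + B * y) := by fun_prop
  have hII : ∀ u v, IntervalIntegrable (fun y => osc (A * y ^ 3 + B * y)) volume u v :=
    fun u v => hcont.intervalIntegrable u v
  -- The point s is the zero of the increasing function 3Ay² + B, or the nearer endpoint if there is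
  -- no zero in the interval. Since the second derivative is at least 6Aα, the first derivative
  -- grows linearly in the distance from s.
  obtain ⟨s, hsα, hsβ, hup, hdown⟩ : ∃ s, α ≤ s ∧ s ≤ β ∧
      (∀ y, s < y → y ≤ β → 6 * A * α * (y - s) ≤ 3 * A * y ^ 2 + B) ∧
      (∀ y, α ≤ y → y < s → 6 * A * α * (s - y) ≤ -(3 * A * y ^ 2 + B)) := by
    have gen : ∀ s y : ℝ, α ≤ s → s ≤ y →
        6 * A * α * (y - s) ≤ 3 * A * y ^ 2 - 3 * A * s ^ 2 := fun s y hs hy => by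
      have : 0 ≤ 3 * A * ((y - s) * (y + s - 2 * α)) :=
        mul_nonneg (by positivity) (mul_nonneg (by linarith) (by linarith))
      nlinarith
    by_cases c1 : 0 ≤ 3 * A * α ^ 2 + B
    · refine ⟨α, le_rfl, hαβ, fun y h1 _ => ?_, fun y h1 h2 => absurd h1 (not_le.2 h2)⟩
      have := gen α y le_rfl h1.le; linarith
    by_cases c2 : 3 * A * β ^ 2 + B ≤ 0
    · refine ⟨β, hαβ, le_rfl, fun y h1 h2 => ?_, fun y h1 h2 => ?_⟩
      · exact absurd h2 (not_le.2 h1)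
      · have := gen y β h1 h2.le; linarith
    push Not at c1 c2
    have hB : 0 ≤ -B / (3 * A) := div_nonneg (by nlinarith [sq_nonneg α]) (by positivity)
    have hs2 : 3 * A * √(-B / (3 * A)) ^ 2 = -B := by
      rw [Real.sq_sqrt hB]; field_simp
    have hsα : α ≤ √(-B / (3 * A)) := by
      refine Real.le_sqrt_of_sq_le ?_
      rw [le_div_iff₀ (by positivity)]; linarith
    refine ⟨√(-B / (3 * A)), hsα, ?_, fun y h1 _ => ?_, fun y h1 h2 => ?_⟩
    · refine Real.sqrt_le_iff.2 ⟨by linarith, ?_⟩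
      rw [div_le_iff₀ (by positivity)]; linarith
    · have := gen _ y hsα h1.le; linarith
    · have := gen y _ h1 h2.le; linarith
  set f := fun y => osc (A * y ^ 3 + B * y) with hf
  have triv : ∀ u v, u ≤ v → v ≤ u + h → ‖∫ y in u..v, f y‖ ≤ h := fun u v huv hv => by
    refine (intervalIntegral.norm_integral_le_of_norm_le_const (C := 1) fun y _ => ?_).trans ?_
    · simp [hf]
    · rw [abs_of_nonneg] <;> linarith
  have hδ : 0 < 6 * √(A * α) := by positivity
  have hδh : 6 * A * α * h = 6 * √(A * α) := by
    rw [hh, mul_one_div, div_eq_iff hs.ne', mul_assoc 6 (√(A * α)), hs2]; ring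
  have hsmall : 1 / (6 * √(A * α)) ≤ h := by
    rw [hh]; exact one_div_le_one_div_of_le hs (by linarith)
  have right : ‖∫ y in s..β, f y‖ ≤ 2 * h := by
    rcases le_total β (s + h) with hb | hb
    · exact (triv s β hsβ hb).trans (by linarith)
    · rw [← intervalIntegral.integral_add_adjacent_intervals (hII s (s + h)) (hII (s + h) β)]
      refine (norm_add_le _ _).trans ?_
      have := triv s (s + h) (by linarith) le_rfl
      have h2 := norm_intervalIntegral_osc_le_of_deriv (δ := 6 * √(A * α)) hb hδ hd1 hd2
        (by fun_prop) (fun y hy => by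
          have : 0 ≤ y := by linarith [hy.1]
          positivity) (fun y hy => by
          refine le_trans ?_ (le_abs_self _)
          refine le_trans ?_ (hup y (by linarith [hy.1]) hy.2)
          rw [← hδh]
          exact mul_le_mul_of_nonneg_left (by linarith [hy.1]) (by positivity))
      linarith
  have left : ‖∫ y in α..s, f y‖ ≤ 2 * h := by
    rcases le_total s (α + h) with hb | hb
    · exact (triv α s hsα hb).trans (by linarith)
    · rw [← intervalIntegral.integral_add_adjacent_intervals (hII α (s - h)) (hII (s - h) s)]
      refine (norm_add_le _ _).trans ?_
      have := triv (s - h) s (by linarith) (by linarith)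
      have h2 := norm_intervalIntegral_osc_le_of_deriv (δ := 6 * √(A * α)) (u := α) (v := s - h)
        (by linarith) hδ hd1 hd2
        (by fun_prop) (fun y hy => by
          have : 0 ≤ y := by linarith [hy.1]
          positivity) (fun y hy => by
          refine le_trans ?_ (neg_le_abs _)
          refine le_trans ?_ (hdown y hy.1 (by linarith [hy.2]))
          rw [← hδh]
          exact mul_le_mul_of_nonneg_left (by linarith [hy.2]) (by positivity))
      linarith
  rw [← intervalIntegral.integral_add_adjacent_intervals (hII α s) (hII s β)]
  refine (norm_add_le _ _).trans ?_
  have : 4 / √(A * α) = 2 * h + 2 * h := by rw [hh]; ring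
  rw [this]
  exact add_le_add left right

theorem norm_intervalIntegral_osc_cubic_le {A B α β : ℝ} (hA : A ≠ 0) (hα : 0 < α)
    (hαβ : α ≤ β) :
    ‖∫ y in α..β, osc (A * y ^ 3 + B * y)‖ ≤ 4 / √(|A| * α) := by
  rcases lt_or_gt_of_ne hA with h | h
  · rw [abs_of_neg h, ← RCLike.norm_conj, ← intervalIntegral.intervalIntegral_conj]
    simp_rw [conj_osc]
    have := norm_intervalIntegral_osc_cubic_le_of_pos (A := -A) (B := -B) (neg_pos.2 h) hα hαβ
    refine le_of_eq_of_le (congrArg _ (intervalIntegral.integral_congr fun y _ => ?_)) this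
    exact congrArg osc (by ring)
  · rw [abs_of_pos h]
    exact norm_intervalIntegral_osc_cubic_le_of_pos h hα hαβ

/-! ### Several variables: separation of the amplitude and the bound |t|^{-m/2} -/

/-- A smooth compactly supported amplitude can be removed from an integral against a product
function, at the cost of linear twists. -/
theorem exists_norm_integral_mul_prod_le {m : ℕ} {Q : Type*} [NormedAddCommGroup Q]
    [NormedSpace ℝ Q] [FiniteDimensional ℝ Q] {G : (Fin m → ℝ) × Q → ℂ}
    (hG : ContDiff ℝ ∞ G) (hGc : HasCompactSupport G) {α β : ℝ} (hαβ : α ≤ β)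
    (hbox : ∀ y q, G (y, q) ≠ 0 → ∀ i, y i ∈ Icc α β) :
    ∃ C, 0 ≤ C ∧ ∀ (q : Q) (u : Fin m → ℝ → ℂ) (B : Fin m → ℝ), (∀ i, Continuous (u i)) →
      (∀ i η, ‖∫ y in α..β, u i y * osc (η * y)‖ ≤ B i) →
      ‖∫ y : Fin m → ℝ, G (y, q) * ∏ i, u i (y i)‖ ≤ C * ∏ i, B i := by
  -- Fourier inversion needs an inner product space. The amplitude is expanded jointly in y and the
  -- parameter q, and the resulting constant, the L¹ norm of the transform, does not depend on q.
  let L := toEuclidean (E := (Fin m → ℝ) × Q)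
  have hsm : ContDiff ℝ ∞ (G ∘ L.symm) := hG.comp L.symm.contDiff
  have hcs : HasCompactSupport (G ∘ L.symm) :=
    hGc.comp_homeomorph L.symm.toHomeomorph
  let S : 𝓢(EuclideanSpace ℝ (Fin (Module.finrank ℝ ((Fin m → ℝ) × Q))), ℂ) :=
    hcs.toSchwartzMap hsm
  have hS : ∀ x, S x = G (L.symm x) := fun x => rfl
  set T : 𝓢(EuclideanSpace ℝ (Fin (Module.finrank ℝ ((Fin m → ℝ) × Q))), ℂ) := 𝓕 S with hT
  have hint : Integrable (fun e => T e) := T.integrable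
  have hinv : ∀ x, S x = ∫ e, osc ⟪e, x⟫ * T e := by
    intro x
    have h1 : 𝓕⁻ T = S := FourierTransform.fourierInv_fourier_eq S
    have h2 : S x = 𝓕⁻ (⇑T) x := by
      conv_lhs => rw [← h1]
      rw [SchwartzMap.fourierInv_coe]
    rw [h2, Real.fourierInv_eq']
    refine integral_congr_ae (ae_of_all _ fun e => ?_)
    simp only [smul_eq_mul, osc]
    congr 2
    push_cast
    ring
  refine ⟨∫ e, ‖T e‖, integral_nonneg fun _ => norm_nonneg _, fun q u B hu hB => ?_⟩
  set U : Fin m → ℝ → ℂ := fun i => (Icc α β).indicator (u i) with hU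
  have hUi : ∀ i, Integrable (U i) := fun i =>
    (integrable_indicator_iff measurableSet_Icc).2 ((hu i).continuousOn.integrableOn_compact isCompact_Icc)
  have hUp : Integrable (fun y : Fin m → ℝ => ∏ i, U i (y i)) := Integrable.fintype_prod hUi
  have e1 : (∫ y : Fin m → ℝ, G (y, q) * ∏ i, u i (y i)) =
      ∫ y : Fin m → ℝ, ∫ e, (∏ i, U i (y i)) * (osc ⟪e, L (y, q)⟫ * T e) := by
    refine integral_congr_ae (ae_of_all _ fun y => ?_)
    simp only
    rw [integral_const_mul, ← hinv, hS, L.symm_apply_apply]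
    by_cases h : G (y, q) = 0
    · simp [h]
    · rw [mul_comm]
      congr 1
      refine Finset.prod_congr rfl fun i _ => ?_
      rw [hU]
      simp only
      rw [indicator_of_mem (hbox y q h i)]
  have hLc : Continuous fun p : (Fin m → ℝ) ×
      EuclideanSpace ℝ (Fin (Module.finrank ℝ ((Fin m → ℝ) × Q))) => osc ⟪p.2, L (p.1, q)⟫ := by
    have : Continuous fun p : (Fin m → ℝ) ×
      EuclideanSpace ℝ (Fin (Module.finrank ℝ ((Fin m → ℝ) × Q))) => L (p.1, q) :=
      L.continuous.comp (by fun_prop)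
    fun_prop
  have hprod : Integrable (Function.uncurry fun (y : Fin m → ℝ) e =>
      (∏ i, U i (y i)) * (osc ⟪e, L (y, q)⟫ * T e)) (volume.prod volume) := by
    have := (hUp.mul_prod hint).bdd_mul (c := 1) hLc.aestronglyMeasurable
      (ae_of_all _ fun p => by simp)
    refine this.congr (ae_of_all _ fun p => ?_)
    simp only [Function.uncurry]
    ring
  rw [e1, integral_integral_swap hprod]
  -- Every frequency is an affine function of y. It therefore contributes one linear twist per
  -- coordinate, together with a unimodular constant that carries q, and the integral factors over
  -- the coordinates.
  have e2 : ∀ e, ∃ η : Fin m → ℝ, ∃ c : ℝ, ∀ y, ⟪e, L (y, q)⟫ = ∑ i, η i * y i + c := by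
    intro e
    refine ⟨fun i => ⟪e, L (Pi.single i 1, 0)⟫, ⟪e, L (0, q)⟫, fun y => ?_⟩
    have : (y, q) = ∑ i, y i • ((Pi.single i 1 : Fin m → ℝ), (0 : Q)) + (0, q) := by
      ext
      · simp [Prod.fst_sum, Finset.sum_apply, Pi.single_apply]
      · simp [Prod.snd_sum]
    rw [this, map_add, inner_add_right, map_sum, inner_sum]
    congr 1
    refine Finset.sum_congr rfl fun i _ => ?_
    rw [map_smul, inner_smul_right, mul_comm]
  have hB0 : ∀ i, 0 ≤ B i := fun i => (norm_nonneg _).trans (hB i 0)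
  rw [← integral_mul_const]
  refine norm_integral_le_of_norm_le (hint.norm.mul_const _) (ae_of_all _ fun e => ?_)
  obtain ⟨η, c, hη⟩ := e2 e
  have e3 : (fun y : Fin m → ℝ => (∏ i, U i (y i)) * (osc ⟪e, L (y, q)⟫ * T e)) =
      fun y => (∏ i, (U i (y i) * osc (η i * y i))) * (osc c * T e) := by
    funext y
    rw [hη, osc_add, osc_sum, Finset.prod_mul_distrib]
    ring
  rw [e3, integral_mul_const, integral_fintype_prod_volume_eq_prod
    (fun i (t : ℝ) => U i t * osc (η i * t)), norm_mul, norm_mul, norm_osc, one_mul, mul_comm,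
    norm_prod]
  refine mul_le_mul_of_nonneg_left (Finset.prod_le_prod (fun _ _ => norm_nonneg _) fun i _ => ?_)
    (norm_nonneg _)
  refine le_of_eq_of_le (congrArg _ ?_) (hB i (η i))
  rw [intervalIntegral.integral_of_le hαβ, ← integral_Icc_eq_integral_Ioc,
    ← integral_indicator measurableSet_Icc]
  refine integral_congr_ae (ae_of_all _ fun t => ?_)
  simp only [hU]
  by_cases ht : t ∈ Icc α β
  · simp [indicator_of_mem ht]
  · simp [indicator_of_notMem ht]

/-- Oscillatory integrals with a separable cubic phase, uniformly in all lower order terms. -/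
theorem exists_norm_integral_mul_osc_cubic_le {m : ℕ} {Q : Type*} [NormedAddCommGroup Q]
    [NormedSpace ℝ Q] [FiniteDimensional ℝ Q] {G : (Fin m → ℝ) × Q → ℂ}
    (hG : ContDiff ℝ ∞ G) (hGc : HasCompactSupport G) {α β : ℝ} (hα : 0 < α) (hαβ : α ≤ β)
    (hbox : ∀ y q, G (y, q) ≠ 0 → ∀ i, y i ∈ Icc α β) {a : Fin m → ℝ} (ha : ∀ i, a i ≠ 0) :
    ∃ C, 0 ≤ C ∧ ∀ (q : Q) (t : ℝ) (b : Fin m → ℝ), t ≠ 0 →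
      ‖∫ y : Fin m → ℝ, G (y, q) * osc (t * ∑ i, a i * y i ^ 3 + ∑ i, b i * y i)‖ ≤
        C * |t| ^ (-(m : ℝ) / 2) := by
  obtain ⟨C, hC0, hC⟩ := exists_norm_integral_mul_prod_le hG hGc hαβ hbox
  refine ⟨C * ∏ i, 4 / √(|a i| * α), by positivity, fun q t b ht => ?_⟩
  have h := hC q (fun i y => osc (t * a i * y ^ 3 + b i * y))
    (fun i => 4 / √(|t * a i| * α)) (fun i => by fun_prop) fun i η => by
      have := norm_intervalIntegral_osc_cubic_le (A := t * a i) (B := b i + η)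
        (mul_ne_zero ht (ha i)) hα hαβ
      refine le_of_eq_of_le (congrArg _ (intervalIntegral.integral_congr fun y _ => ?_)) this
      simp only [← osc_add]
      exact congrArg osc (by ring)
  have e1 : (fun y : Fin m → ℝ => G (y, q) * osc (t * ∑ i, a i * y i ^ 3 + ∑ i, b i * y i)) =
      fun y => G (y, q) * ∏ i, osc (t * a i * y i ^ 3 + b i * y i) := by
    funext y
    rw [← osc_sum, Finset.sum_add_distrib, Finset.mul_sum]
    simp only [mul_assoc]
  rw [e1]
  refine h.trans (le_of_eq ?_)
  have e2 : ∀ i, 4 / √(|t * a i| * α) = 4 / √(|a i| * α) * |t| ^ (-(1 : ℝ) / 2) := fun i => by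
    rw [abs_mul, mul_assoc, Real.sqrt_mul (abs_nonneg t), Real.sqrt_eq_rpow |t|,
      show -(1 : ℝ) / 2 = -(1 / 2) by ring, Real.rpow_neg (abs_nonneg _)]
    have := (Real.rpow_pos_of_pos (abs_pos.2 ht) (1 / 2 : ℝ)).ne'
    field_simp
  simp_rw [e2]
  rw [Finset.prod_mul_distrib, Finset.prod_const, Finset.card_univ, Fintype.card_fin,
    ← Real.rpow_mul_natCast (abs_nonneg t), mul_assoc]
  congr 3
  ring

/-! ### Nonstationary phase -/

/-- A smooth function on `ℝ` that agrees with `z⁻¹` away from the origin. -/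
theorem exists_contDiff_eq_inv {c : ℝ} (hc : 0 < c) :
    ∃ f : ℝ → ℝ, ContDiff ℝ ∞ f ∧ ∀ z, c ≤ |z| → f z = z⁻¹ := by
  refine ⟨fun z => Real.smoothTransition (2 * (z / c) ^ 2 - 1) * z⁻¹, ?_, fun z hz => ?_⟩
  · refine contDiff_iff_contDiffAt.2 fun z => ?_
    by_cases hz : z = 0
    · have : (fun z => Real.smoothTransition (2 * (z / c) ^ 2 - 1) * z⁻¹) =ᶠ[nhds z]
          fun _ => 0 := by
        have h1 : ∀ᶠ y in nhds z, 2 * (y / c) ^ 2 - 1 < 0 := by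
          refine ContinuousAt.eventually_lt (by fun_prop) continuousAt_const ?_
          simp [hz]
        filter_upwards [h1] with y hy
        simp [Real.smoothTransition.zero_of_nonpos hy.le]
      exact contDiffAt_const.congr_of_eventuallyEq this
    · exact (Real.smoothTransition.contDiff.comp (by fun_prop)).contDiffAt.mul
        (contDiffAt_inv ℝ hz)
  · have : 1 ≤ 2 * (z / c) ^ 2 - 1 := by
      have h1 : 1 ≤ |z / c| := by
        rw [abs_div, abs_of_pos hc, le_div_iff₀ hc]; linarith
      have := sq_abs (z / c)
      nlinarith
    simp [Real.smoothTransition.one_of_one_le this]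

section Parts
variable {Y : Type*} [NormedAddCommGroup Y] [NormedSpace ℝ Y] [FiniteDimensional ℝ Y]
  [MeasurableSpace Y] [BorelSpace Y]

theorem integral_eq_zero_of_hasLineDerivAt {μ : Measure Y} [μ.IsAddHaarMeasure]
    {f f' : Y → ℂ} {u : Y} (hf : Integrable f μ) (hf' : Integrable f' μ)
    (h : ∀ x, HasLineDerivAt ℝ f (f' x) x u) : ∫ x, f' x ∂μ = 0 := by
  have := integral_bilinear_hasLineDerivAt_right_eq_neg_left_of_integrable (μ := μ)
    (f := fun _ : Y => (1 : ℂ)) (f' := fun _ => 0) (g := f) (g' := f') (v := u)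
    (B := ContinuousLinearMap.mul ℝ ℂ) (by simp) (by simpa using hf') (by simpa using hf)
    (fun x _ => by simpa using (hasFDerivAt_const (1 : ℂ) x).hasLineDerivAt u) (fun x _ => h x)
  simpa using this

end Parts

section Class
variable {V : Type*} [NormedAddCommGroup V] [NormedSpace ℝ V]

theorem contDiff_fderiv_apply {G : V → ℂ} (hG : ContDiff ℝ ∞ G) (u : V) :
    ContDiff ℝ ∞ fun x => fderiv ℝ G x u :=
  (hG.fderiv_right (m := ∞) (by simp)).clm_apply contDiff_const

theorem hasLineDerivAt_of_contDiff {G : V → ℂ} (hG : ContDiff ℝ ∞ G) (x u : V) :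
    HasLineDerivAt ℝ G (fderiv ℝ G x u) x u :=
  ((hG.differentiable (by simp)) x).hasFDerivAt.hasLineDerivAt u

theorem mem_of_fderiv_apply_ne_zero {G : V → ℂ} {K : Set V} (hK : IsClosed K)
    (h : ∀ x, G x ≠ 0 → x ∈ K) {x u : V} (hx : fderiv ℝ G x u ≠ 0) : x ∈ K := by
  have h1 : tsupport G ⊆ K := closure_minimal (fun x hx => h x hx) hK
  apply h1
  apply support_fderiv_subset ℝ
  intro h2
  simp [h2] at hx

end Class

/-- The phase `t ∑ a_i x_i³ - ξ ⬝ x`. -/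
noncomputable def phase {m : ℕ} (a : Fin m → ℝ) (t : ℝ) (ξ x : Fin m → ℝ) : ℝ :=
  t * ∑ i, a i * x i ^ 3 - ∑ i, ξ i * x i

@[fun_prop] theorem continuous_phase {m : ℕ} (a : Fin m → ℝ) (t : ℝ) (ξ : Fin m → ℝ) :
    Continuous (phase a t ξ) := by
  unfold phase; fun_prop

theorem hasLineDerivAt_sum {m : ℕ} (g g' : Fin m → ℝ → ℝ)
    (h : ∀ i s, HasDerivAt (g i) (g' i s) s) (x : Fin m → ℝ) (i : Fin m) :
    HasLineDerivAt ℝ (fun x : Fin m → ℝ => ∑ j, g j (x j)) (g' i (x i)) x (Pi.single i 1) := by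
  unfold HasLineDerivAt
  have : ∀ j ∈ Finset.univ, HasDerivAt (fun s : ℝ => g j ((x + s • (Pi.single i (1 : ℝ) : Fin m → ℝ)) j))
      (g' j (x j) * (Pi.single i (1 : ℝ) : Fin m → ℝ) j) 0 := fun j _ => by
    have h1 : HasDerivAt (fun s : ℝ => (x + s • (Pi.single i (1 : ℝ) : Fin m → ℝ)) j)
        ((Pi.single i (1 : ℝ) : Fin m → ℝ) j) 0 := by
      simpa using ((hasDerivAt_id (0 : ℝ)).mul_const ((Pi.single i (1 : ℝ) : Fin m → ℝ) j)).const_add (x j)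
    exact HasDerivAt.comp (0 : ℝ) (by simpa using h j (x j)) h1
  refine (HasDerivAt.fun_sum this).congr_deriv ?_
  simp [Pi.single_apply]

theorem hasLineDerivAt_phase {m : ℕ} (a : Fin m → ℝ) (t : ℝ) (ξ x : Fin m → ℝ) (i : Fin m) :
    HasLineDerivAt ℝ (phase a t ξ) (3 * t * a i * x i ^ 2 - ξ i) x (Pi.single i 1) := by
  have := hasLineDerivAt_sum (fun i s => t * (a i * s ^ 3) - ξ i * s)
    (fun i s => 3 * t * a i * s ^ 2 - ξ i) (fun i s => by
      refine ((((hasDerivAt_pow 3 s).const_mul (a i)).const_mul t).sub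
        ((hasDerivAt_id s).const_mul (ξ i))).congr_deriv ?_
      simp; ring) x i
  convert! this using 1
  funext x
  simp [phase, Finset.mul_sum, Finset.sum_sub_distrib]

theorem hasLineDerivAt_osc {Y : Type*} [AddCommGroup Y] [Module ℝ Y] {f : Y → ℝ} {f' : ℝ}
    {x u : Y} (h : HasLineDerivAt ℝ f f' x u) :
    HasLineDerivAt ℝ (fun y => osc (f y)) (2 * Real.pi * Complex.I * f' * osc (f x)) x u := by
  unfold HasLineDerivAt at *
  have h1 := (hasDerivAt_osc (f (x + (0 : ℝ) • u))).scomp (0 : ℝ) h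
  refine h1.congr_deriv ?_
  simp
  ring

theorem hasLineDerivAt_mul {Y : Type*} [AddCommGroup Y] [Module ℝ Y] {f g : Y → ℂ} {f' g' : ℂ}
    {x u : Y} (hf : HasLineDerivAt ℝ f f' x u) (hg : HasLineDerivAt ℝ g g' x u) :
    HasLineDerivAt ℝ (fun y => f y * g y) (f' * g x + f x * g') x u := by
  unfold HasLineDerivAt at *
  refine (HasDerivAt.mul hf hg).congr_deriv ?_
  simp

/-- Repeated integration by parts in a direction in which the phase is not stationary. -/
theorem exists_norm_integral_le_of_nonstationary_aux {m : ℕ} (a : Fin m → ℝ) (i : Fin m) {c : ℝ}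
    (hc : 0 < c) {K : Set (Fin m → ℝ)} (hK : IsClosed K) (A : ℕ) :
    ∀ G : (Fin m → ℝ) × (ℝ × ℝ) → ℂ, ContDiff ℝ ∞ G → HasCompactSupport G →
      (∀ x, G x ≠ 0 → x.1 ∈ K) → ∃ C, 0 ≤ C ∧ ∀ (α β Λ : ℝ) (ξ : Fin m → ℝ), 0 < Λ →
        ξ i = Λ * β → (∀ x ∈ K, c ≤ |3 * α * a i * x i ^ 2 - β|) →
        ‖∫ x, G (x, (α, β)) * osc (phase a (Λ * α) ξ x)‖ ≤ C / Λ ^ A := by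
  obtain ⟨inv, hinv, hinv'⟩ := exists_contDiff_eq_inv hc
  induction A with
  | zero =>
    intro G hG hGc hGK
    obtain ⟨M, hM⟩ := hG.continuous.bounded_above_of_compact_support hGc
    set S : Set (Fin m → ℝ) := Prod.fst '' tsupport G
    have hS : IsCompact S := hGc.image continuous_fst
    refine ⟨∫ x, S.indicator (fun _ => |M|) x, integral_nonneg fun x =>
      indicator_nonneg (fun _ _ => abs_nonneg _) _, fun α β Λ ξ hΛ _ _ => ?_⟩
    rw [pow_zero, div_one]
    refine norm_integral_le_of_norm_le ?_ (ae_of_all _ fun x => ?_)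
    · exact (integrable_indicator_iff hS.measurableSet).2
        (integrableOn_const hS.measure_lt_top.ne)
    · rw [norm_mul, norm_osc, mul_one]
      by_cases h : G (x, (α, β)) = 0
      · rw [h, norm_zero]; exact indicator_nonneg (fun _ _ => abs_nonneg _) _
      · rw [indicator_of_mem (show x ∈ S from ⟨_, subset_tsupport _ h, rfl⟩)]
        exact (hM _).trans (le_abs_self _)
  | succ A ih =>
    intro G hG hGc hGK
    -- The amplitude divided by the rescaled derivative of the phase. The parameters α = t/Λ and β =
    -- ξ_i/Λ are variables of the amplitude, so differentiating in x_i stays inside the class of the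
    -- induction and the constants remain uniform in α and β.
    set G1 : (Fin m → ℝ) × (ℝ × ℝ) → ℂ :=
      fun x => G x * ((inv (3 * x.2.1 * a i * x.1 i ^ 2 - x.2.2) : ℝ) : ℂ) with hG1
    have hG1s : ContDiff ℝ ∞ G1 :=
      hG.mul (Complex.ofRealCLM.contDiff.comp (hinv.comp (by fun_prop)))
    have hG1c : HasCompactSupport G1 := hGc.mul_right
    set u : (Fin m → ℝ) × (ℝ × ℝ) := (Pi.single i 1, 0) with hu
    have hG1K : ∀ x, G1 x ≠ 0 → x ∈ (Prod.fst ⁻¹' K : Set ((Fin m → ℝ) × (ℝ × ℝ))) :=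
      fun x hx => hGK x fun h => hx (by simp [hG1, h])
    obtain ⟨C, hC0, hC⟩ := ih (fun x => fderiv ℝ G1 x u) (contDiff_fderiv_apply hG1s u)
      (hG1c.fderiv_apply ℝ u) fun x hx =>
        mem_of_fderiv_apply_ne_zero (hK.preimage continuous_fst) hG1K hx
    refine ⟨C, hC0, fun α β Λ ξ hΛ hξ hlow => ?_⟩
    have hsl : ∀ H : (Fin m → ℝ) × (ℝ × ℝ) → ℂ, Continuous H → HasCompactSupport H →
        Integrable fun x => H (x, (α, β)) * osc (phase a (Λ * α) ξ x) := fun H hH hHc => by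
      refine Continuous.integrable_of_hasCompactSupport (by fun_prop) (HasCompactSupport.mul_right ?_)
      refine HasCompactSupport.of_support_subset_isCompact (hHc.image continuous_fst) fun x hx => ?_
      exact ⟨(x, (α, β)), subset_tsupport _ hx, rfl⟩
    have hd : ∀ x : Fin m → ℝ, HasLineDerivAt ℝ
        (fun x => G1 (x, (α, β)) * osc (phase a (Λ * α) ξ x))
        (fderiv ℝ G1 (x, (α, β)) u * osc (phase a (Λ * α) ξ x) +
          (2 * Real.pi * Complex.I * Λ) * (G (x, (α, β)) * osc (phase a (Λ * α) ξ x)))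
        x (Pi.single i 1) := fun x => by
      have h1 : HasLineDerivAt ℝ (fun x => G1 (x, (α, β))) (fderiv ℝ G1 (x, (α, β)) u) x
          (Pi.single i 1) := by
        have := hasLineDerivAt_of_contDiff hG1s (x, (α, β)) u
        unfold HasLineDerivAt at *
        convert! this using 3
        · simp [hu]
      have h2 := hasLineDerivAt_mul h1 (hasLineDerivAt_osc (hasLineDerivAt_phase a (Λ * α) ξ x i))
      convert! h2 using 2
      by_cases hx : x ∈ K
      · simp only [hG1]
        have h3 := hlow x hx
        rw [hinv' _ h3]
        have h4 : 3 * α * a i * x i ^ 2 - β ≠ 0 := by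
          intro h; rw [h, abs_zero] at h3; linarith
        have h5 : 3 * (Λ * α) * a i * x i ^ 2 - ξ i = Λ * (3 * α * a i * x i ^ 2 - β) := by
          rw [hξ]; ring
        rw [h5]
        set z := 3 * α * a i * x i ^ 2 - β
        have h6 : (z : ℂ) ≠ 0 := by exact_mod_cast h4
        push_cast
        field_simp
      · have : G (x, (α, β)) = 0 := by
          by_contra h; exact hx (hGK _ h)
        simp [hG1, this]
    have hI1 := hsl _ (contDiff_fderiv_apply hG1s u).continuous (hG1c.fderiv_apply ℝ u)
    have hI2 := hsl _ hG.continuous hGc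
    have key := integral_eq_zero_of_hasLineDerivAt (hsl _ hG1s.continuous hG1c)
      (hI1.add (hI2.const_mul (2 * Real.pi * Complex.I * Λ))) hd
    simp only [Pi.add_apply] at key
    rw [integral_add hI1 (hI2.const_mul _), integral_const_mul] at key
    have h7 := hC α β Λ ξ hΛ hξ hlow
    rw [eq_neg_of_add_eq_zero_left key, norm_neg, norm_mul] at h7
    have h8 : ‖(2 * Real.pi * Complex.I * Λ : ℂ)‖ = 2 * Real.pi * Λ := by
      simp [abs_of_pos Real.pi_pos, abs_of_pos hΛ]
    rw [h8] at h7
    rw [pow_succ, ← div_div, le_div_iff₀ hΛ]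
    refine le_trans ?_ h7
    have := Real.pi_gt_three
    have h9 := norm_nonneg (∫ x, G (x, (α, β)) * osc (phase a (Λ * α) ξ x))
    have : Λ ≤ 2 * Real.pi * Λ := by nlinarith
    nlinarith

/-- The parameters t/Λ and ξ_i/Λ lie in [−1, 1]. A cutoff equal to 1 there makes the amplitude
compactly supported in all variables without changing the integral. -/
theorem exists_norm_integral_le_of_nonstationary {m : ℕ} (a : Fin m → ℝ) {c : ℝ} (hc : 0 < c)
    {w : (Fin m → ℝ) → ℂ} (hw : ContDiff ℝ ∞ w) (hwc : HasCompactSupport w) (A : ℕ) :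
    ∃ C, 0 ≤ C ∧ ∀ (t Λ : ℝ) (ξ : Fin m → ℝ) (i : Fin m), 0 < Λ → |t| ≤ Λ → |ξ i| ≤ Λ →
      (∀ x ∈ tsupport w, c * Λ ≤ |3 * t * a i * x i ^ 2 - ξ i|) →
      ‖∫ x, w x * osc (phase a t ξ x)‖ ≤ C / Λ ^ A := by
  have hb : ∃ ρ : ℝ → ℝ, ContDiff ℝ ∞ ρ ∧ HasCompactSupport ρ ∧ ∀ x, |x| ≤ 1 → ρ x = 1 := by
    let f : ContDiffBump (0 : ℝ) := ⟨1, 2, by norm_num, by norm_num⟩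
    exact ⟨f, f.contDiff, f.hasCompactSupport, fun x hx => f.one_of_mem_closedBall (by simpa using hx)⟩
  obtain ⟨ρ, hρ, hρc, hρ1⟩ := hb
  set G : (Fin m → ℝ) × (ℝ × ℝ) → ℂ := fun x => w x.1 * ((ρ x.2.1 * ρ x.2.2 : ℝ) : ℂ) with hG
  have hGs : ContDiff ℝ ∞ G :=
    (hw.comp contDiff_fst).mul (Complex.ofRealCLM.contDiff.comp
      ((hρ.comp (by fun_prop)).mul (hρ.comp (by fun_prop))))
  have hGc : HasCompactSupport G := by
    refine HasCompactSupport.of_support_subset_isCompact (hwc.prod (hρc.prod hρc)) fun x hx => ?_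
    have h1 : w x.1 ≠ 0 := fun h => hx (by simp [hG, h])
    have h2 : ρ x.2.1 ≠ 0 := fun h => hx (by simp [hG, h])
    have h3 : ρ x.2.2 ≠ 0 := fun h => hx (by simp [hG, h])
    exact ⟨subset_tsupport _ h1, subset_tsupport _ h2, subset_tsupport _ h3⟩
  choose C hC0 hC using fun i => exists_norm_integral_le_of_nonstationary_aux a i hc
    (isClosed_tsupport w) A G hGs hGc
    (fun x hx => subset_tsupport _ fun h => hx (by simp [hG, h]))
  refine ⟨∑ i, C i, Finset.sum_nonneg fun i _ => hC0 i, fun t Λ ξ i hΛ ht hξ hlow => ?_⟩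
  have h1 := hC i (t / Λ) (ξ i / Λ) Λ ξ hΛ (by field_simp) fun x hx => by
    have h2 := hlow x hx
    have : 3 * (t / Λ) * a i * x i ^ 2 - ξ i / Λ = (3 * t * a i * x i ^ 2 - ξ i) / Λ := by
      field_simp
    rw [this, abs_div, abs_of_pos hΛ, le_div_iff₀ hΛ]
    exact h2
  have h3 : ρ (t / Λ) = 1 := hρ1 _ (by rw [abs_div, abs_of_pos hΛ]; exact div_le_one_of_le₀ ht hΛ.le)
  have h4 : ρ (ξ i / Λ) = 1 :=
    hρ1 _ (by rw [abs_div, abs_of_pos hΛ]; exact div_le_one_of_le₀ hξ hΛ.le)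
  simp only [hG, h3, h4, mul_div_cancel₀ t hΛ.ne', mul_one, Complex.ofReal_one] at h1
  refine h1.trans ?_
  gcongr
  exact Finset.single_le_sum (f := C) (fun i _ => hC0 i) (Finset.mem_univ i)

/-! ### The stationary range: gaining powers of the critical value -/

/-- The Euler operator `t d/dt` on Schwartz functions. -/
noncomputable def eulerOp (k : 𝓢(ℝ, ℂ)) : 𝓢(ℝ, ℂ) :=
  SchwartzMap.smulLeftCLM ℂ (id : ℝ → ℝ) (SchwartzMap.derivCLM ℂ ℂ k)

theorem eulerOp_apply (k : 𝓢(ℝ, ℂ)) (t : ℝ) : eulerOp k t = t * deriv k t := by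
  rw [eulerOp, SchwartzMap.smulLeftCLM_apply_apply (by fun_prop)]
  simp

theorem exists_norm_le_div_one_add_pow (k : 𝓢(ℝ, ℂ)) (A : ℕ) :
    ∃ C, 0 ≤ C ∧ ∀ t, ‖k t‖ ≤ C / (1 + |t|) ^ A := by
  obtain ⟨C0, h0, hC0⟩ := k.decay 0 0
  obtain ⟨C1, h1, hC1⟩ := k.decay A 0
  refine ⟨2 ^ A * (C0 + C1), by positivity, fun t => ?_⟩
  have e0 := hC0 t
  have e1 := hC1 t
  simp only [pow_zero, one_mul, norm_iteratedFDeriv_zero, Real.norm_eq_abs] at e0 e1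
  rw [le_div_iff₀ (by positivity)]
  have h2 : (1 + |t|) ^ A ≤ 2 ^ A * (1 + |t| ^ A) := by
    rcases le_total |t| 1 with h | h
    · calc (1 + |t|) ^ A ≤ 2 ^ A := pow_le_pow_left₀ (by positivity) (by linarith) _
        _ ≤ _ := le_mul_of_one_le_right (by positivity) (by linarith [pow_nonneg (abs_nonneg t) A])
    · calc (1 + |t|) ^ A ≤ (2 * |t|) ^ A := pow_le_pow_left₀ (by positivity) (by linarith) _
        _ = 2 ^ A * |t| ^ A := mul_pow _ _ _
        _ ≤ _ := by gcongr; linarith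
  calc ‖k t‖ * (1 + |t|) ^ A ≤ ‖k t‖ * (2 ^ A * (1 + |t| ^ A)) := by gcongr
    _ = 2 ^ A * (‖k t‖ + |t| ^ A * ‖k t‖) := by ring
    _ ≤ _ := by gcongr

/-- The cubic polynomial with critical points `±p_i`. -/
noncomputable def critPoly {m : ℕ} (a p y : Fin m → ℝ) : ℝ :=
  ∑ i, a i * (y i ^ 3 - 3 * p i ^ 2 * y i)

@[fun_prop] theorem continuous_critPoly {m : ℕ} (a p : Fin m → ℝ) :
    Continuous (critPoly a p) := by
  unfold critPoly; fun_prop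

theorem hasLineDerivAt_critPoly {m : ℕ} (a p y : Fin m → ℝ) (i : Fin m) :
    HasLineDerivAt ℝ (critPoly a p) (3 * a i * (y i ^ 2 - p i ^ 2)) y (Pi.single i 1) := by
  refine hasLineDerivAt_sum (fun i s => a i * (s ^ 3 - 3 * p i ^ 2 * s))
    (fun i s => 3 * a i * (s ^ 2 - p i ^ 2)) (fun i s => ?_) y i
  refine (((hasDerivAt_pow 3 s).sub
    ((hasDerivAt_id s).const_mul (3 * p i ^ 2))).const_mul (a i)).congr_deriv ?_
  simp; ring

section Stationary

variable {m : ℕ} (a : Fin m → ℝ) (inv : ℝ → ℝ)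

/-- The integrand of the stationary part, `k(μ v⁻²) G(y, v, p) e(λ v f_p(y))`. -/
noncomputable def statIntegrand (k : 𝓢(ℝ, ℂ)) (G : ((Fin m → ℝ) × ℝ) × (Fin m → ℝ) → ℂ)
    (μ lam : ℝ) (p : Fin m → ℝ) (z : (Fin m → ℝ) × ℝ) : ℂ :=
  k (μ * inv z.2 ^ 2) * (G (z, p) * osc (lam * (z.2 * critPoly a p z.1)))

variable {a inv}

theorem integrable_mul_slice {g : (Fin m → ℝ) × ℝ → ℂ} (hg : Continuous g)
    {G : ((Fin m → ℝ) × ℝ) × (Fin m → ℝ) → ℂ} (hG : Continuous G) (hGc : HasCompactSupport G)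
    (p : Fin m → ℝ) : Integrable fun z => g z * G (z, p) := by
  refine Continuous.integrable_of_hasCompactSupport (by fun_prop) (HasCompactSupport.mul_left ?_)
  refine HasCompactSupport.of_support_subset_isCompact (hGc.image continuous_fst) fun x hx => ?_
  exact ⟨(x, p), subset_tsupport _ hx, rfl⟩

theorem integrable_statIntegrand (hinv : Continuous inv) (k : 𝓢(ℝ, ℂ))
    {G : ((Fin m → ℝ) × ℝ) × (Fin m → ℝ) → ℂ} (hG : Continuous G) (hGc : HasCompactSupport G)
    (μ lam : ℝ) (p : Fin m → ℝ) : Integrable (statIntegrand a inv k G μ lam p) := by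
  have hk := k.continuous
  refine (integrable_mul_slice (g := fun z => k (μ * inv z.2 ^ 2) *
    osc (lam * (z.2 * critPoly a p z.1))) (by fun_prop) hG hGc p).congr
    (ae_of_all _ fun z => ?_)
  simp only [statIntegrand]; ring

/-- The region on which amplitudes are supported. -/
def posRegion (m : ℕ) (c : ℝ) : Set (((Fin m → ℝ) × ℝ) × (Fin m → ℝ)) :=
  {x | c ≤ x.1.2 ∧ ∀ i, c ≤ x.1.1 i ∧ c ≤ x.2 i}

theorem isClosed_posRegion (m : ℕ) (c : ℝ) : IsClosed (posRegion m c) := by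
  simp only [posRegion, ofPred_and, ofPred_forall]
  refine (isClosed_le (by fun_prop) (by fun_prop)).inter (isClosed_iInter fun i => ?_)
  exact (isClosed_le (by fun_prop) (by fun_prop)).inter (isClosed_le (by fun_prop) (by fun_prop))

/-- The critical value lies in the ideal generated by the derivatives of the phase λ v f_p(y). From
y³ − 3p²y + 2p³ = (y − p)²(y + 2p) one gets f_p(p) = f_p(y) − Σ q_i·3a_i(y_i² − p_i²) with q_i =
(y_i − p_i)(y_i + 2p_i)/(3(y_i + p_i)), which is smooth where y_i and p_i are positive. Here f_p(y)
comes from ∂_v and the other terms from ∂_{y_i}. Integration by parts moves these derivatives onto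
the amplitude and onto k(μv⁻²), so both the amplitudes and the kernels stay in their classes and the
identity can be iterated. -/
theorem integral_statIntegrand_identity {c : ℝ} (hc : 0 < c) (hinv : ContDiff ℝ ∞ inv)
    (hinv' : ∀ z, c / 2 ≤ |z| → inv z = z⁻¹) (k : 𝓢(ℝ, ℂ))
    {G : ((Fin m → ℝ) × ℝ) × (Fin m → ℝ) → ℂ} (hG : ContDiff ℝ ∞ G) (hGc : HasCompactSupport G)
    (hGr : ∀ x, G x ≠ 0 → x ∈ posRegion m c) :
    ∃ G1 G2 : ((Fin m → ℝ) × ℝ) × (Fin m → ℝ) → ℂ,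
      (ContDiff ℝ ∞ G1 ∧ HasCompactSupport G1 ∧ ∀ x, G1 x ≠ 0 → x ∈ posRegion m c) ∧
      (ContDiff ℝ ∞ G2 ∧ HasCompactSupport G2 ∧ ∀ x, G2 x ≠ 0 → x ∈ posRegion m c) ∧
      ∀ μ lam p, (2 * Real.pi * Complex.I * (lam * critPoly a p p : ℝ)) *
          ∫ z, statIntegrand a inv k G μ lam p z =
        (∫ z, statIntegrand a inv k G1 μ lam p z) +
          2 * ∫ z, statIntegrand a inv (eulerOp k) G2 μ lam p z := by
  set q : Fin m → ((Fin m → ℝ) × ℝ) × (Fin m → ℝ) → ℝ := fun i x =>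
    (x.1.1 i - x.2 i) * (x.1.1 i + 2 * x.2 i) / 3 * inv (x.1.1 i + x.2 i) with hq
  have hqs : ∀ i, ContDiff ℝ ∞ (q i) := fun i => by
    have : ContDiff ℝ ∞ fun x : ((Fin m → ℝ) × ℝ) × (Fin m → ℝ) => inv (x.1.1 i + x.2 i) :=
      hinv.comp (by fun_prop)
    simp only [hq]
    fun_prop
  set Gq : Fin m → ((Fin m → ℝ) × ℝ) × (Fin m → ℝ) → ℂ := fun i x => (q i x : ℂ) * G x with hGq
  have hGqs : ∀ i, ContDiff ℝ ∞ (Gq i) := fun i => (Complex.ofRealCLM.contDiff.comp (hqs i)).mul hG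
  have hGqc : ∀ i, HasCompactSupport (Gq i) := fun i => hGc.mul_left
  have hGqr : ∀ i x, Gq i x ≠ 0 → x ∈ posRegion m c := fun i x hx => hGr x fun h => hx (by simp [hGq, h])
  set u0 : ((Fin m → ℝ) × ℝ) × (Fin m → ℝ) := ((0, 1), 0) with hu0
  set u : Fin m → ((Fin m → ℝ) × ℝ) × (Fin m → ℝ) := fun i => ((Pi.single i 1, 0), 0) with hu
  have hiv : ContDiff ℝ ∞ fun x : ((Fin m → ℝ) × ℝ) × (Fin m → ℝ) => ((inv x.1.2 : ℝ) : ℂ) :=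
    Complex.ofRealCLM.contDiff.comp (hinv.comp (by fun_prop))
  set G1 : ((Fin m → ℝ) × ℝ) × (Fin m → ℝ) → ℂ := fun x =>
    -fderiv ℝ G x u0 + ∑ i, (inv x.1.2 : ℂ) * fderiv ℝ (Gq i) x (u i) with hG1
  set G2 : ((Fin m → ℝ) × ℝ) × (Fin m → ℝ) → ℂ := fun x => (inv x.1.2 : ℂ) * G x with hG2
  have hcl := isClosed_posRegion m c
  have hG1s : ContDiff ℝ ∞ G1 := (contDiff_fderiv_apply hG u0).neg.add
    (ContDiff.sum fun i _ => hiv.mul (contDiff_fderiv_apply (hGqs i) (u i)))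
  have hG1r : ∀ x, x ∉ tsupport G → G1 x = 0 := fun x hx => by
    have h1 : fderiv ℝ G x u0 = 0 := by
      have : fderiv ℝ G x = 0 := by
        by_contra h; exact hx (support_fderiv_subset ℝ h)
      simp [this]
    have h2 : ∀ i, fderiv ℝ (Gq i) x (u i) = 0 := fun i => by
      have : fderiv ℝ (Gq i) x = 0 := by
        by_contra h
        exact hx (closure_mono (s := Function.support (Gq i)) (t := Function.support G)
          (fun y hy h' => hy (by simp [hGq, h'])) (support_fderiv_subset ℝ h))
      simp [this]
    simp [hG1, h1, h2]
  have hts : tsupport G ⊆ posRegion m c := closure_minimal (fun x hx => hGr x hx) hcl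
  refine ⟨G1, G2, ⟨hG1s, HasCompactSupport.intro hGc hG1r, fun x hx => hts ?_⟩,
    ⟨hiv.mul hG, hGc.mul_left, fun x hx => hGr x fun h => hx (by simp [hG2, h])⟩,
    fun μ lam p => ?_⟩
  · by_contra h; exact hx (hG1r x h)
  set κ : ℝ → ℂ := fun v => k (μ * inv v ^ 2) with hκ
  set o : (Fin m → ℝ) × ℝ → ℂ := fun z => osc (lam * (z.2 * critPoly a p z.1)) with ho
  have hinvc := hinv.continuous
  have hkc := k.continuous
  have hκc : Continuous κ := by fun_prop
  have hoc : Continuous o := by fun_prop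
  have hκd : ∀ v, HasDerivAt κ (deriv k (μ * inv v ^ 2) * (μ * (2 * inv v * deriv inv v) : ℝ)) v := by
    intro v
    have h1 : HasDerivAt inv (deriv inv v) v := (hinv.differentiable (by simp) v).hasDerivAt
    have h2 : HasDerivAt (fun v => μ * inv v ^ 2) (μ * (2 * inv v * deriv inv v)) v := by
      refine ((h1.pow 2).const_mul μ).congr_deriv ?_
      simp
    have h3 : HasDerivAt k (deriv k (μ * inv v ^ 2)) (μ * inv v ^ 2) :=
      (k.differentiable _).hasDerivAt
    refine (h3.scomp v h2).congr_deriv ?_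
    simp [mul_comm]
  -- The logarithmic derivative of k(μv⁻²) is −2 times the Euler operator of k at the same point. No
  -- factor μ is lost. Only v ≥ c matters, where `inv` is the true inverse.
  have hκd' : ∀ v, c ≤ v → deriv k (μ * inv v ^ 2) * (μ * (2 * inv v * deriv inv v) : ℝ) =
      -2 * (inv v * eulerOp k (μ * inv v ^ 2)) := by
    intro v hv
    have hv0 : 0 < v := hc.trans_le hv
    have h1 : inv =ᶠ[nhds v] fun v => v⁻¹ := by
      have : ∀ᶠ z in nhds v, c / 2 < z := eventually_gt_nhds (by linarith)
      filter_upwards [this] with z hz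
      exact hinv' z (hz.le.trans (le_abs_self z))
    rw [h1.deriv_eq, deriv_inv, eulerOp_apply, h1.self_of_nhds]
    push_cast
    field_simp
  have hI1 := integrable_statIntegrand (a := a) hinvc k hG1s.continuous
    (HasCompactSupport.intro hGc hG1r) μ lam p
  have hI2 : Integrable (statIntegrand a inv (eulerOp k) G2 μ lam p) := integrable_statIntegrand (a := a) hinvc (eulerOp k) (hiv.mul hG).continuous
    (hGc.mul_left (f := fun x : ((Fin m → ℝ) × ℝ) × (Fin m → ℝ) => ((inv x.1.2 : ℝ) : ℂ))) μ lam p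
  have hI0 := integrable_statIntegrand (a := a) hinvc k hG.continuous hGc μ lam p
  -- derivative in `v`
  set D0 : (Fin m → ℝ) × ℝ → ℂ := fun z =>
    (deriv k (μ * inv z.2 ^ 2) * (μ * (2 * inv z.2 * deriv inv z.2) : ℝ)) * (G (z, p) * o z) +
    κ z.2 * (fderiv ℝ G (z, p) u0 * o z +
      G (z, p) * (2 * Real.pi * Complex.I * (lam * critPoly a p z.1 : ℝ) * o z)) with hD0
  have hd0 : ∀ z, HasLineDerivAt ℝ (fun z => κ z.2 * (G (z, p) * o z)) (D0 z) z
      ((0, 1) : (Fin m → ℝ) × ℝ) := by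
    intro z
    have h1 : HasLineDerivAt ℝ (fun z : (Fin m → ℝ) × ℝ => κ z.2)
        (deriv k (μ * inv z.2 ^ 2) * (μ * (2 * inv z.2 * deriv inv z.2) : ℝ)) z (0, 1) := by
      unfold HasLineDerivAt
      have h2 : HasDerivAt (fun s : ℝ => z.2 + s * 1) 1 0 := by
        simpa using ((hasDerivAt_id (0 : ℝ)).const_add z.2)
      have h3 := HasDerivAt.scomp (0 : ℝ)
        (by rw [zero_mul, add_zero]; exact hκd z.2) h2
      rw [one_smul] at h3
      exact h3
    have h2 : HasLineDerivAt ℝ (fun z : (Fin m → ℝ) × ℝ => G (z, p)) (fderiv ℝ G (z, p) u0) z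
        (0, 1) := by
      have := hasLineDerivAt_of_contDiff hG (z, p) u0
      unfold HasLineDerivAt at *
      convert! this using 3
      simp [hu0]
    have h3 : HasLineDerivAt ℝ (fun z : (Fin m → ℝ) × ℝ => lam * (z.2 * critPoly a p z.1))
        (lam * critPoly a p z.1) z (0, 1) := by
      unfold HasLineDerivAt
      have : HasDerivAt (fun s : ℝ => lam * ((z.2 + s) * critPoly a p z.1))
          (lam * (1 * critPoly a p z.1)) 0 :=
        ((((hasDerivAt_id (0 : ℝ)).const_add z.2)).mul_const _).const_mul lam
      simpa using this
    exact hasLineDerivAt_mul h1 (hasLineDerivAt_mul h2 (hasLineDerivAt_osc h3))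
  -- derivatives in `y`
  set D : Fin m → (Fin m → ℝ) × ℝ → ℂ := fun i z =>
    (κ z.2 * inv z.2) * (fderiv ℝ (Gq i) (z, p) (u i) * o z +
      Gq i (z, p) * (2 * Real.pi * Complex.I *
        (lam * (z.2 * (3 * a i * (z.1 i ^ 2 - p i ^ 2))) : ℝ) * o z)) with hD
  have hd : ∀ i z, HasLineDerivAt ℝ (fun z => (κ z.2 * inv z.2) * (Gq i (z, p) * o z)) (D i z) z
      ((Pi.single i 1, 0) : (Fin m → ℝ) × ℝ) := by
    intro i z
    have h1 : HasLineDerivAt ℝ (fun z : (Fin m → ℝ) × ℝ => κ z.2 * inv z.2) 0 z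
        (Pi.single i 1, 0) := by
      unfold HasLineDerivAt
      simpa using hasDerivAt_const (0 : ℝ) (κ z.2 * inv z.2)
    have h2 : HasLineDerivAt ℝ (fun z : (Fin m → ℝ) × ℝ => Gq i (z, p))
        (fderiv ℝ (Gq i) (z, p) (u i)) z (Pi.single i 1, 0) := by
      have := hasLineDerivAt_of_contDiff (hGqs i) (z, p) (u i)
      unfold HasLineDerivAt at *
      convert! this using 3
      simp [hu]
    have h3 : HasLineDerivAt ℝ (fun z : (Fin m → ℝ) × ℝ => lam * (z.2 * critPoly a p z.1))
        (lam * (z.2 * (3 * a i * (z.1 i ^ 2 - p i ^ 2)))) z (Pi.single i 1, 0) := by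
      have := hasLineDerivAt_critPoly a p z.1 i
      unfold HasLineDerivAt at *
      simpa using (this.const_mul z.2).const_mul lam
    have := hasLineDerivAt_mul h1 (hasLineDerivAt_mul h2 (hasLineDerivAt_osc h3))
    rw [zero_mul, zero_add] at this
    exact this
  have hdk : Continuous (deriv k) := (SchwartzMap.derivCLM ℂ ℂ k).continuous
  have hdi : Continuous (deriv inv) := hinv.continuous_deriv (by simp)
  have hint0 : Integrable D0 := by
    have i1 := integrable_mul_slice (g := fun z => (deriv k (μ * inv z.2 ^ 2) *
      (μ * (2 * inv z.2 * deriv inv z.2) : ℝ)) * o z) (by fun_prop) hG.continuous hGc p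
    have i2 := integrable_mul_slice (g := fun z => κ z.2 * o z) (by fun_prop)
      (contDiff_fderiv_apply hG u0).continuous (hGc.fderiv_apply ℝ u0) p
    have i3 := integrable_mul_slice (g := fun z => κ z.2 *
      (2 * Real.pi * Complex.I * (lam * critPoly a p z.1 : ℝ) * o z)) (by fun_prop)
      hG.continuous hGc p
    refine ((i1.add i2).add i3).congr (ae_of_all _ fun z => ?_)
    simp only [hD0, Pi.add_apply]; ring
  have hint : ∀ i, Integrable (D i) := fun i => by
    have i2 := integrable_mul_slice (g := fun z => κ z.2 * inv z.2 * o z) (by fun_prop)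
      (contDiff_fderiv_apply (hGqs i) (u i)).continuous ((hGqc i).fderiv_apply ℝ (u i)) p
    have i3 := integrable_mul_slice (g := fun z => (κ z.2 * inv z.2) *
      (2 * Real.pi * Complex.I * (lam * (z.2 * (3 * a i * (z.1 i ^ 2 - p i ^ 2))) : ℝ) * o z))
      (by fun_prop) (hGqs i).continuous (hGqc i) p
    refine (i2.add i3).congr (ae_of_all _ fun z => ?_)
    simp only [hD, Pi.add_apply]; ring
  have : (volume : Measure ((Fin m → ℝ) × ℝ)).IsAddHaarMeasure := by
    rw [Measure.volume_eq_prod]; infer_instance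
  have z0 : ∫ z, D0 z = 0 := integral_eq_zero_of_hasLineDerivAt
    ((integrable_mul_slice (g := fun z => κ z.2 * o z) (by fun_prop) hG.continuous hGc p).congr
      (ae_of_all _ fun z => by ring)) hint0 hd0
  have zi : ∀ i, ∫ z, D i z = 0 := fun i => integral_eq_zero_of_hasLineDerivAt
    ((integrable_mul_slice (g := fun z => κ z.2 * inv z.2 * o z) (by fun_prop)
      (hGqs i).continuous (hGqc i) p).congr (ae_of_all _ fun z => by ring)) (hint i) (hd i)
  have hz : ∫ z, (D0 z - ∑ i, D i z) = 0 := by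
    rw [integral_sub hint0 (integrable_finsetSum _ fun i _ => hint i),
      integral_finsetSum _ fun i _ => hint i, z0]
    simp [zi]
  -- The left side is a sum of total derivatives. Where G vanishes only the derivatives of the
  -- amplitudes survive, and they agree on both sides; elsewhere the point lies in the region where
  -- `inv` is the inverse and the algebraic identity for f_p(p) applies.
  have hpt : ∀ z, D0 z - ∑ i, D i z =
      (2 * Real.pi * Complex.I * (lam * critPoly a p p : ℝ)) * statIntegrand a inv k G μ lam p z -
        statIntegrand a inv k G1 μ lam p z -
        2 * statIntegrand a inv (eulerOp k) G2 μ lam p z := by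
    intro z
    simp only [statIntegrand, hG1, hG2]
    by_cases h : G (z, p) = 0
    · simp only [hD0, hD, h, hGq, mul_zero, zero_mul, add_zero, zero_sub, zero_add]
      have s1 : ∑ i, κ z.2 * inv z.2 * (fderiv ℝ (Gq i) (z, p) (u i) * o z) =
          κ z.2 * o z * ∑ i, (inv z.2 : ℂ) * fderiv ℝ (Gq i) (z, p) (u i) := by
        rw [Finset.mul_sum]
        exact Finset.sum_congr rfl fun i _ => by ring
      rw [s1]
      simp only [hκ, ho]
      ring
    · obtain ⟨hv, hy⟩ := hGr _ h
      simp only at hv hy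
      have hv0 : 0 < z.2 := hc.trans_le hv
      have hiv : inv z.2 = z.2⁻¹ := hinv' _ (by rw [abs_of_pos hv0]; linarith)
      have hq1 : ∀ i, q i (z, p) * (3 * a i * (z.1 i ^ 2 - p i ^ 2)) =
          a i * ((z.1 i - p i) ^ 2 * (z.1 i + 2 * p i)) := fun i => by
        have h1 := hy i
        have h2 : inv (z.1 i + p i) = (z.1 i + p i)⁻¹ :=
          hinv' _ (by rw [abs_of_pos (by linarith)]; linarith)
        have h3 : z.1 i + p i ≠ 0 := by linarith
        simp only [hq, h2]
        field_simp
        ring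
      have hq2 : critPoly a p z.1 - ∑ i, q i (z, p) * (3 * a i * (z.1 i ^ 2 - p i ^ 2)) =
          critPoly a p p := by
        simp_rw [hq1]
        simp only [critPoly, ← Finset.sum_sub_distrib]
        exact Finset.sum_congr rfl fun i _ => by ring
      have hDi : ∀ i, D i z = κ z.2 * o z * ((inv z.2 : ℂ) * fderiv ℝ (Gq i) (z, p) (u i)) +
          2 * Real.pi * Complex.I * lam * κ z.2 * o z * G (z, p) *
            ((q i (z, p) * (3 * a i * (z.1 i ^ 2 - p i ^ 2)) : ℝ) : ℂ) := fun i => by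
        have h5 : (z.2 : ℂ) ≠ 0 := by exact_mod_cast hv0.ne'
        simp only [hD, hGq, hiv]
        push_cast
        field_simp
      simp_rw [hDi]
      have s1 : ∑ i, κ z.2 * o z * ((inv z.2 : ℂ) * fderiv ℝ (Gq i) (z, p) (u i)) =
          κ z.2 * o z * ∑ i, (inv z.2 : ℂ) * fderiv ℝ (Gq i) (z, p) (u i) := by
        rw [Finset.mul_sum]
      have s2 : ∑ i, 2 * Real.pi * Complex.I * lam * κ z.2 * o z * G (z, p) *
            ((q i (z, p) * (3 * a i * (z.1 i ^ 2 - p i ^ 2)) : ℝ) : ℂ) =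
          2 * Real.pi * Complex.I * lam * κ z.2 * o z * G (z, p) *
            ((∑ i, q i (z, p) * (3 * a i * (z.1 i ^ 2 - p i ^ 2)) : ℝ) : ℂ) := by
        rw [Complex.ofReal_sum, Finset.mul_sum]
      rw [Finset.sum_add_distrib, s1, s2, ← hq2]
      simp only [hD0]
      rw [hκd' _ hv]
      simp only [hκ, ho]
      push_cast
      ring
  simp_rw [hpt] at hz
  have e1 := integral_sub ((hI0.const_mul (2 * Real.pi * Complex.I * (lam * critPoly a p p : ℝ))).sub
    hI1) (hI2.const_mul 2)
  have e2 := integral_sub (hI0.const_mul (2 * Real.pi * Complex.I * (lam * critPoly a p p : ℝ))) hI1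
  simp only [Pi.sub_apply] at e1
  rw [e1, e2, integral_const_mul, integral_const_mul] at hz
  linear_combination hz

end Stationary

section
variable {m : ℕ} {a : Fin m → ℝ} {inv : ℝ → ℝ}

/-- For fixed v the y-integral has cubic phase with coefficient λv and is O(λ^{-m/2}) uniformly in p
and v; the v-integral over a compact interval is then trivial. Since v is bounded above, the decay
of k at μv⁻² gives decay in μ. -/
theorem exists_norm_integral_statIntegrand_le (ha : ∀ i, a i ≠ 0) {c : ℝ} (hc : 0 < c)
    (hinv : ContDiff ℝ ∞ inv) (hinv' : ∀ z, c / 2 ≤ |z| → inv z = z⁻¹) (A : ℕ) (k : 𝓢(ℝ, ℂ))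
    {G : ((Fin m → ℝ) × ℝ) × (Fin m → ℝ) → ℂ} (hG : ContDiff ℝ ∞ G) (hGc : HasCompactSupport G)
    (hGr : ∀ x, G x ≠ 0 → x ∈ posRegion m c) :
    ∃ C, 0 ≤ C ∧ ∀ (μ lam : ℝ) (p : Fin m → ℝ), 0 ≤ μ → 0 < lam →
      ‖∫ z, statIntegrand a inv k G μ lam p z‖ ≤ C / (1 + μ) ^ A * lam ^ (-(m : ℝ) / 2) := by
  obtain ⟨R, hR1, hRc, hR⟩ : ∃ R, 1 ≤ R ∧ c ≤ R ∧ ∀ x, G x ≠ 0 → ‖x‖ ≤ R := by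
    obtain ⟨R, hR⟩ := hGc.isBounded.exists_norm_le
    exact ⟨max R (max 1 c), by simp, by simp, fun x hx =>
      (hR x (subset_tsupport _ hx)).trans (le_max_left _ _)⟩
  have hbox : ∀ y v p, G ((y, v), p) ≠ 0 → v ∈ Icc c R ∧ ∀ i, y i ∈ Icc c R := by
    intro y v p h
    obtain ⟨h1, h2⟩ := hGr _ h
    have h3 := hR _ h
    have h4 : ‖(y, v)‖ ≤ R := (norm_fst_le ((y, v), p)).trans h3
    refine ⟨⟨h1, (le_abs_self v).trans ((norm_snd_le (y, v)).trans h4)⟩, fun i => ⟨(h2 i).1, ?_⟩⟩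
    exact (le_abs_self _).trans ((norm_le_pi_norm y i).trans ((norm_fst_le (y, v)).trans h4))
  set G' : (Fin m → ℝ) × (ℝ × (Fin m → ℝ)) → ℂ := fun x => G ((x.1, x.2.1), x.2.2) with hG'
  have hG's : ContDiff ℝ ∞ G' := hG.comp (by fun_prop)
  have hG'c : HasCompactSupport G' := by
    refine HasCompactSupport.of_support_subset_isCompact
      (hGc.image (f := fun x : ((Fin m → ℝ) × ℝ) × (Fin m → ℝ) => (x.1.1, (x.1.2, x.2)))
        (by fun_prop)) fun x hx => ?_
    exact ⟨((x.1, x.2.1), x.2.2), subset_tsupport _ hx, rfl⟩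
  obtain ⟨C1, hC1, hC1'⟩ := exists_norm_integral_mul_osc_cubic_le hG's hG'c hc hRc
    (fun y q h => (hbox y q.1 q.2 h).2) ha
  obtain ⟨C2, hC2, hC2'⟩ := exists_norm_le_div_one_add_pow k A
  set M : ℝ := C2 * (R ^ 2) ^ A * (C1 * c ^ (-(m : ℝ) / 2)) with hM
  have hM0 : 0 ≤ M := by positivity
  refine ⟨M * (R - c), mul_nonneg hM0 (by linarith), fun μ lam p hμ hlam => ?_⟩
  have hI := integrable_statIntegrand (a := a) hinv.continuous k hG.continuous hGc μ lam p
  rw [Measure.volume_eq_prod] at hI ⊢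
  rw [integral_prod_symm _ hI]
  have hl0 : 0 < lam ^ (-(m : ℝ) / 2) := Real.rpow_pos_of_pos hlam _
  have hbd : ∀ v, ‖∫ y, statIntegrand a inv k G μ lam p (y, v)‖ ≤
      (Icc c R).indicator (fun _ => M / (1 + μ) ^ A * lam ^ (-(m : ℝ) / 2)) v := by
    intro v
    by_cases hv : v ∈ Icc c R
    · rw [indicator_of_mem hv]
      have hv0 : 0 < v := hc.trans_le hv.1
      simp only [statIntegrand]
      rw [integral_const_mul, norm_mul]
      have e1 : ‖∫ y, G ((y, v), p) * osc (lam * (v * critPoly a p y))‖ ≤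
          C1 * |lam * v| ^ (-(m : ℝ) / 2) := by
        have := hC1' (v, p) (lam * v) (fun i => -(lam * v * a i * 3 * p i ^ 2)) (by positivity)
        refine le_of_eq_of_le (congrArg _ (integral_congr_ae (ae_of_all _ fun y => ?_))) this
        simp only [hG', critPoly, Finset.mul_sum, ← Finset.sum_add_distrib]
        congr 3
        funext i
        ring
      have e2 : C1 * |lam * v| ^ (-(m : ℝ) / 2) ≤ C1 * c ^ (-(m : ℝ) / 2) * lam ^ (-(m : ℝ) / 2) := by
        rw [abs_of_pos (by positivity), Real.mul_rpow hlam.le hv0.le, mul_assoc, mul_comm (c ^ _)]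
        gcongr C1 * (_ * ?_)
        exact Real.rpow_le_rpow_of_nonpos hc hv.1 (by
          have : (0 : ℝ) ≤ m := Nat.cast_nonneg m
          linarith)
      have e3 : ‖k (μ * inv v ^ 2)‖ ≤ C2 * (R ^ 2) ^ A / (1 + μ) ^ A := by
        refine (hC2' _).trans ?_
        rw [hinv' v (by rw [abs_of_pos hv0]; linarith [hv.1]), abs_of_nonneg (by positivity),
          div_le_div_iff₀ (by positivity) (by positivity), mul_assoc, ← mul_pow]
        gcongr
        have h1 : 1 ≤ R ^ 2 := one_le_pow₀ hR1
        have h2 : 1 ≤ R ^ 2 * v⁻¹ ^ 2 := by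
          rw [← mul_pow]
          refine one_le_pow₀ ?_
          rw [← div_eq_mul_inv, le_div_iff₀ hv0, one_mul]
          exact hv.2
        nlinarith
      calc _ ≤ C2 * (R ^ 2) ^ A / (1 + μ) ^ A * (C1 * c ^ (-(m : ℝ) / 2) * lam ^ (-(m : ℝ) / 2)) := by
            gcongr
            exact e1.trans e2
        _ = _ := by rw [hM]; ring
    · have : ∀ y, statIntegrand a inv k G μ lam p (y, v) = 0 := fun y => by
        have : G ((y, v), p) = 0 := by
          by_contra h; exact hv (hbox y v p h).1
        simp [statIntegrand, this]
      simp [this, hv]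
  refine (norm_integral_le_of_norm_le ?_ (ae_of_all _ hbd)).trans (le_of_eq ?_)
  · exact (integrable_indicator_iff measurableSet_Icc).2 (integrableOn_const (by simp))
  · rw [integral_indicator measurableSet_Icc]
    simp [hRc]
    ring

/-- Each application of the identity trades a factor λ|f_p(p)| for a change of kernel and amplitude.
The induction on B therefore has to range over all kernels and amplitudes. -/
theorem exists_norm_integral_statIntegrand_mul_pow_le (ha : ∀ i, a i ≠ 0) {c : ℝ} (hc : 0 < c)
    (hinv : ContDiff ℝ ∞ inv) (hinv' : ∀ z, c / 2 ≤ |z| → inv z = z⁻¹) (A B : ℕ) :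
    ∀ (k : 𝓢(ℝ, ℂ)) (G : ((Fin m → ℝ) × ℝ) × (Fin m → ℝ) → ℂ), ContDiff ℝ ∞ G →
    HasCompactSupport G → (∀ x, G x ≠ 0 → x ∈ posRegion m c) →
    ∃ C, 0 ≤ C ∧ ∀ (μ lam : ℝ) (p : Fin m → ℝ), 0 ≤ μ → 0 < lam →
      (lam * |critPoly a p p|) ^ B * ‖∫ z, statIntegrand a inv k G μ lam p z‖ ≤
        C / (1 + μ) ^ A * lam ^ (-(m : ℝ) / 2) := by
  induction B with
  | zero =>
    intro k G hG hGc hGr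
    simpa using exists_norm_integral_statIntegrand_le ha hc hinv hinv' A k hG hGc hGr
  | succ B ih =>
    intro k G hG hGc hGr
    obtain ⟨G1, G2, ⟨h1s, h1c, h1r⟩, ⟨h2s, h2c, h2r⟩, hid⟩ :=
      integral_statIntegrand_identity (a := a) hc hinv hinv' k hG hGc hGr
    obtain ⟨C1, hC1, hC1'⟩ := ih k G1 h1s h1c h1r
    obtain ⟨C2, hC2, hC2'⟩ := ih (eulerOp k) G2 h2s h2c h2r
    refine ⟨C1 + 2 * C2, by positivity, fun μ lam p hμ hlam => ?_⟩
    have h1 := hC1' μ lam p hμ hlam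
    have h2 := hC2' μ lam p hμ hlam
    have h3 := congrArg norm (hid μ lam p)
    rw [norm_mul] at h3
    have h4 : ‖(2 * Real.pi * Complex.I * (lam * critPoly a p p : ℝ) : ℂ)‖ =
        2 * Real.pi * (lam * |critPoly a p p|) := by
      simp [abs_of_pos Real.pi_pos, abs_of_pos hlam]
    rw [h4] at h3
    set L := lam * |critPoly a p p|
    have hL : 0 ≤ L := by positivity
    have h5 := (norm_add_le (∫ z, statIntegrand a inv k G1 μ lam p z)
      (2 * ∫ z, statIntegrand a inv (eulerOp k) G2 μ lam p z))
    rw [norm_mul, Complex.norm_ofNat, ← h3] at h5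
    set N := ‖∫ z, statIntegrand a inv k G μ lam p z‖
    have hN : 0 ≤ N := norm_nonneg _
    have h6 : L * N ≤ 2 * Real.pi * L * N := by
      have := Real.pi_gt_three
      have : 0 ≤ L * N := by positivity
      nlinarith
    calc L ^ (B + 1) * N = L ^ B * (L * N) := by ring
      _ ≤ L ^ B * (‖∫ z, statIntegrand a inv k G1 μ lam p z‖ +
          2 * ‖∫ z, statIntegrand a inv (eulerOp k) G2 μ lam p z‖) := by
        gcongr; exact h6.trans h5
      _ = L ^ B * ‖∫ z, statIntegrand a inv k G1 μ lam p z‖ +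
          2 * (L ^ B * ‖∫ z, statIntegrand a inv (eulerOp k) G2 μ lam p z‖) := by ring
      _ ≤ C1 / (1 + μ) ^ A * lam ^ (-(m : ℝ) / 2) + 2 * (C2 / (1 + μ) ^ A * lam ^ (-(m : ℝ) / 2)) := by
        gcongr
      _ = _ := by ring

end

/-- The oscillatory integral `∫ w(x) e(t ∑ a_i x_i³ - ξ ⬝ x) dx`. -/
noncomputable def oscInt {m : ℕ} (a : Fin m → ℝ) (w : (Fin m → ℝ) → ℂ) (t : ℝ)
    (ξ : Fin m → ℝ) : ℂ :=
  ∫ x, w x * osc (phase a t ξ x)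

section
variable {m : ℕ} {a : Fin m → ℝ} {w : (Fin m → ℝ) → ℂ}

theorem continuous_oscInt (hw : Continuous w) (hwc : HasCompactSupport w) (ξ : Fin m → ℝ) :
    Continuous fun t => oscInt a w t ξ := by
  have h1 : ∀ t, oscInt a w t ξ = ∫ x in tsupport w, w x * osc (phase a t ξ x) := fun t => by
    refine (setIntegral_eq_integral_of_forall_compl_eq_zero fun x hx => ?_).symm
    rw [image_eq_zero_of_notMem_tsupport hx, zero_mul]
  simp_rw [h1]
  refine continuous_parametric_integral_of_continuous (f := fun t x => w x * osc (phase a t ξ x))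
    ?_ hwc
  simp only [Function.uncurry_def]
  unfold phase
  fun_prop

theorem norm_oscInt_le (t : ℝ) (ξ : Fin m → ℝ) : ‖oscInt a w t ξ‖ ≤ ∫ x, ‖w x‖ := by
  refine (norm_integral_le_integral_norm _).trans (le_of_eq ?_)
  simp

theorem exists_norm_oscInt_le_rpow (ha : ∀ i, a i ≠ 0) (hw : ContDiff ℝ ∞ w)
    (hwc : HasCompactSupport w) {c R : ℝ} (hc : 0 < c) (hcR : c ≤ R)
    (hwr : ∀ x, w x ≠ 0 → ∀ i, x i ∈ Icc c R) :
    ∃ C, 0 ≤ C ∧ ∀ t ξ, t ≠ 0 → ‖oscInt a w t ξ‖ ≤ C * |t| ^ (-(m : ℝ) / 2) := by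
  -- No parameter is needed here, so the parameter space is taken zero-dimensional.
  set G : (Fin m → ℝ) × (Fin 0 → ℝ) → ℂ := fun x => w x.1 with hG
  have hGc : HasCompactSupport G := by
    refine HasCompactSupport.of_support_subset_isCompact (hwc.prod isCompact_univ) fun x hx => ?_
    exact ⟨subset_tsupport _ hx, mem_univ _⟩
  obtain ⟨C, hC, hC'⟩ := exists_norm_integral_mul_osc_cubic_le (hw.comp contDiff_fst : ContDiff ℝ ∞ G)
    hGc hc hcR (fun y q h => hwr y h) ha
  refine ⟨C, hC, fun t ξ ht => ?_⟩
  have := hC' 0 t (fun i => -ξ i) ht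
  refine le_of_eq_of_le (congrArg _ (integral_congr_ae (ae_of_all _ fun y => ?_))) this
  simp [phase, sub_eq_add_neg]

/-- Outside of `τ₀‖ξ‖ ≤ t ≤ τ₁‖ξ‖`, and everywhere if `ξ` is not in the cone `a_i ξ_i ≥ κ₀‖ξ‖`,
the phase is not stationary. -/
theorem exists_nonstationary [Nonempty (Fin m)] (ha : ∀ i, a i ≠ 0) {c R : ℝ} (hc : 0 < c) (hcR : c ≤ R) :
    ∃ τ₀ τ₁ κ₀ c₁ : ℝ, 0 < τ₀ ∧ τ₀ < τ₁ ∧ 0 < κ₀ ∧ 0 < c₁ ∧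
      ∀ (t : ℝ) (ξ : Fin m → ℝ), 0 < t → 0 < ‖ξ‖ →
        (t ≤ τ₀ * ‖ξ‖ ∨ τ₁ * ‖ξ‖ ≤ t ∨ ∃ i, a i * ξ i < κ₀ * ‖ξ‖) →
        ∃ i, ∀ x : Fin m → ℝ, (∀ i, x i ∈ Icc c R) →
          c₁ * (‖ξ‖ + t) ≤ |3 * t * a i * x i ^ 2 - ξ i| := by
  obtain ⟨j, hj⟩ := Finite.exists_min fun i => |a i|
  set b := |a j| with hb
  set d := ‖a‖ with hd
  have hb0 : 0 < b := abs_pos.2 (ha j)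
  have had : ∀ i, |a i| ≤ d := fun i => norm_le_pi_norm a i
  have hbd : b ≤ d := had j
  have hd0 : 0 < d := hb0.trans_le hbd
  have hR0 : 0 < R := hc.trans_le hcR
  -- For t ≤ τ₀‖ξ‖ the cubic part 3t|a_i|x_i² is at most ‖ξ‖/2, and a coordinate with |ξ_i| = ‖ξ‖
  -- works. For t ≥ τ₁‖ξ‖ the cubic part is at least 3‖ξ‖, and the coordinate with the smallest
  -- |a_j| works. In between, a_iξ_i < κ₀‖ξ‖ forces a_i(3t a_i x_i² − ξ_i) ≥ 2κ₀‖ξ‖.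
  set τ₀ := 1 / (6 * d * R ^ 2) with hτ₀
  set τ₁ := 1 / (b * c ^ 2) with hτ₁
  have h0 : 0 < τ₀ := by positivity
  have h1 : 0 < τ₁ := by positivity
  have e0 : τ₀ * (6 * d * R ^ 2) = 1 := by rw [hτ₀]; field_simp
  have e1 : τ₁ * (b * c ^ 2) = 1 := by rw [hτ₁]; field_simp
  set κ₀ := τ₀ * b ^ 2 * c ^ 2 with hκ
  have hκ0 : 0 < κ₀ := by positivity
  have h01 : τ₀ < τ₁ := by
    refine one_div_lt_one_div_of_lt (by positivity) ?_
    have : b * c ^ 2 ≤ d * R ^ 2 := by gcongr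
    have : 0 < d * R ^ 2 := by positivity
    linarith
  set c₁ := min (1 / 2 / (1 + τ₀)) (min (2 / (1 + τ₁)) (2 * κ₀ / d / (1 + τ₁))) with hc1
  have hc10 : 0 < c₁ := by simp only [hc1, lt_min_iff]; refine ⟨by positivity, by positivity, by positivity⟩
  refine ⟨τ₀, τ₁, κ₀, c₁, h0, h01, hκ0, hc10, fun t ξ ht hξ hor => ?_⟩
  have hξi : ∀ i, |ξ i| ≤ ‖ξ‖ := fun i => norm_le_pi_norm ξ i
  by_cases t0 : t ≤ τ₀ * ‖ξ‖
  · obtain ⟨i, hi⟩ : ∃ i, |ξ i| = ‖ξ‖ := by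
      obtain ⟨i, hi⟩ := Finite.exists_max fun i => |ξ i|
      refine ⟨i, le_antisymm (hξi i) ?_⟩
      exact (pi_norm_le_iff_of_nonneg (abs_nonneg _)).2 hi
    refine ⟨i, fun x hx => ?_⟩
    have hx1 := hx i
    have hx0 : 0 < x i := hc.trans_le hx1.1
    have s1 : |3 * t * a i * x i ^ 2| ≤ ‖ξ‖ / 2 := by
      rw [abs_mul, abs_mul, abs_of_pos (by positivity : (0 : ℝ) < 3 * t), abs_of_pos (by positivity : 0 < x i ^ 2)]
      calc 3 * t * |a i| * x i ^ 2 ≤ 3 * (τ₀ * ‖ξ‖) * d * R ^ 2 := by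
            gcongr
            · exact had i
            · exact hx1.2
        _ = ‖ξ‖ / 2 * (τ₀ * (6 * d * R ^ 2)) := by ring
        _ = _ := by rw [e0, mul_one]
    have s2 : ‖ξ‖ / 2 ≤ |3 * t * a i * x i ^ 2 - ξ i| := by
      have := abs_sub_abs_le_abs_sub (ξ i) (3 * t * a i * x i ^ 2)
      rw [abs_sub_comm] at this
      linarith
    refine le_trans ?_ s2
    calc c₁ * (‖ξ‖ + t) ≤ (1 / 2 / (1 + τ₀)) * (‖ξ‖ + τ₀ * ‖ξ‖) := by
          gcongr
          exact min_le_left _ _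
      _ = _ := by field_simp
  by_cases t1 : τ₁ * ‖ξ‖ ≤ t
  · refine ⟨j, fun x hx => ?_⟩
    have hx1 := hx j
    have hx0 : 0 < x j := hc.trans_le hx1.1
    have s1 : 3 * (t * (b * c ^ 2)) ≤ |3 * t * a j * x j ^ 2| := by
      rw [abs_mul, abs_mul, abs_of_pos (by positivity : (0 : ℝ) < 3 * t), abs_of_pos (by positivity : 0 < x j ^ 2)]
      calc 3 * (t * (b * c ^ 2)) = 3 * t * |a j| * c ^ 2 := by ring
        _ ≤ _ := by
          gcongr
          exact hx1.1
    have s3 : ‖ξ‖ ≤ t * (b * c ^ 2) := by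
      calc ‖ξ‖ = τ₁ * ‖ξ‖ * (b * c ^ 2) := by rw [mul_right_comm, e1, one_mul]
        _ ≤ _ := by gcongr
    have s2 : 2 * (t * (b * c ^ 2)) ≤ |3 * t * a j * x j ^ 2 - ξ j| := by
      have := abs_sub_abs_le_abs_sub (3 * t * a j * x j ^ 2) (ξ j)
      have := hξi j
      linarith
    refine le_trans ?_ s2
    have s4 : ‖ξ‖ ≤ t / τ₁ := by rw [le_div_iff₀ h1, mul_comm]; exact t1
    calc c₁ * (‖ξ‖ + t) ≤ (2 / (1 + τ₁)) * (t / τ₁ + t) := by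
          gcongr
          exact (min_le_right _ _).trans (min_le_left _ _)
      _ = 2 * (t / τ₁) := by field_simp
      _ = 2 * (t * (b * c ^ 2)) := by rw [hτ₁]; field_simp
  · push Not at t0 t1
    obtain ⟨i, hi⟩ : ∃ i, a i * ξ i < κ₀ * ‖ξ‖ := by
      rcases hor with h | h | h
      · exact absurd h (not_le.2 t0)
      · exact absurd h (not_le.2 t1)
      · exact h
    refine ⟨i, fun x hx => ?_⟩
    have hx1 := hx i
    have hx0 : 0 < x i := hc.trans_le hx1.1
    have s1 : 3 * (κ₀ * ‖ξ‖) ≤ 3 * t * (a i) ^ 2 * x i ^ 2 := by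
      calc 3 * (κ₀ * ‖ξ‖) = 3 * (τ₀ * ‖ξ‖) * b ^ 2 * c ^ 2 := by rw [hκ]; ring
        _ ≤ 3 * t * |a i| ^ 2 * x i ^ 2 := by
          gcongr
          · exact hj i
          · exact hx1.1
        _ = _ := by rw [sq_abs]
    have s2 : 2 * (κ₀ * ‖ξ‖) ≤ d * |3 * t * a i * x i ^ 2 - ξ i| := by
      calc 2 * (κ₀ * ‖ξ‖) ≤ a i * (3 * t * a i * x i ^ 2 - ξ i) := by linarith
        _ ≤ |a i| * |3 * t * a i * x i ^ 2 - ξ i| := by rw [← abs_mul]; exact le_abs_self _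
        _ ≤ _ := by gcongr; exact had i
    calc c₁ * (‖ξ‖ + t) ≤ (2 * κ₀ / d / (1 + τ₁)) * (‖ξ‖ + τ₁ * ‖ξ‖) := by
          gcongr
          exact (min_le_right _ _).trans (min_le_right _ _)
      _ = 2 * (κ₀ * ‖ξ‖) / d := by field_simp
      _ ≤ _ := by rw [div_le_iff₀ hd0, mul_comm _ d]; exact s2

theorem integral_Ioi_comp_inv_sq (f : ℝ → ℂ) {lam : ℝ} (hl : 0 < lam) :
    ∫ t in Ioi (0 : ℝ), f t =
      lam * ∫ v in Ioi (0 : ℝ), ((2 * v⁻¹ ^ 3 : ℝ) : ℂ) * f (lam * v⁻¹ ^ 2) := by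
  have h1 := integral_comp_mul_left_Ioi f 0 hl
  have h2 := integral_comp_rpow_Ioi (fun y => f (lam * y)) (p := -2) (by norm_num)
  rw [mul_zero] at h1
  rw [h1] at h2
  have h3 : ∫ v in Ioi (0 : ℝ), ((2 * v⁻¹ ^ 3 : ℝ) : ℂ) * f (lam * v⁻¹ ^ 2) =
      lam⁻¹ • ∫ t in Ioi (0 : ℝ), f t := by
    rw [← h2]
    refine setIntegral_congr_fun measurableSet_Ioi fun v hv => ?_
    have hv0 : (0 : ℝ) < v := hv
    have e1 : v ^ (-2 : ℝ) = v⁻¹ ^ 2 := by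
      rw [Real.rpow_neg hv0.le, inv_pow]; norm_cast
    have e2 : v ^ ((-2 : ℝ) - 1) = v⁻¹ ^ 3 := by
      rw [show (-2 : ℝ) - 1 = -3 by norm_num, Real.rpow_neg hv0.le, inv_pow]; norm_cast
    simp only [e1, e2]
    norm_num
  rw [h3, Complex.real_smul, ← mul_assoc]
  have : (lam : ℂ) ≠ 0 := by exact_mod_cast hl.ne'
  push_cast
  field_simp

/-- The point of the scaling x = vy: with t = λv⁻² and ξ_i = 3λa_ip_i² the phase becomes λ v f_p(y),
whose critical points in y do not move with v. -/
theorem oscInt_scaled {lam v : ℝ} (hv : 0 < v) (p : Fin m → ℝ) :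
    oscInt a w (lam * v⁻¹ ^ 2) (fun i => lam * (3 * a i * p i ^ 2)) =
      (v : ℂ) ^ m * ∫ y, w (v • y) * osc (lam * (v * critPoly a p y)) := by
  have h := Measure.integral_comp_smul_of_nonneg volume
    (fun x => w x * osc (phase a (lam * v⁻¹ ^ 2) (fun i => lam * (3 * a i * p i ^ 2)) x)) v
    (hR := hv.le)
  have h2 : ∀ y, phase a (lam * v⁻¹ ^ 2) (fun i => lam * (3 * a i * p i ^ 2)) (v • y) =
      lam * (v * critPoly a p y) := fun y => by
    simp only [phase, critPoly, Finset.mul_sum, ← Finset.sum_sub_distrib, Pi.smul_apply,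
      smul_eq_mul]
    refine Finset.sum_congr rfl fun i _ => ?_
    field_simp
  simp_rw [h2] at h
  rw [h, oscInt]
  have : (v : ℂ) ≠ 0 := by exact_mod_cast hv.ne'
  simp
  field_simp

end

section
variable {m : ℕ} {a : Fin m → ℝ} {w : (Fin m → ℝ) → ℂ}

/-- The contribution of the stationary range. -/
theorem exists_norm_integral_stationary_le (hm : 3 ≤ m) (ha : ∀ i, a i ≠ 0)
    (hw : ContDiff ℝ ∞ w) {c R : ℝ} (hc : 0 < c)
    (hwr : ∀ x, w x ≠ 0 → ∀ i, x i ∈ Icc c R) {ρ : ℝ → ℝ} (hρ : ContDiff ℝ ∞ ρ)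
    {v₀ v₁ : ℝ} (hv₀ : 0 < v₀) (hρs : ∀ v, ρ v ≠ 0 → v ∈ Icc v₀ v₁) {p₀ p₁ : ℝ} (hp₀ : 0 < p₀)
    (hp : p₀ ≤ p₁) (k : 𝓢(ℝ, ℂ)) (A : ℕ) :
    ∃ C, 0 ≤ C ∧ ∀ (r lam : ℝ) (p : Fin m → ℝ), 0 ≤ r → 0 < lam → (∀ i, p i ∈ Icc p₀ p₁) →
      (1 + lam * |critPoly a p p|) ^ A *
        ‖∫ t in Ioi (0 : ℝ), k (r * t) *
          (ρ (√(lam / t)) * oscInt a w t (fun i => lam * (3 * a i * p i ^ 2)))‖ ≤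
        C / (1 + r * lam) ^ A * lam ^ (1 - (m : ℝ) / 2) := by
  by_cases hv₁ : v₁ < v₀
  · have : ∀ v, ρ v = 0 := fun v => by
      by_contra h
      have := hρs v h
      linarith [this.1, this.2]
    refine ⟨0, le_rfl, fun r lam p _ _ _ => ?_⟩
    simp [this]
  push Not at hv₁
  have hv₁0 : 0 < v₁ := hv₀.trans_le hv₁
  -- A cutoff in the p_i, equal to 1 on [p₀, p₁], makes the amplitude compactly supported in p as
  -- well. This is what gives uniformity in p.
  let bp : ContDiffBump ((p₀ + p₁) / 2) :=
    ⟨(p₁ - p₀) / 2 + p₀ / 4, (p₁ - p₀) / 2 + p₀ / 2, by linarith, by linarith⟩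
  have hbp1 : ∀ x ∈ Icc p₀ p₁, bp x = 1 := fun x hx => by
    refine bp.one_of_mem_closedBall ?_
    rw [Metric.mem_closedBall, Real.dist_eq, abs_le]
    simp only [bp]
    constructor <;> linarith [hx.1, hx.2]
  have hbp0 : ∀ x, bp x ≠ 0 → x ∈ Icc (p₀ / 2) (p₁ + p₀) := fun x hx => by
    have : x ∈ Metric.ball ((p₀ + p₁) / 2) bp.rOut := by
      rw [← bp.support_eq]; exact hx
    rw [Metric.mem_ball, Real.dist_eq, abs_lt] at this
    simp only [bp] at this
    constructor <;> linarith [this.1, this.2]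
  -- The factor 2v^{m-3} combines 2v⁻³ from dt = −2λv⁻³ dv with v^m from x = vy.
  set G : ((Fin m → ℝ) × ℝ) × (Fin m → ℝ) → ℂ := fun x =>
    ((2 * x.1.2 ^ (m - 3) * ρ x.1.2 * ∏ i, bp (x.2 i) : ℝ) : ℂ) * w (x.1.2 • x.1.1) with hG
  have hGs : ContDiff ℝ ∞ G := by
    have h1 : ContDiff ℝ ∞ fun x : ((Fin m → ℝ) × ℝ) × (Fin m → ℝ) => ρ x.1.2 :=
      hρ.comp (by fun_prop)
    have h2 : ContDiff ℝ ∞ fun x : ((Fin m → ℝ) × ℝ) × (Fin m → ℝ) => ∏ i, bp (x.2 i) :=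
      contDiff_prod fun i _ => bp.contDiff.comp (by fun_prop)
    have h3 : ContDiff ℝ ∞ fun x : ((Fin m → ℝ) × ℝ) × (Fin m → ℝ) => w (x.1.2 • x.1.1) :=
      hw.comp (by fun_prop)
    refine ContDiff.mul (Complex.ofRealCLM.contDiff.comp ?_) h3
    exact (ContDiff.mul (by fun_prop) h1).mul h2
  have hG0 : ∀ x, G x ≠ 0 → x.1.2 ∈ Icc v₀ v₁ ∧ (∀ i, x.1.1 i ∈ Icc (c / v₁) (R / v₀)) ∧
      ∀ i, x.2 i ∈ Icc (p₀ / 2) (p₁ + p₀) := by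
    intro x hx
    have h1 : ρ x.1.2 ≠ 0 := fun h => hx (by simp [hG, h])
    have h2 : ∀ i, bp (x.2 i) ≠ 0 := fun i h => by
      have : ∏ i, bp (x.2 i) = 0 := Finset.prod_eq_zero (Finset.mem_univ i) h
      exact hx (by simp only [hG, this]; simp)
    have h3 : w (x.1.2 • x.1.1) ≠ 0 := fun h => hx (by simp [hG, h])
    have hv := hρs _ h1
    have hv0 : 0 < x.1.2 := hv₀.trans_le hv.1
    refine ⟨hv, fun i => ?_, fun i => hbp0 _ (h2 i)⟩
    have h4 := hwr _ h3 i
    simp only [Pi.smul_apply, smul_eq_mul] at h4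
    have h5 : 0 < x.1.1 i := by
      have : 0 < x.1.2 * x.1.1 i := hc.trans_le h4.1
      exact (mul_pos_iff_of_pos_left hv0).1 this
    constructor
    · rw [div_le_iff₀ hv₁0]
      nlinarith [h4.1, hv.2]
    · rw [le_div_iff₀ hv₀]
      nlinarith [h4.2, hv.1]
  have hGc : HasCompactSupport G := by
    refine HasCompactSupport.of_support_subset_isCompact
      (((isCompact_univ_pi fun _ : Fin m => isCompact_Icc (a := c / v₁) (b := R / v₀)).prod
        (isCompact_Icc (a := v₀) (b := v₁))).prod
        (isCompact_univ_pi fun _ : Fin m => isCompact_Icc (a := p₀ / 2) (b := p₁ + p₀))) fun x hx => ?_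
    obtain ⟨h1, h2, h3⟩ := hG0 x hx
    exact ⟨⟨fun i _ => h2 i, h1⟩, fun i _ => h3 i⟩
  set c' := min v₀ (min (c / v₁) (p₀ / 2)) with hc'
  have hc'0 : 0 < c' := by
    simp only [hc', lt_min_iff]; exact ⟨hv₀, by positivity, by positivity⟩
  have hGr : ∀ x, G x ≠ 0 → x ∈ posRegion m c' := fun x hx => by
    obtain ⟨h1, h2, h3⟩ := hG0 x hx
    refine ⟨(min_le_left _ _).trans h1.1, fun i => ⟨?_, ?_⟩⟩
    · exact ((min_le_right _ _).trans (min_le_left _ _)).trans (h2 i).1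
    · exact ((min_le_right _ _).trans (min_le_right _ _)).trans (h3 i).1
  obtain ⟨inv, hinv, hinv'⟩ := exists_contDiff_eq_inv (half_pos hc'0)
  obtain ⟨C0, hC0, hC0'⟩ := exists_norm_integral_statIntegrand_le ha hc'0 hinv hinv' A k hGs hGc hGr
  obtain ⟨C1, hC1, hC1'⟩ := exists_norm_integral_statIntegrand_mul_pow_le ha hc'0 hinv hinv' A A k G
    hGs hGc hGr
  refine ⟨2 ^ A * (C0 + C1), by positivity, fun r lam p hr hl hpp => ?_⟩
  have key : ∫ t in Ioi (0 : ℝ), k (r * t) *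
      (ρ (√(lam / t)) * oscInt a w t (fun i => lam * (3 * a i * p i ^ 2))) =
      lam * ∫ z, statIntegrand a inv k G (r * lam) lam p z := by
    rw [integral_Ioi_comp_inv_sq _ hl]
    congr 1
    have hI := integrable_statIntegrand (a := a) hinv.continuous k hGs.continuous hGc (r * lam) lam p
    rw [Measure.volume_eq_prod] at hI ⊢
    rw [integral_prod_symm _ hI]
    have e9 : ∫ v, ∫ y, statIntegrand a inv k G (r * lam) lam p (y, v) =
        ∫ v in Ioi (0 : ℝ), ∫ y, statIntegrand a inv k G (r * lam) lam p (y, v) := by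
      refine (setIntegral_eq_integral_of_forall_compl_eq_zero fun v hv => ?_).symm
      have : ρ v = 0 := by
        by_contra h
        exact hv (hv₀.trans_le (hρs v h).1)
      simp [statIntegrand, hG, this]
    rw [e9]
    · refine setIntegral_congr_fun measurableSet_Ioi fun v hv => ?_
      have hv0 : (0 : ℝ) < v := hv
      have e1 : √(lam / (lam * v⁻¹ ^ 2)) = v := by
        rw [show lam / (lam * v⁻¹ ^ 2) = v ^ 2 by field_simp]
        exact Real.sqrt_sq hv0.le
      simp only [e1, oscInt_scaled hv0 p, statIntegrand]
      rw [integral_const_mul]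
      by_cases hρv : ρ v = 0
      · simp [hG, hρv]
      have hvv := hρs v hρv
      have e2 : inv v = v⁻¹ := hinv' v (by
        rw [abs_of_pos hv0]
        have : c' ≤ v := (min_le_left _ _).trans hvv.1
        linarith)
      have e3 : ∏ i, bp (p i) = 1 := Finset.prod_eq_one fun i _ => hbp1 _ (hpp i)
      simp only [hG, e3, e2, mul_one, mul_assoc]
      rw [integral_const_mul]
      have e4 : (v : ℂ) ^ m = v ^ (m - 3) * v ^ 3 := by rw [← pow_add]; congr 1; omega
      have : (v : ℂ) ≠ 0 := by exact_mod_cast hv0.ne'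
      rw [e4]
      push_cast
      field_simp
  rw [key, norm_mul, Complex.norm_real, Real.norm_eq_abs, abs_of_pos hl]
  have hμ : 0 ≤ r * lam := by positivity
  have h0 := hC0' (r * lam) lam p hμ hl
  have h1 := hC1' (r * lam) lam p hμ hl
  set N := ‖∫ z, statIntegrand a inv k G (r * lam) lam p z‖
  set L := lam * |critPoly a p p|
  have hL : 0 ≤ L := by positivity
  have h2 : (1 + L) ^ A ≤ 2 ^ A * (1 + L ^ A) := by
    rcases le_total L 1 with h | h
    · calc (1 + L) ^ A ≤ 2 ^ A := pow_le_pow_left₀ (by positivity) (by linarith) _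
        _ ≤ _ := le_mul_of_one_le_right (by positivity) (by linarith [pow_nonneg hL A])
    · calc (1 + L) ^ A ≤ (2 * L) ^ A := pow_le_pow_left₀ (by positivity) (by linarith) _
        _ = 2 ^ A * L ^ A := mul_pow _ _ _
        _ ≤ _ := by gcongr; linarith
  have e5 : lam ^ (1 - (m : ℝ) / 2) = lam * lam ^ (-(m : ℝ) / 2) := by
    rw [show 1 - (m : ℝ) / 2 = 1 + -(m : ℝ) / 2 by ring, Real.rpow_add hl, Real.rpow_one]
  calc (1 + L) ^ A * (lam * N) ≤ 2 ^ A * (1 + L ^ A) * (lam * N) := by gcongr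
    _ = 2 ^ A * lam * (N + L ^ A * N) := by ring
    _ ≤ 2 ^ A * lam * (C0 / (1 + r * lam) ^ A * lam ^ (-(m : ℝ) / 2) +
        C1 / (1 + r * lam) ^ A * lam ^ (-(m : ℝ) / 2)) := by gcongr
    _ = _ := by rw [e5]; ring

end

section
variable {m : ℕ} {a : Fin m → ℝ} {w : (Fin m → ℝ) → ℂ}

/-- The trivial bound for t ≤ 1 and t^{-m/2} for t > 1 give a majorant uniform in ξ; it is
integrable because m ≥ 3. -/
theorem exists_integrable_bound_oscInt (hm : 3 ≤ m) (ha : ∀ i, a i ≠ 0) (hw : ContDiff ℝ ∞ w)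
    (hwc : HasCompactSupport w) {c R : ℝ} (hc : 0 < c) (hcR : c ≤ R)
    (hwr : ∀ x, w x ≠ 0 → ∀ i, x i ∈ Icc c R) :
    ∃ g : ℝ → ℝ, IntegrableOn g (Ioi 0) ∧ ∀ t ξ, 0 < t → ‖oscInt a w t ξ‖ ≤ g t := by
  obtain ⟨C, hC, hC'⟩ := exists_norm_oscInt_le_rpow ha hw hwc hc hcR hwr
  refine ⟨fun t => (Ioc 0 1).indicator (fun _ => ∫ x, ‖w x‖) t +
    (Ioi 1).indicator (fun t => C * t ^ (-(m : ℝ) / 2)) t, ?_, fun t ξ ht => ?_⟩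
  · refine Integrable.integrableOn ?_
    refine Integrable.add ?_ ?_
    · exact (integrable_indicator_iff measurableSet_Ioc).2 (integrableOn_const (by simp))
    · refine (integrable_indicator_iff measurableSet_Ioi).2 (Integrable.const_mul ?_ C)
      refine integrableOn_Ioi_rpow_of_lt ?_ one_pos
      have : (3 : ℝ) ≤ m := by exact_mod_cast hm
      linarith
  · have h0 : 0 ≤ ∫ x, ‖w x‖ := integral_nonneg fun _ => norm_nonneg _
    beta_reduce
    rcases le_or_gt t 1 with h | h
    · rw [indicator_of_mem (show t ∈ Ioc (0 : ℝ) 1 from ⟨ht, h⟩),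
        indicator_of_notMem (show t ∉ Ioi (1 : ℝ) from not_lt.2 h), add_zero]
      exact norm_oscInt_le t ξ
    · rw [indicator_of_notMem (show t ∉ Ioc (0 : ℝ) 1 from fun h' => not_le.2 h h'.2),
        indicator_of_mem (show t ∈ Ioi (1 : ℝ) from h), zero_add]
      simpa [abs_of_pos ht] using hC' t ξ ht.ne'

set_option maxHeartbeats 1000000 in
/-- The bound for one orthant and one sign of the dual variable. -/
theorem exists_norm_integral_oscInt_le [Nonempty (Fin m)] (hm : 3 ≤ m) (ha : ∀ i, a i ≠ 0)
    (hw : ContDiff ℝ ∞ w) (hwc : HasCompactSupport w) {c R : ℝ} (hc : 0 < c) (hcR : c ≤ R)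
    (hwr : ∀ x, w x ≠ 0 → ∀ i, x i ∈ Icc c R) {Q : (Fin m → ℝ) → ℝ} {CQ : ℝ} (hCQ : 0 ≤ CQ)
    (hQ1 : ∀ ζ, ‖ζ‖ ≤ 1 → |Q ζ| ≤ CQ)
    (hQ2 : ∀ p : Fin m → ℝ, (∀ i, 0 < p i) → ‖fun i => 3 * a i * p i ^ 2‖ = 1 →
      |Q fun i => 3 * a i * p i ^ 2| ≤ CQ * |critPoly a p p|)
    (k : 𝓢(ℝ, ℂ)) (A : ℕ) {R₀ : ℝ} (hR₀ : 0 ≤ R₀) :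
    ∃ C, 0 ≤ C ∧ ∀ (r : ℝ) (ξ : Fin m → ℝ), 0 ≤ r → r ≤ R₀ →
      ‖∫ t in Ioi (0 : ℝ), k (r * t) * oscInt a w t ξ‖ ≤
        C * (max 1 ‖ξ‖) ^ (1 - (m : ℝ) / 2) /
          ((1 + r * ‖ξ‖) ^ A * (1 + ‖ξ‖ * |Q (‖ξ‖⁻¹ • ξ)|) ^ A) := by
  obtain ⟨g, hg, hg'⟩ := exists_integrable_bound_oscInt hm ha hw hwc hc hcR hwr
  obtain ⟨Ck, hCk, hCk'⟩ := exists_norm_le_div_one_add_pow k 0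
  simp only [pow_zero, div_one] at hCk'
  have hg0 : 0 ≤ ∫ t in Ioi (0 : ℝ), Ck * g t := setIntegral_nonneg measurableSet_Ioi fun t ht =>
    mul_nonneg hCk ((norm_nonneg _).trans (hg' t 0 ht))
  have hnorm : ∀ ξ : Fin m → ℝ, ‖‖ξ‖⁻¹ • ξ‖ ≤ 1 := fun ξ => by
    rw [norm_smul, norm_inv, norm_norm]
    exact inv_mul_le_one
  obtain ⟨τ₀, τ₁, κ₀, c₁, hτ₀, hτ, hκ₀, hc₁, hns⟩ := exists_nonstationary ha hc hcR
  have hτ₁ : 0 < τ₁ := hτ₀.trans hτ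
  -- cutoff
  set v₀ := √(1 / τ₁) with hv₀
  set v₁ := √(1 / τ₀) with hv₁
  have hv₀0 : 0 < v₀ := Real.sqrt_pos.2 (by positivity)
  have hv01 : v₀ < v₁ := Real.sqrt_lt_sqrt (by positivity) (one_div_lt_one_div_of_lt hτ₀ hτ)
  let bp : ContDiffBump ((v₀ + v₁) / 2) :=
    ⟨(v₁ - v₀) / 2, (v₁ - v₀) / 2 + v₀ / 2, by linarith, by linarith⟩
  have hbp1 : ∀ x ∈ Icc v₀ v₁, bp x = 1 := fun x hx => by
    refine bp.one_of_mem_closedBall ?_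
    rw [Metric.mem_closedBall, Real.dist_eq, abs_le]
    simp only [bp]
    constructor <;> linarith [hx.1, hx.2]
  have hbp0 : ∀ x, bp x ≠ 0 → x ∈ Icc (v₀ / 2) (v₁ + v₀) := fun x hx => by
    have : x ∈ Metric.ball ((v₀ + v₁) / 2) bp.rOut := by
      rw [← bp.support_eq]; exact hx
    rw [Metric.mem_ball, Real.dist_eq, abs_lt] at this
    simp only [bp] at this
    constructor <;> linarith [this.1, this.2]
  -- In the variable v = √(λ/t) the possibly stationary range τ₀λ < t < τ₁λ is v₀ < v < v₁, where
  -- the cutoff is 1.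
  have hbpz : ∀ t lam : ℝ, 0 < t → 0 < lam → bp (√(lam / t)) ≠ 1 → t ≤ τ₀ * lam ∨ τ₁ * lam ≤ t := by
    intro t lam ht hl h
    by_contra h'
    push Not at h'
    refine h (hbp1 _ ⟨Real.sqrt_le_sqrt ?_, Real.sqrt_le_sqrt ?_⟩)
    · rw [div_le_div_iff₀ hτ₁ ht]; linarith
    · rw [div_le_div_iff₀ ht hτ₀]; linarith
  obtain ⟨bM, hbM⟩ : ∃ M : ℝ, ∀ x, |1 - bp x| ≤ M := ⟨1, fun x => by
    rw [abs_le]; constructor <;> linarith [bp.nonneg (x := x), bp.le_one (x := x)]⟩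
  set d := ‖a‖ with hd
  have had : ∀ i, |a i| ≤ d := fun i => norm_le_pi_norm a i
  obtain ⟨i₀⟩ := ‹Nonempty (Fin m)›
  have hd0 : 0 < d := (abs_pos.2 (ha i₀)).trans_le (had i₀)
  set p₀ := √(κ₀ / (3 * d ^ 2)) with hp₀
  have hp₀0 : 0 < p₀ := Real.sqrt_pos.2 (by positivity)
  obtain ⟨j, hj⟩ := Finite.exists_min fun i => |a i|
  set b := |a j| with hb
  have hb0 : 0 < b := abs_pos.2 (ha j)
  set p₁ := max p₀ √(1 / (3 * b)) with hp₁
  obtain ⟨Cs, hCs, hCs'⟩ := exists_norm_integral_stationary_le hm ha hw hc hwr bp.contDiff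
    (half_pos hv₀0) hbp0 hp₀0 (le_max_left _ _ : p₀ ≤ p₁) k A
  -- Of the integrations by parts, 2A absorb the factors (1 + rλ)^A and (1 + λ|Q|)^A, m give λ^{-m}
  -- ≤ λ^{1-m/2} for λ ≥ 1, and 2 make the t-integral converge.
  obtain ⟨Cn, hCn, hCn'⟩ := exists_norm_integral_le_of_nonstationary a hc₁ hw hwc (2 * A + m + 2)
  have hIq : IntegrableOn (fun t : ℝ => (1 + t ^ 2)⁻¹) (Ioi 0) := integrable_inv_one_add_sq.integrableOn
  set I₀ := ∫ t in Ioi (0 : ℝ), (1 + t ^ 2)⁻¹ with hI₀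
  have hI₀0 : 0 ≤ I₀ := setIntegral_nonneg measurableSet_Ioi fun t _ => by positivity
  -- the nonstationary range
  have hts : ∀ x ∈ tsupport w, ∀ i, x i ∈ Icc c R := by
    have : tsupport w ⊆ Set.pi univ fun _ : Fin m => Icc c R :=
      closure_minimal (fun x hx i _ => hwr x hx i) (isClosed_set_pi fun i _ => isClosed_Icc)
    exact fun x hx i => this hx i (mem_univ _)
  have hW : ∀ (t : ℝ) (ξ : Fin m → ℝ), 0 < t → 1 ≤ ‖ξ‖ →
      (t ≤ τ₀ * ‖ξ‖ ∨ τ₁ * ‖ξ‖ ≤ t ∨ ∃ i, a i * ξ i < κ₀ * ‖ξ‖) →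
      ‖oscInt a w t ξ‖ ≤ Cn / ‖ξ‖ ^ (2 * A + m) * (1 + t ^ 2)⁻¹ := by
    intro t ξ ht hξ hor
    have hξ0 : 0 < ‖ξ‖ := one_pos.trans_le hξ
    obtain ⟨i, hi⟩ := hns t ξ ht hξ0 hor
    have h1 := hCn' t (‖ξ‖ + t) ξ i (by positivity) (by rw [abs_of_pos ht]; linarith)
      ((norm_le_pi_norm ξ i).trans (by linarith)) fun x hx => hi x (hts x hx)
    refine h1.trans ?_
    rw [← div_eq_mul_inv, div_div]
    gcongr
    rw [pow_add (‖ξ‖ + t)]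
    gcongr
    · linarith
    · nlinarith
  have hbad : ∀ (r : ℝ) (ξ : Fin m → ℝ) (χ : ℝ → ℝ), 1 ≤ ‖ξ‖ → (∀ t, |χ t| ≤ 1 + |bM|) →
      (∀ t, 0 < t → χ t ≠ 0 → (t ≤ τ₀ * ‖ξ‖ ∨ τ₁ * ‖ξ‖ ≤ t ∨ ∃ i, a i * ξ i < κ₀ * ‖ξ‖)) →
      ‖∫ t in Ioi (0 : ℝ), k (r * t) * (χ t * oscInt a w t ξ)‖ ≤
        Ck * (1 + |bM|) * Cn * I₀ / ‖ξ‖ ^ (2 * A + m) := by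
    intro r ξ χ hξ hχ hχ'
    have e : Ck * (1 + |bM|) * Cn * I₀ / ‖ξ‖ ^ (2 * A + m) =
        ∫ t in Ioi (0 : ℝ), Ck * (1 + |bM|) * (Cn / ‖ξ‖ ^ (2 * A + m)) * (1 + t ^ 2)⁻¹ := by
      rw [integral_const_mul, ← hI₀]; ring
    rw [e]
    refine norm_integral_le_of_norm_le (hIq.const_mul _)
      ((ae_restrict_iff' measurableSet_Ioi).2 (ae_of_all _ fun t ht => ?_))
    have ht0 : (0 : ℝ) < t := ht
    by_cases h : χ t = 0
    · simp only [h, Complex.ofReal_zero, zero_mul, mul_zero, norm_zero]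
      have : 0 < ‖ξ‖ := one_pos.trans_le hξ
      positivity
    · rw [norm_mul, norm_mul, Complex.norm_real, Real.norm_eq_abs]
      calc _ ≤ Ck * ((1 + |bM|) * (Cn / ‖ξ‖ ^ (2 * A + m) * (1 + t ^ 2)⁻¹)) := by
            gcongr
            · exact hCk' _
            · exact hχ t
            · exact hW t ξ ht0 hξ (hχ' t ht0 h)
        _ = _ := by ring
  set Cb := Ck * (1 + |bM|) * Cn * I₀ with hCb
  have hCb0 : 0 ≤ Cb := by positivity
  refine ⟨(∫ t in Ioi (0 : ℝ), Ck * g t) * ((1 + R₀) ^ A * (1 + CQ) ^ A) +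
    (1 + CQ) ^ A * Cs + Cb * ((1 + R₀) ^ A * (1 + CQ) ^ A), by positivity, fun r ξ hr hrR => ?_⟩
  set lam := ‖ξ‖ with hlam
  have hl0 : 0 ≤ lam := norm_nonneg _
  set q := |Q (lam⁻¹ • ξ)| with hq
  have hq0 : 0 ≤ q := abs_nonneg _
  have hqC : q ≤ CQ := hQ1 _ (hnorm ξ)
  rw [le_div_iff₀ (by positivity)]
  rcases le_or_gt lam 1 with hl | hl
  · rw [max_eq_left hl, Real.one_rpow, mul_one]
    have h1 : ‖∫ t in Ioi (0 : ℝ), k (r * t) * oscInt a w t ξ‖ ≤ ∫ t in Ioi (0 : ℝ), Ck * g t := by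
      refine norm_integral_le_of_norm_le (hg.const_mul _)
        ((ae_restrict_iff' measurableSet_Ioi).2 (ae_of_all _ fun t ht => ?_))
      rw [norm_mul]
      exact mul_le_mul (hCk' _) (hg' t ξ ht) (norm_nonneg _) hCk
    calc _ ≤ (∫ t in Ioi (0 : ℝ), Ck * g t) * ((1 + R₀ * 1) ^ A * (1 + 1 * CQ) ^ A) := by gcongr
      _ ≤ _ := by
        rw [mul_one, one_mul]
        have : 0 ≤ (1 + CQ) ^ A * Cs + Cb * ((1 + R₀) ^ A * (1 + CQ) ^ A) := by positivity
        linarith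
  · have hl0 : 0 < lam := one_pos.trans hl
    rw [max_eq_right hl.le]
    have hX : (1 + r * lam) ^ A * (1 + lam * q) ^ A ≤
        ((1 + R₀) ^ A * (1 + CQ) ^ A) * lam ^ (2 * A) := by
      have e : ((1 + R₀) ^ A * (1 + CQ) ^ A) * lam ^ (2 * A) =
        ((1 + R₀) * lam) ^ A * ((1 + CQ) * lam) ^ A := by rw [mul_pow, mul_pow]; ring
      rw [e]
      gcongr
      · nlinarith
      · nlinarith
    have hY : Cb / lam ^ (2 * A + m) * ((1 + r * lam) ^ A * (1 + lam * q) ^ A) ≤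
        Cb * ((1 + R₀) ^ A * (1 + CQ) ^ A) * lam ^ (1 - (m : ℝ) / 2) := by
      calc _ ≤ Cb / lam ^ (2 * A + m) * (((1 + R₀) ^ A * (1 + CQ) ^ A) * lam ^ (2 * A)) := by gcongr
        _ = Cb * ((1 + R₀) ^ A * (1 + CQ) ^ A) * (lam ^ m)⁻¹ := by rw [pow_add]; field_simp
        _ ≤ _ := by
          gcongr
          rw [← Real.rpow_natCast, ← Real.rpow_neg hl0.le]
          refine Real.rpow_le_rpow_of_exponent_le hl.le ?_
          have : (0 : ℝ) ≤ m := Nat.cast_nonneg m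
          linarith
    have hP1 : 0 ≤ (∫ t in Ioi (0 : ℝ), Ck * g t) * ((1 + R₀) ^ A * (1 + CQ) ^ A) *
      lam ^ (1 - (m : ℝ) / 2) := by positivity
    have hP2 : 0 ≤ (1 + CQ) ^ A * Cs * lam ^ (1 - (m : ℝ) / 2) := by positivity
    -- Outside the cone a_iξ_i ≥ κ₀λ there is no stationary point for any t > 0, and the
    -- nonstationary bound covers the whole t-integral. Inside the cone the integral is split by the
    -- cutoff.
    by_cases hgood : ∃ i, a i * ξ i < κ₀ * lam
    · have h1 := hbad r ξ (fun _ => 1) hl.le (fun t => by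
        rw [abs_one]; linarith [abs_nonneg bM]) (fun t _ _ => Or.inr (Or.inr hgood))
      simp only [Complex.ofReal_one, one_mul] at h1
      calc _ ≤ Cb / lam ^ (2 * A + m) * ((1 + r * lam) ^ A * (1 + lam * q) ^ A) := by gcongr
        _ ≤ _ := hY
        _ ≤ _ := by rw [add_mul, add_mul]; linarith
    · push Not at hgood
      have hpos : ∀ i, κ₀ / (3 * d ^ 2) ≤ ξ i / lam / (3 * a i) := fun i => by
        have h1 := hgood i
        have h2 : ξ i / lam / (3 * a i) = a i * ξ i / (lam * (3 * |a i| ^ 2)) := by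
          rw [sq_abs]
          have := ha i
          field_simp
        rw [h2, div_le_div_iff₀ (by positivity)
          (mul_pos hl0 (mul_pos three_pos (pow_pos (abs_pos.2 (ha i)) 2)))]
        calc κ₀ * (lam * (3 * |a i| ^ 2)) = κ₀ * lam * (3 * |a i| ^ 2) := by ring
          _ ≤ (a i * ξ i) * (3 * d ^ 2) := by
            have : |a i| ^ 2 ≤ d ^ 2 := by gcongr; exact had i
            have h3 : 0 ≤ κ₀ * lam := by positivity
            gcongr
            exact h3.trans h1
      have hpos' : ∀ i, 0 < ξ i / lam / (3 * a i) := fun i => lt_of_lt_of_le (by positivity) (hpos i)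
      -- Inside the cone ξ/λ = (3a_ip_i²)_i is solvable with the p_i in a fixed compact subinterval
      -- of the positive half-line.
      set p : Fin m → ℝ := fun i => √(ξ i / lam / (3 * a i)) with hp
      have hp2 : ∀ i, ξ i = lam * (3 * a i * p i ^ 2) := fun i => by
        simp only [hp]
        rw [Real.sq_sqrt (hpos' i).le]
        have := ha i
        field_simp
      have hp2' : (fun i => 3 * a i * p i ^ 2) = lam⁻¹ • ξ := by
        funext i
        rw [Pi.smul_apply, smul_eq_mul, hp2 i]
        field_simp
      have hξe : ξ = fun i => lam * (3 * a i * p i ^ 2) := funext hp2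
      have hpm : ∀ i, p i ∈ Icc p₀ p₁ := fun i => by
        refine ⟨Real.sqrt_le_sqrt (hpos i), le_trans (Real.sqrt_le_sqrt ?_) (le_max_right _ _)⟩
        refine (le_abs_self _).trans ?_
        rw [abs_div, abs_div, abs_mul, abs_of_pos hl0, abs_of_pos (three_pos (α := ℝ))]
        refine div_le_div₀ zero_le_one ?_ (by positivity) ?_
        · exact div_le_one_of_le₀ (norm_le_pi_norm ξ i) hl0.le
        · have := hj i
          linarith
      have hunit : ‖fun i => 3 * a i * p i ^ 2‖ = 1 := by
        rw [hp2', norm_smul, norm_inv, norm_norm, ← hlam, inv_mul_cancel₀ hl0.ne']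
      have hqf : q ≤ CQ * |critPoly a p p| := by
        have := hQ2 p (fun i => hp₀0.trans_le (hpm i).1) hunit
        rw [hp2'] at this
        exact this
      have hs := hCs' r lam p hr hl0 hpm
      rw [← hξe] at hs
      have hWc := continuous_oscInt (a := a) hw.continuous hwc ξ
      have hkc := k.continuous
      have hmeas : ∀ χ : ℝ → ℝ, Measurable χ → (∀ t, |χ t| ≤ 1 + |bM|) →
          IntegrableOn (fun t => k (r * t) * (χ t * oscInt a w t ξ)) (Ioi 0) := by
        intro χ hχm hχ
        refine Integrable.mono' ((hg.const_mul (Ck * (1 + |bM|)))) ?_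
          ((ae_restrict_iff' measurableSet_Ioi).2 (ae_of_all _ fun t ht => ?_))
        · have h1 : Continuous fun t => k (r * t) := by fun_prop
          exact (h1.measurable.mul ((Complex.measurable_ofReal.comp hχm).mul
            hWc.measurable)).aestronglyMeasurable
        · rw [norm_mul, norm_mul, Complex.norm_real, Real.norm_eq_abs]
          calc _ ≤ Ck * ((1 + |bM|) * g t) := by
                gcongr
                · exact hCk' _
                · exact hχ t
                · exact hg' t ξ ht
            _ = _ := by ring
      have hsm : Measurable fun t : ℝ => bp (√(lam / t)) :=
        bp.continuous.measurable.comp (by fun_prop)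
      have hb1 : ∀ t, |1 - bp (√(lam / t))| ≤ 1 + |bM| := fun t =>
        (hbM _).trans ((le_abs_self _).trans (by linarith))
      have i1 := hmeas _ hsm fun t => by
        rw [abs_of_nonneg bp.nonneg]
        linarith [bp.le_one (x := √(lam / t)), abs_nonneg bM]
      have i2 := hmeas (fun t => 1 - bp (√(lam / t))) (measurable_const.sub hsm) hb1
      have hsplit : ∫ t in Ioi (0 : ℝ), k (r * t) * oscInt a w t ξ =
          (∫ t in Ioi (0 : ℝ), k (r * t) * (bp (√(lam / t)) * oscInt a w t ξ)) +
          ∫ t in Ioi (0 : ℝ), k (r * t) * ((1 - bp (√(lam / t)) : ℝ) * oscInt a w t ξ) := by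
        rw [← integral_add i1 i2]
        refine integral_congr_ae (ae_of_all _ fun t => ?_)
        simp only
        push_cast
        ring
      have h2 := hbad r ξ (fun t => 1 - bp (√(lam / t))) hl.le hb1 (fun t ht h => by
        have : bp (√(lam / t)) ≠ 1 := fun h' => h (by rw [h', sub_self])
        rcases hbpz t lam ht hl0 this with h | h
        · exact Or.inl h
        · exact Or.inr (Or.inl h))
      rw [hsplit]
      set N1 := ‖∫ t in Ioi (0 : ℝ), k (r * t) * (bp (√(lam / t)) * oscInt a w t ξ)‖
      have h3 : N1 * ((1 + r * lam) ^ A * (1 + lam * q) ^ A) ≤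
          (1 + CQ) ^ A * Cs * lam ^ (1 - (m : ℝ) / 2) := by
        have h4 : (1 + lam * q) ≤ (1 + CQ) * (1 + lam * |critPoly a p p|) := by
          have : lam * q ≤ lam * (CQ * |critPoly a p p|) := by gcongr
          nlinarith [mul_nonneg hl0.le (abs_nonneg (critPoly a p p))]
        rw [div_mul_eq_mul_div, le_div_iff₀ (by positivity)] at hs
        calc _ ≤ N1 * ((1 + r * lam) ^ A * ((1 + CQ) * (1 + lam * |critPoly a p p|)) ^ A) := by gcongr
          _ = (1 + CQ) ^ A * ((1 + lam * |critPoly a p p|) ^ A * N1 * (1 + r * lam) ^ A) := by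
            rw [mul_pow]; ring
          _ ≤ (1 + CQ) ^ A * (Cs * lam ^ (1 - (m : ℝ) / 2)) := by gcongr
          _ = _ := by ring
      calc _ ≤ (N1 + Cb / lam ^ (2 * A + m)) * ((1 + r * lam) ^ A * (1 + lam * q) ^ A) := by
            gcongr
            exact (norm_add_le _ _).trans (add_le_add le_rfl h2)
        _ ≤ _ := by rw [add_mul, add_mul, add_mul]; linarith

end

/-! ### Riemann sums and the weight of the delta method -/

/-- Smooth functions supported in `[1/2, 2]`. -/
structure IsBlock (φ : ℝ → ℝ) : Prop where
  smooth : ContDiff ℝ ∞ φ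
  supp : ∀ x, φ x ≠ 0 → x ∈ Icc (1 / 2 : ℝ) 2

theorem IsBlock.hasCompactSupport {φ : ℝ → ℝ} (h : IsBlock φ) : HasCompactSupport φ :=
  HasCompactSupport.of_support_subset_isCompact isCompact_Icc fun x hx => h.supp x hx

/-- The Riemann sum `z⁻¹ ∑_{j ≥ 1} φ(j/z)`. -/
noncomputable def riemannSum (φ : ℝ → ℝ) (z : ℝ) : ℝ := ∑' j : ℕ, z⁻¹ * φ ((j + 1 : ℕ) / z)

theorem IsBlock.term_eq_zero {φ : ℝ → ℝ} (h : IsBlock φ) {Z z : ℝ} {N : ℕ} (hz : 0 < z) (hzZ : z ≤ Z)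
    (hN : 2 * Z ≤ N) {j : ℕ} (hj : N ≤ j) : φ ((j + 1 : ℕ) / z) = 0 := by
  by_contra h'
  have h1 := (h.supp _ h').2
  rw [div_le_iff₀ hz] at h1
  have : (N : ℝ) ≤ j := by exact_mod_cast hj
  push_cast at h1
  linarith

theorem IsBlock.riemannSum_eq {φ : ℝ → ℝ} (h : IsBlock φ) {Z z : ℝ} {N : ℕ} (hz : 0 < z)
    (hzZ : z ≤ Z) (hN : 2 * Z ≤ N) :
    riemannSum φ z = ∑ j ∈ Finset.range N, z⁻¹ * φ ((j + 1 : ℕ) / z) := by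
  refine tsum_eq_sum fun j hj => ?_
  rw [h.term_eq_zero hz hzZ hN (by simpa using hj), mul_zero]

/-- The operator `φ ↦ -(uφ)'`, conjugate to `z d/dz` under `riemannSum`. -/
noncomputable def blockOp (φ : ℝ → ℝ) : ℝ → ℝ := fun u => -(φ u + u * deriv φ u)

theorem IsBlock.blockOp {φ : ℝ → ℝ} (h : IsBlock φ) : IsBlock (blockOp φ) := by
  have h1 : ContDiff ℝ ∞ (deriv φ) := by
    have := h.smooth.iterate_deriv 1
    simpa using this
  refine ⟨(h.smooth.add (contDiff_id.mul h1)).neg, fun x hx => ?_⟩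
  have h2 : tsupport φ ⊆ Icc (1 / 2 : ℝ) 2 := closure_minimal (fun x hx => h.supp x hx) isClosed_Icc
  by_contra h3
  have h4 : φ x = 0 := by
    by_contra h'; exact h3 (h.supp x h')
  have h5 : deriv φ x = 0 := by
    by_contra h'; exact h3 (h2 (support_deriv_subset h'))
  simp [HybridBound.blockOp, h4, h5] at hx

/-- −(uφ)' is a total derivative. Hence for `blockOp φ` the Riemann sum and its error coincide, and
z d/dz maps the error for φ to the error for `blockOp φ`. -/
theorem IsBlock.integral_blockOp {φ : ℝ → ℝ} (h : IsBlock φ) : ∫ x, HybridBound.blockOp φ x = 0 := by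
  have hd : ∀ x, HasDerivAt (fun u => u * φ u) (φ x + x * deriv φ x) x := fun x => by
    refine ((hasDerivAt_id x).mul (h.smooth.differentiable (by simp) x).hasDerivAt).congr_deriv ?_
    simp
  have hc : Continuous fun x => φ x + x * deriv φ x :=
    h.smooth.continuous.add (continuous_id.mul (h.smooth.continuous_deriv (by simp)))
  simp only [HybridBound.blockOp]
  rw [integral_neg, neg_eq_zero]
  refine integral_eq_zero_of_hasDerivAt_of_integrable hd ?_ ?_
  · refine hc.integrable_of_hasCompactSupport ?_
    have := h.blockOp.hasCompactSupport.neg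
    convert! this using 1
    funext x
    simp [HybridBound.blockOp]
  · exact (continuous_id.mul h.smooth.continuous).integrable_of_hasCompactSupport
      h.hasCompactSupport.mul_left

theorem IsBlock.hasDerivAt_riemannSum {φ : ℝ → ℝ} (h : IsBlock φ) {z : ℝ} (hz : 0 < z) :
    HasDerivAt (riemannSum φ) (z⁻¹ * riemannSum (HybridBound.blockOp φ) z) z := by
  have hN : 2 * (z + 1) ≤ (⌈2 * (z + 1)⌉₊ : ℝ) := Nat.le_ceil _
  have h1 : riemannSum φ =ᶠ[nhds z]
      fun z' => ∑ j ∈ Finset.range ⌈2 * (z + 1)⌉₊, z'⁻¹ * φ ((j + 1 : ℕ) / z') := by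
    filter_upwards [eventually_gt_nhds hz, eventually_lt_nhds (lt_add_one z)] with y hy1 hy2
    exact h.riemannSum_eq hy1 hy2.le hN
  refine HasDerivAt.congr_of_eventuallyEq ?_ h1
  rw [h.blockOp.riemannSum_eq hz (by linarith : z ≤ z + 1) hN, Finset.mul_sum]
  refine HasDerivAt.fun_sum fun j _ => ?_
  have e1 : HasDerivAt (fun z' : ℝ => ((j + 1 : ℕ) : ℝ) / z') (-((j + 1 : ℕ) : ℝ) / z ^ 2) z := by
    refine ((hasDerivAt_inv hz.ne').const_mul ((j + 1 : ℕ) : ℝ)).congr_deriv ?_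
    field_simp
  have e2 := (h.smooth.differentiable (by simp) (((j + 1 : ℕ) : ℝ) / z)).hasDerivAt.comp z e1
  refine ((hasDerivAt_inv hz.ne').mul e2).congr_deriv ?_
  simp only [HybridBound.blockOp, Function.comp]
  field_simp
  ring

/-- The error of the Riemann sum. -/
noncomputable def riemannErr (φ : ℝ → ℝ) (z : ℝ) : ℝ := riemannSum φ z - ∫ x, φ x

theorem IsBlock.hasDerivAt_riemannErr {φ : ℝ → ℝ} (h : IsBlock φ) {z : ℝ} (hz : 0 < z) :
    HasDerivAt (riemannErr φ) (z⁻¹ * riemannErr (HybridBound.blockOp φ) z) z := by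
  rw [riemannErr, h.integral_blockOp, sub_zero]
  exact (h.hasDerivAt_riemannSum hz).sub_const _

theorem IsBlock.contDiffOn_riemannErr (n : ℕ) : ∀ {φ : ℝ → ℝ}, IsBlock φ →
    ContDiffOn ℝ n (riemannErr φ) (Ioi 0) := by
  induction n with
  | zero =>
    intro φ h
    exact contDiffOn_zero.2 fun z hz => (h.hasDerivAt_riemannErr hz).continuousAt.continuousWithinAt
  | succ n ih =>
    intro φ h
    rw [Nat.cast_succ, contDiffOn_succ_iff_deriv_of_isOpen isOpen_Ioi]
    refine ⟨fun z hz => (h.hasDerivAt_riemannErr hz).differentiableAt.differentiableWithinAt,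
      by simp, ?_⟩
    have h1 : ContDiffOn ℝ n (fun z => z⁻¹ * riemannErr (HybridBound.blockOp φ) z) (Ioi 0) :=
      ContDiffOn.mul (contDiffOn_id.inv fun z hz => (ne_of_gt hz)) (ih h.blockOp)
    exact h1.congr fun z hz => (h.hasDerivAt_riemannErr hz).deriv

/-- Poisson summation: the error is rapidly decreasing. -/
theorem IsBlock.exists_abs_riemannErr_le {φ : ℝ → ℝ} (h : IsBlock φ) (A : ℕ) :
    ∃ C, 0 ≤ C ∧ ∀ z, 1 ≤ z → |riemannErr φ z| ≤ C / z ^ A := by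
  have hs : ContDiff ℝ ∞ fun x => (φ x : ℂ) := Complex.ofRealCLM.contDiff.comp h.smooth
  have hc : HasCompactSupport fun x => (φ x : ℂ) := h.hasCompactSupport.comp_left (g := ((↑) : ℝ → ℂ)) (by simp)
  let Φ : 𝓢(ℝ, ℂ) := hc.toSchwartzMap hs
  have hΦ : ∀ x, Φ x = φ x := fun x => rfl
  set Ψ : 𝓢(ℝ, ℂ) := 𝓕 Φ with hΨ
  have hΨv : ∀ t, Ψ t = ∫ x, osc (-(x * t)) * φ x := fun t => by
    rw [hΨ, SchwartzMap.fourier_coe, Real.fourier_eq']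
    refine integral_congr_ae (ae_of_all _ fun x => ?_)
    simp only [smul_eq_mul, hΦ, osc]
    congr 2
    simp
    ring
  obtain ⟨C, hC, hC'⟩ := exists_norm_le_div_one_add_pow Ψ (A + 2)
  have hsum : Summable fun n : ℤ => C * (1 / (n : ℝ) ^ 2) :=
    (Real.summable_one_div_int_pow.2 one_lt_two).mul_left C
  refine ⟨∑' n : ℤ, C * (1 / (n : ℝ) ^ 2), tsum_nonneg fun n => by positivity, fun z hz => ?_⟩
  have hz0 : 0 < z := one_pos.trans_le hz
  have hs2 : ContDiff ℝ ∞ fun x => (φ (x / z) : ℂ) := hs.comp (by fun_prop)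
  have hc2 : HasCompactSupport fun x => (φ (x / z) : ℂ) := by
    refine HasCompactSupport.of_support_subset_isCompact (isCompact_Icc (a := z / 2) (b := 2 * z))
      fun x hx => ?_
    have h1 := h.supp (x / z) (by simpa using hx)
    rw [mem_Icc, le_div_iff₀ hz0, div_le_iff₀ hz0] at h1
    constructor <;> linarith [h1.1, h1.2]
  let S : 𝓢(ℝ, ℂ) := hc2.toSchwartzMap hs2
  have hSv : ∀ x, S x = φ (x / z) := fun x => rfl
  have hFS : ∀ t, (𝓕 S : 𝓢(ℝ, ℂ)) t = z * Ψ (z * t) := fun t => by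
    rw [hΨv, SchwartzMap.fourier_coe, Real.fourier_eq']
    have := Measure.integral_comp_div (fun x => osc (-(x * (z * t))) * (φ x : ℂ)) z
    rw [abs_of_pos hz0, Complex.real_smul] at this
    rw [← this]
    refine integral_congr_ae (ae_of_all _ fun x => ?_)
    simp only [smul_eq_mul, hSv, osc]
    congr 2
    have : (z : ℂ) ≠ 0 := by exact_mod_cast hz0.ne'
    simp
    field_simp
  -- Poisson summation for φ(x/z). The frequency 0 is the integral of φ; the frequencies n ≠ 0
  -- contribute O(z^{-A}n⁻²), which is why A + 2 powers of decay were requested.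
  have hP := SchwartzMap.tsum_eq_tsum_fourier S 0
  have hL : ∑' n : ℤ, S (0 + n) = z * riemannSum φ z := by
    have inj : Function.Injective fun j : ℕ => ((j : ℤ) + 1) := fun i j hij => by
      simpa using hij
    rw [← inj.tsum_eq, riemannSum, Complex.ofReal_tsum, ← tsum_mul_left]
    · refine tsum_congr fun j => ?_
      rw [hSv]
      have : (z : ℂ) ≠ 0 := by exact_mod_cast hz0.ne'
      push_cast
      rw [zero_add]
      field_simp
    · intro n hn
      rw [Function.mem_support, hSv] at hn
      have h1 := (h.supp _ (by simpa using hn)).1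
      rw [le_div_iff₀ hz0] at h1
      have h2 : (0 : ℝ) < n := by linarith
      have h3 : 0 < n := by exact_mod_cast h2
      exact ⟨(n - 1).toNat, by simp; omega⟩
  have hR : ∀ n : ℤ, (𝓕 S : 𝓢(ℝ, ℂ)) n * fourier n ((0 : ℝ) : UnitAddCircle) = z * Ψ (z * n) := fun n => by
    rw [hFS]; simp
  have hbd : ∀ n : ℤ, n ≠ 0 → ‖Ψ (z * n)‖ ≤ C * (1 / (n : ℝ) ^ 2) / z ^ A := by
    intro n hn
    refine (hC' _).trans ?_
    have h1 : (1 : ℝ) ≤ |(n : ℝ)| := by exact_mod_cast Int.one_le_abs hn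
    rw [mul_one_div, div_div]
    have h2 : 0 < (n : ℝ) ^ 2 := by rw [← sq_abs]; positivity
    gcongr
    rw [← sq_abs, mul_comm, pow_add, abs_mul, abs_of_pos hz0]
    gcongr
    · nlinarith
    · nlinarith
  have hsΨ : Summable fun n : ℤ => Ψ (z * n) := by
    refine Summable.of_norm ?_
    have h2 : Summable fun n : ℤ => C * (1 / (n : ℝ) ^ 2) / z ^ A := hsum.div_const _
    refine Summable.of_norm_bounded_eventually h2 ?_
    filter_upwards [(Set.finite_singleton (0 : ℤ)).eventually_cofinite_notMem] with n hn
    rw [norm_norm]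
    exact hbd n (by simpa using hn)
  have hmain : (riemannSum φ z : ℂ) = Ψ 0 + ∑' n : ℤ, if n = 0 then 0 else Ψ (z * n) := by
    have h1 : (z : ℂ) ≠ 0 := by exact_mod_cast hz0.ne'
    refine mul_left_cancel₀ h1 ?_
    rw [← hL, hP]
    simp_rw [hR]
    rw [tsum_mul_left, hsΨ.tsum_eq_add_tsum_ite 0]
    simp
  have hint : Ψ 0 = ((∫ x, φ x : ℝ) : ℂ) := by
    rw [hΨv, ← integral_complex_ofReal]; simp
  have : ((riemannErr φ z : ℝ) : ℂ) = ∑' n : ℤ, if n = 0 then 0 else Ψ (z * n) := by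
    rw [riemannErr, Complex.ofReal_sub, hmain, hint]; ring
  rw [← Real.norm_eq_abs, ← Complex.norm_real, this, ← tsum_div_const]
  refine tsum_of_norm_bounded (hsum.div_const _).hasSum fun n => ?_
  split_ifs with hn
  · rw [norm_zero]; positivity
  · exact hbd n hn

theorem IsBlock.contDiffAt_riemannErr {φ : ℝ → ℝ} (h : IsBlock φ) {z : ℝ} (hz : 0 < z) :
    ContDiffAt ℝ ∞ (riemannErr φ) z := by
  refine contDiffAt_infty.2 fun n => ?_
  exact (IsBlock.contDiffOn_riemannErr n h).contDiffAt (Ioi_mem_nhds hz)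

/-- The functions z^{-l}E_φ(z), with φ a block function and l varying, span a space stable under
d/dz, so rapid decay passes to all derivatives. -/
theorem IsBlock.exists_abs_iteratedDeriv_riemannErr_le (n : ℕ) : ∀ {φ : ℝ → ℝ}, IsBlock φ →
    ∀ l A : ℕ, ∃ C, 0 ≤ C ∧ ∀ z, 1 ≤ z →
      |iteratedDeriv n (fun z => z⁻¹ ^ l * riemannErr φ z) z| ≤ C / z ^ A := by
  induction n with
  | zero =>
    intro φ h l A
    obtain ⟨C, hC, hC'⟩ := h.exists_abs_riemannErr_le A
    refine ⟨C, hC, fun z hz => ?_⟩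
    rw [iteratedDeriv_zero, abs_mul]
    have h1 : |z⁻¹ ^ l| ≤ 1 := by
      rw [abs_pow]
      refine pow_le_one₀ (abs_nonneg _) ?_
      rw [abs_inv, abs_of_pos (by linarith)]
      exact inv_le_one_of_one_le₀ hz
    calc _ ≤ 1 * (C / z ^ A) := by
          gcongr
          exact hC' z hz
      _ = _ := one_mul _
  | succ n ih =>
    intro φ h l A
    obtain ⟨C1, hC1, hC1'⟩ := ih h (l + 1) A
    obtain ⟨C2, hC2, hC2'⟩ := ih h.blockOp (l + 1) A
    refine ⟨l * C1 + C2, by positivity, fun z hz => ?_⟩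
    have hz0 : 0 < z := one_pos.trans_le hz
    have hd : deriv (fun z => z⁻¹ ^ l * riemannErr φ z) =ᶠ[nhds z]
        (fun z => (-(l : ℝ)) * (z⁻¹ ^ (l + 1) * riemannErr φ z)) +
          fun z => z⁻¹ ^ (l + 1) * riemannErr (HybridBound.blockOp φ) z := by
      filter_upwards [eventually_gt_nhds hz0] with y hy
      have h1 : HasDerivAt (fun z : ℝ => z⁻¹ ^ l) (-(l : ℝ) * y⁻¹ ^ (l + 1)) y := by
        refine ((hasDerivAt_inv hy.ne').pow l).congr_deriv ?_
        rcases l with _ | l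
        · simp
        · simp only [Nat.add_sub_cancel, pow_succ]
          ring
      have h2 : HasDerivAt (fun z => z⁻¹ ^ l * riemannErr φ z) _ y :=
        h1.mul (h.hasDerivAt_riemannErr hy)
      rw [h2.deriv]
      simp only [Pi.add_apply, pow_succ]
      ring
    have hi : ContDiffAt ℝ ∞ (fun z : ℝ => z⁻¹ ^ (l + 1)) z := (contDiffAt_inv ℝ hz0.ne').pow _
    have s1 : ContDiffAt ℝ n (fun z => z⁻¹ ^ (l + 1) * riemannErr φ z) z :=
      (hi.mul (h.contDiffAt_riemannErr hz0)).of_le (by exact_mod_cast le_top)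
    have s2 : ContDiffAt ℝ n (fun z => z⁻¹ ^ (l + 1) * riemannErr (HybridBound.blockOp φ) z) z :=
      (hi.mul (h.blockOp.contDiffAt_riemannErr hz0)).of_le (by exact_mod_cast le_top)
    rw [iteratedDeriv_succ', hd.iteratedDeriv_eq, iteratedDeriv_add (contDiffAt_const.mul s1) s2,
      iteratedDeriv_const_mul_field]
    have e1 := hC1' z hz
    have e2 := hC2' z hz
    calc _ ≤ |-(l : ℝ) * iteratedDeriv n (fun z => z⁻¹ ^ (l + 1) * riemannErr φ z) z| + _ :=
          abs_add_le _ _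
      _ ≤ l * (C1 / z ^ A) + C2 / z ^ A := by
        rw [abs_mul, abs_neg, Nat.abs_cast]
        gcongr
      _ = _ := by ring

/-- For z < 1/2 every sample point (j+1)/z lies beyond the support of φ. The error is thus constant
near 0, which makes its even extension smooth at the origin. -/
theorem IsBlock.riemannErr_of_lt {φ : ℝ → ℝ} (h : IsBlock φ) {z : ℝ} (hz : 0 ≤ z)
    (hz' : z < 1 / 2) : riemannErr φ z = -∫ x, φ x := by
  have : riemannSum φ z = 0 := by
    rcases hz.eq_or_lt with rfl | hz0
    · simp [riemannSum]
    · rw [riemannSum, ← tsum_zero]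
      refine tsum_congr fun j => ?_
      have : φ ((j + 1 : ℕ) / z) = 0 := by
        by_contra h'
        have h1 := (h.supp _ h').2
        rw [div_le_iff₀ hz0] at h1
        push_cast at h1
        have : (0 : ℝ) ≤ j := Nat.cast_nonneg j
        linarith
      rw [this, mul_zero]
  rw [riemannErr, this, zero_sub]

/-- The even extension of the error of the Riemann sum is a Schwartz function. -/
theorem IsBlock.exists_schwartz {φ : ℝ → ℝ} (h : IsBlock φ) :
    ∃ b : 𝓢(ℝ, ℂ), ∀ z, b z = (riemannErr φ |z| : ℂ) := by
  have hsm : ContDiff ℝ ∞ fun z => riemannErr φ |z| := by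
    refine contDiff_iff_contDiffAt.2 fun z => ?_
    by_cases hz : z = 0
    · have : (fun z => riemannErr φ |z|) =ᶠ[nhds z] fun _ => -∫ x, φ x := by
        subst hz
        filter_upwards [Metric.ball_mem_nhds (0 : ℝ) (by norm_num : (0 : ℝ) < 1 / 2)] with y hy
        rw [Metric.mem_ball, Real.dist_eq, sub_zero] at hy
        exact h.riemannErr_of_lt (abs_nonneg _) hy
      exact contDiffAt_const.congr_of_eventuallyEq this
    · exact (h.contDiffAt_riemannErr (abs_pos.2 hz)).comp z (contDiffAt_abs hz)
  have heven : ∀ n z, iteratedDeriv n (fun z => riemannErr φ |z|) (-z) =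
      (-1 : ℝ) ^ n * iteratedDeriv n (fun z => riemannErr φ |z|) z := fun n z => by
    have := iteratedDeriv_comp_neg n (fun z => riemannErr φ |z|) (-z)
    simp only [abs_neg, neg_neg, smul_eq_mul] at this
    exact this
  have hdec : ∀ k n : ℕ, ∃ C, ∀ z, ‖z‖ ^ k * ‖iteratedFDeriv ℝ n (fun z => riemannErr φ |z|) z‖ ≤ C := by
    intro k n
    obtain ⟨C, hC, hC'⟩ := IsBlock.exists_abs_iteratedDeriv_riemannErr_le n h 0 k
    have hcont : Continuous (iteratedDeriv n fun z => riemannErr φ |z|) :=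
      hsm.continuous_iteratedDeriv n (by exact_mod_cast le_top)
    obtain ⟨M, hM⟩ := (isCompact_Icc (a := (-1 : ℝ)) (b := 1)).exists_bound_of_continuousOn
      hcont.continuousOn
    have hbig : ∀ z, 1 ≤ z → |z| ^ k * |iteratedDeriv n (fun z => riemannErr φ |z|) z| ≤ C := by
      intro z hz
      have hz0 : 0 < z := one_pos.trans_le hz
      have : (fun z => riemannErr φ |z|) =ᶠ[nhds z] fun z => z⁻¹ ^ 0 * riemannErr φ z := by
        filter_upwards [eventually_gt_nhds hz0] with y hy
        rw [abs_of_pos hy, pow_zero, one_mul]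
      rw [this.iteratedDeriv_eq, abs_of_pos hz0]
      have := hC' z hz
      rwa [le_div_iff₀ (by positivity), mul_comm] at this
    refine ⟨max M C, fun z => ?_⟩
    rw [norm_iteratedFDeriv_eq_norm_iteratedDeriv]
    rcases le_total |z| 1 with hz | hz
    · refine le_trans ?_ (le_max_left _ _)
      have h1 := hM z (abs_le.1 hz)
      calc _ ≤ 1 * ‖iteratedDeriv n (fun z => riemannErr φ |z|) z‖ := by
            gcongr
            exact pow_le_one₀ (norm_nonneg _) hz
        _ ≤ M := by rw [one_mul]; exact h1
    · refine le_trans ?_ (le_max_right _ _)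
      rcases le_abs.1 hz with h1 | h1
      · exact hbig z h1
      · have := hbig (-z) h1
        rw [heven, abs_neg, abs_mul, abs_pow, abs_neg, abs_one, one_pow, one_mul] at this
        exact this
  let b : 𝓢(ℝ, ℝ) := ⟨fun z => riemannErr φ |z|, hsm, hdec⟩
  exact ⟨b.postcompCLM Complex.ofRealCLM, fun z => rfl⟩

theorem bump_eq (x : ℝ) : bump x = expNegInvGlue (1 - x ^ 2) := by
  rw [bump, expNegInvGlue]
  have : |x| < 1 ↔ ¬ 1 - x ^ 2 ≤ 0 := by
    rw [not_le, sub_pos, sq_lt_one_iff_abs_lt_one]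
  by_cases h : |x| < 1
  · rw [if_pos h, if_neg (this.1 h)]
  · rw [if_neg h, if_pos (not_not.1 (fun h' => h (this.2 h')))]

theorem contDiff_omega : ContDiff ℝ ∞ omega := by
  unfold omega
  simp_rw [bump_eq]
  exact contDiff_const.mul (expNegInvGlue.contDiff.comp (by fun_prop))

theorem omega_ne_zero {x : ℝ} (h : omega x ≠ 0) : 1 / 2 < x ∧ x < 1 := by
  have : |4 * x - 3| < 1 := by
    by_contra h'
    exact h (by simp [omega, bump, h'])
  rw [abs_lt] at this
  constructor <;> linarith [this.1, this.2]

theorem contDiff_inv_mul {f : ℝ → ℝ} (hf : ∀ x, x ≠ 0 → ContDiffAt ℝ ∞ f x)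
    (h0 : ∀ x, x < 1 / 2 → f x = 0) : ContDiff ℝ ∞ f := by
  refine contDiff_iff_contDiffAt.2 fun x => ?_
  by_cases hx : x = 0
  · have : f =ᶠ[nhds x] fun _ => 0 := by
      filter_upwards [eventually_lt_nhds (show x < 1 / 2 by rw [hx]; norm_num)] with y hy
      exact h0 y hy
    exact contDiffAt_const.congr_of_eventuallyEq this
  · exact hf x hx

theorem isBlock_omega_mul_inv : IsBlock fun v => omega v * v⁻¹ := by
  refine ⟨contDiff_inv_mul (fun x hx => contDiff_omega.contDiffAt.mul (contDiffAt_inv ℝ hx))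
    fun x hx => ?_, fun x hx => ?_⟩
  · have : omega x = 0 := by
      by_contra h; linarith [(omega_ne_zero h).1]
    rw [this, zero_mul]
  · have := omega_ne_zero (left_ne_zero_of_mul hx)
    constructor <;> linarith [this.1, this.2]

theorem isBlock_omega_inv_mul_inv : IsBlock fun v => omega v⁻¹ * v⁻¹ := by
  have key : ∀ x : ℝ, omega x⁻¹ ≠ 0 → 1 < x ∧ x < 2 := fun x hx => by
    have h := omega_ne_zero hx
    have hx0 : 0 < x := inv_pos.1 (by linarith [h.1])
    constructor
    · exact (inv_lt_one₀ hx0).1 h.2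
    · have := h.1
      rw [one_div, inv_lt_inv₀ two_pos hx0] at this
      exact this
  refine ⟨contDiff_inv_mul (fun x hx => (contDiff_omega.contDiffAt.comp x
    (contDiffAt_inv ℝ hx)).mul (contDiffAt_inv ℝ hx)) fun x hx => ?_, fun x hx => ?_⟩
  · have : omega x⁻¹ = 0 := by
      by_contra h; linarith [(key x h).1]
    rw [this, zero_mul]
  · have := key x (left_ne_zero_of_mul hx)
    constructor <;> linarith [this.1, this.2]

/-- Invariance of dv/v under v ↦ 1/v. This makes the main terms of the two Riemann sums in h cancel.
-/
theorem integral_omega_inv_mul_inv :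
    ∫ v : ℝ, omega v⁻¹ * v⁻¹ = ∫ v : ℝ, omega v * v⁻¹ := by
  have e1 : ∫ v : ℝ, omega v * v⁻¹ = ∫ v in Ioi (0 : ℝ), omega v * v⁻¹ := by
    refine (setIntegral_eq_integral_of_forall_compl_eq_zero fun x hx => ?_).symm
    by_contra h
    exact hx (lt_of_lt_of_le (by norm_num) (isBlock_omega_mul_inv.supp x h).1)
  have e2 : ∫ v : ℝ, omega v⁻¹ * v⁻¹ = ∫ v in Ioi (0 : ℝ), omega v⁻¹ * v⁻¹ := by
    refine (setIntegral_eq_integral_of_forall_compl_eq_zero fun x hx => ?_).symm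
    by_contra h
    exact hx (lt_of_lt_of_le (by norm_num) (isBlock_omega_inv_mul_inv.supp x h).1)
  rw [e1, e2, ← integral_comp_rpow_Ioi (fun v => omega v * v⁻¹) (p := -1) (by norm_num)]
  refine setIntegral_congr_fun measurableSet_Ioi fun v hv => ?_
  have hv0 : (0 : ℝ) < v := hv
  have e3 : v ^ ((-1 : ℝ) - 1) = v⁻¹ ^ 2 := by
    rw [show (-1 : ℝ) - 1 = -2 by norm_num, Real.rpow_neg hv0.le, inv_pow]; norm_cast
  simp only [e3, Real.rpow_neg_one, inv_inv]
  simp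
  field_simp

/-- The weight `h` in terms of errors of Riemann sums. -/
theorem hFun_eq {r : ℝ} (hr : 0 < r) (y : ℝ) :
    hFun r y = r⁻¹ * (riemannErr (fun v => omega v * v⁻¹) r⁻¹ -
      riemannErr (fun v => omega v⁻¹ * v⁻¹) (|y| / r)) := by
  set φ := fun v : ℝ => omega v⁻¹ * v⁻¹ with hφ
  set ψ := fun v : ℝ => omega v * v⁻¹ with hψ
  have hφb : IsBlock φ := isBlock_omega_inv_mul_inv
  have hψb : IsBlock ψ := isBlock_omega_mul_inv
  have hκ : ∫ v, φ v = ∫ v, ψ v := integral_omega_inv_mul_inv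
  have hsum : ∀ {f : ℝ → ℝ}, IsBlock f → ∀ z, 0 ≤ z →
      Summable fun j : ℕ => z⁻¹ * f ((j + 1 : ℕ) / z) := fun {f} hf z hz => by
    rcases hz.eq_or_lt with rfl | hz0
    · simp [summable_zero]
    · refine summable_of_ne_finset_zero (s := Finset.range ⌈2 * z⌉₊) fun j hj => ?_
      rw [hf.term_eq_zero hz0 le_rfl (Nat.le_ceil _) (by simpa using hj), mul_zero]
  have hyr : 0 ≤ |y| / r := by positivity
  rw [riemannErr, riemannErr, hκ, sub_sub_sub_cancel_right, riemannSum, riemannSum,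
    ← (hsum hψb _ (inv_pos.2 hr).le).tsum_sub (hsum hφb _ hyr), ← tsum_mul_left, hFun,
    tsum_pnat_eq_tsum_succ (f := fun j : ℕ => (r * (j : ℝ))⁻¹ *
      (omega (r * (j : ℝ)) - omega (|y| / (r * (j : ℝ)))))]
  refine tsum_congr fun j => ?_
  have hj : (0 : ℝ) < ((j + 1 : ℕ) : ℝ) := by positivity
  set J := ((j + 1 : ℕ) : ℝ)
  simp only [hφ, hψ, inv_inv, div_inv_eq_mul]
  rcases (abs_nonneg y).eq_or_lt with h0 | h0
  · rw [← h0]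
    have : omega 0 = 0 := by
      by_contra h; linarith [(omega_ne_zero h).1]
    simp [this]
    field_simp
  · have e1 : (J / (|y| / r))⁻¹ = |y| / (r * J) := by field_simp
    rw [e1, mul_comm J r]
    field_simp

/-! ### The critical value as a factor of the dual form -/

section Dual

variable {m : ℕ} {F : Fin m → ℤ} {P : MvPolynomial (Fin m) ℤ}

theorem IsDualForm.aeval_eq (hP : IsDualForm F P) : ∃ q : ℚ, q ≠ 0 ∧ ∀ t : Fin m → ℂ,
    MvPolynomial.aeval (fun i => (F i : ℂ) * t i ^ 2) P =
      q * ∏ ε : Fin m → ℤˣ with (∀ i : Fin m, (i : ℕ) = 0 → ε i = 1),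
        ∑ i, ((ε i : ℤ) : ℂ) * F i * t i ^ 3 := by
  obtain ⟨q, hq, h⟩ := hP
  refine ⟨q, hq, fun t => ?_⟩
  have := congrArg ((MvPolynomial.aeval t : MvPolynomial (Fin m) ℚ →ₐ[ℚ] ℂ).restrictScalars ℤ) h
  rw [MvPolynomial.comp_aeval_apply] at this
  simpa [map_prod] using this

theorem ofReal_dualReal (P : MvPolynomial (Fin m) ℤ) (c : Fin m → ℝ) :
    ((dualReal P c : ℝ) : ℂ) = MvPolynomial.aeval (fun i => (c i : ℂ)) P := by
  rw [dualReal]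
  exact (MvPolynomial.aeval_algebraMap_apply ℂ c P).symm

@[fun_prop] theorem continuous_dualReal (P : MvPolynomial (Fin m) ℤ) : Continuous (dualReal P) := by
  unfold dualReal
  simp_rw [MvPolynomial.aeval_def, MvPolynomial.eval₂_eq']
  fun_prop

theorem exists_abs_dualReal_le (P : MvPolynomial (Fin m) ℤ) :
    ∃ C, 0 ≤ C ∧ ∀ c, ‖c‖ ≤ 1 → |dualReal P c| ≤ C := by
  obtain ⟨C, hC⟩ := (isCompact_closedBall (0 : Fin m → ℝ) 1).exists_bound_of_continuousOn
    (continuous_dualReal P).continuousOn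
  refine ⟨|C|, abs_nonneg _, fun c hc => (hC c (by simpa using hc)).trans (le_abs_self _)⟩

/-- The form divides the value of the dual form at a stationary point. -/
theorem IsDualForm.exists_abs_dualReal_le_critPoly (hP : IsDualForm F P) (hF : ∀ i, F i ≠ 0) :
    ∃ C, 0 ≤ C ∧ ∀ (s : ℤˣ) (σ : Fin m → ℤˣ) (p : Fin m → ℝ), (∀ i, 0 < p i) →
      (∀ i, |3 * ((s * σ i * F i : ℤ) : ℝ) * p i ^ 2| ≤ 1) →
      |dualReal P fun i => (σ i : ℤ) * (3 * ((s * σ i * F i : ℤ) : ℝ) * p i ^ 2)| ≤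
        C * |critPoly (fun i => ((s * σ i * F i : ℤ) : ℝ)) p p| := by
  obtain ⟨q, hq, h⟩ := hP.aeval_eq
  set M : ℝ := 1 + ∑ i, |(F i : ℝ)| * 27 with hM
  have hM1 : 1 ≤ M := by
    have : 0 ≤ ∑ i, |(F i : ℝ)| * 27 := Finset.sum_nonneg fun i _ => by positivity
    linarith
  refine ⟨|(q : ℝ)| * (27 * M ^ (Fintype.card (Fin m → ℤˣ))), by positivity, fun s σ p hp hb => ?_⟩
  -- the square root of `3s`
  obtain ⟨u, hu2, hu⟩ : ∃ u : ℂ, u ^ 2 = 3 * ((s : ℤ) : ℂ) ∧ ‖u‖ ^ 2 = 3 := by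
    obtain ⟨u, hu⟩ := IsAlgClosed.exists_pow_nat_eq (3 * ((s : ℤ) : ℂ)) (n := 2) two_pos
    refine ⟨u, hu, ?_⟩
    rw [← norm_pow, hu]
    rcases Int.units_eq_one_or s with rfl | rfl <;> simp
  have hu3 : ‖u ^ 3‖ ≤ 27 := by
    have : ‖u‖ ≤ 3 := by nlinarith [norm_nonneg u]
    rw [norm_pow]
    calc ‖u‖ ^ 3 ≤ 3 ^ 3 := by gcongr
      _ = 27 := by norm_num
  have hpow : ∀ τ : ℤˣ, ((τ : ℤ) : ℂ) * ((τ : ℤ) : ℂ) = 1 := fun τ => by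
    rcases Int.units_eq_one_or τ with rfl | rfl <;> simp
  have hnorm : ∀ τ : ℤˣ, ‖((τ : ℤ) : ℂ)‖ = 1 := fun τ => by
    rcases Int.units_eq_one_or τ with rfl | rfl <;> simp
  have habs : ∀ τ : ℤˣ, |((τ : ℤ) : ℝ)| = 1 := fun τ => by
    rcases Int.units_eq_one_or τ with rfl | rfl <;> simp
  have hp1 : ∀ i, p i ≤ 1 := fun i => by
    have h1 := hb i
    have h2 : (1 : ℝ) ≤ |(F i : ℝ)| := by
      rw [← Int.cast_abs]; exact_mod_cast Int.one_le_abs (hF i)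
    push_cast at h1
    rw [abs_mul, abs_mul, abs_mul, abs_mul, habs, habs, abs_of_nonneg (sq_nonneg (p i)), abs_of_pos three_pos] at h1
    by_contra h3
    push Not at h3
    nlinarith [mul_le_mul h2 (show 1 ≤ p i ^ 2 by nlinarith) zero_le_one (by positivity)]
  -- Since σ_i² = 1 and u² = 3s, the argument is F_i(up_i)², so the defining product can be
  -- evaluated at t_i = up_i, at the price of complex u when s = −1.
  have hval : ((dualReal P fun i => (σ i : ℤ) * (3 * ((s * σ i * F i : ℤ) : ℝ) * p i ^ 2) : ℝ) : ℂ) =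
      q * ∏ ε : Fin m → ℤˣ with (∀ i : Fin m, (i : ℕ) = 0 → ε i = 1),
        (u ^ 3 * ∑ i, ((ε i : ℤ) : ℂ) * F i * (p i : ℂ) ^ 3) := by
    rw [ofReal_dualReal]
    have e1 : (fun i => (((σ i : ℤ) * (3 * ((s * σ i * F i : ℤ) : ℝ) * p i ^ 2) : ℝ) : ℂ)) =
        fun i => (F i : ℂ) * (u * p i) ^ 2 := by
      funext i
      push_cast
      rw [mul_pow, hu2]
      linear_combination (3 * (s : ℤ) * (F i : ℂ) * (p i : ℂ) ^ 2) * hpow (σ i)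
    rw [e1, h]
    congr 1
    refine Finset.prod_congr rfl fun ε _ => ?_
    rw [Finset.mul_sum]
    exact Finset.sum_congr rfl fun i _ => by ring
  have hfac : ∀ ε : Fin m → ℤˣ, ‖u ^ 3 * ∑ i, ((ε i : ℤ) : ℂ) * F i * (p i : ℂ) ^ 3‖ ≤ M := by
    intro ε
    rw [norm_mul]
    have : ‖∑ i, ((ε i : ℤ) : ℂ) * F i * (p i : ℂ) ^ 3‖ ≤ ∑ i, |(F i : ℝ)| := by
      refine norm_sum_le_of_le _ fun i _ => ?_
      rw [norm_mul, norm_mul, hnorm, one_mul, norm_pow, Complex.norm_real, Complex.norm_intCast,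
        Real.norm_of_nonneg (hp i).le]
      exact mul_le_of_le_one_right (abs_nonneg _) (pow_le_one₀ (hp i).le (hp1 i))
    calc _ ≤ 27 * ∑ i, |(F i : ℝ)| := by gcongr
      _ ≤ M := by rw [hM, ← Finset.sum_mul]; linarith
  -- the normalized sign vector
  obtain ⟨s0, hs0⟩ : ∃ s0 : ℤˣ, ∀ i : Fin m, (i : ℕ) = 0 → s0 * σ i = 1 := by
    rcases m with _ | m
    · exact ⟨1, fun i => i.elim0⟩
    · refine ⟨σ 0, fun i hi => ?_⟩
      have : i = 0 := Fin.ext hi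
      rw [this, Int.units_mul_self]
  have hmem : (fun i => s0 * σ i) ∈ Finset.univ.filter
      (fun ε : Fin m → ℤˣ => ∀ i : Fin m, (i : ℕ) = 0 → ε i = 1) := by
    simpa using hs0
  rw [← Real.norm_eq_abs, ← Complex.norm_real, hval, norm_mul, ← Finset.mul_prod_erase _ _ hmem, norm_mul, norm_prod]
  -- f_p(p) = −2s Σ σ_iF_ip_i³, so the factor at the sign vector σ, normalized to have first entry
  -- 1, is the critical value up to a bounded constant. All other factors are at most M because p_i
  -- ≤ 1.
  have hcrit : ‖u ^ 3 * ∑ i, (((s0 * σ i : ℤˣ) : ℤ) : ℂ) * F i * (p i : ℂ) ^ 3‖ ≤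
      27 * |critPoly (fun i => ((s * σ i * F i : ℤ) : ℝ)) p p| := by
    rw [norm_mul]
    have e2 : critPoly (fun i => ((s * σ i * F i : ℤ) : ℝ)) p p =
        -2 * (s : ℤ) * ∑ i, ((σ i : ℤ) : ℝ) * F i * p i ^ 3 := by
      rw [critPoly, Finset.mul_sum]
      refine Finset.sum_congr rfl fun i _ => ?_
      push_cast; ring
    have e3 : ∑ i, (((s0 * σ i : ℤˣ) : ℤ) : ℂ) * F i * (p i : ℂ) ^ 3 =
        (s0 : ℤ) * ((∑ i, ((σ i : ℤ) : ℝ) * F i * p i ^ 3 : ℝ) : ℂ) := by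
      push_cast
      rw [Finset.mul_sum]
      exact Finset.sum_congr rfl fun i _ => by ring
    rw [e2, e3, norm_mul, hnorm, Complex.norm_real, abs_mul, abs_mul, habs, Real.norm_eq_abs]
    norm_num
    have := abs_nonneg (∑ i, ((σ i : ℤ) : ℝ) * F i * p i ^ 3)
    rw [norm_pow] at hu3
    nlinarith
  have hrest : ∏ ε ∈ (Finset.univ.filter
      (fun ε : Fin m → ℤˣ => ∀ i : Fin m, (i : ℕ) = 0 → ε i = 1)).erase (fun i => s0 * σ i),
      ‖u ^ 3 * ∑ i, ((ε i : ℤ) : ℂ) * F i * (p i : ℂ) ^ 3‖ ≤ M ^ (Fintype.card (Fin m → ℤˣ)) := by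
    refine (Finset.prod_le_prod (fun _ _ => norm_nonneg _) fun ε _ => hfac ε).trans ?_
    rw [Finset.prod_const]
    exact pow_le_pow_right₀ hM1 (Finset.card_le_univ _)
  have hqn : ‖(q : ℂ)‖ = |(q : ℝ)| := by
    rw [← Complex.ofReal_ratCast, Complex.norm_real, Real.norm_eq_abs]
  rw [hqn]
  calc _ ≤ |(q : ℝ)| * (27 * |critPoly (fun i => ((s * σ i * F i : ℤ) : ℝ)) p p| *
        M ^ (Fintype.card (Fin m → ℤˣ))) := by gcongr
    _ = _ := by ring

end Dual

/-! ### Reduction to the positive orthant -/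

section
variable {m : ℕ}

/-- The reflection of the coordinates by signs. -/
def reflect (σ : Fin m → ℤˣ) (x : Fin m → ℝ) : Fin m → ℝ := fun i => ((σ i : ℤ) : ℝ) * x i

theorem abs_units (τ : ℤˣ) : |((τ : ℤ) : ℝ)| = 1 := by
  rcases Int.units_eq_one_or τ with rfl | rfl <;> simp

theorem units_mul_self (τ : ℤˣ) : ((τ : ℤ) : ℝ) * ((τ : ℤ) : ℝ) = 1 := by
  rcases Int.units_eq_one_or τ with rfl | rfl <;> simp

theorem reflect_reflect (σ : Fin m → ℤˣ) (x : Fin m → ℝ) : reflect σ (reflect σ x) = x := by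
  funext i
  rw [reflect, reflect, ← mul_assoc, units_mul_self, one_mul]

theorem contDiff_reflect (σ : Fin m → ℤˣ) : ContDiff ℝ ∞ (reflect σ) := by
  unfold reflect; fun_prop

theorem norm_reflect (σ : Fin m → ℤˣ) (x : Fin m → ℝ) : ‖reflect σ x‖ = ‖x‖ := by
  simp only [Pi.norm_def, reflect]
  congr 2
  funext i
  apply NNReal.coe_injective
  rw [coe_nnnorm, coe_nnnorm, norm_mul, Real.norm_eq_abs, abs_units, one_mul]

theorem reflect_smul (σ : Fin m → ℤˣ) (t : ℝ) (x : Fin m → ℝ) :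
    reflect σ (t • x) = t • reflect σ x := by
  funext i
  simp only [reflect, Pi.smul_apply, smul_eq_mul]; ring

theorem integral_reflect {E : Type*} [NormedAddCommGroup E] [NormedSpace ℝ E] (σ : Fin m → ℤˣ)
    (f : (Fin m → ℝ) → E) : ∫ x, f (reflect σ x) = ∫ x, f x := by
  have h1 : ∀ i, MeasurePreserving (fun t : ℝ => ((σ i : ℤ) : ℝ) * t) := fun i => by
    rcases Int.units_eq_one_or (σ i) with h | h
    · have : (fun t : ℝ => ((σ i : ℤ) : ℝ) * t) = id := by funext t; simp [h]
      rw [this]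
      exact MeasurePreserving.id _
    · simpa [h] using Measure.measurePreserving_neg (volume : Measure ℝ)
  have h2 : MeasurePreserving (reflect σ) volume volume :=
    volume_preserving_pi h1
  exact h2.integral_comp ((contDiff_reflect σ).continuous.measurableEmbedding
    (Function.LeftInverse.injective (reflect_reflect σ))) f

/-- The part of `w` in an orthant, reflected to the positive orthant. -/
noncomputable def orthant (c : ℝ) (w : (Fin m → ℝ) → ℂ) (σ : Fin m → ℤˣ) (x : Fin m → ℝ) : ℂ :=
  w (reflect σ x) * ((∏ i, Real.smoothTransition (x i / c) : ℝ) : ℂ)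

/-- On the support |x_i| ≥ c, so of the two transition functions at ±x_i/c one equals 1 and the
other 0. Expanding the product over i of their sums gives a partition of unity indexed by the sign
vectors. -/
theorem sum_orthant {c : ℝ} (hc : 0 < c) {w : (Fin m → ℝ) → ℂ} (h : ∀ x, w x ≠ 0 → ∀ i, c ≤ |x i|)
    (x : Fin m → ℝ) : w x = ∑ σ, orthant c w σ (reflect σ x) := by
  simp only [orthant, reflect_reflect]
  rw [← Finset.mul_sum, ← Complex.ofReal_sum]
  by_cases hx : w x = 0
  · rw [hx, zero_mul]
  have : ∑ σ : Fin m → ℤˣ, ∏ i, Real.smoothTransition (reflect σ x i / c) = 1 := by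
    have := Finset.prod_univ_sum (fun _ : Fin m => (Finset.univ : Finset ℤˣ))
      (fun i τ => Real.smoothTransition (((τ : ℤ) : ℝ) * x i / c))
    rw [Fintype.piFinset_univ] at this
    simp only [reflect]
    rw [← this]
    refine Finset.prod_eq_one fun i _ => ?_
    rw [UnitsInt.univ, Finset.sum_pair (by decide)]
    rcases le_abs.1 (h x hx i) with h1 | h1
    · rw [Real.smoothTransition.one_of_one_le, Real.smoothTransition.zero_of_nonpos, add_zero]
      · simp only [Units.val_neg, Units.val_one, Int.cast_neg, Int.cast_one, neg_mul, one_mul]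
        rw [neg_div, neg_nonpos]
        exact div_nonneg (by linarith) hc.le
      · simpa using (one_le_div hc).2 h1
    · rw [add_comm, Real.smoothTransition.one_of_one_le, Real.smoothTransition.zero_of_nonpos, add_zero]
      · simp only [Units.val_one, Int.cast_one, one_mul]
        exact div_nonpos_of_nonpos_of_nonneg (by linarith) hc.le
      · simpa using (one_le_div hc).2 h1
  rw [this, Complex.ofReal_one, mul_one]

theorem contDiff_orthant (c : ℝ) {w : (Fin m → ℝ) → ℂ} (hw : ContDiff ℝ ∞ w) (σ : Fin m → ℤˣ) :
    ContDiff ℝ ∞ (orthant c w σ) := by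
  unfold orthant
  have : ContDiff ℝ ∞ fun x : Fin m → ℝ => ∏ i, Real.smoothTransition (x i / c) :=
    contDiff_prod fun i _ => Real.smoothTransition.contDiff.comp
      (show ContDiff ℝ ∞ fun x : Fin m → ℝ => x i / c by fun_prop)
  exact (hw.comp (contDiff_reflect σ)).mul (Complex.ofRealCLM.contDiff.comp this)

theorem hasCompactSupport_orthant (c : ℝ) {w : (Fin m → ℝ) → ℂ} (hw : HasCompactSupport w)
    (σ : Fin m → ℤˣ) : HasCompactSupport (orthant c w σ) := by
  refine HasCompactSupport.mul_right ?_
  let e : (Fin m → ℝ) ≃ₜ (Fin m → ℝ) :=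
    ⟨⟨reflect σ, reflect σ, reflect_reflect σ, reflect_reflect σ⟩,
      (contDiff_reflect σ).continuous, (contDiff_reflect σ).continuous⟩
  exact hw.comp_homeomorph e

theorem orthant_mem {c R : ℝ} (hc : 0 < c) {w : (Fin m → ℝ) → ℂ}
    (h : ∀ x, w x ≠ 0 → ∀ i, c ≤ |x i| ∧ |x i| ≤ R) {σ : Fin m → ℤˣ} {x : Fin m → ℝ}
    (hx : orthant c w σ x ≠ 0) (i : Fin m) : x i ∈ Icc c R := by
  have h1 := h _ (left_ne_zero_of_mul hx) i
  have h2 : 0 < x i := by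
    have := Complex.ofReal_ne_zero.1 (right_ne_zero_of_mul hx)
    by_contra h3
    exact this (Finset.prod_eq_zero (Finset.mem_univ i)
      (Real.smoothTransition.zero_of_nonpos (div_nonpos_of_nonpos_of_nonneg (not_lt.1 h3) hc.le)))
  rw [reflect, abs_mul, abs_units, one_mul, abs_of_pos h2] at h1
  exact h1

theorem oscInt_eq_sum_orthant {c : ℝ} (hc : 0 < c) {w : (Fin m → ℝ) → ℂ} (hw : ContDiff ℝ ∞ w)
    (hwc : HasCompactSupport w) (h : ∀ x, w x ≠ 0 → ∀ i, c ≤ |x i|) (a : Fin m → ℝ) (t : ℝ)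
    (ξ : Fin m → ℝ) :
    oscInt a w t ξ = ∑ σ, oscInt (reflect σ a) (orthant c w σ) t (reflect σ ξ) := by
  have hph : ∀ σ x, phase (reflect σ a) t (reflect σ ξ) (reflect σ x) = phase a t ξ x := by
    intro σ x
    refine congrArg₂ (fun u v : ℝ => t * u - v) (Finset.sum_congr rfl fun i _ => ?_)
      (Finset.sum_congr rfl fun i _ => ?_)
    · simp only [reflect]
      linear_combination (a i * x i ^ 3 * (1 + ((σ i : ℤ) : ℝ) * ((σ i : ℤ) : ℝ))) * units_mul_self (σ i)
    · simp only [reflect]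
      linear_combination (ξ i * x i) * units_mul_self (σ i)
  have hi : ∀ σ, Integrable fun x => orthant c w σ (reflect σ x) * osc (phase a t ξ x) := by
    intro σ
    refine Continuous.integrable_of_hasCompactSupport ?_ ?_
    · have := (contDiff_orthant c hw σ).continuous.comp (contDiff_reflect σ).continuous
      simp only [Function.comp_def] at this
      fun_prop
    · refine HasCompactSupport.mul_right ?_
      let e : (Fin m → ℝ) ≃ₜ (Fin m → ℝ) :=
        ⟨⟨reflect σ, reflect σ, reflect_reflect σ, reflect_reflect σ⟩,
          (contDiff_reflect σ).continuous, (contDiff_reflect σ).continuous⟩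
      exact (hasCompactSupport_orthant c hwc σ).comp_homeomorph e
  have h1 : ∀ σ, oscInt (reflect σ a) (orthant c w σ) t (reflect σ ξ) =
      ∫ x, orthant c w σ (reflect σ x) * osc (phase a t ξ x) := fun σ => by
    rw [oscInt, ← integral_reflect σ]
    simp only [hph]
  simp_rw [h1]
  rw [← integral_finsetSum _ fun σ _ => hi σ]
  refine integral_congr_ae (ae_of_all _ fun x => ?_)
  simp only
  rw [← Finset.sum_mul, ← sum_orthant hc h]

end

/-- Reflection of a Schwartz function. -/
noncomputable def negSchwartz (k : 𝓢(ℝ, ℂ)) : 𝓢(ℝ, ℂ) :=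
  SchwartzMap.compCLMOfContinuousLinearEquiv ℂ (ContinuousLinearEquiv.neg ℝ) k

theorem negSchwartz_apply (k : 𝓢(ℝ, ℂ)) (t : ℝ) : negSchwartz k t = k (-t) := rfl

section
variable {m : ℕ} {F : Fin m → ℤ} {P : MvPolynomial (Fin m) ℤ} {w : (Fin m → ℝ) → ℂ}

theorem oscInt_neg (a : Fin m → ℝ) (t : ℝ) (ξ : Fin m → ℝ) :
    oscInt a w (-t) ξ = oscInt (fun i => -a i) w t ξ := by
  unfold oscInt phase
  refine integral_congr_ae (ae_of_all _ fun x => ?_)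
  simp [Finset.mul_sum]

/-- Each orthant is reflected to the positive one, where the form has coefficients sσ_iF_i and the
dual form is composed with the reflection. The sign s is there because negative t is treated as
positive t for the form −F. -/
theorem exists_norm_integral_Ioi_oscInt_form_le [Nonempty (Fin m)] (hm : 3 ≤ m) (hF : ∀ i, F i ≠ 0)
    (hP : IsDualForm F P) (hw : ContDiff ℝ ∞ w) (hwc : HasCompactSupport w) {c R : ℝ} (hc : 0 < c)
    (hcR : c ≤ R) (h : ∀ x, w x ≠ 0 → ∀ i, c ≤ |x i| ∧ |x i| ≤ R) (k : 𝓢(ℝ, ℂ)) (A : ℕ) {R₀ : ℝ}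
    (hR₀ : 0 ≤ R₀) (s : ℤˣ) :
    ∃ C, 0 ≤ C ∧ ∀ r ξ, 0 ≤ r → r ≤ R₀ →
      ‖∫ t in Ioi (0 : ℝ), k (r * t) * oscInt (fun i => (s : ℤ) * (F i : ℝ)) w t ξ‖ ≤
        C * ((max 1 ‖ξ‖) ^ (1 - (m : ℝ) / 2) /
          ((1 + r * ‖ξ‖) ^ A * (1 + ‖ξ‖ * |dualReal P (‖ξ‖⁻¹ • ξ)|) ^ A)) := by
  obtain ⟨C1, hC1, hC1'⟩ := exists_abs_dualReal_le P
  obtain ⟨C2, hC2, hC2'⟩ := hP.exists_abs_dualReal_le_critPoly hF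
  set a : Fin m → ℝ := fun i => (s : ℤ) * (F i : ℝ) with ha
  have ha0 : ∀ i, a i ≠ 0 := fun i => by
    have h1 := hF i
    have h2 : ((s : ℤ) : ℝ) ≠ 0 := by
      intro h; have := units_mul_self s; simp [h] at this
    simp only [ha]
    exact mul_ne_zero h2 (by exact_mod_cast h1)
  have key : ∀ σ : Fin m → ℤˣ, ∃ C, 0 ≤ C ∧ ∀ r ξ, 0 ≤ r → r ≤ R₀ →
      ‖∫ t in Ioi (0 : ℝ), k (r * t) * oscInt (reflect σ a) (orthant c w σ) t ξ‖ ≤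
        C * (max 1 ‖ξ‖) ^ (1 - (m : ℝ) / 2) /
          ((1 + r * ‖ξ‖) ^ A * (1 + ‖ξ‖ * |dualReal P (reflect σ (‖ξ‖⁻¹ • ξ))|) ^ A) := by
    intro σ
    have hra : ∀ i, reflect σ a i = ((s * σ i * F i : ℤ) : ℝ) := fun i => by
      simp only [reflect, ha]; push_cast; ring
    refine exists_norm_integral_oscInt_le (Q := fun ζ => dualReal P (reflect σ ζ)) (CQ := max C1 C2) hm
      (fun i => ?_) (contDiff_orthant c hw σ)
      (hasCompactSupport_orthant c hwc σ) hc hcR (fun x hx i => orthant_mem hc h hx i)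
      (hC1.trans (le_max_left _ _)) (fun ζ hζ => ?_) (fun p hp hp1 => ?_) k A hR₀
    · have h1 := units_mul_self (σ i)
      have : ((σ i : ℤ) : ℝ) ≠ 0 := by
        intro h; simp [h] at h1
      exact mul_ne_zero this (ha0 i)
    · exact (hC1' _ (by rwa [norm_reflect])).trans (le_max_left _ _)
    · have h1 := hC2' s σ p hp fun i => by
        have := norm_le_pi_norm (fun i => 3 * reflect σ a i * p i ^ 2) i
        rw [hp1, hra] at this
        exact this
      have h2 : reflect σ a = fun i => ((s * σ i * F i : ℤ) : ℝ) := funext hra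
      rw [h2]
      refine le_trans ?_ (mul_le_mul_of_nonneg_right (le_max_right C1 C2) (abs_nonneg _))
      exact h1
  choose C hC hC' using key
  have hint : ∀ (σ : Fin m → ℤˣ) r ξ, 0 ≤ r → IntegrableOn (fun t =>
      k (r * t) * oscInt (reflect σ a) (orthant c w σ) t ξ) (Ioi 0) := by
    intro σ r ξ hr
    have hra : ∀ i, reflect σ a i ≠ 0 := fun i => by
      have h1 := units_mul_self (σ i)
      have : ((σ i : ℤ) : ℝ) ≠ 0 := by
        intro h; simp [h] at h1
      exact mul_ne_zero this (ha0 i)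
    obtain ⟨g, hg, hg'⟩ := exists_integrable_bound_oscInt hm hra (contDiff_orthant c hw σ)
      (hasCompactSupport_orthant c hwc σ) hc hcR (fun x hx i => orthant_mem hc h hx i)
    obtain ⟨Ck, hCk, hCk'⟩ := exists_norm_le_div_one_add_pow k 0
    refine Integrable.mono' (hg.const_mul Ck) ?_
      ((ae_restrict_iff' measurableSet_Ioi).2 (ae_of_all _ fun t ht => ?_))
    · have h1 := continuous_oscInt (a := reflect σ a) (contDiff_orthant c hw σ).continuous
        (hasCompactSupport_orthant c hwc σ) ξ
      have h2 : Continuous fun t => k (r * t) := by have := k.continuous; fun_prop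
      exact (h2.mul h1).aestronglyMeasurable
    · rw [norm_mul]
      gcongr
      · simpa using hCk' (r * t)
      · exact hg' t ξ ht
  refine ⟨∑ σ, C σ, Finset.sum_nonneg fun σ _ => hC σ, fun r ξ hr hrR => ?_⟩
  have e1 : ∀ t, k (r * t) * oscInt a w t ξ =
      ∑ σ, k (r * t) * oscInt (reflect σ a) (orthant c w σ) t (reflect σ ξ) := fun t => by
    rw [oscInt_eq_sum_orthant hc hw hwc (fun x hx i => (h x hx i).1), Finset.mul_sum]
  simp_rw [e1]
  rw [integral_finsetSum _ fun σ _ => hint σ r _ hr, Finset.sum_mul]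
  refine norm_sum_le_of_le _ fun σ _ => ?_
  have := hC' σ r (reflect σ ξ) hr hrR
  rw [norm_reflect, ← reflect_smul, reflect_reflect] at this
  rwa [← mul_div_assoc]

/-- The integral of `w(x) r⁻¹ b(F(x)/r) e(-ξ ⬝ x)` for a Schwartz function `b`. -/
theorem exists_norm_integral_mul_schwartz_le [Nonempty (Fin m)] (hm : 3 ≤ m) (hF : ∀ i, F i ≠ 0)
    (hP : IsDualForm F P) (hw : ContDiff ℝ ∞ w) (hwc : HasCompactSupport w) {c R : ℝ} (hc : 0 < c)
    (hcR : c ≤ R) (h : ∀ x, w x ≠ 0 → ∀ i, c ≤ |x i| ∧ |x i| ≤ R) (b : 𝓢(ℝ, ℂ)) (A : ℕ) {R₀ : ℝ}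
    (hR₀ : 0 ≤ R₀) :
    ∃ C, 0 ≤ C ∧ ∀ r ξ, 0 < r → r ≤ R₀ →
      ‖∫ x, w x * ((r⁻¹ : ℝ) * b (form F x / r)) * osc (-∑ i, ξ i * x i)‖ ≤
        C * ((max 1 ‖ξ‖) ^ (1 - (m : ℝ) / 2) /
          ((1 + r * ‖ξ‖) ^ A * (1 + ‖ξ‖ * |dualReal P (‖ξ‖⁻¹ • ξ)|) ^ A)) := by
  set T : 𝓢(ℝ, ℂ) := 𝓕 b with hT
  obtain ⟨C1, hC1, hC1'⟩ := exists_norm_integral_Ioi_oscInt_form_le hm hF hP hw hwc hc hcR h T A hR₀ 1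
  obtain ⟨C2, hC2, hC2'⟩ :=
    exists_norm_integral_Ioi_oscInt_form_le hm hF hP hw hwc hc hcR h (negSchwartz T) A hR₀ (-1)
  have hinv : ∀ z, b z = ∫ s, osc (s * z) * T s := by
    intro z
    have h1 : 𝓕⁻ T = b := FourierTransform.fourierInv_fourier_eq b
    have h2 : b z = 𝓕⁻ (⇑T) z := by
      conv_lhs => rw [← h1]
      rw [SchwartzMap.fourierInv_coe]
    rw [h2, Real.fourierInv_eq']
    refine integral_congr_ae (ae_of_all _ fun e => ?_)
    simp only [smul_eq_mul, osc, RCLike.inner_apply, conj_trivial]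
    congr 2
    push_cast
    ring
  refine ⟨C1 + C2, by positivity, fun r ξ hr hrR => ?_⟩
  -- Fourier inversion in the scaled form r⁻¹b(y/r) = ∫ b̂(rt)e(ty) dt. Applied with y = F(x), it
  -- turns the kernel into a superposition of the oscillatory integrals already bounded.
  have hinv2 : ∀ y : ℝ, ((r⁻¹ : ℝ) : ℂ) * b (y / r) = ∫ t : ℝ, T (r * t) * osc (t * y) := by
    intro y
    have := Measure.integral_comp_mul_left (fun s => osc (s * (y / r)) * T s) r
    rw [← hinv, abs_of_pos (inv_pos.2 hr)] at this
    rw [← Complex.real_smul, ← this]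
    refine integral_congr_ae (ae_of_all _ fun t => ?_)
    simp only
    rw [mul_comm, show r * t * (y / r) = t * y by field_simp]
  have hTi : Integrable fun t => T (r * t) := T.integrable.comp_mul_left' hr.ne'
  have hwi : Integrable w := hw.continuous.integrable_of_hasCompactSupport hwc
  have e1 : ∫ x, w x * ((r⁻¹ : ℝ) * b (form F x / r)) * osc (-∑ i, ξ i * x i) =
      ∫ t, T (r * t) * oscInt (fun i => (F i : ℝ)) w t ξ := by
    have e2 : ∀ x, w x * ((r⁻¹ : ℝ) * b (form F x / r)) * osc (-∑ i, ξ i * x i) =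
        ∫ t : ℝ, T (r * t) * (w x * osc (phase (fun i => (F i : ℝ)) t ξ x)) := by
      intro x
      rw [hinv2, ← integral_const_mul, ← integral_mul_const]
      refine integral_congr_ae (ae_of_all _ fun t => ?_)
      simp only [phase]
      rw [sub_eq_add_neg, osc_add, form]
      ring
    simp_rw [e2]
    rw [integral_integral_swap]
    · refine integral_congr_ae (ae_of_all _ fun t => ?_)
      simp only
      rw [integral_const_mul, oscInt]
    · have hc2 : Continuous fun p : (Fin m → ℝ) × ℝ => osc (phase (fun i => (F i : ℝ)) p.2 ξ p.1) := by
        unfold phase; fun_prop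
      have := (hwi.mul_prod hTi).bdd_mul (c := 1) hc2.aestronglyMeasurable
        (ae_of_all _ fun p => by simp)
      refine this.congr (ae_of_all _ fun p => ?_)
      simp only [Function.uncurry]
      ring
  have hfi : Integrable fun t => T (r * t) * oscInt (fun i => (F i : ℝ)) w t ξ := by
    have h1 := continuous_oscInt (a := fun i => (F i : ℝ)) hw.continuous hwc ξ
    have := hTi.bdd_mul (c := ∫ x, ‖w x‖) h1.aestronglyMeasurable
      (ae_of_all _ fun t => norm_oscInt_le t ξ)
    refine this.congr (ae_of_all _ fun p => mul_comm _ _)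
  rw [e1, ← integral_add_compl measurableSet_Ioi hfi (s := Ioi (0 : ℝ)), compl_Ioi]
  have e3 : ∫ t in Iic (0 : ℝ), T (r * t) * oscInt (fun i => (F i : ℝ)) w t ξ =
      ∫ t in Ioi (0 : ℝ), negSchwartz T (r * t) *
        oscInt (fun i => ((-1 : ℤˣ) : ℤ) * (F i : ℝ)) w t ξ := by
    have := integral_comp_neg_Ioi (0 : ℝ) fun t => T (r * t) * oscInt (fun i => (F i : ℝ)) w t ξ
    rw [neg_zero] at this
    rw [← this]
    refine integral_congr_ae (ae_of_all _ fun t => ?_)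
    simp [oscInt_neg, negSchwartz_apply]
  rw [e3, add_mul]
  refine (norm_add_le _ _).trans (add_le_add ?_ (hC2' r ξ hr.le hrR))
  simpa using hC1' r ξ hr.le hrR

end

/-! ### Derivatives of the integrals with respect to log n -/

/-- Smooth functions supported in `c ≤ |x_i| ≤ R`. -/
structure IsAmplitude {m : ℕ} (c R : ℝ) (w : (Fin m → ℝ) → ℂ) : Prop where
  smooth : ContDiff ℝ ∞ w
  supp : ∀ x, w x ≠ 0 → ∀ i, c ≤ |x i| ∧ |x i| ≤ R

section
variable {m : ℕ} {c R : ℝ} {w : (Fin m → ℝ) → ℂ}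

theorem isCompact_shell_box : IsCompact {x : Fin m → ℝ | ∀ i, c ≤ |x i| ∧ |x i| ≤ R} := by
  refine IsCompact.of_isClosed_subset (isCompact_closedBall (0 : Fin m → ℝ) |R|) ?_ fun x hx => ?_
  · simp only [Set.ofPred_forall]
    refine isClosed_iInter fun i => ?_
    exact (isClosed_le continuous_const (continuous_apply i).abs).inter
      (isClosed_le (continuous_apply i).abs continuous_const)
  · rw [mem_closedBall_zero_iff, pi_norm_le_iff_of_nonneg (abs_nonneg _)]
    exact fun i => (hx i).2.trans (le_abs_self _)

theorem IsAmplitude.hasCompactSupport (h : IsAmplitude c R w) : HasCompactSupport w :=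
  HasCompactSupport.of_support_subset_isCompact isCompact_shell_box fun x hx => h.supp x hx

/-- The operator `w ↦ m w + x ⬝ ∇w`. -/
noncomputable def divOp (w : (Fin m → ℝ) → ℂ) (x : Fin m → ℝ) : ℂ := m * w x + fderiv ℝ w x x

theorem IsAmplitude.divOp (h : IsAmplitude c R w) : IsAmplitude c R (divOp w) := by
  refine ⟨(contDiff_const.mul h.smooth).add
    ((h.smooth.fderiv_right (m := ∞) (by simp)).clm_apply contDiff_id), fun x hx => ?_⟩
  by_contra h3
  have h4 : w x = 0 := by
    by_contra h'; exact h3 (h.supp x h')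
  have h5 : fderiv ℝ w x x = 0 := by
    by_contra h'
    exact h3 (mem_of_fderiv_apply_ne_zero isCompact_shell_box.isClosed (fun x hx => h.supp x hx) h')
  simp [HybridBound.divOp, h4, h5] at hx

theorem IsAmplitude.exists_norm_fourier_le (h : IsAmplitude c R w) (A : ℕ) :
    ∃ C, 0 ≤ C ∧ ∀ ξ : Fin m → ℝ, ‖∫ x, w x * osc (-∑ i, ξ i * x i)‖ ≤ C / (1 + ‖ξ‖) ^ A := by
  -- With zero cubic coefficients the phase is linear, and the largest coordinate of ξ is
  -- nonstationary everywhere.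
  obtain ⟨C, hC, hC'⟩ := exists_norm_integral_le_of_nonstationary (fun _ : Fin m => (0 : ℝ)) one_pos
    h.smooth h.hasCompactSupport A
  have hI : 0 ≤ ∫ x, ‖w x‖ := integral_nonneg fun _ => norm_nonneg _
  refine ⟨2 ^ A * (C + ∫ x, ‖w x‖), by positivity, fun ξ => ?_⟩
  have h0 : ‖∫ x, w x * osc (-∑ i, ξ i * x i)‖ ≤ ∫ x, ‖w x‖ := by
    refine (norm_integral_le_integral_norm _).trans (le_of_eq ?_)
    simp
  rw [le_div_iff₀ (by positivity)]
  rcases le_total ‖ξ‖ 1 with h1 | h1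
  · calc _ ≤ (∫ x, ‖w x‖) * 2 ^ A := by gcongr; linarith
      _ ≤ _ := by rw [mul_comm]; gcongr; linarith
  · have hpos : 0 < ‖ξ‖ := one_pos.trans_le h1
    have hne : Nonempty (Fin m) := by
      by_contra hne
      rw [not_nonempty_iff] at hne
      simp [Pi.norm_def] at hpos
    obtain ⟨i, -, hi⟩ := Finset.exists_mem_eq_sup' (s := Finset.univ)
      (Finset.univ_nonempty (α := Fin m)) fun i => ‖ξ i‖₊
    have hi' : ‖ξ‖ = |ξ i| := by
      rw [Pi.norm_def, ← Finset.sup'_eq_sup Finset.univ_nonempty, hi]; rfl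
    have := hC' 0 ‖ξ‖ ξ i hpos (by simp [hpos.le]) hi'.ge fun x _ => by
      simp [hi']
    simp only [phase, zero_mul, zero_sub] at this
    calc _ ≤ C / ‖ξ‖ ^ A * (2 * ‖ξ‖) ^ A := by gcongr; linarith
      _ = 2 ^ A * C := by rw [mul_pow]; field_simp
      _ ≤ _ := by gcongr; linarith

end

/-- The integral `∫ w(x) r⁻¹ β(F(x)/r) e(-ξ ⬝ x) dx` along the flow `r = r₀ eᵗ`, `ξ = e⁻ᵗ ξ₀`. -/
noncomputable def flowInt {m : ℕ} (F : Fin m → ℤ) (w : (Fin m → ℝ) → ℂ) (β : ℝ → ℂ) (r₀ : ℝ)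
    (ξ₀ : Fin m → ℝ) (t : ℝ) : ℂ :=
  ∫ x, w x * (((r₀ * Real.exp t)⁻¹ : ℝ) * β (form F x / (r₀ * Real.exp t))) *
    osc (-∑ i, (Real.exp (-t) * ξ₀ i) * x i)

section
variable {m : ℕ} {c R : ℝ} {w : (Fin m → ℝ) → ℂ} {F : Fin m → ℤ} {β : ℝ → ℂ}

/-- The operator `β ↦ -β + 2zβ'`. -/
noncomputable def kernelOp (β : ℝ → ℂ) (z : ℝ) : ℂ := -β z + 2 * z * deriv β z

theorem contDiff_kernelOp (hβ : ContDiff ℝ ∞ β) : ContDiff ℝ ∞ (kernelOp β) := by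
  have h1 : ContDiff ℝ ∞ (deriv β) := by simpa using hβ.iterate_deriv 1
  exact hβ.neg.add ((contDiff_const.mul Complex.ofRealCLM.contDiff).mul h1)

/-- The integrand of `flowInt` after the substitution `x = eᵗ u`. -/
noncomputable def flowIntegrand (F : Fin m → ℤ) (w : (Fin m → ℝ) → ℂ) (β : ℝ → ℂ) (r₀ : ℝ)
    (ξ₀ : Fin m → ℝ) (t : ℝ) (u : Fin m → ℝ) : ℂ :=
  ((r₀⁻¹ * Real.exp ((m - 1) * t) : ℝ) : ℂ) * (w (Real.exp t • u) *
    β (Real.exp (2 * t) * form F u / r₀)) * osc (-∑ i, ξ₀ i * u i)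

/-- Substituting x = eᵗu frees the character from t. Differentiation then never produces a factor
‖ξ‖. -/
theorem flowInt_eq (r₀ : ℝ) (ξ₀ : Fin m → ℝ) (t : ℝ) :
    flowInt F w β r₀ ξ₀ t = ∫ u, flowIntegrand F w β r₀ ξ₀ t u := by
  have h := Measure.integral_comp_smul (volume : Measure (Fin m → ℝ)) (fun x =>
    w x * (((r₀ * Real.exp t)⁻¹ : ℝ) * β (form F x / (r₀ * Real.exp t))) *
    osc (-∑ i, (Real.exp (-t) * ξ₀ i) * x i)) (Real.exp t)
  rw [Module.finrank_fin_fun, abs_of_pos (by positivity)] at h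
  have h2 : flowInt F w β r₀ ξ₀ t = (Real.exp t ^ m) • ∫ u : Fin m → ℝ,
      (w (Real.exp t • u) * (((r₀ * Real.exp t)⁻¹ : ℝ) *
        β (form F (Real.exp t • u) / (r₀ * Real.exp t))) *
      osc (-∑ i, (Real.exp (-t) * ξ₀ i) * (Real.exp t • u) i)) := by
    rw [h, smul_smul, mul_inv_cancel₀ (by positivity), one_smul]
    rfl
  rw [h2, ← integral_smul]
  refine integral_congr_ae (ae_of_all _ fun u => ?_)
  simp only [flowIntegrand]
  have e1 : form F (Real.exp t • u) / (r₀ * Real.exp t) = Real.exp (2 * t) * form F u / r₀ := by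
    have : form F (Real.exp t • u) = Real.exp t ^ 3 * form F u := by
      simp only [form, Finset.mul_sum]
      refine Finset.sum_congr rfl fun i _ => ?_
      simp only [Pi.smul_apply, smul_eq_mul]; ring
    rw [this, show 2 * t = t + t by ring, Real.exp_add]
    have := (Real.exp_pos t).ne'
    by_cases h0 : r₀ = 0
    · simp [h0]
    field_simp
  have e2 : ∀ i, (Real.exp (-t) * ξ₀ i) * (Real.exp t • u) i = ξ₀ i * u i := fun i => by
    rw [Pi.smul_apply, smul_eq_mul, Real.exp_neg]
    have := (Real.exp_pos t).ne'
    field_simp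
  have e3 : Real.exp t ^ m * (r₀ * Real.exp t)⁻¹ = r₀⁻¹ * Real.exp ((m - 1) * t) := by
    rw [sub_mul, Real.exp_sub, one_mul, Real.exp_nat_mul]
    have := (Real.exp_pos t).ne'
    by_cases h0 : r₀ = 0
    · simp [h0]
    field_simp
  simp_rw [e1, e2, ← e3, Complex.real_smul]
  push_cast
  ring

/-- The Jacobian and the factor r⁻¹ together give the exponent m − 1, split as m for `divOp` and −1
for `kernelOp`. The argument of β scales like e^{3t}/eᵗ = e^{2t}, hence the term 2zβ'. -/
theorem hasDerivAt_flowIntegrand (hw : ContDiff ℝ ∞ w) (hβ : ContDiff ℝ ∞ β) (r₀ : ℝ)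
    (ξ₀ : Fin m → ℝ) (t : ℝ) (u : Fin m → ℝ) :
    HasDerivAt (fun t => flowIntegrand F w β r₀ ξ₀ t u)
      (flowIntegrand F (divOp w) β r₀ ξ₀ t u + flowIntegrand F w (kernelOp β) r₀ ξ₀ t u) t := by
  have h1 : HasDerivAt (fun t : ℝ => ((r₀⁻¹ * Real.exp ((m - 1) * t) : ℝ) : ℂ))
      (((m - 1) * (r₀⁻¹ * Real.exp ((m - 1) * t)) : ℝ) : ℂ) t := by
    refine HasDerivAt.ofReal_comp ?_
    refine ((((hasDerivAt_id t).const_mul ((m : ℝ) - 1)).exp).const_mul r₀⁻¹).congr_deriv ?_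
    simp; ring
  have h2 : HasDerivAt (fun t : ℝ => w (Real.exp t • u))
      (fderiv ℝ w (Real.exp t • u) (Real.exp t • u)) t :=
    ((hw.differentiable (by simp)) _).hasFDerivAt.comp_hasDerivAt t
      ((Real.hasDerivAt_exp t).smul_const u)
  have h3 : HasDerivAt (fun t : ℝ => β (Real.exp (2 * t) * form F u / r₀))
      (2 * ((Real.exp (2 * t) * form F u / r₀ : ℝ) : ℂ) *
        deriv β (Real.exp (2 * t) * form F u / r₀)) t := by
    have h4 : HasDerivAt (fun t : ℝ => Real.exp (2 * t) * form F u / r₀)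
        (2 * (Real.exp (2 * t) * form F u / r₀)) t := by
      refine (((((hasDerivAt_id t).const_mul 2).exp).mul_const (form F u)).div_const r₀).congr_deriv ?_
      simp; ring
    refine ((hβ.differentiable (by simp) _).hasDerivAt.scomp t h4).congr_deriv ?_
    simp
  refine ((h1.mul (h2.mul h3)).mul_const _).congr_deriv ?_
  simp only [flowIntegrand, divOp, kernelOp, Pi.mul_apply]
  push_cast
  ring

theorem continuous_flowIntegrand (hw : Continuous w) (hβ : Continuous β) (r₀ : ℝ)
    (ξ₀ : Fin m → ℝ) : Continuous fun p : ℝ × (Fin m → ℝ) => flowIntegrand F w β r₀ ξ₀ p.1 p.2 := by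
  unfold flowIntegrand form
  fun_prop

theorem flowIntegrand_ne_zero (h : IsAmplitude c R w) {r₀ : ℝ} {ξ₀ : Fin m → ℝ} {t T : ℝ}
    {u : Fin m → ℝ} (ht : T ≤ t) (hu : flowIntegrand F w β r₀ ξ₀ t u ≠ 0) :
    u ∈ Metric.closedBall (0 : Fin m → ℝ) (|R| * Real.exp (-T)) := by
  have h1 : w (Real.exp t • u) ≠ 0 := left_ne_zero_of_mul (right_ne_zero_of_mul (left_ne_zero_of_mul hu))
  rw [mem_closedBall_zero_iff, pi_norm_le_iff_of_nonneg (by positivity)]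
  intro i
  have h2 := (h.supp _ h1 i).2
  rw [Pi.smul_apply, smul_eq_mul, abs_mul, abs_of_pos (Real.exp_pos _)] at h2
  rw [Real.exp_neg, ← div_eq_mul_inv, le_div_iff₀ (Real.exp_pos _), Real.norm_eq_abs]
  calc |u i| * Real.exp T ≤ |u i| * Real.exp t := by gcongr
    _ ≤ |R| := by rw [mul_comm]; exact h2.trans (le_abs_self _)

theorem hasDerivAt_flowInt (h : IsAmplitude c R w) (hβ : ContDiff ℝ ∞ β) (r₀ : ℝ)
    (ξ₀ : Fin m → ℝ) (t : ℝ) :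
    HasDerivAt (flowInt F w β r₀ ξ₀)
      (flowInt F (divOp w) β r₀ ξ₀ t + flowInt F w (kernelOp β) r₀ ξ₀ t) t := by
  have hfun : flowInt F w β r₀ ξ₀ = fun t => ∫ u, flowIntegrand F w β r₀ ξ₀ t u :=
    funext fun t => flowInt_eq r₀ ξ₀ t
  have c0 := continuous_flowIntegrand (F := F) h.smooth.continuous hβ.continuous r₀ ξ₀
  have c1 := continuous_flowIntegrand (F := F) h.divOp.smooth.continuous hβ.continuous r₀ ξ₀
  have c2 := continuous_flowIntegrand (F := F) h.smooth.continuous (contDiff_kernelOp hβ).continuous r₀ ξ₀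
  set B := Metric.closedBall (0 : Fin m → ℝ) (|R| * Real.exp (-(t - 1))) with hB
  have hBc : IsCompact B := isCompact_closedBall _ _
  have int : ∀ {w' : (Fin m → ℝ) → ℂ} {β' : ℝ → ℂ}, IsAmplitude c R w' → Continuous β' →
      Integrable fun u => flowIntegrand F w' β' r₀ ξ₀ t u := by
    intro w' β' hw' hβ'
    refine Continuous.integrable_of_hasCompactSupport ?_
      (HasCompactSupport.of_support_subset_isCompact hBc fun u hu =>
        flowIntegrand_ne_zero hw' (by linarith) hu)
    exact (continuous_flowIntegrand (F := F) hw'.smooth.continuous hβ' r₀ ξ₀).comp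
      (Continuous.prodMk_right t)
  obtain ⟨M, hM⟩ := ((isCompact_Icc (a := t - 1) (b := t + 1)).prod hBc).exists_bound_of_continuousOn
    (c1.add c2).continuousOn
  rw [hfun, flowInt_eq, flowInt_eq, ← integral_add (int h.divOp hβ.continuous)
    (int h (contDiff_kernelOp hβ).continuous)]
  refine (hasDerivAt_integral_of_dominated_loc_of_deriv_le (μ := volume)
    (F := fun t u => flowIntegrand F w β r₀ ξ₀ t u)
    (F' := fun t u => flowIntegrand F (divOp w) β r₀ ξ₀ t u + flowIntegrand F w (kernelOp β) r₀ ξ₀ t u)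
    (bound := B.indicator fun _ => M) (s := Icc (t - 1) (t + 1)) (Icc_mem_nhds (by linarith) (by linarith))
    (Filter.Eventually.of_forall fun s => ?_) (int h hβ.continuous) ?_
    (ae_of_all _ fun u s hs => ?_) ?_ (ae_of_all _ fun u s hs => ?_)).2
  · exact (c0.comp (Continuous.prodMk_right s)).aestronglyMeasurable
  · exact ((c1.add c2).comp (Continuous.prodMk_right t)).aestronglyMeasurable
  · by_cases hu : u ∈ B
    · rw [indicator_of_mem hu]
      exact hM (s, u) ⟨hs, hu⟩
    · have z1 : flowIntegrand F (divOp w) β r₀ ξ₀ s u = 0 := by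
        by_contra h'; exact hu (flowIntegrand_ne_zero h.divOp hs.1 h')
      have z2 : flowIntegrand F w (kernelOp β) r₀ ξ₀ s u = 0 := by
        by_contra h'; exact hu (flowIntegrand_ne_zero h hs.1 h')
      rw [indicator_of_notMem hu, z1, z2]; simp
  · exact (integrable_indicator_iff hBc.measurableSet).2 (integrableOn_const hBc.measure_lt_top.ne)
  · exact hasDerivAt_flowIntegrand h.smooth hβ r₀ ξ₀ s u

theorem contDiff_flowInt_nat (n : ℕ) : ∀ {w : (Fin m → ℝ) → ℂ} {β : ℝ → ℂ}, IsAmplitude c R w →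
    ContDiff ℝ ∞ β → ∀ r₀ ξ₀, ContDiff ℝ n (flowInt F w β r₀ ξ₀) := by
  induction n with
  | zero =>
    intro w β h hβ r₀ ξ₀
    exact contDiff_zero.2 (continuous_iff_continuousAt.2 fun t =>
      (hasDerivAt_flowInt h hβ r₀ ξ₀ t).continuousAt)
  | succ n ih =>
    intro w β h hβ r₀ ξ₀
    push_cast
    rw [contDiff_succ_iff_deriv]
    refine ⟨fun t => (hasDerivAt_flowInt h hβ r₀ ξ₀ t).differentiableAt, by simp, ?_⟩
    have : deriv (flowInt F w β r₀ ξ₀) = fun t =>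
        flowInt F (divOp w) β r₀ ξ₀ t + flowInt F w (kernelOp β) r₀ ξ₀ t :=
      funext fun t => (hasDerivAt_flowInt h hβ r₀ ξ₀ t).deriv
    rw [this]
    exact (ih h.divOp hβ r₀ ξ₀).add (ih h (contDiff_kernelOp hβ) r₀ ξ₀)

theorem contDiff_flowInt (h : IsAmplitude c R w) (hβ : ContDiff ℝ ∞ β) (r₀ : ℝ) (ξ₀ : Fin m → ℝ) :
    ContDiff ℝ ∞ (flowInt F w β r₀ ξ₀) :=
  contDiff_infty.2 fun n => contDiff_flowInt_nat n h hβ r₀ ξ₀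

end

/-- The decay of `J_{c,X}(n)` in terms of `r = n/X^{3/2}` and `ξ = Xc/n`. -/
noncomputable def decayBound {m : ℕ} (P : MvPolynomial (Fin m) ℤ) (A : ℕ) (r : ℝ)
    (ξ : Fin m → ℝ) : ℝ :=
  (max 1 ‖ξ‖) ^ (1 - (m : ℝ) / 2) /
    ((1 + r * ‖ξ‖) ^ A * (1 + ‖ξ‖ * |dualReal P (‖ξ‖⁻¹ • ξ)|) ^ A)

section
variable {m : ℕ} {c R : ℝ} {w : (Fin m → ℝ) → ℂ} {F : Fin m → ℤ} {P : MvPolynomial (Fin m) ℤ}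

theorem decayBound_nonneg (P : MvPolynomial (Fin m) ℤ) (A : ℕ) {r : ℝ} (hr : 0 ≤ r)
    (ξ : Fin m → ℝ) : 0 ≤ decayBound P A r ξ := by
  unfold decayBound
  have : 0 ≤ max 1 ‖ξ‖ := zero_le_one.trans (le_max_left _ _)
  positivity

/-- For bounded r every factor in the denominator of the decay bound is O(1 + ‖ξ‖), so rapid decay
in ξ alone suffices. This serves the part of J whose kernel does not depend on F(x). -/
theorem exists_le_decayBound (hm : 3 ≤ m) (P : MvPolynomial (Fin m) ℤ) (A : ℕ) {R₀ : ℝ} (hR₀ : 0 ≤ R₀) :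
    ∃ C, 0 ≤ C ∧ ∀ r ξ, 0 ≤ r → r ≤ R₀ → 1 / (1 + ‖ξ‖) ^ (2 * A + m) ≤ C * decayBound P A r ξ := by
  obtain ⟨C, hC, hC'⟩ := exists_abs_dualReal_le P
  refine ⟨(1 + R₀) ^ A * (1 + C) ^ A, by positivity, fun r ξ hr hrR => ?_⟩
  have hn := norm_nonneg ξ
  have hP : |dualReal P (‖ξ‖⁻¹ • ξ)| ≤ C := hC' _ (by
    rw [norm_smul, norm_inv, norm_norm]; exact inv_mul_le_one)
  have h1 : 1 + r * ‖ξ‖ ≤ (1 + R₀) * (1 + ‖ξ‖) := by nlinarith [mul_le_mul_of_nonneg_right hrR hn]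
  have h2 : 1 + ‖ξ‖ * |dualReal P (‖ξ‖⁻¹ • ξ)| ≤ (1 + C) * (1 + ‖ξ‖) := by
    nlinarith [mul_le_mul_of_nonneg_left hP hn]
  have h3 : 1 / (1 + ‖ξ‖) ^ m ≤ (max 1 ‖ξ‖) ^ (1 - (m : ℝ) / 2) := by
    rw [one_div, ← Real.rpow_natCast, ← Real.rpow_neg (by positivity)]
    have hm' : (3 : ℝ) ≤ m := by exact_mod_cast hm
    calc (1 + ‖ξ‖) ^ (-(m : ℝ)) ≤ (1 + ‖ξ‖) ^ (1 - (m : ℝ) / 2) :=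
          Real.rpow_le_rpow_of_exponent_le (by linarith) (by linarith)
      _ ≤ _ := Real.rpow_le_rpow_of_nonpos (by positivity) (max_le (by linarith) (by linarith))
          (by linarith)
  unfold decayBound
  rw [pow_add, ← mul_div_assoc, div_le_div_iff₀ (by positivity) (by positivity), one_mul]
  rw [div_le_iff₀ (by positivity)] at h3
  calc (1 + r * ‖ξ‖) ^ A * (1 + ‖ξ‖ * |dualReal P (‖ξ‖⁻¹ • ξ)|) ^ A
      ≤ ((1 + R₀) * (1 + ‖ξ‖)) ^ A * ((1 + C) * (1 + ‖ξ‖)) ^ A := by gcongr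
    _ = (1 + R₀) ^ A * (1 + C) ^ A * 1 * (1 + ‖ξ‖) ^ (2 * A) := by
      rw [mul_pow, mul_pow]; ring
    _ ≤ (1 + R₀) ^ A * (1 + C) ^ A * ((max 1 ‖ξ‖) ^ (1 - (m : ℝ) / 2) * (1 + ‖ξ‖) ^ m) *
        (1 + ‖ξ‖) ^ (2 * A) := by gcongr
    _ = _ := by ring

theorem kernelOp_schwartz (b : 𝓢(ℝ, ℂ)) :
    kernelOp (b : ℝ → ℂ) = ((-b + (2 : ℂ) • eulerOp b : 𝓢(ℝ, ℂ)) : ℝ → ℂ) := by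
  funext z
  simp [kernelOp, eulerOp_apply]
  ring

theorem kernelOp_one : kernelOp (fun _ => 1) = fun _ => -1 := by
  funext z; simp [kernelOp]

/-- A derivative along the flow replaces w by `divOp w`, or b by −b + 2zb'. These are again an
amplitude with the same support condition and a Schwartz function, so the undifferentiated bound
applies at every order. -/
theorem exists_norm_iteratedDeriv_flowInt_le [Nonempty (Fin m)] (hm : 3 ≤ m) (hF : ∀ i, F i ≠ 0)
    (hP : IsDualForm F P) (hc : 0 < c) (hcR : c ≤ R) (A : ℕ) {R₀ : ℝ} (hR₀ : 0 ≤ R₀) (j : ℕ) :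
    ∀ {w : (Fin m → ℝ) → ℂ}, IsAmplitude c R w → ∀ b : 𝓢(ℝ, ℂ),
    ∃ C, 0 ≤ C ∧ ∀ r₀ ξ₀ t, 0 < r₀ → r₀ * Real.exp t ≤ R₀ →
      ‖iteratedDeriv j (flowInt F w b r₀ ξ₀) t‖ ≤
        C * decayBound P A (r₀ * Real.exp t) (Real.exp (-t) • ξ₀) := by
  induction j with
  | zero =>
    intro w h b
    obtain ⟨C, hC, hC'⟩ := exists_norm_integral_mul_schwartz_le hm hF hP h.smooth
      h.hasCompactSupport hc hcR h.supp b A hR₀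
    refine ⟨C, hC, fun r₀ ξ₀ t hr ht => ?_⟩
    rw [iteratedDeriv_zero]
    exact hC' (r₀ * Real.exp t) (Real.exp (-t) • ξ₀) (by positivity) ht
  | succ j ih =>
    intro w h b
    obtain ⟨C1, hC1, hC1'⟩ := ih h.divOp b
    obtain ⟨C2, hC2, hC2'⟩ := ih h (-b + (2 : ℂ) • eulerOp b)
    refine ⟨C1 + C2, by positivity, fun r₀ ξ₀ t hr ht => ?_⟩
    have hd : deriv (flowInt F w b r₀ ξ₀) = flowInt F (divOp w) b r₀ ξ₀ +
        flowInt F w (-b + (2 : ℂ) • eulerOp b : 𝓢(ℝ, ℂ)) r₀ ξ₀ := by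
      funext s
      rw [(hasDerivAt_flowInt h (b.smooth ⊤) r₀ ξ₀ s).deriv]
      simp only [Pi.add_apply, ← kernelOp_schwartz]
    have s1 := (contDiff_flowInt_nat (F := F) j h.divOp (b.smooth ⊤) r₀ ξ₀).contDiffAt (x := t)
    have s2 := (contDiff_flowInt_nat (F := F) j h ((-b + (2 : ℂ) • eulerOp b).smooth ⊤) r₀ ξ₀).contDiffAt
      (x := t)
    rw [iteratedDeriv_succ', hd, iteratedDeriv_add s1 s2, add_mul]
    exact (norm_add_le _ _).trans (add_le_add (hC1' r₀ ξ₀ t hr ht) (hC2' r₀ ξ₀ t hr ht))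

/-- The part of the flow that comes from the constant kernel. -/
noncomputable def constFlow (F : Fin m → ℤ) (φ : ℝ → ℝ) (w : (Fin m → ℝ) → ℂ) (r₀ : ℝ)
    (ξ₀ : Fin m → ℝ) (t : ℝ) : ℂ :=
  ((riemannErr φ (r₀ * Real.exp t)⁻¹ : ℝ) : ℂ) * flowInt F w (fun _ => 1) r₀ ξ₀ t

/-- The constant kernel is not a Schwartz function, so this part is differentiated as a product. The
Riemann error at z = 1/r yields minus the error for `blockOp φ`, and the −1 coming from the constant
kernel is absorbed into the amplitude. -/
theorem hasDerivAt_constFlow {φ : ℝ → ℝ} (hφ : IsBlock φ) (h : IsAmplitude c R w) {r₀ : ℝ}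
    (hr : 0 < r₀) (ξ₀ : Fin m → ℝ) (t : ℝ) :
    HasDerivAt (constFlow F φ w r₀ ξ₀)
      (-constFlow F (blockOp φ) w r₀ ξ₀ t + constFlow F φ (fun x => divOp w x + (-1) * w x) r₀ ξ₀ t) t := by
  have hz : 0 < (r₀ * Real.exp t)⁻¹ := by positivity
  have h1 : HasDerivAt (fun t : ℝ => ((riemannErr φ (r₀ * Real.exp t)⁻¹ : ℝ) : ℂ))
      (-((riemannErr (blockOp φ) (r₀ * Real.exp t)⁻¹ : ℝ) : ℂ)) t := by
    rw [← Complex.ofReal_neg]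
    refine HasDerivAt.ofReal_comp ?_
    have h2 : HasDerivAt (fun t => (r₀ * Real.exp t)⁻¹) (-(r₀ * Real.exp t)⁻¹) t := by
      refine (((Real.hasDerivAt_exp t).const_mul r₀).inv (by positivity)).congr_deriv ?_
      have := (Real.exp_pos t).ne'
      field_simp
    refine ((hφ.hasDerivAt_riemannErr hz).comp t h2).congr_deriv ?_
    field_simp
  refine (h1.mul (hasDerivAt_flowInt h contDiff_const r₀ ξ₀ t)).congr_deriv ?_
  have h3 : flowInt F (fun x => divOp w x + (-1) * w x) (fun _ => 1) r₀ ξ₀ t =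
      flowInt F (divOp w) (fun _ => 1) r₀ ξ₀ t + flowInt F w (kernelOp fun _ => 1) r₀ ξ₀ t := by
    rw [kernelOp_one, flowInt, flowInt, flowInt, ← integral_add]
    · refine integral_congr_ae (ae_of_all _ fun x => ?_)
      simp only
      ring
    · refine Continuous.integrable_of_hasCompactSupport ?_
        (h.divOp.hasCompactSupport.mul_right.mul_right)
      have := h.divOp.smooth.continuous
      fun_prop
    · refine Continuous.integrable_of_hasCompactSupport ?_
        (h.hasCompactSupport.mul_right.mul_right)
      have := h.smooth.continuous
      fun_prop
  simp only [constFlow]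
  rw [h3]
  ring

theorem IsAmplitude.divOp_sub (h : IsAmplitude c R w) :
    IsAmplitude c R fun x => HybridBound.divOp w x + (-1) * w x := by
  refine ⟨h.divOp.smooth.add (contDiff_const.mul h.smooth), fun x hx => ?_⟩
  by_cases h1 : w x = 0
  · refine h.divOp.supp x ?_
    simpa [h1] using hx
  · exact h.supp x h1

theorem contDiff_constFlow_nat (n : ℕ) : ∀ {φ : ℝ → ℝ} {w : (Fin m → ℝ) → ℂ}, IsBlock φ →
    IsAmplitude c R w → ∀ r₀ ξ₀, 0 < r₀ → ContDiff ℝ n (constFlow F φ w r₀ ξ₀) := by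
  induction n with
  | zero =>
    intro φ w hφ h r₀ ξ₀ hr
    exact contDiff_zero.2 (continuous_iff_continuousAt.2 fun t =>
      (hasDerivAt_constFlow hφ h hr ξ₀ t).continuousAt)
  | succ n ih =>
    intro φ w hφ h r₀ ξ₀ hr
    push_cast
    rw [contDiff_succ_iff_deriv]
    refine ⟨fun t => (hasDerivAt_constFlow hφ h hr ξ₀ t).differentiableAt, by simp, ?_⟩
    have : deriv (constFlow F φ w r₀ ξ₀) = fun t => -constFlow F (blockOp φ) w r₀ ξ₀ t +
        constFlow F φ (fun x => divOp w x + (-1) * w x) r₀ ξ₀ t :=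
      funext fun t => (hasDerivAt_constFlow hφ h hr ξ₀ t).deriv
    rw [this]
    exact (ih hφ.blockOp h r₀ ξ₀ hr).neg.add (ih hφ h.divOp_sub r₀ ξ₀ hr)

/-- The decay of the error at 1/r compensates the singular factor r⁻¹ as r → 0. -/
theorem IsBlock.exists_inv_mul_riemannErr_le {φ : ℝ → ℝ} (hφ : IsBlock φ) (R₀ : ℝ) :
    ∃ C, 0 ≤ C ∧ ∀ r, 0 < r → r ≤ R₀ → r⁻¹ * |riemannErr φ r⁻¹| ≤ C := by
  obtain ⟨C1, hC1, hC1'⟩ := hφ.exists_abs_riemannErr_le 1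
  obtain ⟨C2, hC2⟩ := (isCompact_Icc (a := (1 : ℝ)) (b := R₀)).exists_bound_of_continuousOn
    (f := fun r => riemannErr φ r⁻¹) fun r hr => by
      have h0 : (0 : ℝ) < r := by linarith [hr.1]
      exact ((hφ.contDiffAt_riemannErr (inv_pos.2 h0)).continuousAt.comp
        (continuousAt_inv₀ h0.ne')).continuousWithinAt
  refine ⟨max C1 C2, hC1.trans (le_max_left _ _), fun r hr hrR => ?_⟩
  rcases le_total r 1 with h | h
  · have := hC1' r⁻¹ ((one_le_inv₀ hr).2 h)
    rw [pow_one, le_div_iff₀ (by positivity), mul_comm] at this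
    exact this.trans (le_max_left _ _)
  · calc _ ≤ 1 * |riemannErr φ r⁻¹| := by gcongr; exact inv_le_one_of_one_le₀ h
      _ ≤ _ := by rw [one_mul]; exact (hC2 r ⟨h, hrR⟩).trans (le_max_right _ _)

theorem exists_norm_iteratedDeriv_constFlow_le (hm : 3 ≤ m) (P : MvPolynomial (Fin m) ℤ) (A : ℕ)
    {R₀ : ℝ} (hR₀ : 0 ≤ R₀) (j : ℕ) :
    ∀ {φ : ℝ → ℝ} {w : (Fin m → ℝ) → ℂ}, IsBlock φ → IsAmplitude c R w →
    ∃ C, 0 ≤ C ∧ ∀ r₀ ξ₀ t, 0 < r₀ → r₀ * Real.exp t ≤ R₀ →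
      ‖iteratedDeriv j (constFlow F φ w r₀ ξ₀) t‖ ≤
        C * decayBound P A (r₀ * Real.exp t) (Real.exp (-t) • ξ₀) := by
  induction j with
  | zero =>
    intro φ w hφ h
    obtain ⟨C1, hC1, hC1'⟩ := hφ.exists_inv_mul_riemannErr_le R₀
    obtain ⟨C2, hC2, hC2'⟩ := h.exists_norm_fourier_le (2 * A + m)
    obtain ⟨C3, hC3, hC3'⟩ := exists_le_decayBound hm P A hR₀
    refine ⟨C1 * C2 * C3, by positivity, fun r₀ ξ₀ t hr ht => ?_⟩
    have hr' : 0 < r₀ * Real.exp t := by positivity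
    have e1 : constFlow F φ w r₀ ξ₀ t =
        (((r₀ * Real.exp t)⁻¹ * riemannErr φ (r₀ * Real.exp t)⁻¹ : ℝ) : ℂ) *
        ∫ x, w x * osc (-∑ i, (Real.exp (-t) • ξ₀) i * x i) := by
      rw [constFlow, flowInt, ← integral_const_mul, ← integral_const_mul]
      refine integral_congr_ae (ae_of_all _ fun x => ?_)
      simp only [Pi.smul_apply, smul_eq_mul]
      push_cast
      ring
    rw [iteratedDeriv_zero, e1, norm_mul, Complex.norm_real, norm_mul, Real.norm_eq_abs,
      Real.norm_eq_abs, abs_of_pos (inv_pos.2 hr')]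
    calc _ ≤ C1 * (C2 / (1 + ‖Real.exp (-t) • ξ₀‖) ^ (2 * A + m)) := by
          gcongr
          · exact hC1' _ hr' ht
          · exact hC2' _
      _ = C1 * C2 * (1 / (1 + ‖Real.exp (-t) • ξ₀‖) ^ (2 * A + m)) := by ring
      _ ≤ C1 * C2 * (C3 * decayBound P A (r₀ * Real.exp t) (Real.exp (-t) • ξ₀)) := by
          gcongr
          exact hC3' _ _ hr'.le ht
      _ = _ := by ring
  | succ j ih =>
    intro φ w hφ h
    obtain ⟨C1, hC1, hC1'⟩ := ih hφ.blockOp h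
    obtain ⟨C2, hC2, hC2'⟩ := ih hφ h.divOp_sub
    refine ⟨C1 + C2, by positivity, fun r₀ ξ₀ t hr ht => ?_⟩
    have hd : deriv (constFlow F φ w r₀ ξ₀) = (-constFlow F (blockOp φ) w r₀ ξ₀) +
        constFlow F φ (fun x => divOp w x + (-1) * w x) r₀ ξ₀ :=
      funext fun s => (hasDerivAt_constFlow hφ h hr ξ₀ s).deriv
    have s1 : ContDiffAt ℝ j (-constFlow F (blockOp φ) w r₀ ξ₀) t :=
      (contDiff_constFlow_nat (F := F) j hφ.blockOp h r₀ ξ₀ hr).neg.contDiffAt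
    have s2 := (contDiff_constFlow_nat (F := F) j hφ h.divOp_sub r₀ ξ₀ hr).contDiffAt (x := t)
    rw [iteratedDeriv_succ', hd, iteratedDeriv_add s1 s2, iteratedDeriv_neg, add_mul]
    refine (norm_add_le _ _).trans (add_le_add ?_ (hC2' r₀ ξ₀ t hr ht))
    rw [norm_neg]
    exact hC1' r₀ ξ₀ t hr ht

end

section
variable {m : ℕ} {F : Fin m → ℤ} {P : MvPolynomial (Fin m) ℤ} {w : (Fin m → ℝ) → ℝ}

/-- The Hessian determinant is the product of the 6F_ix_i, so it vanishes on every coordinate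
hyperplane. The compact support of w avoids these and hence stays at a positive distance from them.
-/
theorem IsWeight.exists_isAmplitude [Nonempty (Fin m)] (h : IsWeight F w) :
    ∃ c R : ℝ, 0 < c ∧ c ≤ R ∧ IsAmplitude c R fun x => (w x : ℂ) := by
  have hne : ∀ x ∈ tsupport w, ∀ i, x i ≠ 0 := by
    intro x hx i hi
    have : x ∈ tsupport w ∩ {x | hessDet F x = 0} := by
      refine ⟨hx, ?_⟩
      simp only [mem_ofPred_eq, hessDet, Matrix.det_diagonal]
      exact Finset.prod_eq_zero (Finset.mem_univ i) (by simp [hi])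
    rw [h.disjoint] at this
    exact this
  have hmin : ∀ i, ∃ a, 0 < a ∧ ∀ x ∈ tsupport w, a ≤ |x i| := fun i =>
    h.compact.isCompact.exists_forall_le' (f := fun x : Fin m → ℝ => |x i|)
      ((continuous_apply i).abs.continuousOn) fun x hx => abs_pos.2 (hne x hx i)
  choose a ha ha' using hmin
  obtain ⟨j, hj⟩ := Finite.exists_min a
  obtain ⟨R, hR⟩ := h.compact.isCompact.exists_bound_of_continuousOn (f := fun x => x)
    continuousOn_id
  refine ⟨a j, max (a j) R, ha j, le_max_left _ _, Complex.ofRealCLM.contDiff.comp h.smooth,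
    fun x hx i => ?_⟩
  have hx' : x ∈ tsupport w := subset_tsupport w (by simpa using hx)
  exact ⟨(hj i).trans (ha' i x hx'),
    ((norm_le_pi_norm x i).trans (hR x hx')).trans (le_max_right _ _)⟩

theorem hFun_eq_zero {r y : ℝ} (hr : 1 < r) (hy : 2 * |y| < r) : hFun r y = 0 := by
  rw [hFun, ← tsum_zero]
  refine tsum_congr fun j => ?_
  have hj : (1 : ℝ) ≤ (j : ℝ) := by exact_mod_cast j.pos
  have h1 : 1 * r ≤ r * j := by nlinarith
  have z1 : omega (r * j) = 0 := by
    by_contra h; linarith [(omega_ne_zero h).2]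
  have z2 : omega (|y| / (r * j)) = 0 := by
    by_contra h
    have := (omega_ne_zero h).1
    rw [lt_div_iff₀ (by linarith)] at this
    linarith
  rw [z1, z2]; simp

/-- On the support of w the form is bounded by some M, and h(r, y) has no nonzero term once r
exceeds 1 and 2|y|. All other estimates may therefore assume r ≤ R₀. -/
theorem IsWeight.exists_Jint_eq_zero (h : IsWeight F w) : ∃ R₀ : ℝ, 0 ≤ R₀ ∧
    ∀ (X : ℝ) (c : Fin m → ℝ) (n : ℝ), R₀ < n / X ^ (3 / 2 : ℝ) → Jint F w X c n = 0 := by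
  obtain ⟨M, hM⟩ := h.compact.isCompact.exists_bound_of_continuousOn (f := form F) (by
    unfold form; fun_prop)
  refine ⟨max 1 (2 * M), zero_le_one.trans (le_max_left _ _), fun X c n hn => ?_⟩
  rw [max_lt_iff] at hn
  rw [Jint, ← integral_zero (Fin m → ℝ) ℂ]
  refine integral_congr_ae (ae_of_all _ fun x => ?_)
  simp only
  by_cases hx : x ∈ tsupport w
  · have h1 := hM x hx
    rw [Real.norm_eq_abs] at h1
    rw [hFun_eq_zero hn.1 (by linarith)]; simp
  · rw [image_eq_zero_of_notMem_tsupport hx]; simp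

/-- In h(r, y) = r⁻¹(E_ψ(1/r) − E_φ(|y|/r)) the first error does not involve x and gives
`constFlow`; the second is the Schwartz kernel b at F(x)/r. The path n = eᵗ is the flow that starts
at r₀ = X^{-3/2}, ξ₀ = Xc. -/
theorem exists_Jint_eq (F : Fin m → ℤ) : ∃ b : 𝓢(ℝ, ℂ), ∃ φ : ℝ → ℝ, IsBlock φ ∧
    ∀ (w : (Fin m → ℝ) → ℝ) (c₀ R : ℝ), IsAmplitude c₀ R (fun x => (w x : ℂ)) →
    ∀ (X : ℝ) (c : Fin m → ℝ), 0 < X → (fun t : ℝ => Jint F w X c (Real.exp t)) =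
      constFlow F φ (fun x => (w x : ℂ)) (X ^ (3 / 2 : ℝ))⁻¹ (X • c) +
        (-flowInt F (fun x => (w x : ℂ)) b (X ^ (3 / 2 : ℝ))⁻¹ (X • c)) := by
  obtain ⟨b, hb⟩ := isBlock_omega_inv_mul_inv.exists_schwartz
  refine ⟨b, _, isBlock_omega_mul_inv, fun w c₀ R hw X c hX => ?_⟩
  funext t
  have hX' : 0 < X ^ (3 / 2 : ℝ) := Real.rpow_pos_of_pos hX _
  have hr : 0 < (X ^ (3 / 2 : ℝ))⁻¹ * Real.exp t := by positivity
  have hwc := hw.smooth.continuous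
  simp only [Pi.add_apply, Pi.neg_apply]
  rw [← sub_eq_add_neg, constFlow, flowInt, flowInt, ← integral_const_mul, ← integral_sub]
  · refine integral_congr_ae (ae_of_all _ fun x => ?_)
    simp only
    rw [hb, abs_div, abs_of_pos hr,
      show Real.exp t / X ^ (3 / 2 : ℝ) = (X ^ (3 / 2 : ℝ))⁻¹ * Real.exp t by
        rw [div_eq_mul_inv, mul_comm], hFun_eq hr]
    have e1 : Complex.exp (-(2 * Real.pi * Complex.I * ((X / Real.exp t * ∑ i, c i * x i : ℝ) : ℂ))) =
        osc (-∑ i, Real.exp (-t) * (X • c) i * x i) := by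
      rw [osc]
      congr 1
      have : ∑ i, Real.exp (-t) * (X • c) i * x i = X / Real.exp t * ∑ i, c i * x i := by
        rw [Finset.mul_sum]
        refine Finset.sum_congr rfl fun i _ => ?_
        rw [Pi.smul_apply, smul_eq_mul, Real.exp_neg]
        ring
      rw [this]
      push_cast
      ring
    rw [e1]
    push_cast
    ring
  · refine Continuous.integrable_of_hasCompactSupport ?_
      (HasCompactSupport.mul_left hw.hasCompactSupport.mul_right.mul_right)
    fun_prop
  · refine Continuous.integrable_of_hasCompactSupport ?_ (hw.hasCompactSupport.mul_right.mul_right)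
    have h1 := b.continuous
    have h2 : Continuous (form F) := by unfold form; fun_prop
    fun_prop

theorem IsWeight.contDiff_Jint [Nonempty (Fin m)] (h : IsWeight F w) {X : ℝ} (hX : 0 < X)
    (c : Fin m → ℝ) : ContDiff ℝ ∞ fun t : ℝ => Jint F w X c (Real.exp t) := by
  obtain ⟨b, φ, hφ, hJ⟩ := exists_Jint_eq F
  obtain ⟨c₀, R, hc, hcR, hw⟩ := h.exists_isAmplitude
  rw [hJ w c₀ R hw X c hX]
  exact (contDiff_infty.2 fun n => contDiff_constFlow_nat n hφ hw _ _ (by positivity)).add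
    (contDiff_flowInt hw (b.smooth ⊤) _ _).neg

/-- Decay of all the derivatives of `J_{c,X}(n)`. -/
theorem IsWeight.exists_norm_iteratedDeriv_Jint_le [Nonempty (Fin m)] (hm : 3 ≤ m)
    (hF : ∀ i, F i ≠ 0) (hP : IsDualForm F P) (h : IsWeight F w) (j A : ℕ) :
    ∃ C, 0 ≤ C ∧ ∀ (X : ℝ) (c : Fin m → ℝ) (n : ℝ), 0 < X → 0 < n →
      ‖iteratedDeriv j (fun t : ℝ => Jint F w X c (Real.exp t)) (Real.log n)‖ ≤
        C * decayBound P A (n / X ^ (3 / 2 : ℝ)) ((X / n) • c) := by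
  obtain ⟨b, φ, hφ, hJ⟩ := exists_Jint_eq F
  obtain ⟨c₀, R, hc, hcR, hw⟩ := h.exists_isAmplitude
  obtain ⟨R₀, hR₀, hz⟩ := h.exists_Jint_eq_zero
  obtain ⟨C1, hC1, hC1'⟩ := exists_norm_iteratedDeriv_constFlow_le (F := F) hm P A hR₀ j hφ hw
  obtain ⟨C2, hC2, hC2'⟩ := exists_norm_iteratedDeriv_flowInt_le hm hF hP hc hcR A hR₀ j hw b
  refine ⟨C1 + C2, by positivity, fun X c n hX hn => ?_⟩
  have hX' : 0 < X ^ (3 / 2 : ℝ) := Real.rpow_pos_of_pos hX _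
  have er : (X ^ (3 / 2 : ℝ))⁻¹ * Real.exp (Real.log n) = n / X ^ (3 / 2 : ℝ) := by
    rw [Real.exp_log hn, mul_comm, ← div_eq_mul_inv]
  have eξ : Real.exp (-Real.log n) • X • c = (X / n) • c := by
    rw [Real.exp_neg, Real.exp_log hn, smul_smul, div_eq_mul_inv, mul_comm]
  rcases le_or_gt (n / X ^ (3 / 2 : ℝ)) R₀ with hR | hR
  · have s1 := (contDiff_constFlow_nat (F := F) j hφ hw (X ^ (3 / 2 : ℝ))⁻¹ (X • c)
      (by positivity)).contDiffAt (x := Real.log n)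
    have s2 := (contDiff_flowInt_nat (F := F) j hw (b.smooth ⊤) (X ^ (3 / 2 : ℝ))⁻¹ (X • c)).contDiffAt
      (x := Real.log n)
    replace s2 : ContDiffAt ℝ j (-flowInt F (fun x => (w x : ℂ)) b (X ^ (3 / 2 : ℝ))⁻¹ (X • c))
      (Real.log n) := s2.neg
    have b1 := hC1' (X ^ (3 / 2 : ℝ))⁻¹ (X • c) (Real.log n) (by positivity) (by rw [er]; exact hR)
    have b2 := hC2' (X ^ (3 / 2 : ℝ))⁻¹ (X • c) (Real.log n) (by positivity) (by rw [er]; exact hR)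
    rw [er, eξ] at b1 b2
    rw [hJ w c₀ R hw X c hX, iteratedDeriv_add s1 s2, iteratedDeriv_neg, add_mul]
    refine (norm_add_le _ _).trans (add_le_add b1 ?_)
    rw [norm_neg]
    exact b2
  · have : (fun t : ℝ => Jint F w X c (Real.exp t)) =ᶠ[nhds (Real.log n)] fun _ => 0 := by
      have hc' : ContinuousAt (fun t => Real.exp t / X ^ (3 / 2 : ℝ)) (Real.log n) := by fun_prop
      have : ∀ᶠ t in nhds (Real.log n), R₀ < Real.exp t / X ^ (3 / 2 : ℝ) :=
        hc'.eventually_const_lt (by beta_reduce; rw [Real.exp_log hn]; exact hR)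
      filter_upwards [this] with t ht using hz X c _ ht
    rw [this.iteratedDeriv_eq]
    have h0 : iteratedDeriv j (fun _ : ℝ => (0 : ℂ)) (Real.log n) = 0 := by
      rw [iteratedDeriv_const]; simp
    rw [h0, norm_zero]
    exact mul_nonneg (by positivity) (decayBound_nonneg P A (by positivity) _)

end

/-! ### Existence of admissible weights -/

/-- A positive Schwartz function that is large on dyadic shells. -/
theorem exists_schwartz_ge {E : Type*} [NormedAddCommGroup E] [NormedSpace ℝ E]
    [FiniteDimensional ℝ E] {e : ℕ → ℝ} (he : ∀ k, 0 < e k)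
    (hs : ∀ K : ℕ, Summable fun k => e k * (2 ^ k) ^ K) :
    ∃ ν : 𝓢(E, ℝ), (∀ a, 0 < ν a) ∧ ∀ k a, ‖a‖ ≤ 2 ^ (k + 1) → e k ≤ ν a := by
  -- The inner radius 2 makes the k-th summand equal to e_k on the whole ball of radius 2^{k+1}.
  let f : ContDiffBump (0 : E) := ⟨2, 3, by norm_num, by norm_num⟩
  let γ : 𝓢(E, ℝ) := f.hasCompactSupport.toSchwartzMap f.contDiff
  have hγ : ∀ a, γ a = f a := fun a => rfl
  have hγ0 : ∀ a, 0 ≤ γ a := fun a => f.nonneg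
  set h : ℕ → E → ℝ := fun k a => e k • γ (((2 ^ k)⁻¹ : ℝ) • a) with hh
  have hsm : ∀ k, ContDiff ℝ ∞ (h k) := fun k =>
    contDiff_const.smul (f := fun _ => e k)
      ((γ.smooth ⊤).comp (contDiff_const_smul ((2 ^ k)⁻¹ : ℝ)))
  have hC : ∀ K n : ℕ, ∃ C, 0 ≤ C ∧ ∀ k a, ‖a‖ ^ K * ‖iteratedFDeriv ℝ n (h k) a‖ ≤
      C * (e k * (2 ^ k) ^ K) := by
    intro K n
    obtain ⟨C, hC, hC'⟩ := γ.decay K n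
    refine ⟨C, hC.le, fun k a => ?_⟩
    set s : ℝ := (2 ^ k)⁻¹ with hs
    have hs0 : 0 < s := by positivity
    have hs1 : s ≤ 1 := inv_le_one_of_one_le₀ (one_le_pow₀ (by norm_num))
    set L : E →L[ℝ] E := s • ContinuousLinearMap.id ℝ E with hL
    have hLn : ‖L‖ ≤ 1 := by
      rw [hL, norm_smul, Real.norm_of_nonneg hs0.le]
      exact mul_le_one₀ hs1 (norm_nonneg _) ContinuousLinearMap.norm_id_le
    have e1 : h k = e k • (γ ∘ L) := by
      funext a; simp [hh, hL, s]
    have e2 : ‖iteratedFDeriv ℝ n (h k) a‖ ≤ e k * ‖iteratedFDeriv ℝ n γ (s • a)‖ := by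
      rw [e1, iteratedFDeriv_const_smul_apply
        (((γ.smooth n).comp L.contDiff).contDiffAt), norm_smul, Real.norm_of_nonneg (he k).le]
      refine mul_le_mul_of_nonneg_left ?_ (he k).le
      rw [L.iteratedFDeriv_comp_right (γ.smooth n) a le_rfl]
      refine (ContinuousMultilinearMap.norm_compContinuousLinearMap_le _ _).trans ?_
      have : L a = s • a := by simp [hL]
      rw [this]
      refine mul_le_of_le_one_right (norm_nonneg _) ?_
      exact Finset.prod_le_one (fun _ _ => norm_nonneg _) fun _ _ => hLn
    have e3 : ‖a‖ = 2 ^ k * ‖s • a‖ := by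
      rw [norm_smul, Real.norm_of_nonneg hs0.le, hs]
      field_simp
    calc ‖a‖ ^ K * ‖iteratedFDeriv ℝ n (h k) a‖
        ≤ (2 ^ k * ‖s • a‖) ^ K * (e k * ‖iteratedFDeriv ℝ n γ (s • a)‖) := by
          rw [← e3]; gcongr
      _ = (‖s • a‖ ^ K * ‖iteratedFDeriv ℝ n γ (s • a)‖) * (e k * (2 ^ k) ^ K) := by
          rw [mul_pow]; ring
      _ ≤ _ := by
          have := (he k).le
          gcongr
          exact hC' _
  choose C hC0 hC' using hC
  have hv : ∀ n : ℕ, ((n : ℕ∞)) ≤ ⊤ → Summable fun k => C 0 n * (e k * (2 ^ k) ^ 0) := fun n _ =>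
    (hs 0).mul_left _
  have hb : ∀ (n : ℕ) (k : ℕ) (a : E), (n : ℕ∞) ≤ ⊤ → ‖iteratedFDeriv ℝ n (h k) a‖ ≤
      C 0 n * (e k * (2 ^ k) ^ 0) := fun n k a _ => by
    simpa using hC' 0 n k a
  have hsum : ∀ a, Summable fun k => h k a := fun a => by
    refine Summable.of_norm_bounded (hv 0 le_top) fun k => ?_
    have := hb 0 k a le_top
    rwa [norm_iteratedFDeriv_zero] at this
  have hh0 : ∀ k a, 0 ≤ h k a := fun k a => mul_nonneg (he k).le (hγ0 _)
  let ν : 𝓢(E, ℝ) := ⟨fun a => ∑' k, h k a, contDiff_tsum (N := ⊤) hsm hv hb, fun K n => by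
    refine ⟨∑' k, C K n * (e k * (2 ^ k) ^ K), fun a => ?_⟩
    rw [iteratedFDeriv_tsum_apply (N := ⊤) hsm hv hb le_top]
    have s1 : Summable fun k => ‖iteratedFDeriv ℝ n (h k) a‖ :=
      Summable.of_nonneg_of_le (fun _ => norm_nonneg _) (fun k => hb n k a le_top) (hv n le_top)
    calc _ ≤ ‖a‖ ^ K * ∑' k, ‖iteratedFDeriv ℝ n (h k) a‖ := by
          gcongr; exact norm_tsum_le_tsum_norm s1
      _ = ∑' k, ‖a‖ ^ K * ‖iteratedFDeriv ℝ n (h k) a‖ := tsum_mul_left.symm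
      _ ≤ _ := (s1.mul_left _).tsum_le_tsum (fun k => hC' K n k a) ((hs K).mul_left _)⟩
  have hge : ∀ k a, ‖a‖ ≤ 2 ^ (k + 1) → e k ≤ ν a := by
    intro k a ha
    have h1 : h k a ≤ ∑' k, h k a := (hsum a).le_tsum k fun j _ => hh0 j a
    have h2 : γ (((2 ^ k)⁻¹ : ℝ) • a) = 1 := by
      rw [hγ]
      refine f.one_of_mem_closedBall ?_
      rw [mem_closedBall_zero_iff, norm_smul, norm_inv, norm_pow, Real.norm_two]
      change _ ≤ (2 : ℝ)
      rw [inv_mul_le_iff₀ (by positivity), ← pow_succ]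
      exact ha
    have h3 : h k a = e k := by simp only [hh, h2, smul_eq_mul, mul_one]
    rw [← h3]
    exact h1
  refine ⟨ν, fun a => ?_, hge⟩
  obtain ⟨k, -, hk⟩ := exists_nat_pow_near (x := max 1 ‖a‖) (y := 2) (le_max_left _ _) (by norm_num)
  exact (he k).trans_le (hge k a ((le_max_right _ _).trans hk.le))

/-- A positive Schwartz function dominates countably many rates of rapid decay. -/
theorem exists_schwartz_dominating {E : Type*} [NormedAddCommGroup E] [NormedSpace ℝ E]
    [FiniteDimensional ℝ E] {C : ℕ → ℕ → ℝ} (hC : ∀ j A, 0 ≤ C j A) :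
    ∃ ν : 𝓢(E, ℝ), (∀ a, 0 < ν a) ∧ ∀ j, ∃ K, ∀ (a b : E) (M y : ℝ), 0 ≤ M →
      (∀ A, y ≤ C j A * (M / ((1 + ‖a‖) ^ A * (1 + ‖b‖) ^ A))) →
      y ≤ K * M * ν a ^ 3 * ν b := by
  -- The factor 2^{A²} keeps the infimum φ_k below at least 2^{-k²}, because kA ≤ k² + A². The sum
  -- makes D_A dominate C_{j,A} for all j ≤ A.
  set D : ℕ → ℝ := fun A => 2 ^ (A ^ 2) * (1 + ∑ j ∈ Finset.range (A + 1), C j A) with hD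
  have hsum0 : ∀ A, 0 ≤ ∑ j ∈ Finset.range (A + 1), C j A := fun A =>
    Finset.sum_nonneg fun j _ => hC j A
  have hD2 : ∀ A, 2 ^ (A ^ 2) ≤ D A := fun A =>
    le_mul_of_one_le_right (by positivity) (by linarith [hsum0 A])
  have hD1 : ∀ A, 1 ≤ D A := fun A => (one_le_pow₀ (by norm_num)).trans (hD2 A)
  have hDC : ∀ j A, j ≤ A → C j A ≤ D A := fun j A hj => by
    have h1 : C j A ≤ ∑ j ∈ Finset.range (A + 1), C j A :=
      Finset.single_le_sum (f := fun j => C j A) (fun j _ => hC j A)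
        (Finset.mem_range.2 (by omega))
    have h2 : (1 : ℝ) ≤ 2 ^ (A ^ 2) := one_le_pow₀ (by norm_num)
    simp only [hD]
    nlinarith [hsum0 A]
  set φ : ℕ → ℝ := fun k => ⨅ A : ℕ, D A / (2 ^ k) ^ A with hφ
  have hbdd : ∀ k, BddBelow (range fun A : ℕ => D A / ((2 : ℝ) ^ k) ^ A) := fun k =>
    ⟨0, by rintro _ ⟨A, rfl⟩; have := hD1 A; positivity⟩
  have hφle : ∀ k A, φ k ≤ D A / (2 ^ k) ^ A := fun k A => ciInf_le (hbdd k) A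
  have hφ0 : ∀ k, 0 < φ k := fun k => by
    refine lt_of_lt_of_le (show (0 : ℝ) < (2 ^ (k ^ 2))⁻¹ by positivity) (le_ciInf fun A => ?_)
    rw [le_div_iff₀ (by positivity), inv_mul_le_iff₀ (by positivity)]
    refine le_trans ?_ (mul_le_mul_of_nonneg_left (hD2 A) (by positivity))
    rw [← pow_mul, ← pow_add]
    refine pow_le_pow_right₀ (by norm_num) ?_
    nlinarith [sq_nonneg ((k : ℤ) - A), sq_nonneg (k - A), Nat.zero_le (k * A), two_mul_le_add_sq k A]
  -- A fourth root, because the target is ν(a)³ν(b) with both values at least e_k, and e_k⁴ = φ_k.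
  -- It still decays faster than any power of 2^k.
  set e : ℕ → ℝ := fun k => √(√(φ k)) with he
  have he0 : ∀ k, 0 < e k := fun k => Real.sqrt_pos.2 (Real.sqrt_pos.2 (hφ0 k))
  have he4 : ∀ k, e k ^ 4 = φ k := fun k => by
    rw [show (4 : ℕ) = 2 * 2 by norm_num, pow_mul, he]
    simp only
    rw [Real.sq_sqrt (Real.sqrt_nonneg _), Real.sq_sqrt (hφ0 k).le]
  have hes : ∀ K : ℕ, Summable fun k => e k * (2 ^ k) ^ K := by
    intro K
    refine Summable.of_nonneg_of_le (fun k => mul_nonneg (he0 k).le (by positivity)) (fun k => ?_)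
      (summable_geometric_two.mul_left (D (4 * (K + 1))))
    have h1 : e k ≤ D (4 * (K + 1)) / (2 ^ k) ^ (K + 1) := by
      have hd := hD1 (4 * (K + 1))
      rw [← pow_le_pow_iff_left₀ (he0 k).le (by positivity) (n := 4) (by norm_num), he4]
      refine (hφle k (4 * (K + 1))).trans ?_
      rw [div_pow, ← pow_mul _ (K + 1) 4, mul_comm (K + 1) 4]
      gcongr
      exact le_self_pow₀ hd (by norm_num)
    calc e k * (2 ^ k) ^ K ≤ D (4 * (K + 1)) / (2 ^ k) ^ (K + 1) * (2 ^ k) ^ K := by gcongr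
      _ = D (4 * (K + 1)) * (1 / 2) ^ k := by
        rw [pow_succ, one_div, inv_pow]; field_simp
  obtain ⟨ν, hν, hν'⟩ := exists_schwartz_ge (E := E) he0 hes
  refine ⟨ν, hν, fun j => ⟨1 + C j j, fun a b M y hM hy => ?_⟩⟩
  have hCj := hC j j
  obtain ⟨k, hk, hk'⟩ := exists_nat_pow_near (x := max (1 + ‖a‖) (1 + ‖b‖)) (y := 2)
    ((le_add_of_nonneg_right (norm_nonneg a)).trans (le_max_left _ _)) (by norm_num)
  have hka : ‖a‖ ≤ 2 ^ (k + 1) := by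
    have := (le_max_left _ _).trans hk'.le; linarith
  have hkb : ‖b‖ ≤ 2 ^ (k + 1) := by
    have := (le_max_right _ _).trans hk'.le; linarith
  have hprod : (2 : ℝ) ^ k ≤ (1 + ‖a‖) * (1 + ‖b‖) := by
    refine hk.trans (max_le ?_ ?_) <;> nlinarith [norm_nonneg a, norm_nonneg b]
  have hy' : ∀ A, y ≤ C j A * M / (2 ^ k) ^ A := fun A => by
    refine (hy A).trans ?_
    rw [← mul_pow, ← mul_div_assoc]
    have := hC j A
    gcongr
  have hyφ : y ≤ (1 + C j j) * M * φ k := by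
    rw [hφ]
    simp only
    rw [Real.mul_iInf_of_nonneg (by positivity)]
    refine le_ciInf fun A => ?_
    have hd := hD1 A
    -- For A ≥ j the constant D_A majorizes C_{j,A}. For the finitely many A ≤ j the estimate of
    -- order j is already stronger, at the cost of the constant C_{j,j}.
    rcases le_total j A with h | h
    · calc y ≤ C j A * M / (2 ^ k) ^ A := hy' A
        _ ≤ D A * M / (2 ^ k) ^ A := by gcongr; exact hDC j A h
        _ = 1 * M * (D A / (2 ^ k) ^ A) := by ring
        _ ≤ _ := by gcongr; linarith
    · calc y ≤ C j j * M / (2 ^ k) ^ j := hy' j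
        _ ≤ C j j * M / (2 ^ k) ^ A := by
          gcongr
          exact one_le_pow₀ (by norm_num)
        _ = C j j * M * (1 / (2 ^ k) ^ A) := by ring
        _ ≤ (1 + C j j) * M * (D A / (2 ^ k) ^ A) := by gcongr; linarith
  calc y ≤ (1 + C j j) * M * (e k ^ 3 * e k) := by rw [← pow_succ, he4]; exact hyφ
    _ ≤ (1 + C j j) * M * (ν a ^ 3 * ν b) := by
      have h1 := hν' k a hka
      have h2 := hν' k b hkb
      have h3 := (he0 k).le
      have h4 := (hν a).le
      gcongr
    _ = _ := by ring

/-- Admissible decay weights exist. -/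
theorem IsWeight.exists_isAdmissible {m : ℕ} [Nonempty (Fin m)] (hm : 3 ≤ m) {F : Fin m → ℤ}
    {P : MvPolynomial (Fin m) ℤ} {w : (Fin m → ℝ) → ℝ} (hF : ∀ i, F i ≠ 0) (hP : IsDualForm F P)
    (h : IsWeight F w) : ∃ ν : SchwartzMap (Fin m → ℝ) ℝ, IsAdmissible F P w ν := by
  choose C hC hC' using fun j A => h.exists_norm_iteratedDeriv_Jint_le hm hF hP j A
  obtain ⟨ν, hν, hν'⟩ := exists_schwartz_dominating (E := Fin m → ℝ) hC
  refine ⟨ν, hν, fun j => ?_⟩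
  obtain ⟨K, hK⟩ := hν' j
  refine ⟨K, fun X c n hX hn => hK _ _ _ _ (by
    have := le_max_left (1 : ℝ) (X * ‖c‖ / n)
    have : 0 ≤ max (1 : ℝ) (X * ‖c‖ / n) := by linarith
    positivity) fun A => ?_⟩
  have hXn : 0 < X / n := by positivity
  have hX' : 0 < X ^ (3 / 2 : ℝ) := Real.rpow_pos_of_pos hX _
  have hX2 : 0 < X ^ (1 / 2 : ℝ) := Real.rpow_pos_of_pos hX _
  have h1 := hC' j A X c n hX hn
  have e0 : ‖(X / n) • c‖ = X * ‖c‖ / n := by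
    rw [norm_smul, Real.norm_of_nonneg hXn.le]; ring
  -- Here r‖ξ‖ becomes ‖c‖/X^{1/2}, independently of n.
  have e1 : n / X ^ (3 / 2 : ℝ) * (X * ‖c‖ / n) = ‖(X ^ (1 / 2 : ℝ))⁻¹ • c‖ := by
    rw [norm_smul, norm_inv, Real.norm_of_nonneg hX2.le]
    have : X ^ (3 / 2 : ℝ) = X ^ (1 / 2 : ℝ) * X := by
      rw [← Real.rpow_add_one hX.ne']; norm_num
    rw [this]
    field_simp
  have e2 : ‖(X / n) • c‖⁻¹ • ((X / n) • c) = ‖c‖⁻¹ • c := by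
    rw [norm_smul, Real.norm_of_nonneg hXn.le, smul_smul, mul_inv, mul_right_comm,
      inv_mul_cancel₀ hXn.ne', one_mul]
  have e3 : X * ‖c‖ / n * |dualReal P (‖c‖⁻¹ • c)| =
      ‖(X / n * |dualReal P (‖c‖⁻¹ • c)|) • c‖ := by
    rw [norm_smul, Real.norm_of_nonneg (by positivity)]; ring
  rw [decayBound, e2, e0, e1, e3] at h1
  exact h1

/-! ### Mellin transforms of the dyadic weights -/

/-- Repeated integration by parts in `∫ j(u) g(u) e^{su} du`. -/
theorem exists_pow_mul_norm_integral_mul_exp_le {α β : ℝ} (k : ℕ) : ∀ g : ℝ → ℂ, ContDiff ℝ ∞ g →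
    (∀ u, g u ≠ 0 → u ∈ Icc α β) → ∃ C, 0 ≤ C ∧ ∀ (j : ℝ → ℂ) (B : ℝ), ContDiff ℝ ∞ j →
      (∀ i ≤ k, ∀ u ∈ Icc α β, ‖iteratedDeriv i j u‖ ≤ B) → ∀ s : ℂ, s.re = 0 →
      ‖s‖ ^ k * ‖∫ u : ℝ, j u * g u * Complex.exp (s * u)‖ ≤ C * B := by
  have hexp : ∀ (s : ℂ) (u : ℝ), s.re = 0 → ‖Complex.exp (s * u)‖ = 1 := fun s u hs => by
    rw [Complex.norm_exp]; simp [hs]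
  induction k with
  | zero =>
    intro g hg hgs
    have hgc : HasCompactSupport g :=
      HasCompactSupport.of_support_subset_isCompact isCompact_Icc fun u hu => hgs u hu
    have hgi := hg.continuous.integrable_of_hasCompactSupport hgc (μ := volume)
    refine ⟨∫ u, ‖g u‖, integral_nonneg fun _ => norm_nonneg _, fun j B hj hB s hs => ?_⟩
    rw [pow_zero, one_mul, mul_comm, ← integral_const_mul]
    refine norm_integral_le_of_norm_le (hgi.norm.const_mul B) (ae_of_all _ fun u => ?_)
    rw [norm_mul, norm_mul, hexp s u hs, mul_one]
    by_cases hu : g u = 0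
    · simp [hu]
    · have := hB 0 le_rfl u (hgs u hu)
      rw [iteratedDeriv_zero] at this
      gcongr
  | succ k ih =>
    intro g hg hgs
    have hg' : ContDiff ℝ ∞ (deriv g) := by simpa using hg.iterate_deriv 1
    have hgs' : ∀ u, deriv g u ≠ 0 → u ∈ Icc α β := fun u hu =>
      (closure_minimal (fun x hx => hgs x hx) isClosed_Icc : tsupport g ⊆ Icc α β)
        (support_deriv_subset hu)
    obtain ⟨C1, hC1, hC1'⟩ := ih g hg hgs
    obtain ⟨C2, hC2, hC2'⟩ := ih (deriv g) hg' hgs'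
    refine ⟨C1 + C2, by positivity, fun j B hj hB s hs => ?_⟩
    have hj' : ContDiff ℝ ∞ (deriv j) := by simpa using hj.iterate_deriv 1
    have b1 := hC1' (deriv j) B hj' (fun i hi u hu => by
      rw [← iteratedDeriv_succ']; exact hB (i + 1) (by omega) u hu) s hs
    have b2 := hC2' j B hj (fun i hi u hu => hB i (by omega) u hu) s hs
    have int : ∀ f h : ℝ → ℂ, Continuous f → Continuous h → (∀ u, h u ≠ 0 → u ∈ Icc α β) →
        Integrable fun u : ℝ => f u * h u * Complex.exp (s * u) := by
      intro f h hf hh hhs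
      refine Continuous.integrable_of_hasCompactSupport (by fun_prop) ?_
      have : HasCompactSupport h :=
        HasCompactSupport.of_support_subset_isCompact isCompact_Icc fun u hu => hhs u hu
      exact this.mul_left.mul_right
    have i0 := int j g hj.continuous hg.continuous hgs
    have i1 := int (deriv j) g hj'.continuous hg.continuous hgs
    have i2 := int j (deriv g) hj.continuous hg'.continuous hgs'
    have hd : ∀ u : ℝ, HasDerivAt (fun u : ℝ => j u * g u * Complex.exp (s * u))
        ((deriv j u * g u * Complex.exp (s * u) + j u * deriv g u * Complex.exp (s * u)) +
          s * (j u * g u * Complex.exp (s * u))) u := fun u => by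
      have h1 : HasDerivAt (fun u : ℝ => Complex.exp (s * u)) (s * Complex.exp (s * u)) u := by
        have := ((Complex.ofRealCLM.hasDerivAt (x := u)).const_mul s).cexp
        refine this.congr_deriv ?_
        simp; ring
      refine (((hj.differentiable (by simp) u).hasDerivAt.mul
        (hg.differentiable (by simp) u).hasDerivAt).mul h1).congr_deriv ?_
      simp only [Pi.mul_apply]
      ring
    have h0 := integral_eq_zero_of_hasDerivAt_of_integrable hd ((i1.add i2).add (i0.const_mul s)) i0
    have e1 : ∫ u : ℝ, ((deriv j u * g u * Complex.exp (s * u) + j u * deriv g u * Complex.exp (s * u)) +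
        s * (j u * g u * Complex.exp (s * u))) = ((∫ u : ℝ, deriv j u * g u * Complex.exp (s * u)) +
        ∫ u : ℝ, j u * deriv g u * Complex.exp (s * u)) + s * ∫ u : ℝ, j u * g u * Complex.exp (s * u) := by
      rw [← integral_const_mul, ← integral_add i1 i2]
      exact integral_add (i1.add i2) (i0.const_mul s)
    rw [e1] at h0
    have h2 : ‖s‖ * ‖∫ u : ℝ, j u * g u * Complex.exp (s * u)‖ ≤
        ‖∫ u : ℝ, deriv j u * g u * Complex.exp (s * u)‖ +
        ‖∫ u : ℝ, j u * deriv g u * Complex.exp (s * u)‖ := by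
      rw [← norm_mul, ← norm_neg, ← eq_neg_of_add_eq_zero_left h0]
      exact norm_add_le _ _
    calc _ = ‖s‖ ^ k * (‖s‖ * ‖∫ u : ℝ, j u * g u * Complex.exp (s * u)‖) := by ring
      _ ≤ ‖s‖ ^ k * _ := mul_le_mul_of_nonneg_left h2 (by positivity)
      _ ≤ _ := by rw [mul_add, add_mul]; exact add_le_add b1 b2

theorem integral_Ioi_eq_integral_exp {f : ℝ → ℂ} {N : ℝ} (hN : 0 < N) :
    ∫ t in Ioi (0 : ℝ), f t = ∫ u : ℝ, ((N * Real.exp u : ℝ) : ℂ) * f (N * Real.exp u) := by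
  have himg : (fun u : ℝ => N * Real.exp u) '' univ = Ioi 0 := by
    rw [image_univ]
    ext t
    refine ⟨?_, fun ht => ⟨Real.log (t / N), ?_⟩⟩
    · rintro ⟨u, rfl⟩; exact mul_pos hN (Real.exp_pos u)
    · have ht' : (0 : ℝ) < t := ht
      simp only
      rw [Real.exp_log (by positivity)]; field_simp
  have hinj : univ.InjOn fun u : ℝ => N * Real.exp u := fun u _ v _ h =>
    Real.exp_injective (mul_left_cancel₀ hN.ne' h)
  rw [← himg, integral_image_eq_integral_abs_deriv_smul MeasurableSet.univ
    (fun x _ => ((Real.hasDerivAt_exp x).const_mul N).hasDerivWithinAt) hinj, Measure.restrict_univ]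
  refine integral_congr_ae (ae_of_all _ fun u => ?_)
  simp only
  rw [abs_of_pos (by positivity), Complex.real_smul]

theorem IsCutoff.exists_support {D : ℝ → ℝ} (hD : IsCutoff D) :
    ∃ a b M : ℝ, 0 < a ∧ a < b ∧ 0 ≤ M ∧ (∀ r, D r ≠ 0 → a ≤ r ∧ r ≤ b) ∧ ∀ r, |D r| ≤ M := by
  obtain ⟨a, ha, ha'⟩ := hD.compact.isCompact.exists_forall_le' (f := fun x : ℝ => x)
    continuousOn_id (a := 0) fun x hx => hD.support_pos hx
  obtain ⟨b, hb⟩ := hD.compact.isCompact.exists_bound_of_continuousOn (f := fun x : ℝ => x)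
    continuousOn_id
  obtain ⟨M, hM⟩ := hD.compact.exists_bound_of_continuous hD.smooth.continuous
  refine ⟨a, max b (a + 1), M, ha, lt_max_of_lt_right (by linarith), (abs_nonneg _).trans (hM 0),
    fun r hr => ?_, hM⟩
  have hr' := subset_tsupport D hr
  exact ⟨ha' r hr', ((le_abs_self r).trans (hb r hr')).trans (le_max_left _ _)⟩

/-- The Mellin transform in one variable. -/
theorem exists_norm_mellin_le {D : ℝ → ℝ} (hD : IsCutoff D) {a b : ℝ} (ha : 0 < a)
    (hab : ∀ r, D r ≠ 0 → a ≤ r ∧ r ≤ b) (e : ℝ) (k : ℕ) :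
    ∃ C, 0 ≤ C ∧ ∀ (G : ℝ → ℂ) (p N B : ℝ), ContDiff ℝ ∞ (fun t => G (Real.exp t)) → 0 < p → 0 < N →
      (∀ i ≤ k, ∀ n ∈ Icc (p * N * a) (p * N * b),
        ‖iteratedDeriv i (fun t => G (Real.exp t)) (Real.log n)‖ ≤ B) → ∀ s : ℂ, s.re = 0 →
      ‖∫ t in Ioi (0 : ℝ), ((t ^ e : ℝ) : ℂ) * G (p * t) * (D (t / N) : ℂ) * (t : ℂ) ^ s *
        ((t⁻¹ : ℝ) : ℂ)‖ ≤ C * B * N ^ e / (1 + ‖s‖) ^ k := by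
  set g : ℝ → ℂ := fun u => ((Real.exp (e * u) * D (Real.exp u) : ℝ) : ℂ) with hg
  have hgs : ContDiff ℝ ∞ g := by
    have h1 : ContDiff ℝ ∞ fun u => D (Real.exp u) := hD.smooth.comp Real.contDiff_exp
    have h2 : ContDiff ℝ ∞ fun u : ℝ => Real.exp (e * u) := by fun_prop
    exact Complex.ofRealCLM.contDiff.comp (h2.mul h1)
  have hgsupp : ∀ u, g u ≠ 0 → u ∈ Icc (Real.log a) (Real.log b) := fun u hu => by
    have h1 := hab _ (right_ne_zero_of_mul (Complex.ofReal_ne_zero.1 hu))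
    exact ⟨(Real.log_le_iff_le_exp ha).2 h1.1,
      (Real.le_log_iff_exp_le (ha.trans_le (h1.1.trans h1.2))).2 h1.2⟩
  obtain ⟨C0, hC0, hC0'⟩ := exists_pow_mul_norm_integral_mul_exp_le 0 g hgs hgsupp
  obtain ⟨C1, hC1, hC1'⟩ := exists_pow_mul_norm_integral_mul_exp_le k g hgs hgsupp
  refine ⟨2 ^ k * (C0 + C1), by positivity, fun G p N B hG hp hN hB s hs => ?_⟩
  have hpN : 0 < p * N := by positivity
  set j : ℝ → ℂ := fun u => G (Real.exp (u + Real.log (p * N))) with hj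
  have hjs : ContDiff ℝ ∞ j := hG.comp (contDiff_id.add contDiff_const)
  have hjd : ∀ i u, iteratedDeriv i j u =
      iteratedDeriv i (fun t => G (Real.exp t)) (u + Real.log (p * N)) := fun i u => by
    have := congrFun (iteratedDeriv_comp_add_const i (fun t => G (Real.exp t)) (Real.log (p * N))) u
    exact this
  have hjB : ∀ i ≤ k, ∀ u ∈ Icc (Real.log a) (Real.log b), ‖iteratedDeriv i j u‖ ≤ B := by
    intro i hi u hu
    rw [hjd]
    have h1 := hB i hi (p * N * Real.exp u) ⟨by
      gcongr; exact (Real.log_le_iff_le_exp ha).1 hu.1, by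
      gcongr
      by_cases hb : 0 < b
      · exact (Real.le_log_iff_exp_le hb).1 hu.2
      · exfalso
        have : ∀ r, D r = 0 := fun r => by
          by_contra h; linarith [hab r h]
        have h2 := hD.normalized
        simp [this] at h2⟩
    rw [Real.log_mul hpN.ne' (Real.exp_pos u).ne', Real.log_exp, add_comm] at h1
    exact h1
  have h0 := hC0' j B hjs (fun i hi => hjB i (by omega)) s hs
  have h1 := hC1' j B hjs hjB s hs
  rw [pow_zero, one_mul] at h0
  set I := ∫ u : ℝ, j u * g u * Complex.exp (s * u) with hI
  have e1 : ∫ t in Ioi (0 : ℝ), ((t ^ e : ℝ) : ℂ) * G (p * t) * (D (t / N) : ℂ) * (t : ℂ) ^ s *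
        ((t⁻¹ : ℝ) : ℂ) = ((N ^ e : ℝ) : ℂ) * (N : ℂ) ^ s * I := by
    rw [integral_Ioi_eq_integral_exp hN, hI, ← integral_const_mul]
    refine integral_congr_ae (ae_of_all _ fun u => ?_)
    have hu := Real.exp_pos u
    simp only [hj, hg]
    have e2 : N * Real.exp u / N = Real.exp u := by field_simp
    have e3 : (N * Real.exp u) ^ e = N ^ e * Real.exp (e * u) := by
      rw [Real.mul_rpow hN.le hu.le, ← Real.exp_mul, mul_comm u e]
    have e4 : ((N * Real.exp u : ℝ) : ℂ) ^ s = (N : ℂ) ^ s * Complex.exp (s * u) := by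
      rw [Complex.ofReal_mul, Complex.mul_cpow_ofReal_nonneg hN.le hu.le,
        Complex.cpow_def_of_ne_zero (Complex.ofReal_ne_zero.2 hu.ne'), ← Complex.ofReal_log hu.le,
        Real.log_exp, mul_comm (u : ℂ)]
    have e5 : Real.exp (u + Real.log (p * N)) = p * (N * Real.exp u) := by
      rw [Real.exp_add, Real.exp_log hpN]; ring
    have e6 : ((N * Real.exp u : ℝ) : ℂ) * (((N * Real.exp u)⁻¹ : ℝ) : ℂ) = 1 := by
      rw [← Complex.ofReal_mul, mul_inv_cancel₀ (by positivity), Complex.ofReal_one]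
    rw [e2, e3, e4, e5]
    push_cast at e6 ⊢
    linear_combination (((N ^ e : ℝ) : ℂ) * Complex.exp (e * u) * G (p * (N * Real.exp u)) *
      D (Real.exp u) * ((N : ℂ) ^ s * Complex.exp (s * u))) * e6
  have hNs : ‖(N : ℂ) ^ s‖ = 1 := by
    rw [Complex.norm_cpow_eq_rpow_re_of_pos hN, hs, Real.rpow_zero]
  have hNe : 0 < N ^ e := Real.rpow_pos_of_pos hN e
  rw [e1, norm_mul, norm_mul, hNs, mul_one, Complex.norm_real, Real.norm_of_nonneg hNe.le,
    le_div_iff₀ (by positivity)]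
  have h2 : (1 + ‖s‖) ^ k ≤ 2 ^ k * (1 + ‖s‖ ^ k) := by
    have hs0 := norm_nonneg s
    rcases le_total ‖s‖ 1 with h | h
    · calc (1 + ‖s‖) ^ k ≤ 2 ^ k := pow_le_pow_left₀ (by positivity) (by linarith) _
        _ ≤ _ := le_mul_of_one_le_right (by positivity) (by linarith [pow_nonneg hs0 k])
    · calc (1 + ‖s‖) ^ k ≤ (2 * ‖s‖) ^ k := pow_le_pow_left₀ (by positivity) (by linarith) _
        _ = 2 ^ k * ‖s‖ ^ k := mul_pow _ _ _
        _ ≤ _ := by gcongr; linarith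
  calc N ^ e * ‖I‖ * (1 + ‖s‖) ^ k ≤ N ^ e * ‖I‖ * (2 ^ k * (1 + ‖s‖ ^ k)) := by gcongr
    _ = N ^ e * 2 ^ k * (‖I‖ + ‖s‖ ^ k * ‖I‖) := by ring
    _ ≤ N ^ e * 2 ^ k * (C0 * B + C1 * B) := by gcongr
    _ = _ := by ring

/-- The outer variable runs over [aN, bN], a set of bounded dx/x-measure on which x^e is of order
N^e, so a bound for the inner integral is enough. -/
theorem exists_norm_integral_prod_le {D : ℝ → ℝ} (hD : IsCutoff D) (e : ℝ) :
    ∃ C, 0 ≤ C ∧ ∀ (f : ℝ × ℝ → ℂ) (N Q : ℝ), 0 < N → 0 ≤ Q →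
      (∀ x, 0 < x → ‖∫ y in Ioi (0 : ℝ), f (x, y)‖ ≤ x ^ e * |D (x / N)| * x⁻¹ * Q) →
      ‖∫ p in Ioi (0 : ℝ) ×ˢ Ioi (0 : ℝ), f p‖ ≤ C * N ^ e * Q := by
  obtain ⟨a, b, M, ha, hab, hM, hDs, hDM⟩ := hD.exists_support
  have hb : 0 < b := ha.trans hab
  have hae := (Real.rpow_pos_of_pos ha e).le
  have hbe := (Real.rpow_pos_of_pos hb e).le
  refine ⟨(a ^ e + b ^ e) * M * a⁻¹ * b, by positivity, fun f N Q hN hQ h => ?_⟩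
  have hNe := (Real.rpow_pos_of_pos hN e).le
  -- Integrability need not be verified: otherwise the integral is 0 by convention and the bound is
  -- trivial.
  by_cases hf : IntegrableOn f (Ioi (0 : ℝ) ×ˢ Ioi (0 : ℝ)) (volume.prod volume)
  swap
  · rw [Measure.volume_eq_prod, integral_undef hf, norm_zero]
    positivity
  rw [Measure.volume_eq_prod, setIntegral_prod _ hf]
  have h1 : ∀ x, 0 < x → D (x / N) ≠ 0 → a * N ≤ x ∧ x ≤ b * N := fun x hx hx' => by
    have := hDs _ hx'
    rwa [le_div_iff₀ hN, div_le_iff₀ hN] at this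
  have h2 : ∫ x in Ioi (0 : ℝ), ∫ y in Ioi (0 : ℝ), f (x, y) =
      ∫ x in Icc (a * N) (b * N), ∫ y in Ioi (0 : ℝ), f (x, y) := by
    apply setIntegral_eq_of_subset_of_forall_sdiff_eq_zero measurableSet_Ioi
    · intro x hx
      exact lt_of_lt_of_le (mul_pos ha hN) hx.1
    · intro x hx
      have h0 : D (x / N) = 0 := by
        by_contra h'
        exact hx.2 (h1 x hx.1 h')
      have := h x hx.1
      rw [h0] at this
      simpa using this
  rw [h2]
  refine (norm_setIntegral_le_of_norm_le_const (C := N ^ e * (a ^ e + b ^ e) * M * (a * N)⁻¹ * Q)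
    (by simp) fun x hx => ?_).trans ?_
  · have hx0 : 0 < x := lt_of_lt_of_le (mul_pos ha hN) hx.1
    refine (h x hx0).trans ?_
    have h3 : x ^ e ≤ N ^ e * (a ^ e + b ^ e) := by
      rcases le_total 0 e with he | he
      · calc x ^ e ≤ (b * N) ^ e := Real.rpow_le_rpow hx0.le hx.2 he
          _ = N ^ e * b ^ e := by rw [Real.mul_rpow hb.le hN.le, mul_comm]
          _ ≤ _ := by gcongr; linarith
      · calc x ^ e ≤ (a * N) ^ e := Real.rpow_le_rpow_of_nonpos (mul_pos ha hN) hx.1 he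
          _ = N ^ e * a ^ e := by rw [Real.mul_rpow ha.le hN.le, mul_comm]
          _ ≤ _ := by gcongr; linarith
    have h4 := hDM (x / N)
    have h5 : x⁻¹ ≤ (a * N)⁻¹ := inv_anti₀ (mul_pos ha hN) hx.1
    gcongr
  · rw [Real.volume_real_Icc_of_le (by gcongr)]
    calc _ ≤ N ^ e * (a ^ e + b ^ e) * M * (a * N)⁻¹ * Q * (b * N) := by
          gcongr
          linarith [mul_pos ha hN]
      _ = _ := by field_simp

/-- Decay of the Mellin transform of the dyadic weights. -/
theorem exists_norm_dyadicMellin_le {m : ℕ} [Nonempty (Fin m)] {F : Fin m → ℤ} {w : (Fin m → ℝ) → ℝ}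
    (hw : IsWeight F w) {D : ℝ → ℝ} (hD : IsCutoff D) {a b : ℝ} (ha : 0 < a) (hb : 0 ≤ b)
    (hab : ∀ r, D r ≠ 0 → a ≤ r ∧ r ≤ b) (k : ℕ) :
    ∃ C, 0 ≤ C ∧ ∀ (X N₀ N₁ B : ℝ) (c : Fin m → ℝ), 0 < X → 0 < N₀ → 0 < N₁ → 0 ≤ B →
      (∀ i ≤ k, ∀ n ∈ Icc (N₀ * N₁ * a ^ 2) (N₀ * N₁ * b ^ 2),
        ‖iteratedDeriv i (fun t => Jint F w X c (Real.exp t)) (Real.log n)‖ ≤ B) →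
      ∀ s₀ s₁ : ℂ, s₀.re = 0 → s₁.re = 0 →
      ‖dyadicMellin F w D X N₀ N₁ c s₀ s₁‖ ≤
        C * B * (N₀ * N₁) ^ ((1 - (m : ℝ)) / 2) / (1 + max ‖s₀‖ ‖s₁‖) ^ k := by
  set e : ℝ := (1 - (m : ℝ)) / 2 with he
  obtain ⟨C1, hC1, hC1'⟩ := exists_norm_mellin_le hD ha hab e k
  obtain ⟨C2, hC2, hC2'⟩ := exists_norm_integral_prod_le hD e
  refine ⟨C2 * C1, by positivity, fun X N₀ N₁ B c hX h0 h1 hB hJ s₀ s₁ hs₀ hs₁ => ?_⟩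
  have hG := hw.contDiff_Jint hX c
  have hxs : ∀ (s : ℂ) (x : ℝ), s.re = 0 → 0 < x → ‖(x : ℂ) ^ s‖ = 1 := fun s x hs hx => by
    rw [Complex.norm_cpow_eq_rpow_re_of_pos hx, hs, Real.rpow_zero]
  have key : ∀ (N N' : ℝ) (s s' : ℂ), N * N' = N₀ * N₁ → 0 < N → 0 < N' → s.re = 0 → s'.re = 0 →
      ∀ x, 0 < x → ‖∫ y in Ioi (0 : ℝ), (((x * y) ^ e : ℝ) : ℂ) * Jint F w X c (x * y) *
        ((D (x / N) * D (y / N') : ℝ) : ℂ) * ((x : ℂ) ^ s * (y : ℂ) ^ s') * (((x * y)⁻¹ : ℝ) : ℂ)‖ ≤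
      x ^ e * |D (x / N)| * x⁻¹ * (C1 * B * N' ^ e / (1 + ‖s'‖) ^ k) := by
    intro N N' s s' hNN hN hN' hs hs' x hx
    have e1 : ∫ y in Ioi (0 : ℝ), (((x * y) ^ e : ℝ) : ℂ) * Jint F w X c (x * y) *
        ((D (x / N) * D (y / N') : ℝ) : ℂ) * ((x : ℂ) ^ s * (y : ℂ) ^ s') * (((x * y)⁻¹ : ℝ) : ℂ) =
        (((x ^ e : ℝ) : ℂ) * (D (x / N) : ℂ) * (x : ℂ) ^ s * ((x⁻¹ : ℝ) : ℂ)) *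
        ∫ y in Ioi (0 : ℝ), ((y ^ e : ℝ) : ℂ) * Jint F w X c (x * y) * (D (y / N') : ℂ) * (y : ℂ) ^ s' *
          ((y⁻¹ : ℝ) : ℂ) := by
      rw [← integral_const_mul]
      refine setIntegral_congr_fun measurableSet_Ioi fun y hy => ?_
      have hy' : (0 : ℝ) < y := hy
      rw [Real.mul_rpow hx.le hy'.le]
      push_cast
      rw [mul_inv]
      ring
    have hxe := (Real.rpow_pos_of_pos hx e).le
    rw [e1, norm_mul, norm_mul, norm_mul, norm_mul, hxs s x hs hx, Complex.norm_real, Complex.norm_real,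
      Complex.norm_real, Real.norm_of_nonneg hxe, Real.norm_of_nonneg (inv_nonneg.2 hx.le), mul_one,
      Real.norm_eq_abs]
    by_cases hDx : D (x / N) = 0
    · simp [hDx]
    have hx' := hab _ hDx
    rw [le_div_iff₀ hN, div_le_iff₀ hN] at hx'
    refine mul_le_mul_of_nonneg_left ?_ (by positivity)
    refine hC1' (Jint F w X c) x N' B hG hx hN' (fun i hi n hn => hJ i hi n ⟨?_, ?_⟩) s' hs'
    · refine le_trans ?_ hn.1
      rw [← hNN]
      calc N * N' * a ^ 2 = (a * N) * N' * a := by ring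
        _ ≤ x * N' * a := by gcongr; exact hx'.1
    · refine hn.2.trans ?_
      rw [← hNN]
      calc x * N' * b ≤ (b * N) * N' * b := by gcongr; exact hx'.2
        _ = _ := by ring
  have hmul : (N₀ * N₁) ^ e = N₀ ^ e * N₁ ^ e := Real.mul_rpow h0.le h1.le
  have hn0 := (Real.rpow_pos_of_pos h0 e).le
  have hn1 := (Real.rpow_pos_of_pos h1 e).le
  -- Integration by parts is carried out in the inner variable only. The variable with the larger
  -- ‖s_i‖ is made the inner one, which produces the maximum in the denominator.
  rcases le_total ‖s₀‖ ‖s₁‖ with h | h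
  · rw [max_eq_right h]
    have := hC2' (fun p => dyadicWeight F w D X N₀ N₁ c p.1 p.2 * ((p.1 : ℂ) ^ s₀ * (p.2 : ℂ) ^ s₁)
      * (((p.1 * p.2)⁻¹ : ℝ) : ℂ)) N₀ (C1 * B * N₁ ^ e / (1 + ‖s₁‖) ^ k) h0 (by positivity)
      (key N₀ N₁ s₀ s₁ rfl h0 h1 hs₀ hs₁)
    refine this.trans (le_of_eq ?_)
    rw [hmul]; ring
  · rw [max_eq_left h]
    have := hC2' (fun p => dyadicWeight F w D X N₀ N₁ c p.2 p.1 * ((p.2 : ℂ) ^ s₀ * (p.1 : ℂ) ^ s₁)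
      * (((p.2 * p.1)⁻¹ : ℝ) : ℂ)) N₁ (C1 * B * N₀ ^ e / (1 + ‖s₀‖) ^ k) h1 (by positivity)
      (fun x hx => by
        have := key N₁ N₀ s₁ s₀ (mul_comm _ _) h1 h0 hs₁ hs₀ x hx
        refine le_of_eq_of_le (congrArg _ ?_) this
        refine setIntegral_congr_fun measurableSet_Ioi fun y hy => ?_
        simp only [dyadicWeight, ← he]
        rw [mul_comm y x, mul_comm (D (y / N₀)), mul_comm ((y : ℂ) ^ s₀)])
    have hsw := setIntegral_prod_swap (μ := (volume : Measure ℝ)) (ν := (volume : Measure ℝ))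
      (Ioi (0 : ℝ)) (Ioi (0 : ℝ)) (fun p : ℝ × ℝ => dyadicWeight F w D X N₀ N₁ c p.1 p.2 *
        ((p.1 : ℂ) ^ s₀ * (p.2 : ℂ) ^ s₁) * (((p.1 * p.2)⁻¹ : ℝ) : ℂ))
    simp only [← Measure.volume_eq_prod] at hsw
    rw [dyadicMellin, ← hsw]
    refine le_trans (le_of_eq ?_) (this.trans (le_of_eq ?_))
    · rfl
    · rw [hmul]; ring

theorem exists_abs_schwartz_le {E : Type*} [NormedAddCommGroup E] [NormedSpace ℝ E] (ν : 𝓢(E, ℝ))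
    (A : ℕ) : ∃ C, 0 < C ∧ ∀ z, |ν z| ≤ C / (1 + ‖z‖) ^ A := by
  refine ⟨2 ^ A * ((Finset.Iic (A, 0)).sup fun m => SchwartzMap.seminorm ℝ m.1 m.2) ν + 1,
    by positivity, fun z => ?_⟩
  have := SchwartzMap.one_add_le_sup_seminorm_apply (𝕜 := ℝ) (m := (A, 0)) (k := A) (n := 0) le_rfl le_rfl ν z
  rw [norm_iteratedFDeriv_zero, Real.norm_eq_abs] at this
  rw [le_div_iff₀ (by positivity), mul_comm]
  linarith

section
variable {m : ℕ} [Nonempty (Fin m)] {F : Fin m → ℤ} {P : MvPolynomial (Fin m) ℤ}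
  {w : (Fin m → ℝ) → ℝ} {ν : SchwartzMap (Fin m → ℝ) ℝ} {D : ℝ → ℝ}

/-- On the support of the cutoffs n is of order N = N₀N₁, so n may be replaced by N in the
admissible bound at the cost of powers of β = max(1, b²). Of the last factor ν only one power of
decay is kept. -/
theorem exists_norm_dyadicMellin_le_of_isAdmissible (hm : 3 ≤ m) (hw : IsWeight F w)
    (hν : IsAdmissible F P w ν) (hD : IsCutoff D) (k : ℕ) :
    ∃ K, 0 ≤ K ∧ ∀ (X N₀ N₁ : ℝ) (c : Fin m → ℝ), 0 < X → 0 < N₀ → 0 < N₁ →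
      ∀ s₀ s₁ : ℂ, s₀.re = 0 → s₁.re = 0 →
      ‖dyadicMellin F w D X N₀ N₁ c s₀ s₁‖ ≤
        K * (N₀ * N₁) ^ ((1 - (m : ℝ)) / 2) * (max 1 (X * ‖c‖ / (N₀ * N₁))) ^ (1 - (m : ℝ) / 2) *
          ν ((X ^ (1 / 2 : ℝ))⁻¹ • c) ^ 3 *
          (1 + X * ‖c‖ * |dualReal P (‖c‖⁻¹ • c)| / (N₀ * N₁))⁻¹ / (1 + max ‖s₀‖ ‖s₁‖) ^ k := by
  obtain ⟨a, b, M, ha, hab, hM, hDs, hDM⟩ := hD.exists_support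
  have hb : 0 < b := ha.trans hab
  have hm' : (3 : ℝ) ≤ m := by exact_mod_cast hm
  obtain ⟨C1, hC1, hC1'⟩ := exists_norm_dyadicMellin_le hw hD ha hb.le hDs k
  obtain ⟨C2, hC2, hC2'⟩ := exists_abs_schwartz_le ν 1
  choose K hK using hν.2
  set K' := ∑ i ∈ Finset.range (k + 1), |K i| with hK'
  have hK'0 : 0 ≤ K' := Finset.sum_nonneg fun _ _ => abs_nonneg _
  have hKi : ∀ i ≤ k, K i ≤ K' := fun i hi => (le_abs_self _).trans
    (Finset.single_le_sum (f := fun i => |K i|) (fun _ _ => abs_nonneg _)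
      (Finset.mem_range.2 (by omega)))
  set β := max 1 (b ^ 2) with hβ
  have hβ1 : 1 ≤ β := le_max_left _ _
  have hβ0 : 0 < β := one_pos.trans_le hβ1
  refine ⟨C1 * (K' * (β ^ ((m : ℝ) / 2 - 1)) * (C2 * β)), by positivity,
    fun X N₀ N₁ c hX h0 h1 s₀ s₁ hs₀ hs₁ => ?_⟩
  have hN : 0 < N₀ * N₁ := by positivity
  set N := N₀ * N₁ with hNdef
  set p := |dualReal P (‖c‖⁻¹ • c)| with hp
  have hp0 : 0 ≤ p := abs_nonneg _
  have hc0 := norm_nonneg c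
  set νc := ν ((X ^ (1 / 2 : ℝ))⁻¹ • c) with hνc
  have hνc0 : 0 < νc := hν.1 _
  set T := (max 1 (X * ‖c‖ / N)) ^ (1 - (m : ℝ) / 2) with hT
  have hT1 : 1 ≤ max 1 (X * ‖c‖ / N) := le_max_left _ _
  have hT0 : 0 ≤ T := Real.rpow_nonneg (by linarith) _
  have hq : 0 ≤ X * ‖c‖ * p / N := by positivity
  set B := K' * (β ^ ((m : ℝ) / 2 - 1) * T) * νc ^ 3 * (C2 * β * (1 + X * ‖c‖ * p / N)⁻¹) with hB
  have hβe := (Real.rpow_pos_of_pos hβ0 ((m : ℝ) / 2 - 1)).le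
  have hbound : ∀ i ≤ k, ∀ n ∈ Icc (N * a ^ 2) (N * b ^ 2),
      ‖iteratedDeriv i (fun t => Jint F w X c (Real.exp t)) (Real.log n)‖ ≤ B := by
    intro i hi n hn
    have hn0 : 0 < n := lt_of_lt_of_le (by positivity) hn.1
    have hnβ : n ≤ N * β := hn.2.trans (by gcongr; exact le_max_right _ _)
    have e1 : (max 1 (X * ‖c‖ / n)) ^ (1 - (m : ℝ) / 2) ≤ β ^ ((m : ℝ) / 2 - 1) * T := by
      have h1 : β⁻¹ * max 1 (X * ‖c‖ / N) ≤ max 1 (X * ‖c‖ / n) := by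
        rw [inv_mul_le_iff₀ hβ0]
        refine max_le ?_ ?_
        · nlinarith [le_max_left (1 : ℝ) (X * ‖c‖ / n)]
        · calc X * ‖c‖ / N ≤ β * (X * ‖c‖ / n) := by
                rw [← mul_div_assoc, div_le_div_iff₀ hN hn0]
                calc X * ‖c‖ * n ≤ X * ‖c‖ * (N * β) := by gcongr
                  _ = _ := by ring
            _ ≤ _ := by gcongr; exact le_max_right _ _
      refine (Real.rpow_le_rpow_of_nonpos (by positivity) h1 (by linarith)).trans (le_of_eq ?_)
      rw [Real.mul_rpow (by positivity) (by positivity), Real.inv_rpow hβ0.le, ← Real.rpow_neg hβ0.le,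
        neg_sub]
    have e2 : ν ((X / n * p) • c) ≤ C2 * β * (1 + X * ‖c‖ * p / N)⁻¹ := by
      refine ((le_abs_self _).trans (hC2' _)).trans ?_
      rw [pow_one, norm_smul, Real.norm_of_nonneg (by positivity), ← div_eq_mul_inv,
        div_le_div_iff₀ (by positivity) (by positivity), mul_assoc C2 β]
      refine mul_le_mul_of_nonneg_left ?_ hC2.le
      have h1 : X * ‖c‖ * p / N ≤ β * (X / n * p * ‖c‖) := by
        rw [div_le_iff₀ hN]
        calc X * ‖c‖ * p = n * (X / n * p * ‖c‖) := by field_simp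
          _ ≤ N * β * (X / n * p * ‖c‖) := by gcongr
          _ = _ := by ring
      linarith
    refine (hK i X c n hX hn0).trans ?_
    have hν0 := (hν.1 ((X / n * p) • c)).le
    have hmax : 0 ≤ (max 1 (X * ‖c‖ / n)) ^ (1 - (m : ℝ) / 2) :=
      Real.rpow_nonneg (zero_le_one.trans (le_max_left _ _)) _
    rw [hB]
    gcongr
    exact hKi i hi
  have hB0 : 0 ≤ B := by positivity
  refine (hC1' X N₀ N₁ B c hX h0 h1 hB0 hbound s₀ s₁ hs₀ hs₁).trans (le_of_eq ?_)
  rw [hB]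
  ring

/-- N^{1/2}N^{(1-m)/2}max(1, X‖c‖/N)^{1-m/2} = max(N, X‖c‖)^{1-m/2}. Dividing ν³ by ν² leaves one ν,
split as ν^θ·ν^{1-θ}; as 1 − θ ≥ 1/2, decay of order 2l of ν turns the second factor into (1 +
C/X^{1/2})^{-l}. -/
theorem exists_norm_hybridTerm_le (hm : 3 ≤ m) (hw : IsWeight F w)
    (hν : IsAdmissible F P w ν) (hD : IsCutoff D) (k l : ℕ) {θ : ℝ} (hθ' : θ ≤ 1 / 2) :
    ∃ K, 0 ≤ K ∧ ∀ (X N₀ N₁ C : ℝ) (c : Fin m → ℤ), 0 < X → 0 < N₀ → 0 < N₁ → 0 < C →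
      C ≤ ‖toReal c‖ → ∀ s₀ s₁ : ℂ, s₀.re = 0 → s₁.re = 0 →
      ‖hybridTerm F P w ν D X N₀ N₁ s₀ s₁ c‖ ≤
        K * (max (N₀ * N₁) (X * C)) ^ (1 - (m : ℝ) / 2) /
          ((1 + max ‖s₀‖ ‖s₁‖) ^ k * (1 + C / X ^ (1 / 2 : ℝ)) ^ l) *
        (‖heartZero F P D N₀ c s₀‖ / N₀ ^ (1 / 2 : ℝ) * ν ((X ^ (1 / 2 : ℝ))⁻¹ • toReal c) ^ θ *
          (1 + X * C * |dualReal P (‖toReal c‖⁻¹ • toReal c)| / (N₀ * N₁))⁻¹) := by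
  obtain ⟨K, hK, hK'⟩ := exists_norm_dyadicMellin_le_of_isAdmissible hm hw hν hD k
  obtain ⟨C2, hC2, hC2'⟩ := exists_abs_schwartz_le ν (2 * l)
  have hm' : (3 : ℝ) ≤ m := by exact_mod_cast hm
  refine ⟨K * C2 ^ (1 - θ), by positivity, fun X N₀ N₁ C c hX h0 h1 hC hc s₀ s₁ hs₀ hs₁ => ?_⟩
  have hN : 0 < N₀ * N₁ := by positivity
  have hX2 : 0 < X ^ (1 / 2 : ℝ) := Real.rpow_pos_of_pos hX _
  have hN2 : 0 < N₀ ^ (1 / 2 : ℝ) := Real.rpow_pos_of_pos h0 _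
  have hNN : 0 < (N₀ * N₁) ^ (1 / 2 : ℝ) := Real.rpow_pos_of_pos hN _
  have hMel := hK' X N₀ N₁ (toReal c) hX h0 h1 s₀ s₁ hs₀ hs₁
  set N := N₀ * N₁ with hNdef
  set L := ‖toReal c‖ with hL
  have hL0 : 0 < L := hC.trans_le hc
  set p := |dualReal P (L⁻¹ • toReal c)| with hp
  have hp0 : 0 ≤ p := abs_nonneg _
  set νc := ν ((X ^ (1 / 2 : ℝ))⁻¹ • toReal c) with hνc
  have hνc0 : 0 < νc := hν.1 _
  set S := (1 + max ‖s₀‖ ‖s₁‖) ^ k with hS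
  have hS0 : 0 < S := by
    have : 0 ≤ max ‖s₀‖ ‖s₁‖ := (norm_nonneg _).trans (le_max_left _ _)
    positivity
  have e1 : N ^ (1 / 2 : ℝ) * (N ^ ((1 - (m : ℝ)) / 2) * (max 1 (X * L / N)) ^ (1 - (m : ℝ) / 2)) ≤
      (max N (X * C)) ^ (1 - (m : ℝ) / 2) := by
    have h2 : max N (X * L) = N * max 1 (X * L / N) := by
      rw [mul_max_of_nonneg _ _ hN.le, mul_one]; congr 1; field_simp
    calc _ = (max N (X * L)) ^ (1 - (m : ℝ) / 2) := by
          rw [h2, Real.mul_rpow hN.le (zero_le_one.trans (le_max_left _ _)), ← mul_assoc,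
            ← Real.rpow_add hN]
          congr 2; ring
      _ ≤ _ := Real.rpow_le_rpow_of_nonpos (lt_max_of_lt_left hN) (by gcongr) (by linarith)
  have e2 : (1 + X * L * p / N)⁻¹ ≤ (1 + X * C * p / N)⁻¹ := by gcongr
  have e3 : νc ≤ νc ^ θ * (C2 ^ (1 - θ) / (1 + C / X ^ (1 / 2 : ℝ)) ^ l) := by
    have h3 : νc = νc ^ θ * νc ^ (1 - θ) := by
      rw [← Real.rpow_add hνc0]; norm_num
    have hy : 1 ≤ 1 + C / X ^ (1 / 2 : ℝ) := by
      have : 0 ≤ C / X ^ (1 / 2 : ℝ) := by positivity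
      linarith
    have h4 : νc ≤ C2 / (1 + C / X ^ (1 / 2 : ℝ)) ^ (2 * l) := by
      refine ((le_abs_self _).trans (hC2' _)).trans ?_
      rw [norm_smul, norm_inv, Real.norm_of_nonneg hX2.le, ← hL, inv_mul_eq_div]
      gcongr
    have h5 : νc ^ (1 - θ) ≤ C2 ^ (1 - θ) / (1 + C / X ^ (1 / 2 : ℝ)) ^ l := by
      refine (Real.rpow_le_rpow hνc0.le h4 (by linarith)).trans ?_
      rw [Real.div_rpow hC2.le (by positivity), ← Real.rpow_natCast _ (2 * l),
        ← Real.rpow_mul (by positivity)]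
      have := (Real.rpow_pos_of_pos hC2 (1 - θ)).le
      gcongr
      rw [← Real.rpow_natCast]
      refine Real.rpow_le_rpow_of_exponent_le hy ?_
      push_cast
      nlinarith [Nat.cast_nonneg (α := ℝ) l]
    conv_lhs => rw [h3]
    gcongr
  set H := ‖heartZero F P D N₀ c s₀‖ / N₀ ^ (1 / 2 : ℝ) with hH
  have hH0 : 0 ≤ H := by positivity
  have e0 : ‖hybridTerm F P w ν D X N₀ N₁ s₀ s₁ c‖ =
      H * N ^ (1 / 2 : ℝ) * ‖dyadicMellin F w D X N₀ N₁ (toReal c) s₀ s₁‖ * (νc ^ 2)⁻¹ := by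
    rw [hybridTerm, norm_mul, norm_mul, norm_mul, norm_div, Complex.norm_real, Complex.norm_real,
      Complex.norm_real, Real.norm_of_nonneg hN2.le, Real.norm_of_nonneg hNN.le,
      Real.norm_of_nonneg (by positivity)]
  have hq : 0 ≤ X * C * p / N := by positivity
  have hq' : 0 ≤ X * L * p / N := by positivity
  have hmx : 0 ≤ (max 1 (X * L / N)) ^ (1 - (m : ℝ) / 2) :=
    Real.rpow_nonneg (zero_le_one.trans (le_max_left _ _)) _
  have hmx' : 0 ≤ (max N (X * C)) ^ (1 - (m : ℝ) / 2) :=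
    Real.rpow_nonneg (hN.le.trans (le_max_left _ _)) _
  have hNe := (Real.rpow_pos_of_pos hN ((1 - (m : ℝ)) / 2)).le
  rw [e0]
  calc _ ≤ H * N ^ (1 / 2 : ℝ) * (K * N ^ ((1 - (m : ℝ)) / 2) * (max 1 (X * L / N)) ^ (1 - (m : ℝ) / 2) *
          νc ^ 3 * (1 + X * L * p / N)⁻¹ / S) * (νc ^ 2)⁻¹ := by gcongr
    _ = H * K / S * (N ^ (1 / 2 : ℝ) * (N ^ ((1 - (m : ℝ)) / 2) *
          (max 1 (X * L / N)) ^ (1 - (m : ℝ) / 2))) * νc * (1 + X * L * p / N)⁻¹ := by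
        field_simp
    _ ≤ H * K / S * (max N (X * C)) ^ (1 - (m : ℝ) / 2) *
          (νc ^ θ * (C2 ^ (1 - θ) / (1 + C / X ^ (1 / 2 : ℝ)) ^ l)) * (1 + X * C * p / N)⁻¹ := by
        gcongr
    _ = _ := by field_simp

end

/-! ### Sums over the bad moduli -/

section
variable {m : ℕ} {F : Fin m → ℤ} {P : MvPolynomial (Fin m) ℤ}

open Classical in
/-- The contribution of the bad moduli in `[R, 2R]`. -/
noncomputable def blockSum (F : Fin m → ℤ) (P : MvPolynomial (Fin m) ℤ) (c : Fin m → ℤ) (R : ℝ) : ℝ :=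
  ∑ n ∈ (Finset.Icc ⌈R⌉₊ ⌊2 * R⌋₊).filter (fun n => DvdInfty n (dualInt P c)),
    ‖expSumNorm F c n‖ / R ^ (1 / 2 : ℝ)

theorem blockSum_nonneg {c : Fin m → ℤ} {R : ℝ} (hR : 0 < R) : 0 ≤ blockSum F P c R :=
  Finset.sum_nonneg fun _ _ => div_nonneg (norm_nonneg _) (Real.rpow_nonneg hR.le _)

theorem norm_expSumNorm_le (F : Fin m → ℤ) (c : Fin m → ℤ) {n : ℕ} (hn : 1 ≤ n) :
    ‖expSumNorm F c n‖ ≤ (n : ℝ) ^ (((m : ℝ) + 1) / 2) := by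
  have hn0 : (0 : ℝ) < n := by exact_mod_cast hn
  have h1 : ‖expSum F c n‖ ≤ (n : ℝ) ^ ((m : ℝ) + 1) := by
    unfold expSum
    have h2 : ∀ a ∈ (Finset.range n).filter (fun a => Nat.Coprime a n),
        ‖∑ x : Fin m → Fin n, Complex.exp (2 * Real.pi * Complex.I *
        (((a : ℤ) * (∑ i, F i * ((x i : ℕ) : ℤ) ^ 3) + ∑ i, c i * ((x i : ℕ) : ℤ) : ℤ) : ℂ)
          / (n : ℂ))‖ ≤ (n : ℝ) ^ m := fun a _ => by
      refine (norm_sum_le_of_le (f := fun x : Fin m → Fin n => _) _ (n := fun _ => (1 : ℝ)) fun x _ =>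
        ?_).trans ?_
      · rw [show ∀ z : ℤ, (2 * Real.pi * Complex.I * (z : ℂ) / (n : ℂ)) =
          ((2 * Real.pi * z / n : ℝ) : ℂ) * Complex.I from fun z => by push_cast; ring]
        rw [Complex.norm_exp_ofReal_mul_I]
      · simp
    refine (norm_sum_le_of_le _ h2).trans ?_
    rw [Finset.sum_const, nsmul_eq_mul, Real.rpow_add_one hn0.ne', Real.rpow_natCast, mul_comm]
    gcongr
    exact (Finset.card_filter_le _ _).trans (by simp)
  rw [expSumNorm, norm_mul, Complex.norm_real, Real.norm_of_nonneg (Real.rpow_nonneg hn0.le _)]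
  calc _ ≤ (n : ℝ) ^ (-((m : ℝ) + 1) / 2) * (n : ℝ) ^ ((m : ℝ) + 1) := by gcongr
    _ = _ := by rw [← Real.rpow_add hn0]; congr 1; ring

/-- O(R) moduli, each with the trivial bound R^{(m+1)/2}, divided by R^{1/2}. This crude estimate
enters only to the small power q − 2. -/
theorem blockSum_le (c : Fin m → ℤ) {R : ℝ} (hR : 0 < R) :
    blockSum F P c R ≤ 2 ^ ((m : ℝ) + 2) * R ^ ((m : ℝ) / 2 + 1) := by
  classical
  have hR2 : 0 < R ^ (1 / 2 : ℝ) := Real.rpow_pos_of_pos hR _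
  have h1 : ∀ n ∈ Finset.Icc ⌈R⌉₊ ⌊2 * R⌋₊, ‖expSumNorm F c n‖ / R ^ (1 / 2 : ℝ) ≤
      (2 * R) ^ (((m : ℝ) + 1) / 2) / R ^ (1 / 2 : ℝ) := fun n hn => by
    rw [Finset.mem_Icc] at hn
    have hn1 : 1 ≤ n := (Nat.ceil_pos.2 hR).trans_le hn.1
    have hn2 : (n : ℝ) ≤ 2 * R := (Nat.le_floor_iff (by positivity)).1 hn.2
    gcongr
    exact (norm_expSumNorm_le F c hn1).trans (by gcongr)
  have h2 : ((Finset.Icc ⌈R⌉₊ ⌊2 * R⌋₊).card : ℝ) ≤ 2 * R := by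
    have : (Finset.Icc ⌈R⌉₊ ⌊2 * R⌋₊).card ≤ ⌊2 * R⌋₊ := by
      rw [Nat.card_Icc]
      have := Nat.ceil_pos.2 hR
      omega
    exact (Nat.cast_le.2 this).trans (Nat.floor_le (by positivity))
  have h2R : (0 : ℝ) < 2 * R := by positivity
  calc blockSum F P c R ≤ ∑ n ∈ Finset.Icc ⌈R⌉₊ ⌊2 * R⌋₊, ‖expSumNorm F c n‖ / R ^ (1 / 2 : ℝ) :=
        Finset.sum_le_sum_of_subset_of_nonneg (Finset.filter_subset _ _) fun _ _ _ => by positivity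
    _ ≤ (Finset.Icc ⌈R⌉₊ ⌊2 * R⌋₊).card • ((2 * R) ^ (((m : ℝ) + 1) / 2) / R ^ (1 / 2 : ℝ)) :=
        Finset.sum_le_card_nsmul _ _ _ h1
    _ ≤ (2 * R) * ((2 * R) ^ (((m : ℝ) + 1) / 2) / R ^ (1 / 2 : ℝ)) := by
        rw [nsmul_eq_mul]
        have := Real.rpow_nonneg h2R.le (((m : ℝ) + 1) / 2)
        gcongr
    _ = 2 ^ (((m : ℝ) + 1) / 2 + 1) * R ^ ((m : ℝ) / 2 + 1) := by
        rw [Real.mul_rpow two_pos.le hR.le, Real.rpow_add_one two_ne_zero,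
          show (m : ℝ) / 2 + 1 = (((m : ℝ) + 1) / 2 + 1) - 1 / 2 by ring, Real.rpow_sub hR,
          Real.rpow_add_one hR.ne']
        ring
    _ ≤ _ := by
        have hm := Nat.cast_nonneg (α := ℝ) m
        have := Real.rpow_nonneg hR.le ((m : ℝ) / 2 + 1)
        refine mul_le_mul_of_nonneg_right ?_ this
        exact Real.rpow_le_rpow_of_exponent_le one_le_two (by linarith)

/-- The support [aN₀, bN₀] of the cutoff is covered by I dyadic intervals [2^i aN₀, 2^{i+1} aN₀], on
which |n^{-s₀}| = 1. This brings the sum into the form controlled by (B3). -/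
theorem norm_heartZero_le {D : ℝ → ℝ} {a b M : ℝ} (ha : 0 < a)
    (hD : ∀ r, D r ≠ 0 → a ≤ r ∧ r ≤ b) (hM : ∀ r, |D r| ≤ M) {I : ℕ} (hI : b < 2 ^ I * a)
    {N₀ : ℝ} (hN : 0 < N₀) (c : Fin m → ℤ) {s₀ : ℂ} (hs : s₀.re = 0) :
    ‖heartZero F P D N₀ c s₀‖ / N₀ ^ (1 / 2 : ℝ) ≤
      M * (2 ^ I * a) ^ (1 / 2 : ℝ) * ∑ i ∈ Finset.range I, blockSum F P c (2 ^ i * a * N₀) := by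
  classical
  have hM0 : 0 ≤ M := (abs_nonneg _).trans (hM 0)
  have hN2 : 0 < N₀ ^ (1 / 2 : ℝ) := Real.rpow_pos_of_pos hN _
  set R : ℕ → ℝ := fun i => 2 ^ i * a * N₀ with hR
  have hR0 : ∀ i, 0 < R i := fun i => by positivity
  set blk : ℕ → Finset ℕ := fun i =>
    (Finset.Icc ⌈R i⌉₊ ⌊2 * R i⌋₊).filter (fun n => DvdInfty n (dualInt P c)) with hblk
  set h : ℕ → ℝ := fun n => ∑ i ∈ Finset.range I, if n ∈ blk i then M * ‖expSumNorm F c n‖ else 0 with hh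
  have hh0 : ∀ n, 0 ≤ h n := fun n => Finset.sum_nonneg fun i _ => by split_ifs <;> positivity
  have hsum : ∀ i ∈ Finset.range I, Summable fun n => if n ∈ blk i then M * ‖expSumNorm F c n‖ else 0 :=
    fun i _ => summable_of_ne_finset_zero (s := blk i) fun n hn => if_neg hn
  have hhs : Summable h := summable_sum hsum
  have hle : ∀ n : ℕ+, ‖if DvdInfty n (dualInt P c) then
    ((n : ℕ) : ℂ) ^ (-s₀) * expSumNorm F c n * ((D ((n : ℕ) / N₀) : ℝ) : ℂ) else 0‖ ≤ h n := by
    intro n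
    split_ifs with hd
    swap
    · rw [norm_zero]; exact hh0 n
    by_cases h0 : D ((n : ℕ) / N₀) = 0
    · rw [h0]; simpa using hh0 n
    have h1 := hD _ h0
    rw [le_div_iff₀ hN, div_le_iff₀ hN] at h1
    obtain ⟨i, hi1, hi2⟩ := exists_nat_pow_near (x := (n : ℝ) / (a * N₀)) (y := 2)
      ((one_le_div (by positivity)).2 h1.1) (by norm_num)
    rw [le_div_iff₀ (by positivity)] at hi1
    rw [div_lt_iff₀ (by positivity)] at hi2
    have hiI : i < I := by
      by_contra hge
      push Not at hge
      have h3 : (2 : ℝ) ^ I ≤ 2 ^ i := pow_le_pow_right₀ (by norm_num) hge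
      have h4 : b * N₀ < 2 ^ i * (a * N₀) := by
        calc b * N₀ < 2 ^ I * a * N₀ := by gcongr
          _ ≤ 2 ^ i * a * N₀ := by gcongr
          _ = _ := by ring
      linarith [h1.2]
    have hmem : (n : ℕ) ∈ blk i := by
      simp only [hblk, Finset.mem_filter, Finset.mem_Icc]
      refine ⟨⟨Nat.ceil_le.2 ?_, (Nat.le_floor_iff (by positivity)).2 ?_⟩, hd⟩
      · simp only [hR]; linarith
      · simp only [hR]; rw [pow_succ] at hi2; linarith
    have hcp : ‖((n : ℕ) : ℂ) ^ (-s₀)‖ = 1 := by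
      rw [Complex.norm_natCast_cpow_of_pos n.pos, Complex.neg_re, hs, neg_zero, Real.rpow_zero]
    rw [norm_mul, norm_mul, hcp, one_mul, Complex.norm_real, Real.norm_eq_abs]
    calc _ ≤ ‖expSumNorm F c n‖ * M := by gcongr; exact hM _
      _ = if (n : ℕ) ∈ blk i then M * ‖expSumNorm F c n‖ else 0 := by rw [if_pos hmem, mul_comm]
      _ ≤ h n := Finset.single_le_sum (f := fun i => if (n : ℕ) ∈ blk i then M * ‖expSumNorm F c n‖ else 0)
          (fun i _ => by split_ifs <;> positivity) (Finset.mem_range.2 hiI)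
  have h1 : ‖heartZero F P D N₀ c s₀‖ ≤ ∑' n, h n := by
    refine (tsum_of_norm_bounded (hhs.comp_injective PNat.coe_injective).hasSum hle).trans ?_
    exact tsum_comp_le_tsum_of_inj hhs hh0 PNat.coe_injective
  have h2 : ∑' n, h n = ∑ i ∈ Finset.range I, M * ∑ n ∈ blk i, ‖expSumNorm F c n‖ := by
    rw [Summable.tsum_finsetSum hsum]
    refine Finset.sum_congr rfl fun i _ => ?_
    rw [tsum_eq_sum (s := blk i) fun n hn => if_neg hn, Finset.mul_sum]
    exact Finset.sum_congr rfl fun n hn => if_pos hn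
  rw [div_le_iff₀ hN2]
  refine h1.trans (h2.le.trans ?_)
  rw [Finset.mul_sum, Finset.sum_mul]
  refine Finset.sum_le_sum fun i hi => ?_
  have hRi := Real.rpow_pos_of_pos (hR0 i) (1 / 2 : ℝ)
  have h3 : ∑ n ∈ blk i, ‖expSumNorm F c n‖ = R i ^ (1 / 2 : ℝ) * blockSum F P c (R i) := by
    rw [blockSum, ← Finset.sum_div]
    field_simp
    rfl
  have h4 : R i ^ (1 / 2 : ℝ) ≤ (2 ^ I * a) ^ (1 / 2 : ℝ) * N₀ ^ (1 / 2 : ℝ) := by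
    rw [← Real.mul_rpow (by positivity) hN.le]
    refine Real.rpow_le_rpow (hR0 i).le ?_ (by norm_num)
    simp only [hR]
    have : (2 : ℝ) ^ i ≤ 2 ^ I := pow_le_pow_right₀ (by norm_num) (Finset.mem_range.1 hi).le
    gcongr
  rw [h3]
  have h5 := blockSum_nonneg (F := F) (P := P) (c := c) (hR0 i)
  calc M * (R i ^ (1 / 2 : ℝ) * blockSum F P c (R i)) ≤
      M * ((2 ^ I * a) ^ (1 / 2 : ℝ) * N₀ ^ (1 / 2 : ℝ) * blockSum F P c (R i)) := by gcongr
    _ = _ := by ring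

theorem heartZero_eq_zero {D : ℝ → ℝ} {b : ℝ} (hD : ∀ r, D r ≠ 0 → r ≤ b)
    {N₀ : ℝ} (hN : 0 < N₀) (hbN : b * N₀ < 1) (c : Fin m → ℤ) (s₀ : ℂ) :
    heartZero F P D N₀ c s₀ = 0 := by
  classical
  rw [heartZero, ← tsum_zero]
  refine tsum_congr fun n => ?_
  have : D ((n : ℕ) / N₀) = 0 := by
    by_contra h
    have := hD _ h
    rw [div_le_iff₀ hN] at this
    have hn : (1 : ℝ) ≤ ((n : ℕ) : ℝ) := by exact_mod_cast n.pos
    linarith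
  rw [this]; simp

theorem B3.exists_sum_sq_le (h : B3 F P) : ∃ δ K : ℝ, 0 < δ ∧ 0 ≤ K ∧ ∀ (Z R : ℝ) (T : Finset (Fin m → ℤ)),
    0 < Z → 0 < R → R ≤ Z ^ 3 → (∀ c ∈ T, ‖toReal c‖ ≤ Z ∧ dualInt P c ≠ 0) →
    ∑ c ∈ T, blockSum F P c R ^ 2 ≤ K * Z ^ m * R ^ (-δ) := by
  obtain ⟨δ, hδ, K, hK⟩ := h
  refine ⟨δ, |K|, hδ, abs_nonneg _, fun Z R T hZ hR hRZ hT => ?_⟩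
  have hfin : {c : Fin m → ℤ | ‖toReal c‖ ≤ Z ∧ dualInt P c ≠ 0}.Finite :=
    (finite_ball Z).subset fun c hc => hc.1
  have hfi : Finite {c : Fin m → ℤ // ‖toReal c‖ ≤ Z ∧ dualInt P c ≠ 0} := hfin
  have hs : Summable fun c : {c : Fin m → ℤ // ‖toReal c‖ ≤ Z ∧ dualInt P c ≠ 0} =>
    blockSum F P c.1 R ^ 2 := summable_of_hasFiniteSupport (Set.toFinite _)
  have h1 := hs.sum_le_tsum (T.attach.map ⟨fun c => ⟨c.1, hT c.1 c.2⟩, fun c d h =>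
    Subtype.ext (congrArg (fun x => x.1) h)⟩) fun c _ => sq_nonneg _
  rw [Finset.sum_map] at h1
  change ∑ c ∈ T.attach, blockSum F P c.1 R ^ 2 ≤ _ at h1
  rw [Finset.sum_attach T fun c => blockSum F P c R ^ 2] at h1
  refine h1.trans ((hK Z R hZ hR hRZ).trans ?_)
  have := Real.rpow_nonneg hR.le (-δ)
  gcongr
  exact le_abs_self K

end

/-! ### Hölder's inequality and the passage from mean squares to ℓ^q -/

/-- Hölder's inequality with three factors. -/
theorem sum_mul_rpow_le {ι : Type*} (T : Finset ι) {a b c : ι → ℝ} (ha : ∀ i, 0 ≤ a i)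
    (hb : ∀ i, 0 ≤ b i) (hc : ∀ i, 0 ≤ c i) {x y z : ℝ} (hx : 0 < x) (hy : 0 < y) (hz : 0 < z)
    (h : x + y + z = 1) :
    ∑ i ∈ T, a i ^ x * b i ^ y * c i ^ z ≤
      (∑ i ∈ T, a i) ^ x * (∑ i ∈ T, b i) ^ y * (∑ i ∈ T, c i) ^ z := by
  have hA : 0 ≤ ∑ i ∈ T, a i := Finset.sum_nonneg fun i _ => ha i
  have hB : 0 ≤ ∑ i ∈ T, b i := Finset.sum_nonneg fun i _ => hb i
  have hC : 0 ≤ ∑ i ∈ T, c i := Finset.sum_nonneg fun i _ => hc i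
  have zero : ∀ f : ι → ℝ, (∀ i, 0 ≤ f i) → ∑ i ∈ T, f i = 0 → ∀ i ∈ T, f i = 0 := fun f hf h =>
    (Finset.sum_eq_zero_iff_of_nonneg fun i _ => hf i).1 h
  have hpos : 0 ≤ (∑ i ∈ T, a i) ^ x * (∑ i ∈ T, b i) ^ y * (∑ i ∈ T, c i) ^ z := by positivity
  rcases hA.eq_or_lt with hA | hA
  · rw [Finset.sum_eq_zero fun i hi => by rw [zero a ha hA.symm i hi, Real.zero_rpow hx.ne']; ring]
    exact hpos
  rcases hB.eq_or_lt with hB | hB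
  · rw [Finset.sum_eq_zero fun i hi => by rw [zero b hb hB.symm i hi, Real.zero_rpow hy.ne']; ring]
    exact hpos
  rcases hC.eq_or_lt with hC | hC
  · rw [Finset.sum_eq_zero fun i hi => by rw [zero c hc hC.symm i hi, Real.zero_rpow hz.ne']; ring]
    exact hpos
  set A := ∑ i ∈ T, a i with hAdef
  set B := ∑ i ∈ T, b i with hBdef
  set C := ∑ i ∈ T, c i with hCdef
  have hx' := Real.rpow_pos_of_pos hA x
  have hy' := Real.rpow_pos_of_pos hB y
  have hz' := Real.rpow_pos_of_pos hC z
  have h1 : ∀ i ∈ T, a i ^ x * b i ^ y * c i ^ z ≤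
      A ^ x * B ^ y * C ^ z * (x * (a i / A) + y * (b i / B) + z * (c i / C)) := fun i _ => by
    have := Real.geom_mean_le_arith_mean3_weighted hx.le hy.le hz.le (div_nonneg (ha i) hA.le)
      (div_nonneg (hb i) hB.le) (div_nonneg (hc i) hC.le) h
    rw [Real.div_rpow (ha i) hA.le, Real.div_rpow (hb i) hB.le, Real.div_rpow (hc i) hC.le] at this
    calc _ = A ^ x * B ^ y * C ^ z * (a i ^ x / A ^ x * (b i ^ y / B ^ y) * (c i ^ z / C ^ z)) := by
          field_simp
      _ ≤ _ := by gcongr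
  refine (Finset.sum_le_sum h1).trans (le_of_eq ?_)
  rw [← Finset.mul_sum, Finset.sum_add_distrib, Finset.sum_add_distrib, ← Finset.mul_sum,
    ← Finset.mul_sum, ← Finset.mul_sum, ← Finset.sum_div, ← Finset.sum_div, ← Finset.sum_div,
    div_self hA.ne', div_self hB.ne', div_self hC.ne', mul_one, mul_one, mul_one, h, mul_one]

/-- Hölder with weights p/q, θp and θ₂p, which add up to 1. Since 0 ≤ g ≤ 1 and θ₂ ≤ 1, g^p may be
replaced by the larger g^{θ₂p}. -/
theorem rpow_sum_rpow_le {ι : Type*} (T : Finset ι) {f A b g : ι → ℝ} (hf : ∀ i, 0 ≤ f i)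
    (hA : ∀ i, 0 ≤ A i) (hb : ∀ i, 0 ≤ b i) (hg : ∀ i, 0 ≤ g i) (hg1 : ∀ i, g i ≤ 1) {p q θ θ₂ K : ℝ}
    (hp : 1 ≤ p) (hq : 0 < q) (hθ : 0 < θ) (hθ₂ : 0 < θ₂) (hθ₂' : θ₂ ≤ 1) (h : 1 / p = 1 / q + θ + θ₂)
    (hK : 0 ≤ K) (hle : ∀ i ∈ T, f i ≤ K * (A i * b i ^ θ * g i)) :
    (∑ i ∈ T, f i ^ p) ^ (1 / p) ≤
      K * ((∑ i ∈ T, A i ^ q) ^ (1 / q) * (∑ i ∈ T, b i) ^ θ * (∑ i ∈ T, g i) ^ θ₂) := by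
  have hp0 : 0 < p := by linarith
  have hsum : p / q + θ * p + θ₂ * p = 1 := by
    have : p * (1 / p) = 1 := by field_simp
    rw [h] at this
    calc _ = p * (1 / q + θ + θ₂) := by ring
      _ = 1 := this
  have h1 := sum_mul_rpow_le T (fun i => Real.rpow_nonneg (hA i) q) hb hg (x := p / q) (y := θ * p)
    (z := θ₂ * p) (by positivity) (by positivity) (by positivity) hsum
  have h2 : ∀ i ∈ T, f i ^ p ≤ K ^ p * ((A i ^ q) ^ (p / q) * b i ^ (θ * p) * g i ^ (θ₂ * p)) := by
    intro i hi
    have hA' := hA i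
    have hb' := Real.rpow_nonneg (hb i) θ
    have hg' := hg i
    refine (Real.rpow_le_rpow (hf i) (hle i hi) hp0.le).trans ?_
    rw [Real.mul_rpow hK (by positivity), Real.mul_rpow (by positivity) hg',
      Real.mul_rpow hA' hb', ← Real.rpow_mul hA', ← Real.rpow_mul (hb i)]
    have e1 : q * (p / q) = p := by field_simp
    rw [e1]
    have e2 : g i ^ p ≤ g i ^ (θ₂ * p) := by
      rcases hg'.eq_or_lt with h0 | h0
      · rw [← h0, Real.zero_rpow hp0.ne', Real.zero_rpow (by positivity)]
      · exact Real.rpow_le_rpow_of_exponent_ge h0 (hg1 i) (by nlinarith)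
    have := Real.rpow_nonneg hA' p
    have := Real.rpow_nonneg (hb i) (θ * p)
    gcongr
  have hSA : 0 ≤ ∑ i ∈ T, A i ^ q := Finset.sum_nonneg fun i _ => Real.rpow_nonneg (hA i) _
  have hSb : 0 ≤ ∑ i ∈ T, b i := Finset.sum_nonneg fun i _ => hb i
  have hSg : 0 ≤ ∑ i ∈ T, g i := Finset.sum_nonneg fun i _ => hg i
  have h3 : ∑ i ∈ T, f i ^ p ≤ K ^ p * ((∑ i ∈ T, A i ^ q) ^ (p / q) * (∑ i ∈ T, b i) ^ (θ * p) *
      (∑ i ∈ T, g i) ^ (θ₂ * p)) := by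
    refine (Finset.sum_le_sum h2).trans ?_
    rw [← Finset.mul_sum]
    gcongr
  refine (Real.rpow_le_rpow (Finset.sum_nonneg fun i _ => Real.rpow_nonneg (hf i) _) h3
    (by positivity)).trans (le_of_eq ?_)
  have hh1 := Real.rpow_nonneg hSA (p / q)
  have hh2 := Real.rpow_nonneg hSb (θ * p)
  have hh3 := Real.rpow_nonneg hSg (θ₂ * p)
  rw [Real.mul_rpow (by positivity) (by positivity), Real.mul_rpow (by positivity) hh3,
    Real.mul_rpow hh1 hh2, ← Real.rpow_mul hK, ← Real.rpow_mul hSA, ← Real.rpow_mul hSb,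
    ← Real.rpow_mul hSg]
  have e1 : p * (1 / p) = 1 := by field_simp
  have e2 : p / q * (1 / p) = 1 / q := by field_simp
  have e3 : θ * p * (1 / p) = θ := by field_simp
  have e4 : θ₂ * p * (1 / p) = θ₂ := by field_simp
  rw [e1, e2, e3, e4, Real.rpow_one]

section
variable {m : ℕ} {F : Fin m → ℤ} {P : MvPolynomial (Fin m) ℤ}

/-- The `ℓ^q` norm of the bad-modulus sums. -/
theorem B3.exists_sum_rpow_heartZero_le (h : B3 F P) : ∃ η B : ℝ, 0 < η ∧ η ≤ 1 / 8 ∧ 0 < B ∧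
    ∀ D : ℝ → ℝ, IsCutoff D → ∃ b : ℝ, 0 < b ∧
      (∀ N₀ c s₀, 0 < N₀ → b * N₀ < 1 → heartZero F P D N₀ c s₀ = 0) ∧
      ∀ q : ℝ, 2 ≤ q → q ≤ 3 → B * (q - 2) ≤ 4 * η → ∃ K, 0 ≤ K ∧
        ∀ (N₀ Z : ℝ) (T : Finset (Fin m → ℤ)) (s₀ : ℂ), 0 < N₀ → 0 < Z → 1 ≤ b * N₀ →
          b * N₀ ≤ Z ^ 3 → s₀.re = 0 → (∀ c ∈ T, ‖toReal c‖ ≤ Z ∧ dualInt P c ≠ 0) →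
          ∑ c ∈ T, (‖heartZero F P D N₀ c s₀‖ / N₀ ^ (1 / 2 : ℝ)) ^ q ≤
            K * Z ^ m * N₀ ^ (-η * q) := by
  obtain ⟨δ, K₁, hδ, hK₁, hB⟩ := h.exists_sum_sq_le
  refine ⟨min δ 1 / 8, (m : ℝ) / 2 + 1, by positivity, by linarith [min_le_right δ 1], by positivity,
    fun D hD => ?_⟩
  set η := min δ 1 / 8 with hη
  have hη0 : 0 < η := by positivity
  have hηδ : 8 * η ≤ δ := by rw [hη]; linarith [min_le_left δ 1]
  obtain ⟨a, b₀, M, ha, hab, hM, hDs, hDM⟩ := hD.exists_support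
  obtain ⟨I, hI⟩ := pow_unbounded_of_one_lt (b₀ / a) (one_lt_two (α := ℝ))
  rw [div_lt_iff₀ ha] at hI
  set b := 2 ^ I * a with hb
  have hb0 : 0 < b := by positivity
  refine ⟨b, hb0, fun N₀ c s₀ hN hbN => heartZero_eq_zero (fun r hr => ((hDs r hr).2.trans hI.le)) hN hbN c s₀,
    fun q hq2 hq3 hBq => ?_⟩
  have hq0 : 0 < q := by linarith
  -- Interpolation x^q = x^{q-2}x², with the trivial bound for the first factor and (B3) for the
  -- second, gives the power R^E. By B(q − 2) ≤ 4η, 8η ≤ δ and q ≤ 3 one has E + ηq ≤ −η, so N₀^E is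
  -- O(N₀^{-ηq}) for N₀ ≥ 1/b.
  set E := ((m : ℝ) / 2 + 1) * (q - 2) - δ with hE
  have hEq : E + η * q ≤ 0 := by nlinarith
  set K₂ : ℝ := 2 ^ ((m : ℝ) + 2) with hK₂
  have hK₂0 : 0 ≤ K₂ := by positivity
  set M' := M * b ^ (1 / 2 : ℝ) with hM'
  have hM'0 : 0 ≤ M' := by positivity
  set ρ : ℕ → ℝ := fun i => 2 ^ i * a with hρ
  have hρ0 : ∀ i, 0 < ρ i := fun i => by positivity
  refine ⟨M' ^ q * ((I : ℝ) ^ (q - 1) * ∑ i ∈ Finset.range I,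
    K₂ ^ (q - 2) * K₁ * (ρ i ^ E * b⁻¹ ^ (E + η * q))), ?_, fun N₀ Z T s₀ hN hZ hbN hbZ hs hT => ?_⟩
  · have : 0 ≤ ∑ i ∈ Finset.range I, K₂ ^ (q - 2) * K₁ * (ρ i ^ E * b⁻¹ ^ (E + η * q)) :=
      Finset.sum_nonneg fun i _ => by
        have := hρ0 i
        positivity
    positivity
  have hR0 : ∀ i, 0 < ρ i * N₀ := fun i => mul_pos (hρ0 i) hN
  have hH : ∀ c, (‖heartZero F P D N₀ c s₀‖ / N₀ ^ (1 / 2 : ℝ)) ^ q ≤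
      M' ^ q * ((I : ℝ) ^ (q - 1) * ∑ i ∈ Finset.range I, blockSum F P c (ρ i * N₀) ^ q) := by
    intro c
    have hx : ∀ i, 0 ≤ blockSum F P c (ρ i * N₀) := fun i => blockSum_nonneg (hR0 i)
    have h1 := norm_heartZero_le (F := F) (P := P) ha hDs hDM hI hN c hs
    have hs0 : 0 ≤ ∑ i ∈ Finset.range I, blockSum F P c (ρ i * N₀) :=
      Finset.sum_nonneg fun i _ => hx i
    refine (Real.rpow_le_rpow (by positivity) h1 hq0.le).trans ?_
    rw [Real.mul_rpow hM'0 hs0]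
    refine mul_le_mul_of_nonneg_left ?_ (by positivity)
    have h2 := Real.rpow_sum_le_const_mul_sum_rpow (Finset.range I)
      (fun i => blockSum F P c (ρ i * N₀)) (p := q) (by linarith)
    simp only [abs_of_nonneg (hx _), Finset.card_range] at h2
    exact h2
  have hblk : ∀ i ∈ Finset.range I, ∑ c ∈ T, blockSum F P c (ρ i * N₀) ^ q ≤
      K₂ ^ (q - 2) * K₁ * (ρ i ^ E * b⁻¹ ^ (E + η * q)) * (Z ^ m * N₀ ^ (-η * q)) := by
    intro i hi
    have hRi := hR0 i
    have hρi := hρ0 i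
    have hRZ : ρ i * N₀ ≤ Z ^ 3 := by
      refine le_trans ?_ hbZ
      have : (2 : ℝ) ^ i ≤ 2 ^ I := pow_le_pow_right₀ (by norm_num) (Finset.mem_range.1 hi).le
      simp only [hρ, hb]
      gcongr
    have h1 := hB Z (ρ i * N₀) T hZ hRi hRZ hT
    have h2 : ∀ c ∈ T, blockSum F P c (ρ i * N₀) ^ q ≤
        (K₂ * (ρ i * N₀) ^ ((m : ℝ) / 2 + 1)) ^ (q - 2) * blockSum F P c (ρ i * N₀) ^ 2 := by
      intro c _
      have hx := blockSum_nonneg (F := F) (P := P) (c := c) hRi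
      have e1 : blockSum F P c (ρ i * N₀) ^ q =
          blockSum F P c (ρ i * N₀) ^ (q - 2) * blockSum F P c (ρ i * N₀) ^ 2 := by
        rw [← Real.rpow_natCast _ 2, ← Real.rpow_add_of_nonneg hx (by linarith) (by norm_num)]
        congr 1; push_cast; ring
      rw [e1]
      refine mul_le_mul_of_nonneg_right ?_ (sq_nonneg _)
      exact Real.rpow_le_rpow hx (blockSum_le c hRi) (by linarith)
    have hp1 := Real.rpow_nonneg hRi.le ((m : ℝ) / 2 + 1)
    calc _ ≤ (K₂ * (ρ i * N₀) ^ ((m : ℝ) / 2 + 1)) ^ (q - 2) *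
          ∑ c ∈ T, blockSum F P c (ρ i * N₀) ^ 2 := by
          rw [Finset.mul_sum]; exact Finset.sum_le_sum h2
      _ ≤ (K₂ * (ρ i * N₀) ^ ((m : ℝ) / 2 + 1)) ^ (q - 2) * (K₁ * Z ^ m * (ρ i * N₀) ^ (-δ)) := by
          gcongr
      _ = K₂ ^ (q - 2) * K₁ * Z ^ m * (ρ i * N₀) ^ E := by
          rw [Real.mul_rpow hK₂0 hp1, ← Real.rpow_mul hRi.le, hE, sub_eq_add_neg (_ * _), Real.rpow_add hRi]
          ring
      _ = K₂ ^ (q - 2) * K₁ * Z ^ m * (ρ i ^ E * (N₀ ^ (E + η * q) * N₀ ^ (-η * q))) := by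
          rw [Real.mul_rpow hρi.le hN.le, ← Real.rpow_add hN]
          congr 3; ring
      _ ≤ K₂ ^ (q - 2) * K₁ * Z ^ m * (ρ i ^ E * (b⁻¹ ^ (E + η * q) * N₀ ^ (-η * q))) := by
          have h3 : N₀ ^ (E + η * q) ≤ b⁻¹ ^ (E + η * q) :=
            Real.rpow_le_rpow_of_nonpos (by positivity) (by rwa [inv_le_iff_one_le_mul₀' hb0]) hEq
          gcongr
      _ = _ := by ring
  calc _ ≤ ∑ c ∈ T, M' ^ q * ((I : ℝ) ^ (q - 1) * ∑ i ∈ Finset.range I, blockSum F P c (ρ i * N₀) ^ q) :=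
        Finset.sum_le_sum fun c _ => hH c
    _ = M' ^ q * ((I : ℝ) ^ (q - 1) * ∑ i ∈ Finset.range I, ∑ c ∈ T, blockSum F P c (ρ i * N₀) ^ q) := by
        rw [← Finset.mul_sum, ← Finset.mul_sum, Finset.sum_comm]
    _ ≤ M' ^ q * ((I : ℝ) ^ (q - 1) * ∑ i ∈ Finset.range I,
        K₂ ^ (q - 2) * K₁ * (ρ i ^ E * b⁻¹ ^ (E + η * q)) * (Z ^ m * N₀ ^ (-η * q))) := by
        gcongr with i hi
        exact hblk i hi
    _ = _ := by rw [← Finset.sum_mul]; ring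

end

/-! ### Integral points at which the dual form is small -/

/-- A complex square root of a real number. -/
noncomputable def complexSqrt (y : ℝ) : ℂ := √y + Complex.I * √(-y)

theorem sqrt_mul_sqrt_neg (y : ℝ) : √y * √(-y) = 0 := by
  rcases le_total y 0 with h | h
  · rw [Real.sqrt_eq_zero_of_nonpos h, zero_mul]
  · rw [Real.sqrt_eq_zero_of_nonpos (neg_nonpos.2 h), mul_zero]

theorem sq_complexSqrt (y : ℝ) : complexSqrt y ^ 2 = y := by
  have h1 : (√y : ℂ) * √(-y) = 0 := by exact_mod_cast sqrt_mul_sqrt_neg y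
  have h2 : √y ^ 2 - √(-y) ^ 2 = y := by
    rcases le_total y 0 with h | h
    · rw [Real.sqrt_eq_zero_of_nonpos h, Real.sq_sqrt (neg_nonneg.2 h)]; ring
    · rw [Real.sqrt_eq_zero_of_nonpos (neg_nonpos.2 h), Real.sq_sqrt h]; ring
  have h3 : (√y : ℂ) ^ 2 - (√(-y) : ℂ) ^ 2 = y := by exact_mod_cast h2
  rw [complexSqrt]
  linear_combination h3 + 2 * Complex.I * h1 + (√(-y) : ℂ) ^ 2 * Complex.I_sq

theorem complexSqrt_pow_three (y : ℝ) :
    complexSqrt y ^ 3 = ((√y ^ 3 : ℝ) : ℂ) + (-√(-y) ^ 3 : ℝ) * Complex.I := by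
  have h1 : (√y : ℂ) * √(-y) = 0 := by exact_mod_cast sqrt_mul_sqrt_neg y
  rw [complexSqrt]
  push_cast
  linear_combination (3 * Complex.I * (√y : ℂ) + 3 * Complex.I ^ 2 * √(-y)) * h1 +
    (√(-y) : ℂ) ^ 3 * Complex.I * Complex.I_sq

/-- After removing (a − b)² from both sides, what remains is (a² − b²)(a + b)² ≤ (a² + ab + b²)² for
a ≥ b ≥ 0. -/
theorem abs_sq_sub_sq_pow_three_le {a b : ℝ} (ha : 0 ≤ a) (hb : 0 ≤ b) :
    |a ^ 2 - b ^ 2| ^ 3 ≤ (a ^ 3 - b ^ 3) ^ 2 := by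
  wlog h : b ≤ a generalizing a b
  · rw [abs_sub_comm, show (a ^ 3 - b ^ 3) ^ 2 = (b ^ 3 - a ^ 3) ^ 2 by ring]
    exact this hb ha (le_of_not_ge h)
  rw [abs_of_nonneg (by nlinarith)]
  have h1 : (a ^ 2 - b ^ 2) * (a + b) ^ 2 ≤ (a ^ 2 + a * b + b ^ 2) ^ 2 := by
    have := mul_nonneg (mul_nonneg ha hb) (sq_nonneg b)
    nlinarith [sq_nonneg (a * b), sq_nonneg (b ^ 2)]
  calc (a ^ 2 - b ^ 2) ^ 3 = (a - b) ^ 2 * ((a ^ 2 - b ^ 2) * (a + b) ^ 2) := by ring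
    _ ≤ (a - b) ^ 2 * (a ^ 2 + a * b + b ^ 2) ^ 2 := by gcongr
    _ = _ := by ring

/-- The value y is recovered from y^{3/2} with Hölder exponent 2/3, on both sides of 0: the real
part of the cube carries the positive part of y and the imaginary part the negative part. -/
theorem abs_sub_pow_three_le (y z : ℝ) :
    |y - z| ^ 3 ≤ 8 * ‖complexSqrt y ^ 3 - complexSqrt z ^ 3‖ ^ 2 := by
  set δ := complexSqrt y ^ 3 - complexSqrt z ^ 3 with hδ
  have hre : δ.re = √y ^ 3 - √z ^ 3 := by
    rw [hδ, complexSqrt_pow_three, complexSqrt_pow_three, Complex.sub_re, Complex.add_re, Complex.add_re,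
      Complex.re_ofReal_mul, Complex.re_ofReal_mul, Complex.ofReal_re, Complex.ofReal_re, Complex.I_re]
    ring
  have him : δ.im = -(√(-y) ^ 3 - √(-z) ^ 3) := by
    rw [hδ, complexSqrt_pow_three, complexSqrt_pow_three, Complex.sub_im, Complex.add_im, Complex.add_im,
      Complex.im_ofReal_mul, Complex.im_ofReal_mul, Complex.ofReal_im, Complex.ofReal_im, Complex.I_im]
    ring
  have h1 := abs_sq_sub_sq_pow_three_le (Real.sqrt_nonneg y) (Real.sqrt_nonneg z)
  have h2 := abs_sq_sub_sq_pow_three_le (Real.sqrt_nonneg (-y)) (Real.sqrt_nonneg (-z))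
  rw [← hre] at h1
  rw [← neg_sq (√(-y) ^ 3 - √(-z) ^ 3), ← him] at h2
  have h3 : δ.re ^ 2 + δ.im ^ 2 = ‖δ‖ ^ 2 := by
    rw [Complex.sq_norm, Complex.normSq_apply]; ring
  have h4 : ∀ y, √y ^ 2 - √(-y) ^ 2 = y := fun y => by
    rcases le_total y 0 with h | h
    · rw [Real.sqrt_eq_zero_of_nonpos h, Real.sq_sqrt (neg_nonneg.2 h)]; ring
    · rw [Real.sqrt_eq_zero_of_nonpos (neg_nonpos.2 h), Real.sq_sqrt h]; ring
  set p := |√y ^ 2 - √z ^ 2|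
  set r := |√(-y) ^ 2 - √(-z) ^ 2|
  have hp : 0 ≤ p := abs_nonneg _
  have hr : 0 ≤ r := abs_nonneg _
  have h5 : |y - z| ≤ p + r := by
    conv_lhs => rw [← h4 y, ← h4 z]
    refine le_trans (le_of_eq ?_) (abs_sub _ _)
    congr 1; ring
  calc |y - z| ^ 3 ≤ (p + r) ^ 3 := by gcongr
    _ ≤ 4 * (p ^ 3 + r ^ 3) := by nlinarith [mul_nonneg (add_nonneg hp hr) (sq_nonneg (p - r))]
    _ ≤ 8 * ‖δ‖ ^ 2 := by nlinarith [sq_nonneg δ.re, sq_nonneg δ.im]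

theorem card_le_of_norm_le {m : ℕ} (T : Finset (Fin m → ℤ)) {R : ℝ} (hR : 0 ≤ R)
    (hT : ∀ c ∈ T, ‖toReal c‖ ≤ R) : (T.card : ℝ) ≤ (2 * R + 1) ^ m := by
  have h1 : T ⊆ Fintype.piFinset fun _ => Finset.Icc (-⌊R⌋) ⌊R⌋ := fun c hc => by
    rw [Fintype.mem_piFinset]
    intro i
    have h2 := abs_le.1 ((norm_le_pi_norm (toReal c) i).trans (hT c hc))
    rw [Finset.mem_Icc]
    refine ⟨?_, Int.le_floor.2 h2.2⟩
    rw [neg_le]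
    refine Int.le_floor.2 ?_
    have := h2.1
    simp only [toReal] at this
    push_cast; linarith
  have h3 := Finset.card_le_card h1
  rw [Fintype.card_piFinset_const, Int.card_Icc] at h3
  have h4 : (0 : ℤ) ≤ ⌊R⌋ := Int.floor_nonneg.2 hR
  have h5 : (((⌊R⌋ + 1 - -⌊R⌋).toNat : ℕ) : ℝ) ≤ 2 * R + 1 := by
    have h6 : (((⌊R⌋ + 1 - -⌊R⌋).toNat : ℤ)) = ⌊R⌋ + 1 - -⌊R⌋ := Int.toNat_of_nonneg (by omega)
    have h7 : (((⌊R⌋ + 1 - -⌊R⌋).toNat : ℕ) : ℝ) = ((⌊R⌋ + 1 - -⌊R⌋ : ℤ) : ℝ) := by exact_mod_cast h6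
    rw [h7]
    push_cast
    have := Int.floor_le R
    linarith
  calc (T.card : ℝ) ≤ (((⌊R⌋ + 1 - -⌊R⌋).toNat ^ m : ℕ) : ℝ) := by exact_mod_cast h3
    _ ≤ _ := by push_cast; gcongr

theorem card_le_of_abs_sub_le (T : Finset ℤ) {d : ℝ} (hd : 0 ≤ d)
    (hT : ∀ x ∈ T, ∀ y ∈ T, |(x : ℝ) - y| ≤ d) : (T.card : ℝ) ≤ d + 1 := by
  rcases T.eq_empty_or_nonempty with rfl | hne
  · simp; linarith
  have h1 : T ⊆ Finset.Icc (T.min' hne) (T.max' hne) := fun x hx =>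
    Finset.mem_Icc.2 ⟨T.min'_le x hx, T.le_max' x hx⟩
  have h2 := Finset.card_le_card h1
  have h3 : T.min' hne ≤ T.max' hne := T.min'_le _ (T.max'_mem hne)
  rw [Int.card_Icc] at h2
  have h4 : (((T.max' hne + 1 - T.min' hne).toNat : ℕ) : ℝ) =
      ((T.max' hne + 1 - T.min' hne : ℤ) : ℝ) := by
    exact_mod_cast Int.toNat_of_nonneg (by omega)
  have h5 := (abs_le.1 (hT _ (T.max'_mem hne) _ (T.min'_mem hne))).2
  calc (T.card : ℝ) ≤ ((T.max' hne + 1 - T.min' hne).toNat : ℕ) := by exact_mod_cast h2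
    _ ≤ d + 1 := by rw [h4]; push_cast; linarith

/-- The number of integral points at which one factor of the dual form is small. -/
theorem card_le_of_norm_factor_le {n : ℕ} {F : Fin (n + 1) → ℤ} (hF : F 0 ≠ 0) (ε : Fin (n + 1) → ℤˣ)
    (T : Finset (Fin (n + 1) → ℤ)) {R A d : ℝ} (hR : 0 ≤ R) (hd : 0 ≤ d)
    (hAd : 32 * |(F 0 : ℝ)| * A ^ 2 ≤ d ^ 3) (hT : ∀ c ∈ T, ‖toReal c‖ ≤ R ∧
      ‖∑ i, ((ε i : ℤ) : ℂ) * F i * complexSqrt (c i / F i) ^ 3‖ ≤ A) :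
    (T.card : ℝ) ≤ (d + 1) * (2 * R + 1) ^ n := by
  -- Fibre over all coordinates except the first. In a fibre only the term at 0 of the factor
  -- varies, so smallness of the factor confines c₀ to an interval of length d.
  have h1 : T.card ≤ ⌊d + 1⌋₊ * (T.image Fin.tail).card := by
    refine Finset.card_le_mul_card_image T _ fun v _ => ?_
    refine Nat.le_floor ?_
    set T' := T.filter fun c => Fin.tail c = v with hT'
    have hinj : Set.InjOn (fun c : Fin (n + 1) → ℤ => c 0) T' := by
      intro c hc c' hc' h
      rw [hT', Finset.coe_filter] at hc hc'
      rw [← Fin.cons_self_tail c, ← Fin.cons_self_tail c', hc.2, hc'.2]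
      simp only at h
      rw [h]
    rw [← Finset.card_image_of_injOn hinj]
    refine card_le_of_abs_sub_le _ hd fun x hx y hy => ?_
    obtain ⟨c, hc, rfl⟩ := Finset.mem_image.1 hx
    obtain ⟨c', hc', rfl⟩ := Finset.mem_image.1 hy
    rw [hT', Finset.mem_filter] at hc hc'
    have h2 : ‖((ε 0 : ℤ) : ℂ) * F 0 * complexSqrt (c 0 / F 0) ^ 3 -
        ((ε 0 : ℤ) : ℂ) * F 0 * complexSqrt (c' 0 / F 0) ^ 3‖ ≤ A + A := by
      have h3 : ∑ i : Fin n, ((ε i.succ : ℤ) : ℂ) * F i.succ * complexSqrt (c i.succ / F i.succ) ^ 3 =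
          ∑ i : Fin n, ((ε i.succ : ℤ) : ℂ) * F i.succ * complexSqrt (c' i.succ / F i.succ) ^ 3 := by
        refine Finset.sum_congr rfl fun i _ => ?_
        have : c i.succ = c' i.succ := congrFun (hc.2.trans hc'.2.symm) i
        rw [this]
      have h4 := (hT c hc.1).2
      have h5 := (hT c' hc'.1).2
      rw [Fin.sum_univ_succ] at h4 h5
      rw [h3] at h4
      refine le_trans (le_of_eq ?_) ((norm_sub_le _ _).trans (add_le_add h4 h5))
      congr 1; ring
    have hε : ‖((ε 0 : ℤ) : ℂ)‖ = 1 := by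
      rcases Int.units_eq_one_or (ε 0) with h | h <;> simp [h]
    rw [← mul_sub, norm_mul, norm_mul, hε, one_mul, Complex.norm_intCast] at h2
    have hF0 : 0 < |(F 0 : ℝ)| := abs_pos.2 (by exact_mod_cast hF)
    have h6 := abs_sub_pow_three_le (c 0 / F 0) (c' 0 / F 0)
    rw [← sub_div, abs_div, div_pow, div_le_iff₀ (by positivity)] at h6
    -- The constant 32 in the hypothesis is 8·2²: the 8 of `abs_sub_pow_three_le` and the square of
    -- A + A. Of the three powers of |F₀| two are consumed here.
    have h7 : (|(F 0 : ℝ)| * ‖complexSqrt (c 0 / F 0) ^ 3 - complexSqrt (c' 0 / F 0) ^ 3‖) ^ 2 ≤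
        (A + A) ^ 2 := by gcongr
    refine le_of_pow_le_pow_left₀ three_ne_zero hd ?_
    nlinarith
  have h2 : ((T.image Fin.tail).card : ℝ) ≤ (2 * R + 1) ^ n := by
    refine card_le_of_norm_le _ hR fun v hv => ?_
    obtain ⟨c, hc, rfl⟩ := Finset.mem_image.1 hv
    refine (pi_norm_le_iff_of_nonneg hR).2 fun i => ?_
    exact (norm_le_pi_norm (toReal c) i.succ).trans (hT c hc).1
  calc (T.card : ℝ) ≤ (⌊d + 1⌋₊ : ℝ) * (T.image Fin.tail).card := by exact_mod_cast h1
    _ ≤ _ := by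
      gcongr
      exact Nat.floor_le (by positivity)

/-- The number of integral points at which the dual form is small. -/
theorem IsDualForm.exists_card_le {n : ℕ} {F : Fin (n + 1) → ℤ} {P : MvPolynomial (Fin (n + 1)) ℤ}
    (hF : ∀ i, F i ≠ 0) (hP : IsDualForm F P) : ∃ a K : ℝ, 0 < a ∧ a ≤ 1 / 2 ∧ 0 ≤ K ∧
      ∀ (C μ : ℝ) (T : Finset (Fin (n + 1) → ℤ)), 1 / 2 ≤ C → 0 < μ →
        (∀ c ∈ T, C ≤ ‖toReal c‖ ∧ ‖toReal c‖ ≤ 2 * C ∧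
          |dualReal P (‖toReal c‖⁻¹ • toReal c)| ≤ μ) →
        (T.card : ℝ) ≤ K * C ^ (n + 1) * (1 / C + μ ^ (2 * a)) := by
  classical
  obtain ⟨q, hq, h⟩ := hP.aeval_eq
  set E := Finset.univ.filter
    (fun ε : Fin (n + 1) → ℤˣ => ∀ i : Fin (n + 1), (i : ℕ) = 0 → ε i = 1) with hE
  have hEne : E.Nonempty := ⟨fun _ => 1, by simp [hE]⟩
  set D := E.card with hD
  have hD0 : D ≠ 0 := Finset.card_ne_zero.2 hEne
  have hD1 : (1 : ℝ) ≤ D := by exact_mod_cast Nat.one_le_iff_ne_zero.2 hD0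
  have hq0 : 0 < |(q : ℝ)| := abs_pos.2 (by exact_mod_cast hq)
  have hF1 : (1 : ℝ) ≤ |(F 0 : ℝ)| := by
    rw [← Int.cast_abs]; exact_mod_cast Int.one_le_abs (hF 0)
  -- If a product of D factors is small, one of them is at most of order μ^{1/D}. The Hölder
  -- exponent 2/3 turns this into a relative interval length μ^{2/(3D)} = μ^{2a}.
  set a : ℝ := 1 / (3 * D) with ha
  have ha2 : a ≤ 1 / 2 := by
    rw [ha]; exact one_div_le_one_div_of_le two_pos (by linarith)
  set L : (Fin (n + 1) → ℤˣ) → (Fin (n + 1) → ℤ) → ℂ := fun ε c =>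
    ∑ i, ((ε i : ℤ) : ℂ) * F i * complexSqrt (c i / F i) ^ 3 with hL
  refine ⟨a, D * 6 ^ n * (1 + 8 * |(F 0 : ℝ)| * |(q : ℝ)| ^ (-(2 * a))), by positivity, ha2, by positivity,
    fun C μ T hC hμ hT => ?_⟩
  have hC0 : 0 < C := by linarith
  set σ : ℝ := (μ / |(q : ℝ)|) ^ (1 / (D : ℝ)) with hσ
  have hσ0 : 0 < σ := by positivity
  have hσD : σ ^ D = μ / |(q : ℝ)| := by
    rw [hσ, ← Real.rpow_natCast, ← Real.rpow_mul (by positivity), one_div,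
      inv_mul_cancel₀ (by exact_mod_cast hD0), Real.rpow_one]
  -- The factors are homogeneous of degree 3/2, so at c/‖c‖ they equal ‖c‖^{-3/2}L_ε(c). If all of
  -- them exceeded σ, the dual form would exceed |q|σ^D = μ.
  have key : ∀ c ∈ T, ∃ ε ∈ E, ‖L ε c‖ ≤ σ * √(2 * C) ^ 3 := by
    intro c hc
    obtain ⟨h1, h2, h3⟩ := hT c hc
    have hc0 : 0 < ‖toReal c‖ := hC0.trans_le h1
    set r := √(‖toReal c‖⁻¹) with hr
    have hr0 : 0 < r := Real.sqrt_pos.2 (by positivity)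
    have hr2 : (r : ℂ) ^ 2 = ‖toReal c‖⁻¹ := by
      rw [hr]; exact_mod_cast Real.sq_sqrt (by positivity)
    have e1 : ((dualReal P (‖toReal c‖⁻¹ • toReal c) : ℝ) : ℂ) =
        q * ∏ ε ∈ E, ((r : ℂ) ^ 3 * L ε c) := by
      rw [ofReal_dualReal]
      have e2 : (fun i => (((‖toReal c‖⁻¹ • toReal c) i : ℝ) : ℂ)) =
          fun i => (F i : ℂ) * (r * complexSqrt (c i / F i)) ^ 2 := by
        funext i
        have : (F i : ℂ) ≠ 0 := by exact_mod_cast hF i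
        rw [mul_pow, sq_complexSqrt, hr2]
        simp only [Pi.smul_apply, toReal, smul_eq_mul]
        push_cast
        field_simp
      rw [e2, h]
      congr 1
      refine Finset.prod_congr rfl fun ε _ => ?_
      rw [hL, Finset.mul_sum]
      exact Finset.sum_congr rfl fun i _ => by ring
    have e3 : |dualReal P (‖toReal c‖⁻¹ • toReal c)| = |(q : ℝ)| * ∏ ε ∈ E, (r ^ 3 * ‖L ε c‖) := by
      rw [← Real.norm_eq_abs, ← Complex.norm_real, e1, norm_mul, norm_prod, ← Complex.ofReal_ratCast,
        Complex.norm_real, Real.norm_eq_abs]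
      congr 1
      refine Finset.prod_congr rfl fun ε _ => ?_
      rw [norm_mul, norm_pow, Complex.norm_real, Real.norm_of_nonneg hr0.le]
    by_contra hcon
    push Not at hcon
    have h4 : ∀ ε ∈ E, σ < r ^ 3 * ‖L ε c‖ := fun ε hε => by
      have h5 : 1 ≤ r * √(2 * C) := by
        rw [hr, ← Real.sqrt_mul (by positivity)]
        refine Real.one_le_sqrt.2 ?_
        rw [inv_mul_eq_div]
        exact (one_le_div hc0).2 h2
      calc σ ≤ σ * (r * √(2 * C)) ^ 3 := le_mul_of_one_le_right hσ0.le (one_le_pow₀ h5)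
        _ = r ^ 3 * (σ * √(2 * C) ^ 3) := by ring
        _ < _ := mul_lt_mul_of_pos_left (hcon ε hε) (by positivity)
    have h6 := Finset.prod_lt_prod_of_nonempty (fun _ _ => hσ0) h4 hEne
    rw [Finset.prod_const, ← hD, hσD, div_lt_iff₀ hq0] at h6
    rw [e3] at h3
    linarith
  have hcov : T ⊆ E.biUnion fun ε => T.filter fun c => ‖L ε c‖ ≤ σ * √(2 * C) ^ 3 := fun c hc => by
    obtain ⟨ε, hε, h1⟩ := key c hc
    exact Finset.mem_biUnion.2 ⟨ε, hε, Finset.mem_filter.2 ⟨hc, h1⟩⟩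
  -- Chosen so that 32|F₀|(σ(2C)^{3/2})² = 256|F₀|σ²C³ is at most d³ = 512|F₀|³σ²C³.
  set d := 8 * |(F 0 : ℝ)| * σ ^ (2 / 3 : ℝ) * C with hd
  have hσ3 : (σ ^ (2 / 3 : ℝ)) ^ 3 = σ ^ 2 := by
    rw [← Real.rpow_natCast, ← Real.rpow_mul hσ0.le, ← Real.rpow_natCast]
    norm_num
  have hcard : ∀ ε ∈ E, ((T.filter fun c => ‖L ε c‖ ≤ σ * √(2 * C) ^ 3).card : ℝ) ≤
      (d + 1) * (6 * C) ^ n := fun ε _ => by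
    refine (card_le_of_norm_factor_le (hF 0) ε _ (R := 2 * C) (A := σ * √(2 * C) ^ 3) (d := d)
      (by positivity) (by positivity) ?_ fun c hc => ?_).trans ?_
    · have h1 : (√(2 * C) ^ 3) ^ 2 = (2 * C) ^ 3 := by
        rw [← pow_mul, mul_comm 3 2, pow_mul, Real.sq_sqrt (by positivity)]
      rw [mul_pow, h1, hd, mul_pow, mul_pow, mul_pow, hσ3]
      have h2 : |(F 0 : ℝ)| ≤ |(F 0 : ℝ)| ^ 3 := le_self_pow₀ hF1 three_ne_zero
      have h3 : 0 ≤ σ ^ 2 * C ^ 3 := by positivity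
      nlinarith
    · rw [Finset.mem_filter] at hc
      exact ⟨(hT c hc.1).2.1, hc.2⟩
    · gcongr
      linarith
  have h1 : (T.card : ℝ) ≤ D * ((d + 1) * (6 * C) ^ n) := by
    have h2 : (T.card : ℝ) ≤ ∑ ε ∈ E, ((T.filter fun c => ‖L ε c‖ ≤ σ * √(2 * C) ^ 3).card : ℝ) := by
      exact_mod_cast (Finset.card_le_card hcov).trans Finset.card_biUnion_le
    refine h2.trans ((Finset.sum_le_card_nsmul _ _ _ hcard).trans (le_of_eq ?_))
    rw [nsmul_eq_mul]
  refine h1.trans ?_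
  have hσa : σ ^ (2 / 3 : ℝ) = |(q : ℝ)| ^ (-(2 * a)) * μ ^ (2 * a) := by
    rw [hσ, ← Real.rpow_mul (by positivity), Real.div_rpow hμ.le hq0.le, Real.rpow_neg hq0.le, ha,
      show 1 / (D : ℝ) * (2 / 3) = 2 * (1 / (3 * D)) by field_simp]
    ring
  set Q := |(q : ℝ)| ^ (-(2 * a))
  set M := μ ^ (2 * a)
  have hQ : 0 ≤ Q := by positivity
  have hM : 0 ≤ M := by positivity
  have h3 : d + 1 = C * (8 * |(F 0 : ℝ)| * Q * M + 1 / C) := by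
    rw [hd, hσa]; field_simp
  have h4 : 8 * |(F 0 : ℝ)| * Q * M + 1 / C ≤ (1 + 8 * |(F 0 : ℝ)| * Q) * (1 / C + M) := by
    have : 0 ≤ 8 * |(F 0 : ℝ)| * Q * (1 / C) := by positivity
    nlinarith
  rw [h3]
  calc _ = D * 6 ^ n * C ^ (n + 1) * (8 * |(F 0 : ℝ)| * Q * M + 1 / C) := by ring
    _ ≤ D * 6 ^ n * C ^ (n + 1) * ((1 + 8 * |(F 0 : ℝ)| * Q) * (1 / C + M)) := by gcongr
    _ = _ := by ring

/-- With l = max(min(1, β), 1/C), split at |F^∨(c̃)| = μ = l^{1/2}. Above, each term is at most β/μ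
≤ μ; below, the point count gives C^m(1/C + μ^{2a}) with μ^{2a} = l^a. As a ≤ 1/2 and l ≤ 2, both
are O(C^m l^a). For β ≥ 1 the trivial count suffices. -/
theorem IsDualForm.exists_sum_inv_le {m : ℕ} {F : Fin m → ℤ} {P : MvPolynomial (Fin m) ℤ} (hm : m ≠ 0)
    (hF : ∀ i, F i ≠ 0) (hP : IsDualForm F P) : ∃ a K : ℝ, 0 < a ∧ a ≤ 1 / 2 ∧ 0 ≤ K ∧
      ∀ (C β : ℝ) (T : Finset (Fin m → ℤ)), 1 / 2 ≤ C → 0 < β →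
        (∀ c ∈ T, C ≤ ‖toReal c‖ ∧ ‖toReal c‖ ≤ 2 * C) →
        ∑ c ∈ T, (1 + |dualReal P (‖toReal c‖⁻¹ • toReal c)| / β)⁻¹ ≤
          K * C ^ m * (max (min 1 β) (1 / C)) ^ a := by
  classical
  obtain ⟨n, rfl⟩ := Nat.exists_eq_succ_of_ne_zero hm
  obtain ⟨a, K, ha, ha2, hK, hcard⟩ := hP.exists_card_le hF
  refine ⟨a, 6 ^ (n + 1) * 2 + K * 3, ha, ha2, by positivity, fun C β T hC hβ hT => ?_⟩
  have hC0 : 0 < C := by linarith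
  set Q : (Fin (n + 1) → ℤ) → ℝ := fun c => |dualReal P (‖toReal c‖⁻¹ • toReal c)| with hQ
  have hQ0 : ∀ c, 0 ≤ Q c := fun c => abs_nonneg _
  have htriv : (T.card : ℝ) ≤ 6 ^ (n + 1) * C ^ (n + 1) := by
    refine (card_le_of_norm_le T (R := 2 * C) (by positivity) fun c hc => (hT c hc).2).trans ?_
    rw [← mul_pow]
    gcongr
    linarith
  set l := max (min 1 β) (1 / C) with hl
  have hl0 : 0 < l := lt_max_of_lt_right (by positivity)
  have hla : 0 < l ^ a := by positivity
  rcases le_total 1 β with h1 | h1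
  · have h2 : 1 ≤ l := le_max_of_le_left (by rw [min_eq_left h1])
    have h3 : 1 ≤ l ^ a := Real.one_le_rpow h2 ha.le
    have h4 : ∑ c ∈ T, (1 + Q c / β)⁻¹ ≤ T.card := by
      refine (Finset.sum_le_card_nsmul _ _ 1 fun c _ => ?_).trans (by simp)
      refine inv_le_one_of_one_le₀ ?_
      have : 0 ≤ Q c / β := div_nonneg (hQ0 c) hβ.le
      linarith
    refine h4.trans (htriv.trans ?_)
    have h5 : 6 ^ (n + 1) * C ^ (n + 1) ≤ (6 ^ (n + 1) * 2 + K * 3) * C ^ (n + 1) := by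
      gcongr
      have : (0 : ℝ) < 6 ^ (n + 1) := by positivity
      linarith
    exact h5.trans (le_mul_of_one_le_right (by positivity) h3)
  have hβl : β ≤ l := le_max_of_le_left (by rw [min_eq_right h1])
  have hCl : 1 / C ≤ l := le_max_right _ _
  have hl2 : l ≤ 2 := max_le ((min_le_left _ _).trans one_le_two) (by
    rw [div_le_iff₀ hC0]; linarith)
  have hpow : ∀ b, a ≤ b → b ≤ 1 → l ^ b ≤ 2 * l ^ a := fun b hab hb => by
    rw [show b = (b - a) + a by ring, Real.rpow_add hl0]
    gcongr
    calc l ^ (b - a) ≤ 2 ^ (b - a) := Real.rpow_le_rpow hl0.le hl2 (by linarith)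
      _ ≤ 2 ^ (1 : ℝ) := Real.rpow_le_rpow_of_exponent_le one_le_two (by linarith)
      _ = 2 := Real.rpow_one 2
  set μ := l ^ (1 / 2 : ℝ) with hμ
  have hμ0 : 0 < μ := by positivity
  have h2 : ∀ c ∈ T, (1 + Q c / β)⁻¹ ≤ μ + if Q c ≤ μ then 1 else 0 := fun c _ => by
    have h3 : 0 ≤ Q c / β := div_nonneg (hQ0 c) hβ.le
    split_ifs with h
    · have := inv_le_one_of_one_le₀ (show 1 ≤ 1 + Q c / β by linarith)
      linarith
    · push Not at h
      rw [add_zero]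
      refine inv_le_of_inv_le₀ hμ0 ?_
      have h4 : μ⁻¹ = μ / l := by
        rw [eq_div_iff hl0.ne', inv_mul_eq_iff_eq_mul₀ hμ0.ne', hμ, ← Real.rpow_add hl0]
        norm_num
      rw [h4]
      calc μ / l ≤ Q c / β := by gcongr
        _ ≤ _ := by linarith
  have h3 := hcard C μ (T.filter fun c => Q c ≤ μ) hC hμ0 fun c hc => by
    rw [Finset.mem_filter] at hc
    exact ⟨(hT c hc.1).1, (hT c hc.1).2, hc.2⟩
  have h4 : μ ^ (2 * a) = l ^ a := by
    rw [hμ, ← Real.rpow_mul hl0.le]; congr 1; ring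
  calc ∑ c ∈ T, (1 + Q c / β)⁻¹ ≤ ∑ c ∈ T, (μ + if Q c ≤ μ then 1 else 0) := Finset.sum_le_sum h2
    _ = T.card * μ + ((T.filter fun c => Q c ≤ μ).card : ℝ) := by
      rw [Finset.sum_add_distrib, Finset.sum_const, nsmul_eq_mul, Finset.sum_boole]
    _ ≤ 6 ^ (n + 1) * C ^ (n + 1) * (2 * l ^ a) + K * C ^ (n + 1) * (2 * l ^ a + l ^ a) := by
      rw [h4] at h3
      refine add_le_add (mul_le_mul htriv (hpow _ ha2 (by norm_num)) hμ0.le (by positivity)) (h3.trans ?_)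
      have : 1 / C ≤ 2 * l ^ a := hCl.trans (by simpa using hpow 1 (by linarith) le_rfl)
      gcongr
    _ = _ := by rw [Nat.succ_eq_add_one]; ring

/-! ### Numerical inequalities for the two ranges of N₀ -/

theorem rpow_le_mul_rpow {c x r s : ℝ} (hc : 0 < c) (hx : c ≤ x) (hrs : r ≤ s) :
    x ^ r ≤ c ^ (r - s) * x ^ s := by
  have hx0 := hc.trans_le hx
  calc x ^ r = x ^ (r - s) * x ^ s := by rw [← Real.rpow_add hx0]; congr 1; ring
    _ ≤ _ := by
      have := Real.rpow_le_rpow_of_nonpos hc hx (show r - s ≤ 0 by linarith)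
      gcongr

theorem rpow_le_one_add {y r : ℝ} (hy : 0 < y) (hr : 0 ≤ r) (hr1 : r ≤ 1) : y ^ r ≤ 1 + y := by
  rcases le_total y 1 with h | h
  · have := Real.rpow_le_one hy.le h hr
    linarith
  · have := Real.rpow_le_rpow_of_exponent_le h hr1
    rw [Real.rpow_one] at this
    linarith

/-- The task is to extract n^θ; every power of y that remains has exponent in [0, 1] and is at most
1 + y. For n ≥ y the factor n^{1-μ/2} already contains a sufficiently negative power. For n < y it
comes from the small factor: directly from (n/y)^{3θ}, or from (yU)^{-3θ} through nU³ ≥ c, which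
explains the exponent 3θ. -/
theorem max_rpow_mul_rpow_le {μ e θ c U n y : ℝ} (hμ : 2 ≤ μ) (he : e ≤ μ / 2)
    (hθ : 0 < θ) (h : μ / 2 - e + 3 * θ ≤ 1) (hc : 0 < c) (hU : 0 < U) (hn : 0 < n) (hy : 0 < y)
    (hyU : 1 / 2 ≤ y * U) (hnU : c ≤ n * U ^ 3) :
    (max n y) ^ (1 - μ / 2) * y ^ e * (max (min 1 (n / y)) (1 / (y * U))) ^ (3 * θ) ≤
      (2 + c ^ (-θ)) * (n ^ θ * (1 + y)) := by
  have hnθ : 0 < n ^ θ := Real.rpow_pos_of_pos hn _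
  have hcθ : 0 < c ^ (-θ) := Real.rpow_pos_of_pos hc _
  have hyU0 : 0 < y * U := by positivity
  have h1 : y ^ (1 - μ / 2 - θ) * y ^ e ≤ 1 + y := by
    rw [← Real.rpow_add hy]
    exact rpow_le_one_add hy (by linarith) (by linarith)
  have hl0 : 0 < max (min 1 (n / y)) (1 / (y * U)) := lt_max_of_lt_right (by positivity)
  rcases le_total y n with hyn | hyn
  · have hl2 : max (min 1 (n / y)) (1 / (y * U)) ≤ 2 :=
      max_le ((min_le_left _ _).trans one_le_two) (by rw [div_le_iff₀ hyU0]; linarith)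
    have h2 : (max (min 1 (n / y)) (1 / (y * U))) ^ (3 * θ) ≤ 2 := by
      calc _ ≤ (2 : ℝ) ^ (3 * θ) := Real.rpow_le_rpow hl0.le hl2 (by positivity)
        _ ≤ 2 ^ (1 : ℝ) := Real.rpow_le_rpow_of_exponent_le one_le_two (by linarith)
        _ = 2 := Real.rpow_one 2
    rw [max_eq_left hyn]
    have h3 : n ^ (1 - μ / 2) ≤ n ^ θ * y ^ (1 - μ / 2 - θ) := by
      calc n ^ (1 - μ / 2) = n ^ θ * n ^ (1 - μ / 2 - θ) := by
            rw [← Real.rpow_add hn]; congr 1; ring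
        _ ≤ _ := by
            have := Real.rpow_le_rpow_of_nonpos hy hyn (show 1 - μ / 2 - θ ≤ 0 by linarith)
            gcongr
    calc _ ≤ n ^ θ * y ^ (1 - μ / 2 - θ) * y ^ e * 2 := by gcongr
      _ = 2 * (n ^ θ * (y ^ (1 - μ / 2 - θ) * y ^ e)) := by ring
      _ ≤ 2 * (n ^ θ * (1 + y)) := by gcongr
      _ ≤ _ := by
        have : 0 ≤ n ^ θ * (1 + y) := by positivity
        nlinarith
  · have hny : n / y ≤ 1 := (div_le_one hy).2 hyn
    have hny0 : 0 < n / y := by positivity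
    rw [max_eq_right hyn, min_eq_right hny]
    have h2 : (max (n / y) (1 / (y * U))) ^ (3 * θ) ≤ n ^ θ * y ^ (-θ) + c ^ (-θ) * (n ^ θ * y ^ (-(3 * θ))) := by
      have h3 : (n / y) ^ (3 * θ) ≤ n ^ θ * y ^ (-θ) := by
        calc (n / y) ^ (3 * θ) ≤ (n / y) ^ θ :=
              Real.rpow_le_rpow_of_exponent_ge hny0 hny (by linarith)
          _ = _ := by rw [Real.div_rpow hn.le hy.le, Real.rpow_neg hy.le]; rfl
      have h4 : (1 / (y * U)) ^ (3 * θ) ≤ c ^ (-θ) * (n ^ θ * y ^ (-(3 * θ))) := by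
        have h5 : c ^ θ ≤ n ^ θ * U ^ (3 * θ) := by
          calc c ^ θ ≤ (n * U ^ 3) ^ θ := Real.rpow_le_rpow hc.le hnU hθ.le
            _ = _ := by
              rw [Real.mul_rpow hn.le (by positivity), ← Real.rpow_natCast, ← Real.rpow_mul hU.le]
              norm_num
        have h6 : U ^ (-(3 * θ)) ≤ c ^ (-θ) * n ^ θ := by
          rw [Real.rpow_neg hU.le, Real.rpow_neg hc.le, inv_mul_eq_div,
            le_div_iff₀ (Real.rpow_pos_of_pos hc _), inv_mul_le_iff₀ (Real.rpow_pos_of_pos hU _)]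
          linarith
        rw [one_div, Real.inv_rpow hyU0.le, ← Real.rpow_neg hyU0.le, Real.mul_rpow hy.le hU.le]
        have := Real.rpow_nonneg hy.le (-(3 * θ))
        nlinarith
      have h7 : 0 ≤ n ^ θ * y ^ (-θ) := by positivity
      have h8 : 0 ≤ c ^ (-θ) * (n ^ θ * y ^ (-(3 * θ))) := by positivity
      rcases le_total (n / y) (1 / (y * U)) with h9 | h9
      · rw [max_eq_right h9]; linarith
      · rw [max_eq_left h9]; linarith
    have h10 : y ^ (1 - μ / 2) * y ^ e * y ^ (-θ) ≤ 1 + y := by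
      rw [← Real.rpow_add hy, ← Real.rpow_add hy]
      exact rpow_le_one_add hy (by linarith) (by linarith)
    have h11 : y ^ (1 - μ / 2) * y ^ e * y ^ (-(3 * θ)) ≤ 1 + y := by
      rw [← Real.rpow_add hy, ← Real.rpow_add hy]
      exact rpow_le_one_add hy (by linarith) (by linarith)
    calc _ ≤ y ^ (1 - μ / 2) * y ^ e *
          (n ^ θ * y ^ (-θ) + c ^ (-θ) * (n ^ θ * y ^ (-(3 * θ)))) := by gcongr
      _ = n ^ θ * (y ^ (1 - μ / 2) * y ^ e * y ^ (-θ)) +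
          c ^ (-θ) * n ^ θ * (y ^ (1 - μ / 2) * y ^ e * y ^ (-(3 * θ))) := by ring
      _ ≤ n ^ θ * (1 + y) + c ^ (-θ) * n ^ θ * (1 + y) := by gcongr
      _ ≤ _ := by
        have : 0 ≤ n ^ θ * (1 + y) := by positivity
        nlinarith

/-- The numerical bound in the range of few bad moduli. -/
theorem rpow_bound_of_short {μ e θ c X C N : ℝ} (hμ : 2 ≤ μ) (he : e ≤ μ / 2)
    (hθ : 0 < θ) (h : μ / 2 - e + 3 * θ ≤ 1) (hc : 0 < c) (hX : 0 < X) (hC : 1 / 2 ≤ C) (hN : c ≤ N) :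
    (max N (X * C)) ^ (1 - μ / 2) * C ^ e * (max (min 1 (N / (X * C))) (1 / C)) ^ (3 * θ) ≤
      (2 + c ^ (-θ)) * ((N / X ^ (3 / 2 : ℝ)) ^ θ * X ^ ((6 - 3 * μ) / 4) * X ^ (e / 2) *
        (1 + C / X ^ (1 / 2 : ℝ))) := by
  have hC0 : 0 < C := by linarith
  have hN0 : 0 < N := hc.trans_le hN
  set U := X ^ (1 / 2 : ℝ) with hU
  have hU0 : 0 < U := Real.rpow_pos_of_pos hX _
  have hpow : ∀ r : ℝ, U ^ r = X ^ (r / 2) := fun r => by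
    rw [hU, ← Real.rpow_mul hX.le]; congr 1; ring
  have hX2 : X = U ^ 2 := by rw [← Real.rpow_natCast, hpow]; norm_num
  have hX3 : X ^ (3 / 2 : ℝ) = U ^ 3 := by rw [← Real.rpow_natCast, hpow]; norm_num
  -- Natural units: N is measured by X^{3/2} = U³ and C by X^{1/2} = U.
  set n := N / U ^ 3 with hn
  set y := C / U with hy
  have hn0 : 0 < n := by positivity
  have hy0 : 0 < y := by positivity
  have hNn : N = U ^ 3 * n := by rw [hn]; field_simp
  have hCy : C = y * U := by rw [hy]; field_simp
  have h1 := max_rpow_mul_rpow_le hμ he hθ h hc hU0 hn0 hy0 (by rwa [← hCy]) (by rwa [mul_comm, ← hNn])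
  have h2 : max N (X * C) = U ^ 3 * max n y := by
    rw [mul_max_of_nonneg _ _ (by positivity), ← hNn, hX2, hCy]
    congr 1; ring
  have h3 : N / (X * C) = n / y := by
    rw [hNn, hX2, hCy]; field_simp
  have h4 : (U ^ 3 : ℝ) ^ (1 - μ / 2) = X ^ ((6 - 3 * μ) / 4) := by
    rw [← Real.rpow_natCast, ← Real.rpow_mul hU0.le, hpow]; congr 1; push_cast; ring
  have h5 : C ^ e = y ^ e * X ^ (e / 2) := by
    conv_lhs => rw [hCy, Real.mul_rpow hy0.le hU0.le, hpow]
  rw [hX3, h2, h3, Real.mul_rpow (by positivity) (hy0.le.trans (le_max_right _ _)), h4, h5]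
  conv_lhs => rw [hCy]
  have hp1 : 0 < X ^ ((6 - 3 * μ) / 4) := Real.rpow_pos_of_pos hX _
  have hp2 : 0 < X ^ (e / 2) := Real.rpow_pos_of_pos hX _
  calc _ = X ^ ((6 - 3 * μ) / 4) * X ^ (e / 2) * ((max n y) ^ (1 - μ / 2) * y ^ e *
        (max (min 1 (n / y)) (1 / (y * U))) ^ (3 * θ)) := by ring
    _ ≤ X ^ ((6 - 3 * μ) / 4) * X ^ (e / 2) * ((2 + c ^ (-θ)) * (n ^ θ * (1 + y))) := by gcongr
    _ = _ := by ring

/-- The numerical bound in the range of many bad moduli. -/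
theorem exists_rpow_bound_of_long {μ E θ η r κ c : ℝ} (hμ : 3 ≤ μ) (hE : 0 ≤ E) (hη : 0 ≤ η)
    (hEη : E ≤ μ / 6 - η) (hθ : 0 < θ) (hr : r ≤ 1 / 2)
    (h : μ * θ / 2 + 3 * θ / 2 + μ / 2 * (1 / 2 - r) ≤ η / 2) (hκ : 0 < κ) (hc : 0 < c) :
    ∃ K, 0 ≤ K ∧ ∀ X C N₀ N : ℝ, 0 < X → 1 / 2 ≤ C → 0 < N₀ → κ * N₀ ≤ N → c ≤ N →
      (max N (X * C)) ^ (1 - μ / 2) * N₀ ^ E * X ^ (μ / 2 * θ) ≤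
        K * ((N / X ^ (3 / 2 : ℝ)) ^ θ * ((X * C) ^ (1 - μ / 3 - η / 2) / X ^ (μ / 4)) *
          X ^ (μ / 2 * r)) := by
  -- The exponent of X that must be paid to introduce X^{-3θ/2} and to pass from ℓ² to ℓ^{1/r}. It
  -- costs at most half of the saving η and is obtained from max(N, XC) ≥ X/2.
  set k := μ * θ / 2 + 3 * θ / 2 + μ / 2 * (1 / 2 - r) with hk
  have hk0 : 0 ≤ k := by
    have : 0 ≤ μ / 2 * (1 / 2 - r) := mul_nonneg (by linarith) (by linarith)
    positivity
  refine ⟨κ ^ (-E) * c ^ (1 - μ / 2 + E - (1 - μ / 3 - η / 2 - k)) * 2 ^ k * c ^ (-θ), by positivity,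
    fun X C N₀ N hX hC hN₀ hκN hcN => ?_⟩
  have hC0 : 0 < C := by linarith
  have hN0 : 0 < N := hc.trans_le hcN
  set M := max N (X * C) with hM
  have hNM : N ≤ M := le_max_left _ _
  have hXM : X * C ≤ M := le_max_right _ _
  have hM0 : 0 < M := hN0.trans_le hNM
  have h1 : N₀ ^ E ≤ κ ^ (-E) * M ^ E := by
    rw [Real.rpow_neg hκ.le, inv_mul_eq_div, le_div_iff₀ (Real.rpow_pos_of_pos hκ _),
      ← Real.mul_rpow hN₀.le hκ.le]
    exact Real.rpow_le_rpow (by positivity) (by linarith) hE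
  have h2 : M ^ (1 - μ / 2) * M ^ E ≤ c ^ (1 - μ / 2 + E - (1 - μ / 3 - η / 2 - k)) *
      (M ^ (1 - μ / 3 - η / 2) * M ^ (-k)) := by
    rw [← Real.rpow_add hM0, ← Real.rpow_add hM0, ← sub_eq_add_neg]
    exact rpow_le_mul_rpow hc (hcN.trans hNM) (by linarith)
  have h3 : M ^ (1 - μ / 3 - η / 2) ≤ (X * C) ^ (1 - μ / 3 - η / 2) :=
    Real.rpow_le_rpow_of_nonpos (by positivity) hXM (by linarith)
  have h4 : M ^ (-k) ≤ 2 ^ k * X ^ (-k) := by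
    have h5 : X / 2 ≤ M := by nlinarith
    calc M ^ (-k) ≤ (X / 2) ^ (-k) := Real.rpow_le_rpow_of_nonpos (by positivity) h5 (by linarith)
      _ = _ := by
        rw [Real.div_rpow hX.le two_pos.le, Real.rpow_neg two_pos.le, div_inv_eq_mul, mul_comm]
  have h5 : 1 ≤ c ^ (-θ) * N ^ θ := by
    rw [Real.rpow_neg hc.le, inv_mul_eq_div, one_le_div (Real.rpow_pos_of_pos hc _)]
    exact Real.rpow_le_rpow hc.le hcN hθ.le
  have h6 : X ^ (-k) * X ^ (μ / 2 * θ) = (X ^ (3 / 2 : ℝ))⁻¹ ^ θ * X ^ (μ / 2 * r) / X ^ (μ / 4) := by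
    rw [← Real.rpow_neg hX.le, ← Real.rpow_mul hX.le, ← Real.rpow_add hX, ← Real.rpow_add hX,
      ← Real.rpow_sub hX]
    congr 1
    rw [hk]; ring
  rw [div_eq_mul_inv N, Real.mul_rpow hN0.le (by positivity)]
  have hXC0 : 0 < (X * C) ^ (1 - μ / 3 - η / 2) := Real.rpow_pos_of_pos (by positivity) _
  have hp0 : 0 < X ^ (μ / 2 * θ) := Real.rpow_pos_of_pos hX _
  calc M ^ (1 - μ / 2) * N₀ ^ E * X ^ (μ / 2 * θ)
      ≤ M ^ (1 - μ / 2) * (κ ^ (-E) * M ^ E) * X ^ (μ / 2 * θ) := by gcongr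
    _ = κ ^ (-E) * (M ^ (1 - μ / 2) * M ^ E) * X ^ (μ / 2 * θ) := by ring
    _ ≤ κ ^ (-E) * (c ^ (1 - μ / 2 + E - (1 - μ / 3 - η / 2 - k)) *
      ((X * C) ^ (1 - μ / 3 - η / 2) * (2 ^ k * X ^ (-k)))) * X ^ (μ / 2 * θ) := by
        have : 0 ≤ M ^ (-k) := by positivity
        refine mul_le_mul_of_nonneg_right (mul_le_mul_of_nonneg_left (h2.trans ?_) (by positivity)) hp0.le
        exact mul_le_mul_of_nonneg_left (mul_le_mul h3 h4 this hXC0.le) (by positivity)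
    _ = κ ^ (-E) * c ^ (1 - μ / 2 + E - (1 - μ / 3 - η / 2 - k)) * 2 ^ k *
        ((X * C) ^ (1 - μ / 3 - η / 2) * (X ^ (-k) * X ^ (μ / 2 * θ))) * 1 := by ring
    _ ≤ κ ^ (-E) * c ^ (1 - μ / 2 + E - (1 - μ / 3 - η / 2 - k)) * 2 ^ k *
        ((X * C) ^ (1 - μ / 3 - η / 2) * (X ^ (-k) * X ^ (μ / 2 * θ))) * (c ^ (-θ) * N ^ θ) := by
        have : 0 < X ^ (-k) := Real.rpow_pos_of_pos hX _
        gcongr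
    _ = _ := by rw [h6]; ring

/-! ### Assembly of the hybrid bound -/

section
variable {m : ℕ} {F : Fin m → ℤ} {P : MvPolynomial (Fin m) ℤ} {w : (Fin m → ℝ) → ℝ}
  {ν : 𝓢(Fin m → ℝ, ℝ)} {D : ℝ → ℝ}

theorem tsum_shell (S : Set (Fin m → ℤ)) (C : ℝ) (f : (Fin m → ℤ) → ℝ) :
    ∑' c : shell S C, f c = ∑ c ∈ (finite_shell S C).toFinset, f c := by
  have := Finset.tsum_subtype' (finite_shell S C).toFinset f
  rwa [Finite.coe_toFinset] at this

theorem rho_nonneg (hν : ∀ a, 0 < ν a) {X : ℝ} (hX : 0 < X) (S : Set (Fin m → ℤ)) : 0 ≤ rho ν X S :=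
  div_nonneg (tsum_nonneg fun _ => (hν _).le) (Real.rpow_nonneg hX.le _)

theorem sum_shell_eq_rho (ν : 𝓢(Fin m → ℝ, ℝ)) {X : ℝ} (hX : 0 < X) (S : Set (Fin m → ℤ)) (C : ℝ) :
    ∑ c ∈ (finite_shell S C).toFinset, ν ((X ^ (1 / 2 : ℝ))⁻¹ • toReal c) =
      rho ν X (shell S C) * X ^ ((m : ℝ) / 2) := by
  rw [rho, div_mul_cancel₀ _ (Real.rpow_pos_of_pos hX _).ne',
    tsum_shell S C fun c => ν ((X ^ (1 / 2 : ℝ))⁻¹ • toReal c)]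

theorem half_lt_of_mem_shell {S : Set (Fin m → ℤ)} {C : ℝ} (hC : 0 < C) {c : Fin m → ℤ}
    (hc : c ∈ shell S C) : 1 / 2 < C := by
  have h1 : toReal c ≠ 0 := fun h => by
    have := hc.2.1
    rw [h, norm_zero] at this
    linarith
  obtain ⟨i, hi⟩ := Function.ne_iff.1 h1
  have hi' : c i ≠ 0 := fun h => hi (by simp [toReal, h])
  have h2 : (1 : ℝ) ≤ |(c i : ℝ)| := by
    rw [← Int.cast_abs]; exact_mod_cast Int.one_le_abs hi'
  have h3 := (norm_le_pi_norm (toReal c) i).trans_lt hc.2.2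
  rw [Real.norm_eq_abs] at h3
  have h4 : |toReal c i| = |(c i : ℝ)| := rfl
  linarith

/-- Hölder's inequality for the terms of the hybrid bound. -/
theorem exists_lqNorm_hybridTerm_le_mul [Nonempty (Fin m)] (hm : 3 ≤ m) (hw : IsWeight F w)
    (hν : IsAdmissible F P w ν) (hD : IsCutoff D) (k l : ℕ) {p q θ θ₂ : ℝ} (hp : 1 ≤ p) (hq : 0 < q)
    (hθ : 0 < θ) (hθ' : θ ≤ 1 / 2) (hθ₂ : 0 < θ₂) (hθ₂' : θ₂ ≤ 1) (h : 1 / p = 1 / q + θ + θ₂) :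
    ∃ K, 0 ≤ K ∧ ∀ (S : Set (Fin m → ℤ)) (X N₀ N₁ C : ℝ), 0 < X → 0 < N₀ → 0 < N₁ → 0 < C →
      ∀ s₀ s₁ : ℂ, s₀.re = 0 → s₁.re = 0 →
      lqNorm p (shell S C) (hybridTerm F P w ν D X N₀ N₁ s₀ s₁) ≤
        K * (max (N₀ * N₁) (X * C)) ^ (1 - (m : ℝ) / 2) /
          ((1 + max ‖s₀‖ ‖s₁‖) ^ k * (1 + C / X ^ (1 / 2 : ℝ)) ^ l) *
        ((∑ c ∈ (finite_shell S C).toFinset, (‖heartZero F P D N₀ c s₀‖ / N₀ ^ (1 / 2 : ℝ)) ^ q) ^ (1 / q) *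
          (rho ν X (shell S C) * X ^ ((m : ℝ) / 2)) ^ θ *
          (∑ c ∈ (finite_shell S C).toFinset,
            (1 + |dualReal P (‖toReal c‖⁻¹ • toReal c)| / (N₀ * N₁ / (X * C)))⁻¹) ^ θ₂) := by
  obtain ⟨K, hK, hle⟩ := exists_norm_hybridTerm_le hm hw hν hD k l hθ'
  refine ⟨K, hK, fun S X N₀ N₁ C hX hN₀ hN₁ hC s₀ s₁ hs₀ hs₁ => ?_⟩
  rw [lqNorm, tsum_shell S C fun c => ‖hybridTerm F P w ν D X N₀ N₁ s₀ s₁ c‖ ^ p,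
    ← sum_shell_eq_rho ν hX]
  have hM : 0 < max (N₀ * N₁) (X * C) := lt_max_of_lt_left (by positivity)
  have hg0 : ∀ c : Fin m → ℤ, 0 ≤ |dualReal P (‖toReal c‖⁻¹ • toReal c)| / (N₀ * N₁ / (X * C)) :=
    fun c => by positivity
  refine rpow_sum_rpow_le _ (fun _ => norm_nonneg _) (fun _ => by positivity) (fun _ => (hν.1 _).le)
    (fun c => inv_nonneg.2 (by linarith [hg0 c])) (fun c => inv_le_one_of_one_le₀ (by linarith [hg0 c]))
    hp hq hθ hθ₂ hθ₂' h (by positivity) fun c hc => ?_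
  rw [Finite.mem_toFinset] at hc
  refine (hle X N₀ N₁ C c hX hN₀ hN₁ hC hc.2.1 s₀ s₁ hs₀ hs₁).trans (le_of_eq ?_)
  congr 4
  field_simp

set_option maxHeartbeats 1000000 in
/-- The hybrid bound for the bad moduli. -/
theorem B3.exists_lqNorm_hybridTerm_le (hB3 : B3 F P) (hm4 : 4 ≤ m) (hm6 : m ≤ 6) (hF : ∀ i, F i ≠ 0)
    (hP : IsDualForm F P) : ∃ θ η δ₀ : ℝ, 0 < θ ∧ 0 < η ∧ 0 < δ₀ ∧
      ∀ w, IsWeight F w → ∀ ν, IsAdmissible F P w ν → ∀ D, IsCutoff D → ∀ κ : ℝ, 0 < κ →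
      ∀ k : ℕ, ∀ δ : ℝ, 0 < δ → δ ≤ δ₀ →
      ∃ K : ℝ, ∀ S : Set (Fin m → ℤ), (∀ c ∈ S, dualInt P c ≠ 0) →
        ∀ X N₀ N₁ C : ℝ, 0 < X → 0 < N₀ → κ ≤ N₁ → 0 < C →
        ∀ s₀ s₁ : ℂ, s₀.re = 0 → s₁.re = 0 →
          lqNorm (2 + δ) (shell S C) (hybridTerm F P w ν D X N₀ N₁ s₀ s₁) ≤
            K * (errFactor ν θ η X N₀ N₁ C (shell S C) * (X ^ ((m : ℝ) / 2)) ^ (1 / (2 + δ)) /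
              ((1 + max ‖s₀‖ ‖s₁‖) ^ k * (1 + C / X ^ (1 / 2 : ℝ)) ^ k)) := by
  have : Nonempty (Fin m) := ⟨⟨0, by omega⟩⟩
  have hmr4 : (4 : ℝ) ≤ m := by exact_mod_cast hm4
  have hmr6 : (m : ℝ) ≤ 6 := by exact_mod_cast hm6
  obtain ⟨a, Kg, ha, ha2, hKg, hg⟩ := hP.exists_sum_inv_le (by omega) hF
  obtain ⟨η, B, hη, hη8, hB, hheart⟩ := hB3.exists_sum_rpow_heartZero_le
  -- τ is the Hölder exponent of the sum over small values of the dual form. The last two conditions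
  -- keep q close enough to 2 for the interpolated (B3), and the losses in the long range below η/2.
  obtain ⟨τ, hτ, hτ10, hτB, hτη⟩ : ∃ τ : ℝ, 0 < τ ∧ τ ≤ 1 / 10 ∧ B * (9 * τ) ≤ 4 * η ∧ 3 * τ ≤ η := by
    refine ⟨min (1 / 10) (min (4 * η / (9 * B)) (η / 3)), by positivity, min_le_left _ _, ?_, ?_⟩
    · have : min (1 / 10) (min (4 * η / (9 * B)) (η / 3)) ≤ 4 * η / (9 * B) :=
        (min_le_right _ _).trans (min_le_left _ _)
      rw [le_div_iff₀ (by positivity)] at this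
      linarith
    · have : min (1 / 10) (min (4 * η / (9 * B)) (η / 3)) ≤ η / 3 :=
        (min_le_right _ _).trans (min_le_right _ _)
      linarith
  -- So that the saving l^a, raised to the power τ, is exactly l^{3θ}.
  set θ := a * τ / 3 with hθdef
  have hθ : 0 < θ := by positivity
  have hθτ : θ ≤ τ / 6 := by rw [hθdef]; nlinarith
  refine ⟨θ, η / 2, τ, hθ, by positivity, hτ, fun w hw ν hν D hD κ hκ k δ hδ hδτ => ?_⟩
  set p := 2 + δ with hp
  set r := 1 / p with hr
  have hr1 : r ≤ 1 / 2 := one_div_le_one_div_of_le two_pos (by linarith)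
  have hr2 : 1 / 2 - τ / 4 ≤ r := by
    rw [hr, le_div_iff₀ (by linarith)]
    nlinarith
  have hr0 : 0 < r - θ - τ := by linarith
  -- Determined by 1/(2 + δ) = 1/q + θ + τ. The smallness of δ and τ gives 2 ≤ q ≤ 3 and q − 2 ≤ 9τ.
  set q := 1 / (r - θ - τ) with hq
  have hq1 : 1 / q = r - θ - τ := by rw [hq, one_div_one_div]
  have hq2 : 2 ≤ q := by rw [hq, le_div_iff₀ hr0]; linarith
  have hq3 : q ≤ 3 := by rw [hq, div_le_iff₀ hr0]; linarith
  have hq0 : 0 < q := by linarith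
  have hqB : B * (q - 2) ≤ 4 * η := by
    refine le_trans ?_ hτB
    gcongr
    rw [hq, sub_le_iff_le_add, div_le_iff₀ hr0]
    nlinarith
  obtain ⟨b, hb, hb0, hbq⟩ := hheart D hD
  obtain ⟨Kh, hKh, hKh'⟩ := hbq q hq2 hq3 hqB
  -- One power of decay in C/X^{1/2} more than required; it absorbs the factor 1 + y that the
  -- numerical bounds lose.
  obtain ⟨K₁, hK₁, hmain⟩ := exists_lqNorm_hybridTerm_le_mul (by omega) hw hν hD k (k + 1)
    (p := p) (q := q) (θ := θ) (θ₂ := τ) (by linarith) hq0 hθ (by linarith) hτ (by linarith)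
    (by rw [hq1]; ring)
  set c := κ / b with hc
  have hc0 : 0 < c := by positivity
  set e := m * (r - θ) with he
  have hmθ : m * (1 / 2 - r) ≤ 6 * (τ / 4) := mul_le_mul hmr6 (by linarith) (by linarith) (by norm_num)
  have hmθ0 : 0 ≤ m * (1 / 2 - r) := mul_nonneg (by linarith) (by linarith)
  have hmθ2 : m * θ ≤ 6 * (τ / 6) := mul_le_mul hmr6 hθτ hθ.le (by norm_num)
  have hmθ3 : 4 * θ ≤ m * θ := by gcongr
  -- In the long range Z = (bN₀)^{1/3}, and Z^e N₀^{-η} is a constant times N₀^E·N₀^{-θ}.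
  set E := e / 3 - η + θ with hE
  obtain ⟨K₂, hK₂, hlong⟩ := exists_rpow_bound_of_long (μ := m) (E := E) (θ := θ) (η := η) (r := r)
    (κ := κ) (c := c) (by linarith) (by rw [hE, he]; linarith) hη.le (by rw [hE, he]; linarith) hθ hr1
    (by linarith) hκ hc0
  set A := Kh ^ (1 / q) * Kg ^ τ with hA
  have hA0 : 0 ≤ A := by positivity
  set Ks := A * 2 ^ e * (1 / b) ^ (-η - -θ) * (2 + c ^ (-θ)) with hKs
  set Kl := A * b ^ (e / 3) * 2 * K₂ with hKl
  have hKs0 : 0 ≤ Ks := by positivity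
  have hKl0 : 0 ≤ Kl := by positivity
  refine ⟨K₁ * (Ks + Kl), fun S hS X N₀ N₁ C hX hN₀ hN₁ hC s₀ s₁ hs₀ hs₁ => ?_⟩
  have hN₁0 : 0 < N₁ := hκ.trans_le hN₁
  have hρ := rho_nonneg hν.1 hX (shell S C)
  have hp0 : p ≠ 0 := by linarith
  set T := (finite_shell S C).toFinset with hT
  have hTmem : ∀ x ∈ T, x ∈ shell S C := fun x hx => (finite_shell S C).mem_toFinset.1 hx
  have hzero : (∀ x ∈ T, hybridTerm F P w ν D X N₀ N₁ s₀ s₁ x = 0) →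
      lqNorm p (shell S C) (hybridTerm F P w ν D X N₀ N₁ s₀ s₁) ≤
        K₁ * (Ks + Kl) * (errFactor ν θ (η / 2) X N₀ N₁ C (shell S C) * (X ^ ((m : ℝ) / 2)) ^ (1 / p) /
          ((1 + max ‖s₀‖ ‖s₁‖) ^ k * (1 + C / X ^ (1 / 2 : ℝ)) ^ k)) := fun h => by
    rw [lqNorm, tsum_shell S C fun x => ‖hybridTerm F P w ν D X N₀ N₁ s₀ s₁ x‖ ^ p,
      Finset.sum_eq_zero fun x hx => by rw [h x hx, norm_zero, Real.zero_rpow hp0],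
      Real.zero_rpow (by positivity)]
    unfold errFactor
    positivity
  -- An empty shell, or bN₀ < 1, makes every term vanish. Otherwise C ≥ 1/2 and N₀ ≥ 1/b, and N₁ ≥ κ
  -- gives N ≥ κ/b.
  rcases T.eq_empty_or_nonempty with hTe | ⟨x₀, hx₀⟩
  · exact hzero fun x hx => by simp [hTe] at hx
  have hC2 : 1 / 2 ≤ C := (half_lt_of_mem_shell hC (hTmem x₀ hx₀)).le
  rcases lt_or_ge (b * N₀) 1 with hbN | hbN
  · exact hzero fun x _ => by rw [hybridTerm, hb0 N₀ x s₀ hN₀ hbN]; simp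
  clear hzero hb0 hheart
  have hbN' : 1 / b ≤ N₀ := by rw [div_le_iff₀ hb]; linarith
  set N := N₀ * N₁ with hN
  have hN0 : 0 < N := by positivity
  have hκN : κ * N₀ ≤ N := by rw [hN, mul_comm]; gcongr
  have hcN : c ≤ N := by
    refine le_trans ?_ hκN
    rw [hc, div_eq_mul_one_div]
    gcongr
  set M := max N (X * C) with hM
  have hM0 : 0 < M := lt_max_of_lt_left hN0
  set l := max (min 1 (N / (X * C))) (1 / C) with hl
  have hl0 : 0 < l := lt_max_of_lt_right (by positivity)
  have hl2 : l ^ (3 * θ) ≤ 2 := by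
    have hl2 : l ≤ 2 := max_le ((min_le_left _ _).trans one_le_two) (by rw [div_le_iff₀ hC]; linarith)
    calc _ ≤ (2 : ℝ) ^ (3 * θ) := Real.rpow_le_rpow hl0.le hl2 (by positivity)
      _ ≤ 2 ^ (1 : ℝ) := Real.rpow_le_rpow_of_exponent_le one_le_two (by linarith)
      _ = 2 := Real.rpow_one 2
  set y := C / X ^ (1 / 2 : ℝ) with hy
  have hy0 : 0 < y := by positivity
  set H := ∑ c ∈ T, (‖heartZero F P D N₀ c s₀‖ / N₀ ^ (1 / 2 : ℝ)) ^ q with hH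
  have hH0 : 0 ≤ H := Finset.sum_nonneg fun _ _ => by positivity
  set G := ∑ c ∈ T, (1 + |dualReal P (‖toReal c‖⁻¹ • toReal c)| / (N / (X * C)))⁻¹ with hG
  have hG0 : 0 ≤ G := Finset.sum_nonneg fun _ _ => by positivity
  have hGle : G ^ τ ≤ Kg ^ τ * C ^ (m * τ) * l ^ (3 * θ) := by
    have h1 := hg C (N / (X * C)) T hC2 (by positivity) fun x hx =>
      ⟨(hTmem x hx).2.1, (hTmem x hx).2.2.le⟩
    have h2 : (l ^ a) ^ τ = l ^ (3 * θ) := by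
      rw [← Real.rpow_mul hl0.le, hθdef]; congr 1; ring
    rw [Real.rpow_mul hC.le, ← h2, Real.rpow_natCast, ← Real.mul_rpow hKg (by positivity),
      ← Real.mul_rpow (by positivity) (by positivity)]
    exact Real.rpow_le_rpow hG0 h1 hτ.le
  -- Z is left free here because (B3) needs bN₀ ≤ Z³ as well as Z ≥ 2C. The powers of Z combine to
  -- m/q + mτ = m(r − θ) = e.
  have hHG : ∀ Z, C ≤ Z → b * N₀ ≤ Z ^ 3 → 2 * C ≤ Z →
      H ^ (1 / q) * G ^ τ ≤ A * (Z ^ e * N₀ ^ (-η) * l ^ (3 * θ)) := fun Z hCZ hbZ hCZ2 => by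
    have hZ : 0 < Z := hC.trans_le hCZ
    have h1 := hKh' N₀ Z T s₀ hN₀ hZ hbN hbZ hs₀ fun x hx =>
      ⟨(hTmem x hx).2.2.le.trans hCZ2, hS x (hTmem x hx).1⟩
    have h2 : H ^ (1 / q) ≤ Kh ^ (1 / q) * Z ^ (m * (1 / q)) * N₀ ^ (-η) := by
      calc H ^ (1 / q) ≤ (Kh * Z ^ m * N₀ ^ (-η * q)) ^ (1 / q) :=
            Real.rpow_le_rpow hH0 h1 (by positivity)
        _ = _ := by
          rw [Real.mul_rpow (by positivity) (by positivity), Real.mul_rpow hKh (by positivity),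
            ← Real.rpow_mul hN₀.le, Real.rpow_mul hZ.le, Real.rpow_natCast]
          congr 2
          field_simp
    have h3 : C ^ (m * τ) ≤ Z ^ (m * τ) := Real.rpow_le_rpow hC.le hCZ (by positivity)
    have h4 : Z ^ (m * (1 / q)) * Z ^ (m * τ) = Z ^ e := by
      rw [← Real.rpow_add hZ, hq1, he]; congr 1; ring
    calc H ^ (1 / q) * G ^ τ ≤ (Kh ^ (1 / q) * Z ^ (m * (1 / q)) * N₀ ^ (-η)) *
          (Kg ^ τ * Z ^ (m * τ) * l ^ (3 * θ)) := by
            refine mul_le_mul h2 (hGle.trans ?_) (by positivity) (by positivity)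
            gcongr
      _ = A * ((Z ^ (m * (1 / q)) * Z ^ (m * τ)) * N₀ ^ (-η) * l ^ (3 * θ)) := by rw [hA]; ring
      _ = _ := by rw [h4]
  set Ts := X ^ ((6 - 3 * (m : ℝ)) / 4) with hTs
  set Tl := (X * C) ^ (1 - (m : ℝ) / 3 - η / 2) / X ^ ((m : ℝ) / 4) with hTl
  have hTs0 : 0 < Ts := by positivity
  have hTl0 : 0 < Tl := by positivity
  set V := N₀ ^ (-θ) * (N / X ^ (3 / 2 : ℝ)) ^ θ * X ^ (m / 2 * r) with hV
  have hV0 : 0 < V := by positivity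
  have hXm : (X ^ ((m : ℝ) / 2)) ^ θ = X ^ (m / 2 * θ) := by rw [← Real.rpow_mul hX.le]
  have core : M ^ (1 - (m : ℝ) / 2) * (H ^ (1 / q) * X ^ (m / 2 * θ) * G ^ τ) ≤
      (Ks + Kl) * (V * (Tl + Ts) * (1 + y)) := by
    -- If bN₀ ≤ (2C)³, then Z = 2C is allowed and the saving l^{3θ} is needed to produce
    -- (N/X^{3/2})^θ. Otherwise Z = (bN₀)^{1/3}, and l^{3θ} ≤ 2 is discarded.
    rcases le_or_gt (b * N₀) ((2 * C) ^ 3) with hcase | hcase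
    · have h1 := hHG (2 * C) (by linarith) hcase le_rfl
      have h2 : N₀ ^ (-η) ≤ (1 / b) ^ (-η - -θ) * N₀ ^ (-θ) :=
        rpow_le_mul_rpow (by positivity) hbN' (by linarith)
      have h3 := rpow_bound_of_short (μ := m) (e := e) (θ := θ) (c := c) (X := X) (C := C) (N := N)
        (by linarith) (by rw [he]; nlinarith) hθ (by rw [he]; linarith) hc0 hX hC2 hcN
      have h4 : X ^ (e / 2) * X ^ (m / 2 * θ) = X ^ (m / 2 * r) := by
        rw [← Real.rpow_add hX, he]; congr 1; ring
      calc M ^ (1 - (m : ℝ) / 2) * (H ^ (1 / q) * X ^ (m / 2 * θ) * G ^ τ)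
          = M ^ (1 - (m : ℝ) / 2) * X ^ (m / 2 * θ) * (H ^ (1 / q) * G ^ τ) := by ring
        _ ≤ M ^ (1 - (m : ℝ) / 2) * X ^ (m / 2 * θ) * (A * ((2 * C) ^ e *
              ((1 / b) ^ (-η - -θ) * N₀ ^ (-θ)) * l ^ (3 * θ))) := by
            refine mul_le_mul_of_nonneg_left (h1.trans ?_) (by positivity)
            gcongr
        _ = A * 2 ^ e * (1 / b) ^ (-η - -θ) * N₀ ^ (-θ) * X ^ (m / 2 * θ) *
              (M ^ (1 - (m : ℝ) / 2) * C ^ e * l ^ (3 * θ)) := by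
            rw [Real.mul_rpow two_pos.le hC.le]; ring
        _ ≤ A * 2 ^ e * (1 / b) ^ (-η - -θ) * N₀ ^ (-θ) * X ^ (m / 2 * θ) *
              ((2 + c ^ (-θ)) * ((N / X ^ (3 / 2 : ℝ)) ^ θ * Ts * X ^ (e / 2) * (1 + y))) := by
            gcongr
        _ = Ks * (N₀ ^ (-θ) * (N / X ^ (3 / 2 : ℝ)) ^ θ * (X ^ (e / 2) * X ^ (m / 2 * θ)) * Ts *
              (1 + y)) := by rw [hKs]; ring
        _ = Ks * (V * Ts * (1 + y)) := by rw [h4]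
        _ ≤ (Ks + Kl) * (V * (Tl + Ts) * (1 + y)) := by
            gcongr <;> linarith
    · set Z := (b * N₀) ^ (1 / 3 : ℝ) with hZ
      have hZ3 : Z ^ 3 = b * N₀ := by
        rw [hZ, ← Real.rpow_natCast, ← Real.rpow_mul (by positivity)]; norm_num
      have hZ0 : 0 ≤ Z := by positivity
      have hCZ : 2 * C ≤ Z := le_of_pow_le_pow_left₀ three_ne_zero hZ0 (by rw [hZ3]; exact hcase.le)
      have h1 := hHG Z (by linarith) hZ3.ge hCZ
      have h2 : Z ^ e * N₀ ^ (-η) = b ^ (e / 3) * (N₀ ^ E * N₀ ^ (-θ)) := by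
        rw [hZ, ← Real.rpow_mul (by positivity), Real.mul_rpow hb.le hN₀.le, mul_assoc,
          ← Real.rpow_add hN₀, ← Real.rpow_add hN₀, hE]
        congr 2 <;> ring
      rw [h2] at h1
      have h3 := hlong X C N₀ N hX hC2 hN₀ hκN hcN
      calc M ^ (1 - (m : ℝ) / 2) * (H ^ (1 / q) * X ^ (m / 2 * θ) * G ^ τ)
          = M ^ (1 - (m : ℝ) / 2) * X ^ (m / 2 * θ) * (H ^ (1 / q) * G ^ τ) := by ring
        _ ≤ M ^ (1 - (m : ℝ) / 2) * X ^ (m / 2 * θ) *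
              (A * (b ^ (e / 3) * (N₀ ^ E * N₀ ^ (-θ)) * 2)) := by
            refine mul_le_mul_of_nonneg_left (h1.trans ?_) (by positivity)
            gcongr
        _ = A * b ^ (e / 3) * 2 * N₀ ^ (-θ) *
              (M ^ (1 - (m : ℝ) / 2) * N₀ ^ E * X ^ (m / 2 * θ)) := by ring
        _ ≤ A * b ^ (e / 3) * 2 * N₀ ^ (-θ) *
              (K₂ * ((N / X ^ (3 / 2 : ℝ)) ^ θ * Tl * X ^ (m / 2 * r))) := by gcongr
        _ = Kl * (V * Tl * 1) := by rw [hKl, hV]; ring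
        _ ≤ (Ks + Kl) * (V * (Tl + Ts) * (1 + y)) := by
            gcongr <;> linarith
  refine (hmain S X N₀ N₁ C hX hN₀ hN₁0 hC s₀ s₁ hs₀ hs₁).trans ?_
  set R := rho ν X (shell S C) with hR
  set s := 1 + max ‖s₀‖ ‖s₁‖ with hs
  have hs0 : 0 < s := by positivity
  have hRX : (R * X ^ ((m : ℝ) / 2)) ^ θ = R ^ θ * X ^ (m / 2 * θ) := by
    rw [Real.mul_rpow hρ (by positivity), hXm]
  have hXr : (X ^ ((m : ℝ) / 2)) ^ (1 / p) = X ^ (m / 2 * r) := by rw [← Real.rpow_mul hX.le]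
  rw [hRX, hXr, errFactor, ← hR]
  calc _ = K₁ * R ^ θ / (s ^ k * (1 + y) ^ (k + 1)) *
        (M ^ (1 - (m : ℝ) / 2) * (H ^ (1 / q) * X ^ (m / 2 * θ) * G ^ τ)) := by ring
    _ ≤ K₁ * R ^ θ / (s ^ k * (1 + y) ^ (k + 1)) * ((Ks + Kl) * (V * (Tl + Ts) * (1 + y))) := by
      gcongr
    _ = _ := by
      have hVR : N₀ ^ (-θ) * (N / X ^ (3 / 2 : ℝ)) ^ θ * R ^ θ * (Tl + Ts) * X ^ (m / 2 * r) =
          V * R ^ θ * (Tl + Ts) := by rw [hV]; ring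
      have hy1 : 1 + y ≠ 0 := by positivity
      rw [hVR, pow_succ, ← mul_assoc (s ^ k), mul_div_assoc', div_mul_eq_mul_div,
        div_eq_div_iff (by positivity) (by positivity)]
      ring

end

end HybridBound

theorem mainTheorem7 (m : ℕ) (hm : m = 4 ∨ m = 6) (F : Fin m → ℤ) (hF : ∀ i, F i ≠ 0)
    (P : MvPolynomial (Fin m) ℤ) (hP : HybridBound.IsDualForm F P)
    (hB3 : HybridBound.B3 F P) :
    (∀ w : (Fin m → ℝ) → ℝ, HybridBound.IsWeight F w →
      ∃ ν : SchwartzMap (Fin m → ℝ) ℝ, HybridBound.IsAdmissible F P w ν) ∧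
    ∃ θ η δ₀ : ℝ, 0 < θ ∧ 0 < η ∧ 0 < δ₀ ∧
      ∀ w : (Fin m → ℝ) → ℝ, HybridBound.IsWeight F w →
      ∀ ν : SchwartzMap (Fin m → ℝ) ℝ, HybridBound.IsAdmissible F P w ν →
      ∀ D : ℝ → ℝ, HybridBound.IsCutoff D →
      ∀ κ : ℝ, 0 < κ →
      ∀ k : ℕ, ∀ δ : ℝ, 0 < δ → δ ≤ δ₀ →
      ∃ K : ℝ, ∀ S : Set (Fin m → ℤ), (∀ c ∈ S, HybridBound.dualInt P c ≠ 0) →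
        ∀ X N₀ N₁ C : ℝ, 0 < X → 0 < N₀ → κ ≤ N₁ → 0 < C →
        ∀ s₀ s₁ : ℂ, s₀.re = 0 → s₁.re = 0 →
          HybridBound.lqNorm (2 + δ) (HybridBound.shell S C)
              (HybridBound.hybridTerm F P w ν D X N₀ N₁ s₀ s₁) ≤
            K * (HybridBound.errFactor ν θ η X N₀ N₁ C (HybridBound.shell S C) *
                (X ^ ((m : ℝ) / 2)) ^ (1 / (2 + δ)) /
              ((1 + max ‖s₀‖ ‖s₁‖) ^ k * (1 + C / X ^ (1 / 2 : ℝ)) ^ k)) := by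
  have hm4 : 4 ≤ m := by omega
  have hm6 : m ≤ 6 := by omega
  have : Nonempty (Fin m) := ⟨⟨0, by omega⟩⟩
  exact ⟨fun w hw => hw.exists_isAdmissible (by omega) hF hP,
    hB3.exists_lqNorm_hybridTerm_le hm4 hm6 hF hP⟩
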